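/- **Capacitated fair-range $k$-clustering.** An instance consists of positive integers $k,t$, a finite metric space $(X,d)$ with $n=|X|\ge 2$ points, a set $C\subseteq X$ of clients and a set $F\subseteq X$ of facilities (which may overlap), groups $G_1,\dots,G_t\subseteq F$ (possibly intersecting) with integer bounds $0\le\alpha_i$ and $0\le\beta_i$, and capacities $\zeta:F\to\mathbb Z_{\ge 0}$. A feasible solution is a pair $(S,\rho)$ with $S\subseteq F$, $|S|\le k$, $\rho:C\to S$, such that $\alpha_i\le|S\cap G_i|\le\beta_i$ for every $i$, and $|\rho^{-1}(f)|\le\zeta(f)$ for every $f\in S$. Its cost is $\sum_{c\in C}d(c,\rho(c))$ for $k$-median and $\sum_{c\in C}d(c,\rho(c))^2$ for $k$-means. The machine model is a randomized real RAM: natural-number and real registers, natural-number and real memories with indirect addressing, unit-cost arithmetic (addition and truncated subtraction on natural numbers; the four operations on reals), unit-cost comparisons, and fair random bits. The input is $n,k,t$, the characteristic vectors of $C,F,G_1,\dots,G_t$, the numbers $\zeta,\alpha,\beta$, and the distance matrix. A randomized $\gamma$-approximation algorithm within time $T$ is a program that on every admissible instance halts within $T$ steps for every outcome of its random bits and that,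 if the instance has a feasible solution, outputs with probability at least $2/3$ a feasible solution $(S,\rho)$ whose cost is at most $\gamma$ times the minimum cost of a feasible solution. **Theorem.** Consider instances of polynomially bounded aspect ratio, that is, fix $a\in\mathbb N$ and consider instances with $\max_{x,y}d(x,y)\le n^{a}\cdot\min_{x\ne y}d(x,y)$. There are constants $c_1,c_2,c_3\in\mathbb N$ (depending only on $a$) such that for every real $\varepsilon>0$ there are a randomized $(3+\varepsilon)$-approximation algorithm for capacitated fair-range $k$-median and a randomized $(9+\varepsilon)$-approximation algorithm for capacitated fair-range $k$-means, each running on these instances in time at most $$\bigl(c_1\,2^{t}\,k\,\max(1,\varepsilon^{-1})\,\log n\bigr)^{c_2k}\cdot n^{c_3},$$ that is, in time $(O(2^t k\,\varepsilon^{-1}\log n))^{O(k)}\cdot n^{O(1)}$ for $\varepsilon\le 1$. -/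

import Mathlib

namespace CFR

/-! ### The capacitated fair-range clustering problem -/

/-- An instance of capacitated fair-range `k`-clustering. The points are `0, …, n - 1`; clients and
facilities are (possibly overlapping) sets of points, and `d` is a metric on the points. The values
of `cap` outside `F` play no role. -/
structure Instance where
  n : ℕ
  k : ℕ
  t : ℕ
  k_pos : 0 < k
  t_pos : 0 < t
  C : Finset (Fin n)
  F : Finset (Fin n)
  d : Fin n → Fin n → ℝ
  d_eq_zero_iff : ∀ x y, d x y = 0 ↔ x = y
  d_symm : ∀ x y, d x y = d y x
  d_triangle : ∀ x y z, d x z ≤ d x y + d y z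
  G : Fin t → Finset (Fin n)
  G_subset : ∀ i, G i ⊆ F
  lower : Fin t → ℕ
  upper : Fin t → ℕ
  cap : Fin n → ℕ

namespace Instance

/-- The aspect ratio (largest distance over smallest distance between distinct points) is at
most `D`. -/
def AspectRatioLE (I : Instance) (D : ℝ) : Prop :=
  ∀ x y x' y' : Fin I.n, x' ≠ y' → I.d x y ≤ D * I.d x' y'

/-- `(S, ρ)` is a feasible solution. Only the values of `ρ` on clients matter. -/
structure Feasible (I : Instance) (S : Finset (Fin I.n)) (ρ : Fin I.n → Fin I.n) : Prop where
  subset : S ⊆ I.F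
  card_le : S.card ≤ I.k
  assigned : ∀ c ∈ I.C, ρ c ∈ S
  fair : ∀ i, I.lower i ≤ (S ∩ I.G i).card ∧ (S ∩ I.G i).card ≤ I.upper i
  capacity : ∀ f ∈ S, (I.C.filter fun c => ρ c = f).card ≤ I.cap f

/-- The cost with exponent `p`: `p = 1` is `k`-median, `p = 2` is `k`-means. -/
noncomputable def cost (I : Instance) (p : ℕ) (ρ : Fin I.n → Fin I.n) : ℝ :=
  ∑ c ∈ I.C, I.d c (ρ c) ^ p

/-- `(S, ρ)` is feasible and costs at most `γ` times as much as any (hence as the cheapest)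
feasible solution. -/
def IsApprox (I : Instance) (p : ℕ) (γ : ℝ) (S : Finset (Fin I.n)) (ρ : Fin I.n → Fin I.n) :
    Prop :=
  I.Feasible S ρ ∧ ∀ S' ρ', I.Feasible S' ρ' → I.cost p ρ ≤ γ * I.cost p ρ'

end Instance

/-! ### The machine model: a randomized real RAM

A program works on natural-number registers and real registers (finitely many are mentioned in a
program), and on a natural-number memory and a real memory that are addressed by computed indices.
Arithmetic operations and comparisons have unit cost. Natural numbers can only be added and
subtracted (no unit-cost multiplication), and there is no rounding of reals. -/

/-- Expressions with natural-number values; `sub` is truncated subtraction. -/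
inductive NExp where
  | lit (m : ℕ)
  | reg (i : ℕ)
  | mem (e : NExp)
  | add (e₁ e₂ : NExp)
  | sub (e₁ e₂ : NExp)

/-- Expressions with real values. -/
inductive RExp where
  | ofNat (e : NExp)
  | reg (i : ℕ)
  | mem (e : NExp)
  | add (e₁ e₂ : RExp)
  | sub (e₁ e₂ : RExp)
  | mul (e₁ e₂ : RExp)
  | div (e₁ e₂ : RExp)

/-- Tests. -/
inductive Test where
  | nle (e₁ e₂ : NExp)
  | rle (e₁ e₂ : RExp)
  | not (b : Test)
  | and (b₁ b₂ : Test)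

/-- Programs. `flip i` writes a fair random bit into the natural-number register `i`. -/
inductive Prog where
  | skip
  | setN (i : ℕ) (e : NExp)
  | setR (i : ℕ) (e : RExp)
  | storeN (a e : NExp)
  | storeR (a : NExp) (e : RExp)
  | flip (i : ℕ)
  | seq (P Q : Prog)
  | ite (b : Test) (P Q : Prog)
  | loop (b : Test) (P : Prog)

/-- A state: registers, memories, and the number of random bits used so far. -/
structure State where
  nreg : ℕ → ℕ
  rreg : ℕ → ℝ
  nmem : ℕ → ℕ
  rmem : ℕ → ℝ
  used : ℕ

namespace NExp

def eval (s : State) : NExp → ℕ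
  | lit m => m
  | reg i => s.nreg i
  | mem e => s.nmem (e.eval s)
  | add e₁ e₂ => e₁.eval s + e₂.eval s
  | sub e₁ e₂ => e₁.eval s - e₂.eval s

/-- The number of operations needed to evaluate the expression. -/
def time : NExp → ℕ
  | lit _ => 1
  | reg _ => 1
  | mem e => e.time + 1
  | add e₁ e₂ => e₁.time + e₂.time + 1
  | sub e₁ e₂ => e₁.time + e₂.time + 1

end NExp

namespace RExp

noncomputable def eval (s : State) : RExp → ℝ
  | ofNat e => (e.eval s : ℝ)
  | reg i => s.rreg i
  | mem e => s.rmem (e.eval s)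
  | add e₁ e₂ => e₁.eval s + e₂.eval s
  | sub e₁ e₂ => e₁.eval s - e₂.eval s
  | mul e₁ e₂ => e₁.eval s * e₂.eval s
  | div e₁ e₂ => e₁.eval s / e₂.eval s

def time : RExp → ℕ
  | ofNat e => e.time + 1
  | reg _ => 1
  | mem e => e.time + 1
  | add e₁ e₂ => e₁.time + e₂.time + 1
  | sub e₁ e₂ => e₁.time + e₂.time + 1
  | mul e₁ e₂ => e₁.time + e₂.time + 1
  | div e₁ e₂ => e₁.time + e₂.time + 1

end RExp

namespace Test

def Holds (s : State) : Test → Prop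
  | nle e₁ e₂ => e₁.eval s ≤ e₂.eval s
  | rle e₁ e₂ => e₁.eval s ≤ e₂.eval s
  | not b => ¬ b.Holds s
  | and b₁ b₂ => b₁.Holds s ∧ b₂.Holds s

def time : Test → ℕ
  | nle e₁ e₂ => e₁.time + e₂.time + 1
  | rle e₁ e₂ => e₁.time + e₂.time + 1
  | not b => b.time + 1
  | and b₁ b₂ => b₁.time + b₂.time + 1

end Test

/-- `Exec ω P s s' τ`: started in state `s`, with `ω` as its sequence of random bits, the program
`P` halts in state `s'` after exactly `τ` elementary steps. -/
inductive Exec (ω : ℕ → Bool) : Prog → State → State → ℕ → Prop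
  | skip (s : State) : Exec ω .skip s s 1
  | setN (s : State) (i : ℕ) (e : NExp) :
      Exec ω (.setN i e) s { s with nreg := Function.update s.nreg i (e.eval s) } (e.time + 1)
  | setR (s : State) (i : ℕ) (e : RExp) :
      Exec ω (.setR i e) s { s with rreg := Function.update s.rreg i (e.eval s) } (e.time + 1)
  | storeN (s : State) (a e : NExp) :
      Exec ω (.storeN a e) s { s with nmem := Function.update s.nmem (a.eval s) (e.eval s) }
        (a.time + e.time + 1)
  | storeR (s : State) (a : NExp) (e : RExp) :
      Exec ω (.storeR a e) s { s with rmem := Function.update s.rmem (a.eval s) (e.eval s) }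
        (a.time + e.time + 1)
  | flip (s : State) (i : ℕ) :
      Exec ω (.flip i) s
        { s with nreg := Function.update s.nreg i (ω s.used).toNat, used := s.used + 1 } 1
  | seq {P Q : Prog} {s s' s'' : State} {τ τ' : ℕ} :
      Exec ω P s s' τ → Exec ω Q s' s'' τ' → Exec ω (.seq P Q) s s'' (τ + τ')
  | ite_true {b : Test} {P Q : Prog} {s s' : State} {τ : ℕ} :
      b.Holds s → Exec ω P s s' τ → Exec ω (.ite b P Q) s s' (b.time + τ)
  | ite_false {b : Test} {P Q : Prog} {s s' : State} {τ : ℕ} :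
      ¬ b.Holds s → Exec ω Q s s' τ → Exec ω (.ite b P Q) s s' (b.time + τ)
  | loop_true {b : Test} {P : Prog} {s s' s'' : State} {τ τ' : ℕ} :
      b.Holds s → Exec ω P s s' τ → Exec ω (.loop b P) s' s'' τ' →
        Exec ω (.loop b P) s s'' (b.time + τ + τ')
  | loop_false {b : Test} {P : Prog} {s : State} :
      ¬ b.Holds s → Exec ω (.loop b P) s s b.time

/-! ### Input, output, and randomized approximation algorithms -/

/-- The 0/1 characteristic vector of a set of points. -/
def indicator {n : ℕ} (A : Finset (Fin n)) : List ℕ :=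
  List.ofFn fun x => if x ∈ A then 1 else 0

/-- The natural-number part of the input: `n, k, t`, the clients, the facilities, the capacities,
the lower and upper bounds, and the groups one after another. -/
def natInput (I : Instance) : List ℕ :=
  [I.n, I.k, I.t] ++ indicator I.C ++ indicator I.F ++ List.ofFn I.cap ++ List.ofFn I.lower ++
    List.ofFn I.upper ++ (List.ofFn fun i => indicator (I.G i)).flatten

/-- The real part of the input: the distance matrix, row by row. -/
def realInput (I : Instance) : List ℝ :=
  (List.ofFn fun x => List.ofFn fun y => I.d x y).flatten

/-- The initial state: the input stands at the beginning of the two memories, all else is `0`. -/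
noncomputable def start (I : Instance) : State where
  nreg := fun _ => 0
  rreg := fun _ => 0
  nmem := fun j => (natInput I).getD j 0
  rmem := fun j => (realInput I).getD j 0
  used := 0

/-- In state `s`, the first `n` cells of the natural-number memory hold the characteristic vector
of `S`, and the next `n` cells hold, for each client, the facility it is assigned to. -/
def Outputs (I : Instance) (s : State) (S : Finset (Fin I.n)) (ρ : Fin I.n → Fin I.n) : Prop :=
  (∀ x : Fin I.n, s.nmem (x : ℕ) = if x ∈ S then 1 else 0) ∧
    ∀ c ∈ I.C, s.nmem (I.n + (c : ℕ)) = (ρ c : ℕ)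

/-- A finite string of random bits, continued by `false`. -/
def bits {T : ℕ} (w : Fin T → Bool) (j : ℕ) : Bool :=
  if h : j < T then w ⟨j, h⟩ else false

/-- On the instance `I`, the randomized program `P` always halts within `T` steps (so it uses at
most `T` random bits) and, if `I` has a feasible solution, then with probability at least `2 / 3`
over `T` independent fair random bits it outputs a `γ`-approximate solution. -/
def ApproximatesInTime (P : Prog) (p : ℕ) (γ : ℝ) (I : Instance) (T : ℕ) : Prop :=
  (∀ w : Fin T → Bool, ∃ s τ, τ ≤ T ∧ Exec (bits w) P (start I) s τ) ∧
    ((∃ S ρ, I.Feasible S ρ) →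
      (2 / 3 : ℝ) * 2 ^ T ≤
        (Nat.card {w : Fin T → Bool // ∃ s τ S ρ, τ ≤ T ∧ Exec (bits w) P (start I) s τ ∧
          Outputs I s S ρ ∧ I.IsApprox p γ S ρ} : ℝ))

end CFR

/-! The program never draws a random bit. It computes a small set of points, the leaders, derives
from them a small set Z of candidate facilities, and finds the best solution with centers in Z by
exhaustive search. Put δ = 1/q, where q is about 62 max(1, 1/ε).

Leaders. A point m covers the cluster of a center f if |cluster| · d(f,m)^p is at most (1 + 3δ)
times the cost of the cluster plus δ/k times the cost of the solution. Leaders come from a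
derandomized form of sampling proportionally to the p-th power of the distance. Weight every client
by the p-th power of its distance to the leaders at hand. If a solution has an uncovered cluster,
then, by `Data.exists_heavy_ball`, some uncovered cluster has a ball around its center that carries
a 1/Q share of the total weight, with Q = O(k/δ⁴), and contains only covering points. It therefore
suffices to hit all heavy balls, which serves all solutions simultaneously. Some client lies in a
1/Q share of the balls not yet hit (`Data.card_liveSet_le`), so a greedy choice hits all of the at
most n² balls with O(Q log n) points (`Data.round_spec`). Every round covers one more cluster, hence
after k rounds the O(k Q log n) leaders cover all clusters of every solution (`Data.leaders_spec`).

Candidates. Around each leader lie rings whose radii grow by factors 1 + δ; bounded aspect ratio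
leaves O(q a log n) of them. For every leader, ring and type (set of groups containing a facility),
Z keeps the k facilities of largest capacity. By Hall's theorem the centers of a solution can be
replaced injectively by candidates of the same type, in the same ring around a covering leader, with
at least the same capacity (`Data.exists_replacement`). Fairness and capacities survive, and a
client at c with center f and leader m is now within d(c,f) + (2 + δ) d(f,m) of its center. Since
d(f,m)^p is, in total, about the old cost, this gives the factor 1 + 2 = 3 for p = 1, and 3 + 6 = 9
for p = 2 via (x + 2y)² ≤ 3x² + 6y² (`Data.cost_replacement`).

Search. The sets of at most k candidates are run through as k-tuples of candidates and blanks. For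
each fair one, a cheapest capacitated assignment is built client by client: an optimal assignment of
the earlier clients becomes optimal for one more client by augmenting along a single simple path of
facilities (`Data.exists_shift`). Such a path is again a tuple of candidates, so it too is found by
brute force.

Machine. The steps are written in a language of expressions with bounded sums, searches and
quantifiers, close to the mathematical definitions, and compiled to the RAM (`comp_spec`,
`Cmd.spec_of_ok`). The running time is polynomial in the largest loop bound, with an exponent that
depends neither on ε nor on a (`Cmd.tm_le`, `size_main`, `depth_main`). The loop bounds are
controlled by (|Z| + 1)^k and a polynomial in n and the other parameters (`loopBound_le`), which
gives the time bound (`time_le`). -/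

namespace CFR

/-! ### Bounded search and summation -/

/-- The least `j < N` with `P j`, and `N` if there is none. -/
noncomputable def findLt : ℕ → (ℕ → Prop) → ℕ
  | 0, _ => 0
  | N + 1, P => open Classical in
    if findLt N P < N then findLt N P else if P N then N else N + 1

theorem findLt_le (N : ℕ) (P : ℕ → Prop) : findLt N P ≤ N := by
  induction N with
  | zero => simp [findLt]
  | succ N ih => rw [findLt]; split_ifs <;> omega

theorem findLt_spec' (N : ℕ) (P : ℕ → Prop) :
    (findLt N P < N → P (findLt N P)) ∧ ∀ j < findLt N P, ¬ P j := by
  induction N with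
  | zero => simp [findLt]
  | succ N ih =>
    have hle := findLt_le N P
    rw [findLt]
    split_ifs with h1 h2
    · exact ⟨fun _ => ih.1 h1, ih.2⟩
    · have : findLt N P = N := by omega
      rw [this] at ih
      exact ⟨fun _ => h2, ih.2⟩
    · have : findLt N P = N := by omega
      rw [this] at ih
      refine ⟨fun h => absurd h (by omega), fun j hj => ?_⟩
      rcases Nat.lt_succ_iff_lt_or_eq.mp hj with h | rfl
      · exact ih.2 j h
      · exact h2

theorem findLt_spec {N : ℕ} {P : ℕ → Prop} (h : findLt N P < N) : P (findLt N P) :=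
  (findLt_spec' N P).1 h

theorem not_of_lt_findLt {N : ℕ} {P : ℕ → Prop} {j : ℕ} (h : j < findLt N P) : ¬ P j :=
  (findLt_spec' N P).2 j h

theorem findLt_le_of {N : ℕ} {P : ℕ → Prop} {j : ℕ} (h : P j) : findLt N P ≤ j := by
  by_contra hj
  exact not_of_lt_findLt (not_le.mp hj) h

theorem findLt_lt_of {N : ℕ} {P : ℕ → Prop} {j : ℕ} (hj : j < N) (h : P j) : findLt N P < N :=
  (findLt_le_of h).trans_lt hj

/-- Evaluated expressions agree with their mathematical counterparts only on valid indices. This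
congruence and `sumLt_congr` ask for agreement only there, and are the means of identifying what the
program computes. -/
theorem findLt_congr {N : ℕ} {P P' : ℕ → Prop} (h : ∀ j < N, (P j ↔ P' j)) :
    findLt N P = findLt N P' := by
  induction N with
  | zero => rfl
  | succ N ih =>
    have h1 : P N = P' N := propext (h N (by omega))
    rw [findLt, findLt, ih fun j hj => h j (by omega), h1]

/-- The conditional for natural numbers. -/
noncomputable def choose (P : Prop) (a b : ℕ) : ℕ := open Classical in if P then a else b

theorem choose_pos {P : Prop} (h : P) (a b : ℕ) : choose P a b = a := if_pos h
theorem choose_neg {P : Prop} (h : ¬ P) (a b : ℕ) : choose P a b = b := if_neg h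

/-- The sum of `f j` over all `j < N` with `P j`. -/
noncomputable def sumLt {M : Type} [AddCommMonoid M] (N : ℕ) (P : ℕ → Prop) (f : ℕ → M) : M :=
  open Classical in ∑ j ∈ Finset.range N, if P j then f j else 0

theorem sumLt_succ {M : Type} [AddCommMonoid M] (N : ℕ) (P : ℕ → Prop) (f : ℕ → M) :
    sumLt (N + 1) P f = sumLt N P f + open Classical in if P N then f N else 0 := by
  classical
  rw [sumLt, Finset.sum_range_succ]; rfl

theorem sumLt_congr {M : Type} [AddCommMonoid M] {N : ℕ} {P P' : ℕ → Prop} {f f' : ℕ → M}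
    (h : ∀ j < N, (P j ↔ P' j)) (h' : ∀ j < N, P' j → f j = f' j) :
    sumLt N P f = sumLt N P' f' := by
  classical
  refine Finset.sum_congr rfl fun j hj => ?_
  have hj := Finset.mem_range.mp hj
  by_cases hp : P' j
  · simp [h j hj, hp, h' j hj hp]
  · simp [h j hj, hp]

/-! ### Expressions with bounded quantifiers -/

/-- The types of expressions. -/
inductive Ty where
  | nat
  | real
  | bool

@[reducible] def Ty.den : Ty → Type
  | .nat => ℕ
  | .real => ℝ
  | .bool => Prop

/-- Expressions with bounded sums, searches and quantifiers. The bound `b` is the index of a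
natural-number register; `bv i` is the variable bound by the `i`-th enclosing binder; `arr j e` is
entry `e` of array `j`, where the arrays are interleaved above the address in register `0`. -/
inductive Ex : Ty → Type where
  | lit (m : ℕ) : Ex .nat
  | reg (i : ℕ) : Ex .nat
  | bv (i : ℕ) : Ex .nat
  | mem (e : Ex .nat) : Ex .nat
  | arr (j : ℕ) (e : Ex .nat) : Ex .nat
  | add (a b : Ex .nat) : Ex .nat
  | sub (a b : Ex .nat) : Ex .nat
  | cond (c : Ex .bool) (a b : Ex .nat) : Ex .nat
  | nsum (b : ℕ) (c : Ex .bool) (e : Ex .nat) : Ex .nat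
  | find (b : ℕ) (c : Ex .bool) : Ex .nat
  | ofNat (e : Ex .nat) : Ex .real
  | rreg (i : ℕ) : Ex .real
  | rmem (e : Ex .nat) : Ex .real
  | rarr (j : ℕ) (e : Ex .nat) : Ex .real
  | radd (a b : Ex .real) : Ex .real
  | rsub (a b : Ex .real) : Ex .real
  | rmul (a b : Ex .real) : Ex .real
  | rdiv (a b : Ex .real) : Ex .real
  | rsum (b : ℕ) (c : Ex .bool) (e : Ex .real) : Ex .real
  | nle (a b : Ex .nat) : Ex .bool
  | rle (a b : Ex .real) : Ex .bool
  | not (a : Ex .bool) : Ex .bool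
  | and (a b : Ex .bool) : Ex .bool
  | all (b : ℕ) (c : Ex .bool) : Ex .bool

/-- The address of entry `i` of array `j`. -/
def State.addr (s : State) (j i : ℕ) : ℕ := s.nreg 0 + (16 * i + j)

namespace Ex

/-- The value of an expression; `ρ` lists the values of the bound variables. -/
noncomputable def eval (s : State) : {σ : Ty} → Ex σ → List ℕ → σ.den
  | _, lit m, _ => m
  | _, reg i, _ => s.nreg i
  | _, bv i, ρ => ρ.getD i 0
  | _, mem e, ρ => s.nmem (e.eval s ρ)
  | _, arr j e, ρ => s.nmem (s.addr j (e.eval s ρ))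
  | _, add a b, ρ => (a.eval s ρ + b.eval s ρ : ℕ)
  | _, sub a b, ρ => (a.eval s ρ - b.eval s ρ : ℕ)
  | _, cond c a b, ρ => choose (c.eval s ρ) (a.eval s ρ) (b.eval s ρ)
  | _, nsum b c e, ρ => sumLt (M := ℕ) (s.nreg b) (fun j => c.eval s (j :: ρ))
      fun j => e.eval s (j :: ρ)
  | _, find b c, ρ => findLt (s.nreg b) fun j => c.eval s (j :: ρ)
  | _, ofNat e, ρ => ((e.eval s ρ : ℕ) : ℝ)
  | _, rreg i, _ => s.rreg i
  | _, rmem e, ρ => s.rmem (e.eval s ρ)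
  | _, rarr j e, ρ => s.rmem (s.addr j (e.eval s ρ))
  | _, radd a b, ρ => (a.eval s ρ + b.eval s ρ : ℝ)
  | _, rsub a b, ρ => (a.eval s ρ - b.eval s ρ : ℝ)
  | _, rmul a b, ρ => (a.eval s ρ * b.eval s ρ : ℝ)
  | _, rdiv a b, ρ => (a.eval s ρ / b.eval s ρ : ℝ)
  | _, rsum b c e, ρ => sumLt (M := ℝ) (s.nreg b) (fun j => c.eval s (j :: ρ))
      fun j => e.eval s (j :: ρ)
  | _, nle a b, ρ => (a.eval s ρ : ℕ) ≤ (b.eval s ρ : ℕ)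
  | _, rle a b, ρ => (a.eval s ρ : ℝ) ≤ (b.eval s ρ : ℝ)
  | _, not a, ρ => ¬ a.eval s ρ
  | _, and a b, ρ => a.eval s ρ ∧ b.eval s ρ
  | _, all b c, ρ => ∀ j < s.nreg b, c.eval s (j :: ρ)

/-- Registers are below `64`, and loop bounds are registers below `8`. -/
def ok : {σ : Ty} → Ex σ → Bool
  | _, lit _ => true
  | _, reg i => decide (i < 64)
  | _, bv _ => true
  | _, mem e => e.ok
  | _, arr _ e => e.ok
  | _, add a b => a.ok && b.ok
  | _, sub a b => a.ok && b.ok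
  | _, cond c a b => c.ok && (a.ok && b.ok)
  | _, nsum b c e => decide (b < 8) && (c.ok && e.ok)
  | _, find b c => decide (b < 8) && c.ok
  | _, ofNat e => e.ok
  | _, rreg i => decide (i < 64)
  | _, rmem e => e.ok
  | _, rarr _ e => e.ok
  | _, radd a b => a.ok && b.ok
  | _, rsub a b => a.ok && b.ok
  | _, rmul a b => a.ok && b.ok
  | _, rdiv a b => a.ok && b.ok
  | _, rsum b c e => decide (b < 8) && (c.ok && e.ok)
  | _, nle a b => a.ok && b.ok
  | _, rle a b => a.ok && b.ok
  | _, not a => a.ok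
  | _, and a b => a.ok && b.ok
  | _, all b c => decide (b < 8) && c.ok

/-- An upper bound for the running time of the compiled expression if the loop bounds are at
most `V`. -/
def tm (V : ℕ) : {σ : Ty} → Ex σ → ℕ
  | _, lit _ => 50
  | _, reg _ => 50
  | _, bv _ => 50
  | _, mem e => e.tm V + 50
  | _, arr _ e => e.tm V + 50
  | _, add a b => a.tm V + b.tm V + 50
  | _, sub a b => a.tm V + b.tm V + 50
  | _, cond c a b => c.tm V + (a.tm V + b.tm V) + 50
  | _, nsum _ c e => V * (c.tm V + e.tm V + 50) + 50
  | _, find _ c => V * (c.tm V + 50) + 50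
  | _, ofNat e => e.tm V + 50
  | _, rreg _ => 50
  | _, rmem e => e.tm V + 50
  | _, rarr _ e => e.tm V + 50
  | _, radd a b => a.tm V + b.tm V + 50
  | _, rsub a b => a.tm V + b.tm V + 50
  | _, rmul a b => a.tm V + b.tm V + 50
  | _, rdiv a b => a.tm V + b.tm V + 50
  | _, rsum _ c e => V * (c.tm V + e.tm V + 50) + 50
  | _, nle a b => a.tm V + b.tm V + 50
  | _, rle a b => a.tm V + b.tm V + 50
  | _, not a => a.tm V + 50
  | _, and a b => a.tm V + b.tm V + 50
  | _, all _ c => V * (c.tm V + 50) + 50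

end Ex

/-- Sixteen times the content of register `r`, plus `j`, plus the content of register `0`. -/
def NExp.addr (j r : ℕ) : NExp :=
  let e1 := NExp.add (.reg r) (.reg r)
  let e2 := NExp.add e1 e1
  let e3 := NExp.add e2 e2
  .add (.reg 0) (.add (.add e3 e3) (.lit j))

theorem NExp.eval_addr (s : State) (j r : ℕ) : (NExp.addr j r).eval s = s.addr j (s.nreg r) := by
  simp only [NExp.addr, NExp.eval, State.addr]; ring

/-- `while counter < bound do body; counter := counter + 1`. -/
def upTo (b c : ℕ) (body : Prog) : Prog :=
  .loop (.not (.nle (.reg b) (.reg c))) (.seq body (.setN c (.add (.reg c) (.lit 1))))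

/-- The compiler for expressions. The result is left in register `δ` (truth values as `0` or `1`);
only registers from `δ` on are used, and `ctx` lists the registers holding the bound variables. -/
def comp : {σ : Ty} → Ex σ → List ℕ → ℕ → Prog
  | _, .lit m, _, δ => .setN δ (.lit m)
  | _, .reg i, _, δ => .setN δ (.reg i)
  | _, .bv i, ctx, δ => match ctx[i]? with
    | some r => .setN δ (.reg r)
    | none => .setN δ (.lit 0)
  | _, .mem e, ctx, δ => .seq (comp e ctx δ) (.setN δ (.mem (.reg δ)))
  | _, .arr j e, ctx, δ => .seq (comp e ctx δ) (.setN δ (.mem (.addr j δ)))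
  | _, .add a b, ctx, δ => .seq (comp a ctx δ) (.seq (comp b ctx (δ + 1))
      (.setN δ (.add (.reg δ) (.reg (δ + 1)))))
  | _, .sub a b, ctx, δ => .seq (comp a ctx δ) (.seq (comp b ctx (δ + 1))
      (.setN δ (.sub (.reg δ) (.reg (δ + 1)))))
  | _, .cond c a b, ctx, δ => .seq (comp c ctx δ) (.ite (.nle (.lit 1) (.reg δ))
      (comp a ctx δ) (comp b ctx δ))
  | _, .nsum b c e, ctx, δ => .seq (.setN δ (.lit 0)) (.seq (.setN (δ + 1) (.lit 0))
      (upTo b (δ + 1) (.seq (comp c ((δ + 1) :: ctx) (δ + 2))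
        (.ite (.nle (.lit 1) (.reg (δ + 2))) (.seq (comp e ((δ + 1) :: ctx) (δ + 2))
          (.setN δ (.add (.reg δ) (.reg (δ + 2))))) .skip))))
  | _, .find b c, ctx, δ => .seq (.setN δ (.lit 0)) (.seq (.setN (δ + 1) (.lit 0))
      (upTo b (δ + 1) (.seq (comp c ((δ + 1) :: ctx) (δ + 2))
        (.ite (.and (.nle (.reg (δ + 1)) (.reg δ)) (.not (.nle (.lit 1) (.reg (δ + 2)))))
          (.setN δ (.add (.reg (δ + 1)) (.lit 1))) .skip))))
  | _, .ofNat e, ctx, δ => .seq (comp e ctx δ) (.setR δ (.ofNat (.reg δ)))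
  | _, .rreg i, _, δ => .setR δ (.reg i)
  | _, .rmem e, ctx, δ => .seq (comp e ctx δ) (.setR δ (.mem (.reg δ)))
  | _, .rarr j e, ctx, δ => .seq (comp e ctx δ) (.setR δ (.mem (.addr j δ)))
  | _, .radd a b, ctx, δ => .seq (comp a ctx δ) (.seq (comp b ctx (δ + 1))
      (.setR δ (.add (.reg δ) (.reg (δ + 1)))))
  | _, .rsub a b, ctx, δ => .seq (comp a ctx δ) (.seq (comp b ctx (δ + 1))
      (.setR δ (.sub (.reg δ) (.reg (δ + 1)))))
  | _, .rmul a b, ctx, δ => .seq (comp a ctx δ) (.seq (comp b ctx (δ + 1))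
      (.setR δ (.mul (.reg δ) (.reg (δ + 1)))))
  | _, .rdiv a b, ctx, δ => .seq (comp a ctx δ) (.seq (comp b ctx (δ + 1))
      (.setR δ (.div (.reg δ) (.reg (δ + 1)))))
  | _, .rsum b c e, ctx, δ => .seq (.setR δ (.ofNat (.lit 0))) (.seq (.setN (δ + 1) (.lit 0))
      (upTo b (δ + 1) (.seq (comp c ((δ + 1) :: ctx) (δ + 2))
        (.ite (.nle (.lit 1) (.reg (δ + 2))) (.seq (comp e ((δ + 1) :: ctx) (δ + 2))
          (.setR δ (.add (.reg δ) (.reg (δ + 2))))) .skip))))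
  | _, .nle a b, ctx, δ => .seq (comp a ctx δ) (.seq (comp b ctx (δ + 1))
      (.ite (.nle (.reg δ) (.reg (δ + 1))) (.setN δ (.lit 1)) (.setN δ (.lit 0))))
  | _, .rle a b, ctx, δ => .seq (comp a ctx δ) (.seq (comp b ctx (δ + 1))
      (.ite (.rle (.reg δ) (.reg (δ + 1))) (.setN δ (.lit 1)) (.setN δ (.lit 0))))
  | _, .not a, ctx, δ => .seq (comp a ctx δ) (.setN δ (.sub (.lit 1) (.reg δ)))
  | _, .and a b, ctx, δ => .seq (comp a ctx δ) (.seq (comp b ctx (δ + 1))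
      (.ite (.nle (.lit 1) (.reg δ)) (.setN δ (.reg (δ + 1))) .skip))
  | _, .all b c, ctx, δ => .seq (.setN δ (.lit 1)) (.seq (.setN (δ + 1) (.lit 0))
      (upTo b (δ + 1) (.seq (comp c ((δ + 1) :: ctx) (δ + 2))
        (.ite (.nle (.lit 1) (.reg (δ + 2))) .skip (.setN δ (.lit 0))))))

/-! ### Correctness of the compiled expressions -/

/-- `P` halts in `s'` after `τ` steps, whatever the random bits are. -/
def Runs (P : Prog) (s s' : State) (τ : ℕ) : Prop := ∀ ω, Exec ω P s s' τ

/-- `s'` has the same memory as `s`, and the same contents of the registers below `δ`. -/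
structure Keep (δ : ℕ) (s s' : State) : Prop where
  nreg : ∀ i < δ, s'.nreg i = s.nreg i
  rreg : ∀ i < δ, s'.rreg i = s.rreg i
  nmem : s'.nmem = s.nmem
  rmem : s'.rmem = s.rmem

theorem Keep.refl (δ : ℕ) (s : State) : Keep δ s s := ⟨fun _ _ => rfl, fun _ _ => rfl, rfl, rfl⟩

theorem Keep.trans {δ : ℕ} {s s' s'' : State} (h : Keep δ s s') (h' : Keep δ s' s'') :
    Keep δ s s'' :=
  ⟨fun i hi => (h'.nreg i hi).trans (h.nreg i hi), fun i hi => (h'.rreg i hi).trans (h.rreg i hi),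
    h'.nmem.trans h.nmem, h'.rmem.trans h.rmem⟩

theorem Keep.mono {δ δ' : ℕ} {s s' : State} (h : Keep δ' s s') (hδ : δ ≤ δ') : Keep δ s s' :=
  ⟨fun i hi => h.nreg i (by omega), fun i hi => h.rreg i (by omega), h.nmem, h.rmem⟩

/-- The state after writing a natural-number register. -/
def State.setN (s : State) (i v : ℕ) : State := { s with nreg := Function.update s.nreg i v }

/-- The state after writing a real register. -/
noncomputable def State.setR (s : State) (i : ℕ) (v : ℝ) : State :=
  { s with rreg := Function.update s.rreg i v }

theorem Keep.setN {δ i v : ℕ} (s : State) (h : δ ≤ i) : Keep δ s (s.setN i v) :=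
  ⟨fun j hj => Function.update_of_ne (by omega) _ _, fun _ _ => rfl, rfl, rfl⟩

theorem Keep.setR {δ i : ℕ} {v : ℝ} (s : State) (h : δ ≤ i) : Keep δ s (s.setR i v) :=
  ⟨fun _ _ => rfl, fun j hj => Function.update_of_ne (by omega) _ _, rfl, rfl⟩

theorem State.nreg_setN (s : State) (i v j : ℕ) :
    (s.setN i v).nreg j = if j = i then v else s.nreg j := by
  simp [State.setN, Function.update_apply]

theorem State.rreg_setR (s : State) (i : ℕ) (v : ℝ) (j : ℕ) :
    (s.setR i v).rreg j = if j = i then v else s.rreg j := by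
  simp [State.setR, Function.update_apply]

@[simp] theorem State.nreg_setR (s : State) (i : ℕ) (v : ℝ) : (s.setR i v).nreg = s.nreg := rfl
@[simp] theorem State.rreg_setN (s : State) (i v : ℕ) : (s.setN i v).rreg = s.rreg := rfl

theorem Keep.addr {δ : ℕ} {s s' : State} (h : Keep δ s s') (hδ : 64 ≤ δ) (j i : ℕ) :
    s'.addr j i = s.addr j i := by
  simp [State.addr, h.nreg 0 (by omega)]

/-- A well-formed expression reads only registers below `64`, memory and bound variables, so scratch
work done by other compiled code cannot change its value. -/
theorem Ex.eval_keep {s s' : State} (h : Keep 64 s s') : ∀ {σ : Ty} (e : Ex σ), e.ok → ∀ ρ,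
    e.eval s' ρ = e.eval s ρ := by
  intro σ e
  induction e <;> intro hok ρ <;> simp only [Ex.ok, Bool.and_eq_true, decide_eq_true_eq] at hok
  all_goals simp_all only [Ex.eval, h.nmem, h.rmem, h.addr le_rfl, h.nreg, h.rreg]
  all_goals rw [h.nreg _ (by omega)]

theorem Runs.skip (s : State) : Runs .skip s s 1 := fun _ => .skip s

theorem Runs.setN (s : State) (i : ℕ) (e : NExp) :
    Runs (.setN i e) s (s.setN i (e.eval s)) (e.time + 1) := fun _ => .setN s i e

theorem Runs.setR (s : State) (i : ℕ) (e : RExp) :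
    Runs (.setR i e) s (s.setR i (e.eval s)) (e.time + 1) := fun _ => .setR s i e

theorem Runs.seq {P Q : Prog} {s s' s'' : State} {τ τ' : ℕ} (h : Runs P s s' τ)
    (h' : Runs Q s' s'' τ') : Runs (.seq P Q) s s'' (τ + τ') := fun ω => .seq (h ω) (h' ω)

theorem Runs.ite_true {b : Test} {P Q : Prog} {s s' : State} {τ : ℕ} (hb : b.Holds s)
    (h : Runs P s s' τ) : Runs (.ite b P Q) s s' (b.time + τ) := fun ω => .ite_true hb (h ω)

theorem Runs.ite_false {b : Test} {P Q : Prog} {s s' : State} {τ : ℕ} (hb : ¬ b.Holds s)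
    (h : Runs Q s s' τ) : Runs (.ite b P Q) s s' (b.time + τ) := fun ω => .ite_false hb (h ω)

/-- The invariant rule for counting loops. The body must not disturb the counter, and the invariant
is required after the increment. The slack `10` pays for test and increment in each round, `5` for
the final failing test. -/
theorem upTo_runs {b c N tb : ℕ} {body : Prog} (Inv : ℕ → State → Prop)
    (hb : ∀ j s, Inv j s → s.nreg c = j ∧ s.nreg b = N)
    (hbody : ∀ j < N, ∀ s, Inv j s → ∃ s' τ, Runs body s s' τ ∧ τ ≤ tb ∧ s'.nreg c = j ∧
      Inv (j + 1) (s'.setN c (j + 1))) (s : State) (h0 : Inv 0 s) :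
    ∃ s' τ, Runs (upTo b c body) s s' τ ∧ τ ≤ N * (tb + 10) + 5 ∧ Inv N s' := by
  -- Induction on the number `m` of remaining rounds, since the semantics unfolds a loop from its
  -- first round.
  have key : ∀ m j s, j + m = N → Inv j s →
      ∃ s' τ, Runs (upTo b c body) s s' τ ∧ τ ≤ m * (tb + 10) + 5 ∧ Inv N s' := by
    intro m
    induction m with
    | zero =>
      intro j s hj hI
      obtain ⟨h1, h2⟩ := hb _ _ hI
      obtain rfl : j = N := by omega
      refine ⟨s, _, fun ω => .loop_false ?_, ?_, hI⟩
      · simp [Test.Holds, NExp.eval, h1, h2]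
      · simp [Test.time, NExp.time]
    | succ m ih =>
      intro j s hj hI
      obtain ⟨h1, h2⟩ := hb _ _ hI
      obtain ⟨s1, τ1, r1, t1, c1, I1⟩ := hbody j (by omega) s hI
      obtain ⟨s2, τ2, r2, t2, I2⟩ := ih (j + 1) _ (by omega) I1
      have r3 := Runs.setN s1 c (.add (.reg c) (.lit 1))
      rw [NExp.eval, NExp.eval, NExp.eval, c1] at r3
      refine ⟨s2, _, fun ω => .loop_true ?_ (r1.seq r3 ω) (r2 ω), ?_, I2⟩
      · simp [Test.Holds, NExp.eval, h1, h2]; omega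
      · simp only [Test.time, NExp.time]
        rw [add_mul]; omega
  exact key N 0 s (by omega) h0

/-- The bound variables have the values `ρ`. -/
def CtxOK (ctx ρ : List ℕ) (δ : ℕ) (s : State) : Prop :=
  List.Forall₂ (fun r v => r < δ ∧ s.nreg r = v) ctx ρ

theorem CtxOK.keep {ctx ρ : List ℕ} {δ δ' : ℕ} {s s' : State} (h : CtxOK ctx ρ δ s)
    (hk : Keep δ s s') (hδ : δ ≤ δ') : CtxOK ctx ρ δ' s' :=
  List.Forall₂.imp (fun r _ hr => ⟨by omega, by rw [hk.nreg r hr.1, hr.2]⟩) h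

/-- The register holding the result has the right content. -/
def Res (s : State) (δ : ℕ) : (σ : Ty) → σ.den → Prop
  | .nat, v => s.nreg δ = v
  | .real, v => s.rreg δ = v
  | .bool, v => open Classical in s.nreg δ = if v then 1 else 0

/-- The compiled expression computes the value of the expression. -/
def CompSpec (V : ℕ) {σ : Ty} (e : Ex σ) : Prop :=
  ∀ ctx ρ δ s, 64 ≤ δ → CtxOK ctx ρ δ s → (∀ b < 8, s.nreg b ≤ V) →
    ∃ s' τ, Runs (comp e ctx δ) s s' τ ∧ τ ≤ e.tm V ∧ Keep δ s s' ∧ Res s' δ σ (e.eval s ρ)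

theorem ok_bound {V : ℕ} {s s' : State} {δ : ℕ} (h : Keep δ s s') (hδ : 64 ≤ δ)
    (hV : ∀ b < 8, s.nreg b ≤ V) : ∀ b < 8, s'.nreg b ≤ V := fun b hb => by
  rw [h.nreg b (by omega)]; exact hV b hb

/-- The compiled operand leaves its value in register `δ`; only the final instruction `P δ` differs
between the unary constructors, so only that remains to be checked. -/
theorem compSpec_unary {V : ℕ} {σ σ' : Ty} {a : Ex σ} {e : Ex σ'} (ha : CompSpec V a)
    (P : ℕ → Prog) (hc : ∀ ctx δ, comp e ctx δ = .seq (comp a ctx δ) (P δ))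
    (hP : ∀ δ s s1 ρ, 64 ≤ δ → Keep δ s s1 → Res s1 δ σ (a.eval s ρ) →
      ∃ s' τ, Runs (P δ) s1 s' τ ∧ τ ≤ 50 ∧ Keep δ s1 s' ∧ Res s' δ σ' (e.eval s ρ))
    (ht : a.tm V + 50 ≤ e.tm V) : CompSpec V e := by
  intro ctx ρ δ s hδ hctx hV
  obtain ⟨s1, τ1, r1, t1, k1, e1⟩ := ha ctx ρ δ s hδ hctx hV
  obtain ⟨s2, τ2, r2, t2, k2, e2⟩ := hP δ s s1 ρ hδ k1 e1
  exact ⟨s2, _, hc ctx δ ▸ r1.seq r2, by omega, k1.trans k2, e2⟩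

/-- The second operand is compiled with scratch space from `δ + 1` on, so the first result survives
in register `δ`; by `Ex.eval_keep` the second value is still the one in the original state. -/
theorem compSpec_binary {V : ℕ} {σ σ' : Ty} {a b : Ex σ} {e : Ex σ'} (ha : CompSpec V a)
    (hb : CompSpec V b) (hbok : b.ok) (P : ℕ → Prog)
    (hc : ∀ ctx δ, comp e ctx δ = .seq (comp a ctx δ) (.seq (comp b ctx (δ + 1)) (P δ)))
    (hP : ∀ δ s s1 ρ, 64 ≤ δ → Res s1 δ σ (a.eval s ρ) → Res s1 (δ + 1) σ (b.eval s ρ) →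
      ∃ s' τ, Runs (P δ) s1 s' τ ∧ τ ≤ 50 ∧ Keep δ s1 s' ∧ Res s' δ σ' (e.eval s ρ))
    (ht : a.tm V + b.tm V + 50 ≤ e.tm V) : CompSpec V e := by
  intro ctx ρ δ s hδ hctx hV
  obtain ⟨s1, τ1, r1, t1, k1, e1⟩ := ha ctx ρ δ s hδ hctx hV
  obtain ⟨s2, τ2, r2, t2, k2, e2⟩ := hb ctx ρ (δ + 1) s1 (by omega)
    (hctx.keep k1 (by omega)) (ok_bound k1 hδ hV)
  rw [Ex.eval_keep (k1.mono hδ) b hbok] at e2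
  have e1' : Res s2 δ σ (a.eval s ρ) := by
    cases σ
    · exact (k2.nreg δ (by omega)).trans e1
    · exact (k2.rreg δ (by omega)).trans e1
    · exact (k2.nreg δ (by omega)).trans e1
  obtain ⟨s3, τ3, r3, t3, k3, e3⟩ := hP δ s s2 ρ hδ e1' e2
  exact ⟨s3, _, hc ctx δ ▸ r1.seq (r2.seq r3), by omega,
    k1.trans ((k2.mono (by omega)).trans k3), e3⟩

/-- Compiled binders: an accumulator in register `δ`, a counter in register `δ + 1`. -/
theorem compSpec_binder {V b : ℕ} {σ' : Ty} {c : Ex .bool} {e : Ex σ'} (hb : b < 8)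
    (hc : CompSpec V c) (hcok : c.ok) (te : ℕ) (P0 : ℕ → Prog) (P : List ℕ → ℕ → Prog)
    (val : State → List ℕ → ℕ → σ'.den)
    (hcomp : ∀ ctx δ, comp e ctx δ = .seq (P0 δ) (.seq (.setN (δ + 1) (.lit 0))
      (upTo b (δ + 1) (.seq (comp c ((δ + 1) :: ctx) (δ + 2)) (P ctx δ)))))
    (hP0 : ∀ δ s ρ, ∃ s' τ, Runs (P0 δ) s s' τ ∧ τ ≤ 3 ∧ Keep δ s s' ∧
      Res s' δ σ' (val s ρ 0))
    (hP : ∀ ctx ρ δ s s1 j, 64 ≤ δ → j < s.nreg b → Keep δ s s1 → s1.nreg (δ + 1) = j →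
      CtxOK ((δ + 1) :: ctx) (j :: ρ) (δ + 2) s1 → (∀ b < 8, s1.nreg b ≤ V) →
      Res s1 δ σ' (val s ρ j) → Res s1 (δ + 2) .bool (c.eval s (j :: ρ)) →
      ∃ s' τ, Runs (P ctx δ) s1 s' τ ∧ τ ≤ te + 20 ∧ Keep δ s1 s' ∧ s'.nreg (δ + 1) = j ∧
        Res s' δ σ' (val s ρ (j + 1)))
    (hval : ∀ s ρ, val s ρ (s.nreg b) = e.eval s ρ)
    (ht : V * (c.tm V + te + 50) + 50 ≤ e.tm V) : CompSpec V e := by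
  intro ctx ρ δ s hδ hctx hV
  obtain ⟨s1, τ1, r1, t1, k1, e1⟩ := hP0 δ s ρ
  have hset : ∀ (s' : State) (v : ℕ) (x : σ'.den), Res s' δ σ' x →
      Res (s'.setN (δ + 1) v) δ σ' x := by
    intro s' v x hx
    cases σ'
    · exact (Function.update_of_ne (by omega) _ _).trans hx
    · exact hx
    · exact (Function.update_of_ne (by omega) _ _).trans hx
  obtain ⟨s3, τ3, r3, t3, k3, c3, e3⟩ := upTo_runs (b := b) (c := δ + 1) (N := s.nreg b)
    (tb := c.tm V + (te + 20)) (body := .seq (comp c ((δ + 1) :: ctx) (δ + 2)) (P ctx δ))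
    (fun j s' => Keep δ s s' ∧ s'.nreg (δ + 1) = j ∧ Res s' δ σ' (val s ρ j))
    (fun j s' h => ⟨h.2.1, h.1.nreg b (by omega)⟩)
    (by
      intro j hj s' ⟨hk, hcj, hr⟩
      have hV' := ok_bound hk hδ hV
      have hctx' : CtxOK ((δ + 1) :: ctx) (j :: ρ) (δ + 2) s' :=
        List.Forall₂.cons ⟨by omega, hcj⟩ (hctx.keep hk (by omega))
      obtain ⟨s4, τ4, r4, t4, k4, e4⟩ := hc ((δ + 1) :: ctx) (j :: ρ) (δ + 2) s' (by omega) hctx' hV'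
      rw [Ex.eval_keep (hk.mono hδ) c hcok] at e4
      have hr4 : Res s4 δ σ' (val s ρ j) := by
        cases σ'
        · exact (k4.nreg δ (by omega)).trans hr
        · exact (k4.rreg δ (by omega)).trans hr
        · exact (k4.nreg δ (by omega)).trans hr
      have k4' := k4.mono (show δ ≤ δ + 2 by omega)
      obtain ⟨s5, τ5, r5, t5, k5, c5, e5⟩ := hP ctx ρ δ s s4 j hδ hj (hk.trans k4')
        ((k4.nreg _ (by omega)).trans hcj) (hctx'.keep k4 le_rfl) (ok_bound k4' hδ hV') hr4 e4
      refine ⟨s5, _, r4.seq r5, by omega, c5, ?_, ?_, hset _ _ _ e5⟩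
      · exact (hk.trans k4').trans (k5.trans (Keep.setN _ (by omega)))
      · simp [State.nreg_setN])
    (s1.setN (δ + 1) 0) ⟨k1.trans (Keep.setN _ (by omega)), by simp [State.nreg_setN], hset _ _ _ e1⟩
  refine ⟨s3, _, hcomp ctx δ ▸ r1.seq ((Runs.setN s1 (δ + 1) (.lit 0)).seq r3), ?_, k3, ?_⟩
  · have : s.nreg b * (c.tm V + (te + 20) + 10) ≤ V * (c.tm V + te + 50) :=
      Nat.mul_le_mul (hV b hb) (by omega)
    simp only [NExp.time]
    omega
  · rw [← hval]; exact e3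

theorem setN_step {σ : ℕ} {s : State} {e : NExp} {v : ℕ} (δ : ℕ) (hv : e.eval s = v)
    (ht : e.time ≤ 49) (hσ : σ ≤ δ) :
    ∃ s' τ, Runs (.setN δ e) s s' τ ∧ τ ≤ 50 ∧ Keep σ s s' ∧ s'.nreg δ = v :=
  ⟨_, _, Runs.setN s δ e, by omega, Keep.setN s hσ, by simp [State.nreg_setN, hv]⟩

theorem setR_step {σ : ℕ} {s : State} {e : RExp} {v : ℝ} (δ : ℕ) (hv : e.eval s = v)
    (ht : e.time ≤ 49) (hσ : σ ≤ δ) :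
    ∃ s' τ, Runs (.setR δ e) s s' τ ∧ τ ≤ 50 ∧ Keep σ s s' ∧ s'.rreg δ = v :=
  ⟨_, _, Runs.setR s δ e, by omega, Keep.setR s hσ, by simp [State.rreg_setR, hv]⟩

theorem ite_step {σ δ : ℕ} {s : State} (T : Test) (P : Prop) [Decidable P]
    (hT : T.Holds s ↔ P) (ht : T.time ≤ 40) (hσ : σ ≤ δ) :
    ∃ s' τ, Runs (.ite T (.setN δ (.lit 1)) (.setN δ (.lit 0))) s s' τ ∧ τ ≤ 50 ∧ Keep σ s s' ∧
      s'.nreg δ = if P then 1 else 0 := by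
  by_cases h : P
  · refine ⟨_, _, Runs.ite_true (hT.mpr h) (Runs.setN s δ _), ?_, Keep.setN s hσ, ?_⟩
    · simp only [NExp.time]; omega
    · simp [State.nreg_setN, h, NExp.eval]
  · refine ⟨_, _, Runs.ite_false (fun h' => h (hT.mp h')) (Runs.setN s δ _), ?_, Keep.setN s hσ, ?_⟩
    · simp only [NExp.time]; omega
    · simp [State.nreg_setN, h, NExp.eval]

theorem res_flag {s : State} {δ : ℕ} {P : Prop} (h : Res s δ .bool P) :
    (Test.nle (.lit 1) (.reg δ)).Holds s ↔ P := by
  classical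
  rw [Res] at h
  by_cases hp : P <;> simp [Test.Holds, NExp.eval, h, hp]

theorem compSpec_cond {V : ℕ} {c : Ex .bool} {a b : Ex .nat} (hc : CompSpec V c)
    (ha : CompSpec V a) (hb : CompSpec V b) (haok : a.ok) (hbok : b.ok) :
    CompSpec V (.cond c a b) := by
  intro ctx ρ δ s hδ hctx hV
  obtain ⟨s1, τ1, r1, t1, k1, e1⟩ := hc ctx ρ δ s hδ hctx hV
  have hf := res_flag e1
  by_cases h : c.eval s ρ
  · obtain ⟨s2, τ2, r2, t2, k2, e2⟩ := ha ctx ρ δ s1 hδ (hctx.keep k1 le_rfl) (ok_bound k1 hδ hV)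
    rw [Ex.eval_keep (k1.mono hδ) a haok] at e2
    refine ⟨s2, _, r1.seq (Runs.ite_true (hf.mpr h) r2), ?_, k1.trans k2, ?_⟩
    · simp only [Test.time, NExp.time, Ex.tm]; omega
    · rw [Ex.eval, choose_pos h]; exact e2
  · obtain ⟨s2, τ2, r2, t2, k2, e2⟩ := hb ctx ρ δ s1 hδ (hctx.keep k1 le_rfl) (ok_bound k1 hδ hV)
    rw [Ex.eval_keep (k1.mono hδ) b hbok] at e2
    refine ⟨s2, _, r1.seq (Runs.ite_false (fun h' => h (hf.mp h')) r2), ?_, k1.trans k2, ?_⟩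
    · simp only [Test.time, NExp.time, Ex.tm]; omega
    · rw [Ex.eval, choose_neg h]; exact e2

/-- One round of a conditional sum, shared by natural and real sums: `v` and `v'` are the
accumulator before and after the round, and `acc` is the instruction that adds the summand. -/
theorem compSpec_sum_step {V : ℕ} {σ : Ty} {e : Ex σ} (he : CompSpec V e) (heok : e.ok)
    (ctx ρ : List ℕ) (δ : ℕ) (s s1 : State) (j : ℕ) (hδ : 64 ≤ δ) (k1 : Keep δ s s1)
    (hj : s1.nreg (δ + 1) = j) (hctx : CtxOK ((δ + 1) :: ctx) (j :: ρ) (δ + 2) s1)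
    (hV : ∀ b < 8, s1.nreg b ≤ V) (P : Prop) (hP : Res s1 (δ + 2) .bool P) (acc : Prog)
    (v v' : σ.den) (hv : Res s1 δ σ v) (hv' : ¬ P → v' = v)
    (hacc : ∀ s2, Keep δ s1 s2 → s2.nreg (δ + 1) = j → Res s2 δ σ v → P →
      Res s2 (δ + 2) σ (e.eval s (j :: ρ)) →
      ∃ s' τ, Runs acc s2 s' τ ∧ τ ≤ 8 ∧ Keep δ s2 s' ∧ s'.nreg (δ + 1) = j ∧ Res s' δ σ v') :
    ∃ s' τ, Runs (.ite (.nle (.lit 1) (.reg (δ + 2))) (.seq (comp e ((δ + 1) :: ctx) (δ + 2)) acc)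
      .skip) s1 s' τ ∧ τ ≤ e.tm V + 20 ∧ Keep δ s1 s' ∧ s'.nreg (δ + 1) = j ∧ Res s' δ σ v' := by
  have hf := res_flag hP
  by_cases h : P
  · obtain ⟨s2, τ2, r2, t2, k2, e2⟩ := he _ _ (δ + 2) s1 (by omega) hctx hV
    rw [Ex.eval_keep (k1.mono hδ) e heok] at e2
    have hr : Res s2 δ σ v := by
      cases σ
      · exact (k2.nreg δ (by omega)).trans hv
      · exact (k2.rreg δ (by omega)).trans hv
      · exact (k2.nreg δ (by omega)).trans hv
    have k2' := k2.mono (show δ ≤ δ + 2 by omega)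
    obtain ⟨s3, τ3, r3, t3, k3, c3, e3⟩ :=
      hacc s2 k2' ((k2.nreg _ (by omega)).trans hj) hr h e2
    refine ⟨s3, _, Runs.ite_true (hf.mpr h) (r2.seq r3), ?_, k2'.trans k3, c3, e3⟩
    simp only [Test.time, NExp.time]; omega
  · refine ⟨s1, _, Runs.ite_false (fun h' => h (hf.mp h')) (Runs.skip s1), ?_, Keep.refl _ _, hj, ?_⟩
    · simp only [Test.time, NExp.time]; omega
    · rw [hv' h]; exact hv

theorem compSpec_nsum {V b : ℕ} {c : Ex .bool} {e : Ex .nat} (hb : b < 8) (hc : CompSpec V c)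
    (hcok : c.ok) (he : CompSpec V e) (heok : e.ok) : CompSpec V (.nsum b c e) := by
  classical
  refine compSpec_binder hb hc hcok (e.tm V) (fun δ => .setN δ (.lit 0))
    (fun ctx δ => .ite (.nle (.lit 1) (.reg (δ + 2))) (.seq (comp e ((δ + 1) :: ctx) (δ + 2))
          (.setN δ (.add (.reg δ) (.reg (δ + 2))))) .skip)
    (fun s ρ j => sumLt (M := ℕ) j (fun j => c.eval s (j :: ρ)) fun j => e.eval s (j :: ρ))
    (fun _ _ => rfl) ?_ ?_ (fun _ _ => rfl) (by simp only [Ex.tm]; omega)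
  · intro δ s ρ
    exact ⟨_, _, Runs.setN s δ (.lit 0), by simp [NExp.time], Keep.setN s le_rfl,
      by simp [Res, State.nreg_setN, NExp.eval, sumLt]⟩
  · intro ctx ρ δ s s1 j hδ hj k1 hcj hctx hV hr hres
    refine compSpec_sum_step he heok ctx ρ δ s s1 j hδ k1 hcj hctx hV _ hres _ _ _ hr ?_ ?_
    · intro hn; simp [sumLt_succ, hn]
    · intro s2 k2 hc2 hr2 hP hv
      refine ⟨_, _, Runs.setN s2 δ _, by simp [NExp.time], Keep.setN s2 le_rfl,
        by simp [State.nreg_setN, hc2], ?_⟩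
      simp only [Res] at hr2 hv ⊢
      simp [State.nreg_setN, sumLt_succ, hP, NExp.eval, hr2, hv]

theorem compSpec_rsum {V b : ℕ} {c : Ex .bool} {e : Ex .real} (hb : b < 8) (hc : CompSpec V c)
    (hcok : c.ok) (he : CompSpec V e) (heok : e.ok) : CompSpec V (.rsum b c e) := by
  classical
  refine compSpec_binder hb hc hcok (e.tm V) (fun δ => .setR δ (.ofNat (.lit 0)))
    (fun ctx δ => .ite (.nle (.lit 1) (.reg (δ + 2))) (.seq (comp e ((δ + 1) :: ctx) (δ + 2))
          (.setR δ (.add (.reg δ) (.reg (δ + 2))))) .skip)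
    (fun s ρ j => sumLt (M := ℝ) j (fun j => c.eval s (j :: ρ)) fun j => e.eval s (j :: ρ))
    (fun _ _ => rfl) ?_ ?_ (fun _ _ => rfl) (by simp only [Ex.tm]; omega)
  · intro δ s ρ
    exact ⟨_, _, Runs.setR s δ (.ofNat (.lit 0)), by simp [RExp.time, NExp.time], Keep.setR s le_rfl,
      by simp [Res, State.rreg_setR, NExp.eval, RExp.eval, sumLt]⟩
  · intro ctx ρ δ s s1 j hδ hj k1 hcj hctx hV hr hres
    refine compSpec_sum_step he heok ctx ρ δ s s1 j hδ k1 hcj hctx hV _ hres _ _ _ hr ?_ ?_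
    · intro hn; simp [sumLt_succ, hn]
    · intro s2 k2 hc2 hr2 hP hv
      refine ⟨_, _, Runs.setR s2 δ _, by simp [RExp.time], Keep.setR s2 le_rfl, by simpa using hc2, ?_⟩
      simp only [Res] at hr2 hv ⊢
      simp [State.rreg_setR, sumLt_succ, hP, RExp.eval, hr2, hv]

/-- The accumulator after `j` rounds is `findLt j`, which equals the counter exactly while nothing
has been found. The test "counter ≤ accumulator" thus serves as the flag for an unfinished search.
-/
theorem compSpec_find {V b : ℕ} {c : Ex .bool} (hb : b < 8) (hc : CompSpec V c)
    (hcok : c.ok) : CompSpec V (.find b c) := by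
  classical
  refine compSpec_binder hb hc hcok 0 (fun δ => .setN δ (.lit 0))
    (fun ctx δ => .ite (.and (.nle (.reg (δ + 1)) (.reg δ)) (.not (.nle (.lit 1) (.reg (δ + 2)))))
          (.setN δ (.add (.reg (δ + 1)) (.lit 1))) .skip)
    (fun s ρ j => findLt j (fun j => c.eval s (j :: ρ)))
    (fun _ _ => rfl) ?_ ?_ (fun _ _ => rfl) (by simp only [Ex.tm]; simp)
  · intro δ s ρ
    exact ⟨_, _, Runs.setN s δ (.lit 0), by simp [NExp.time], Keep.setN s le_rfl,
      by simp [Res, State.nreg_setN, NExp.eval, findLt]⟩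
  · intro ctx ρ δ s s1 j hδ hj k1 hcj hctx hV hr hres
    have hf := res_flag hres
    have hle := findLt_le j (fun j => c.eval s (j :: ρ))
    simp only [Res] at hr
    by_cases h : (findLt j (fun j => c.eval s (j :: ρ)) < j) ∨ c.eval s (j :: ρ)
    · refine ⟨s1, _, Runs.ite_false ?_ (Runs.skip s1), by simp [Test.time, NExp.time],
        Keep.refl _ _, hcj, ?_⟩
      · rw [Test.Holds, Test.Holds, Test.Holds, hf]
        simp only [NExp.eval, hr, hcj]
        rintro ⟨h1, h2⟩
        rcases h with h | h
        · exact absurd h1 (by omega)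
        · exact h2 h
      · simp only [Res, findLt]
        split_ifs with h1 h2
        · exact hr
        · omega
        · tauto
    · rw [not_or] at h
      refine ⟨_, _, Runs.ite_true ?_ (Runs.setN s1 δ _), by simp [Test.time, NExp.time],
        Keep.setN _ le_rfl, by simp [State.nreg_setN, hcj], ?_⟩
      · rw [Test.Holds, Test.Holds, Test.Holds, hf]
        simp only [NExp.eval, hr, hcj]
        exact ⟨by omega, h.2⟩
      · simp [Res, findLt, h.1, h.2, State.nreg_setN, NExp.eval, hcj]

theorem compSpec_all {V b : ℕ} {c : Ex .bool} (hb : b < 8) (hc : CompSpec V c)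
    (hcok : c.ok) : CompSpec V (.all b c) := by
  classical
  refine compSpec_binder hb hc hcok 0 (fun δ => .setN δ (.lit 1))
    (fun ctx δ => .ite (.nle (.lit 1) (.reg (δ + 2))) .skip (.setN δ (.lit 0)))
    (fun s ρ j => ∀ j' < j, c.eval s (j' :: ρ))
    (fun _ _ => rfl) ?_ ?_ (fun _ _ => rfl) (by simp only [Ex.tm]; simp)
  · intro δ s ρ
    exact ⟨_, _, Runs.setN s δ (.lit 1), by simp [NExp.time], Keep.setN s le_rfl,
      by simp [Res, State.nreg_setN, NExp.eval]⟩
  · intro ctx ρ δ s s1 j hδ hj k1 hcj hctx hV hr hres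
    have hf := res_flag hres
    have hsucc : (∀ j' < j + 1, c.eval s (j' :: ρ)) ↔
        (∀ j' < j, c.eval s (j' :: ρ)) ∧ c.eval s (j :: ρ) := Nat.forall_lt_succ_right
    simp only [Res] at hr
    by_cases h : c.eval s (j :: ρ)
    · refine ⟨s1, _, Runs.ite_true (hf.mpr h) (Runs.skip s1), by simp [Test.time, NExp.time],
        Keep.refl _ _, hcj, ?_⟩
      simp only [Res, hr]
      congr 1
      rw [hsucc]
      simp [h]
    · refine ⟨_, _, Runs.ite_false (fun h' => h (hf.mp h')) (Runs.setN s1 δ _),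
        by simp [Test.time, NExp.time], Keep.setN _ le_rfl, by simp [State.nreg_setN, hcj], ?_⟩
      simp only [Res]
      rw [if_neg (fun h' => h (hsucc.mp h').2)]
      simp [State.nreg_setN, NExp.eval]

/-- Induction on the expression. Sums, searches and quantifiers are reduced to `compSpec_binder`,
the other compound cases to the unary, binary and conditional rules. -/
theorem comp_spec (V : ℕ) : ∀ {σ : Ty} (e : Ex σ), e.ok → CompSpec V e := by
  classical
  intro σ e
  induction e <;> intro hok <;> simp only [Ex.ok, Bool.and_eq_true, decide_eq_true_eq] at hok
  case lit m =>
    intro ctx ρ δ s hδ _ _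
    exact setN_step δ rfl (by simp [NExp.time]) le_rfl
  case reg i =>
    intro ctx ρ δ s hδ _ _
    exact setN_step δ rfl (by simp [NExp.time]) le_rfl
  case bv i =>
    intro ctx ρ δ s hδ hctx _
    have hlen : ctx.length = ρ.length := List.Forall₂.length_eq hctx
    rcases hi : ctx[i]? with _ | r
    · simp only [comp, hi]
      refine setN_step δ ?_ (by simp [NExp.time]) le_rfl
      have : ρ.length ≤ i := hlen ▸ List.getElem?_eq_none_iff.mp hi
      simp [NExp.eval, Ex.eval, this]
    · simp only [comp, hi]
      refine setN_step δ ?_ (by simp [NExp.time]) le_rfl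
      obtain ⟨hl, hr⟩ := List.getElem?_eq_some_iff.mp hi
      have := List.Forall₂.get hctx hl (hlen ▸ hl)
      simp only [List.get_eq_getElem, hr] at this
      simp [NExp.eval, Ex.eval, this.2, List.getElem?_eq_getElem (hlen ▸ hl)]
  case mem e he =>
    refine compSpec_unary (he hok) (fun δ => .setN δ (.mem (.reg δ))) (fun _ _ => rfl) ?_
      (by simp [Ex.tm])
    intro δ s s1 ρ hδ k1 h1
    refine setN_step δ ?_ (by simp [NExp.time]) le_rfl
    simp only [Res] at h1
    simp [NExp.eval, Ex.eval, h1, k1.nmem]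
  case arr j e he =>
    refine compSpec_unary (he hok) (fun δ => .setN δ (.mem (.addr j δ))) (fun _ _ => rfl) ?_
      (by simp [Ex.tm])
    intro δ s s1 ρ hδ k1 h1
    refine setN_step δ ?_ (by simp [NExp.time, NExp.addr]) le_rfl
    simp only [Res] at h1
    simp [NExp.eval, NExp.eval_addr, Ex.eval, h1, k1.nmem, k1.addr hδ]
  case add a b ha hb =>
    refine compSpec_binary (ha hok.1) (hb hok.2) hok.2
      (fun δ => .setN δ (.add (.reg δ) (.reg (δ + 1)))) (fun _ _ => rfl) ?_ (by simp [Ex.tm])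
    intro δ s s1 ρ hδ h1 h2
    refine setN_step δ ?_ (by simp [NExp.time]) le_rfl
    simp only [Res] at h1 h2
    simp [NExp.eval, Ex.eval, h1, h2]
  case sub a b ha hb =>
    refine compSpec_binary (ha hok.1) (hb hok.2) hok.2
      (fun δ => .setN δ (.sub (.reg δ) (.reg (δ + 1)))) (fun _ _ => rfl) ?_ (by simp [Ex.tm])
    intro δ s s1 ρ hδ h1 h2
    refine setN_step δ ?_ (by simp [NExp.time]) le_rfl
    simp only [Res] at h1 h2
    simp [NExp.eval, Ex.eval, h1, h2]
  case cond c a b hc ha hb => exact compSpec_cond (hc hok.1) (ha hok.2.1) (hb hok.2.2) hok.2.1 hok.2.2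
  case nsum b c e hc he => exact compSpec_nsum hok.1 (hc hok.2.1) hok.2.1 (he hok.2.2) hok.2.2
  case find b c hc => exact compSpec_find hok.1 (hc hok.2) hok.2
  case ofNat e he =>
    refine compSpec_unary (he hok) (fun δ => .setR δ (.ofNat (.reg δ))) (fun _ _ => rfl) ?_
      (by simp [Ex.tm])
    intro δ s s1 ρ hδ k1 h1
    refine setR_step δ ?_ (by simp [NExp.time, RExp.time]) le_rfl
    simp only [Res] at h1
    simp [NExp.eval, RExp.eval, Ex.eval, h1]
  case rreg i =>
    intro ctx ρ δ s hδ _ _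
    exact setR_step δ rfl (by simp [RExp.time]) le_rfl
  case rmem e he =>
    refine compSpec_unary (he hok) (fun δ => .setR δ (.mem (.reg δ))) (fun _ _ => rfl) ?_
      (by simp [Ex.tm])
    intro δ s s1 ρ hδ k1 h1
    refine setR_step δ ?_ (by simp [NExp.time, RExp.time]) le_rfl
    simp only [Res] at h1
    simp [NExp.eval, RExp.eval, Ex.eval, h1, k1.rmem]
  case rarr j e he =>
    refine compSpec_unary (he hok) (fun δ => .setR δ (.mem (.addr j δ))) (fun _ _ => rfl) ?_
      (by simp [Ex.tm])
    intro δ s s1 ρ hδ k1 h1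
    refine setR_step δ ?_ (by simp [NExp.time, RExp.time, NExp.addr]) le_rfl
    simp only [Res] at h1
    simp [RExp.eval, NExp.eval_addr, Ex.eval, h1, k1.rmem, k1.addr hδ]
  case radd a b ha hb =>
    refine compSpec_binary (ha hok.1) (hb hok.2) hok.2
      (fun δ => .setR δ (.add (.reg δ) (.reg (δ + 1)))) (fun _ _ => rfl) ?_ (by simp [Ex.tm])
    intro δ s s1 ρ hδ h1 h2
    refine setR_step δ ?_ (by simp [RExp.time]) le_rfl
    simp only [Res] at h1 h2
    simp [RExp.eval, Ex.eval, h1, h2]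
  case rsub a b ha hb =>
    refine compSpec_binary (ha hok.1) (hb hok.2) hok.2
      (fun δ => .setR δ (.sub (.reg δ) (.reg (δ + 1)))) (fun _ _ => rfl) ?_ (by simp [Ex.tm])
    intro δ s s1 ρ hδ h1 h2
    refine setR_step δ ?_ (by simp [RExp.time]) le_rfl
    simp only [Res] at h1 h2
    simp [RExp.eval, Ex.eval, h1, h2]
  case rmul a b ha hb =>
    refine compSpec_binary (ha hok.1) (hb hok.2) hok.2
      (fun δ => .setR δ (.mul (.reg δ) (.reg (δ + 1)))) (fun _ _ => rfl) ?_ (by simp [Ex.tm])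
    intro δ s s1 ρ hδ h1 h2
    refine setR_step δ ?_ (by simp [RExp.time]) le_rfl
    simp only [Res] at h1 h2
    simp [RExp.eval, Ex.eval, h1, h2]
  case rdiv a b ha hb =>
    refine compSpec_binary (ha hok.1) (hb hok.2) hok.2
      (fun δ => .setR δ (.div (.reg δ) (.reg (δ + 1)))) (fun _ _ => rfl) ?_ (by simp [Ex.tm])
    intro δ s s1 ρ hδ h1 h2
    refine setR_step δ ?_ (by simp [RExp.time]) le_rfl
    simp only [Res] at h1 h2
    simp [RExp.eval, Ex.eval, h1, h2]
  case rsum b c e hc he => exact compSpec_rsum hok.1 (hc hok.2.1) hok.2.1 (he hok.2.2) hok.2.2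
  case nle a b ha hb =>
    refine compSpec_binary (ha hok.1) (hb hok.2) hok.2
      (fun δ => .ite (.nle (.reg δ) (.reg (δ + 1))) (.setN δ (.lit 1)) (.setN δ (.lit 0)))
      (fun _ _ => rfl) ?_ (by simp [Ex.tm])
    intro δ s s1 ρ hδ h1 h2
    simp only [Res] at h1 h2
    exact ite_step _ _ (by simp [Test.Holds, NExp.eval, h1, h2, Ex.eval])
      (by simp [Test.time, NExp.time]) le_rfl
  case rle a b ha hb =>
    refine compSpec_binary (ha hok.1) (hb hok.2) hok.2
      (fun δ => .ite (.rle (.reg δ) (.reg (δ + 1))) (.setN δ (.lit 1)) (.setN δ (.lit 0)))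
      (fun _ _ => rfl) ?_ (by simp [Ex.tm])
    intro δ s s1 ρ hδ h1 h2
    simp only [Res] at h1 h2
    exact ite_step _ _ (by simp [Test.Holds, RExp.eval, h1, h2, Ex.eval])
      (by simp [Test.time, RExp.time]) le_rfl
  case not a ha =>
    refine compSpec_unary (ha hok) (fun δ => .setN δ (.sub (.lit 1) (.reg δ))) (fun _ _ => rfl) ?_
      (by simp [Ex.tm])
    intro δ s s1 ρ hδ k1 h1
    refine setN_step δ ?_ (by simp [NExp.time]) le_rfl
    simp only [Res] at h1
    by_cases h : a.eval s ρ <;> simp [NExp.eval, Ex.eval, h1, h]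
  case and a b ha hb =>
    refine compSpec_binary (ha hok.1) (hb hok.2) hok.2
      (fun δ => .ite (.nle (.lit 1) (.reg δ)) (.setN δ (.reg (δ + 1))) .skip)
      (fun _ _ => rfl) ?_ (by simp [Ex.tm])
    intro δ s s1 ρ hδ h1 h2
    have hf := res_flag h1
    simp only [Res] at h1 h2
    by_cases h : a.eval s ρ
    · refine ⟨_, _, Runs.ite_true (hf.mpr h) (Runs.setN s1 δ _), by simp [Test.time, NExp.time],
        Keep.setN s1 le_rfl, ?_⟩
      simp [Res, State.nreg_setN, NExp.eval, h2, Ex.eval, h]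
    · refine ⟨s1, _, Runs.ite_false (fun h' => h (hf.mp h')) (Runs.skip s1),
        by simp [Test.time, NExp.time], Keep.refl _ _, ?_⟩
      simp [Res, h1, Ex.eval, h]
  case all b c hc => exact compSpec_all hok.1 (hc hok.2) hok.2

/-! ### Commands -/

/-- Commands. `loop v b P` runs `P` with `0, 1, …` in register `v`, once for every number below the
content of register `b`. -/
inductive Cmd where
  | skip
  | setN (i : ℕ) (e : Ex .nat)
  | setR (i : ℕ) (e : Ex .real)
  | storeN (j : ℕ) (a e : Ex .nat)
  | storeR (j : ℕ) (a : Ex .nat) (e : Ex .real)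
  | seq (P Q : Cmd)
  | ite (c : Ex .bool) (P Q : Cmd)
  | loop (v b : ℕ) (P : Cmd)

/-- The state after writing an entry of a natural-number array. -/
def State.storeN (s : State) (j i v : ℕ) : State :=
  { s with nmem := Function.update s.nmem (s.addr j i) v }

/-- The state after writing an entry of a real array. -/
noncomputable def State.storeR (s : State) (j i : ℕ) (v : ℝ) : State :=
  { s with rmem := Function.update s.rmem (s.addr j i) v }

theorem Runs.storeN (s : State) (j δ δ' : ℕ) :
    Runs (.storeN (.addr j δ) (.reg δ')) s (s.storeN j (s.nreg δ) (s.nreg δ'))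
      ((NExp.addr j δ).time + 2) := fun ω => by
  have := Exec.storeN (ω := ω) s (.addr j δ) (.reg δ')
  simp only [NExp.eval_addr, NExp.eval] at this
  exact this

theorem Runs.storeR (s : State) (j δ δ' : ℕ) :
    Runs (.storeR (.addr j δ) (.reg δ')) s (s.storeR j (s.nreg δ) (s.rreg δ'))
      ((NExp.addr j δ).time + 2) := fun ω => by
  have := Exec.storeR (ω := ω) s (.addr j δ) (.reg δ')
  simp only [NExp.eval_addr, RExp.eval] at this
  exact this

/-- Iterate `f` with `0, …, N - 1` in register `v`. -/
def State.iter (f : State → State) (v : ℕ) : ℕ → State → State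
  | 0, s => s
  | N + 1, s => f ((State.iter f v N s).setN v N)

namespace Cmd

/-- The effect of a command. -/
noncomputable def run : Cmd → State → State
  | skip, s => s
  | setN i e, s => s.setN i (e.eval s [])
  | setR i e, s => s.setR i (e.eval s [])
  | storeN j a e, s => s.storeN j (a.eval s []) (e.eval s [])
  | storeR j a e, s => s.storeR j (a.eval s []) (e.eval s [])
  | seq P Q, s => Q.run (P.run s)
  | ite c P Q, s => open Classical in if c.eval s [] then P.run s else Q.run s
  | loop v b P, s => State.iter P.run v (s.nreg b) s

/-- The command is well-formed and does not write the registers below `8`. -/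
def ok : Cmd → Bool
  | skip => true
  | setN i e => decide (8 ≤ i) && (decide (i < 64) && e.ok)
  | setR i e => decide (i < 64) && e.ok
  | storeN j a e => decide (j < 16) && (a.ok && e.ok)
  | storeR j a e => decide (j < 16) && (a.ok && e.ok)
  | seq P Q => P.ok && Q.ok
  | ite c P Q => c.ok && (P.ok && Q.ok)
  | loop v b P => decide (8 ≤ v) && (decide (v < 64) && (decide (b < 8) && P.ok))

/-- An upper bound for the running time if the loop bounds are at most `V`. -/
def tm (V : ℕ) : Cmd → ℕ
  | skip => 50
  | setN _ e => e.tm V + 50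
  | setR _ e => e.tm V + 50
  | storeN _ a e => a.tm V + e.tm V + 100
  | storeR _ a e => a.tm V + e.tm V + 100
  | seq P Q => P.tm V + Q.tm V + 50
  | ite c P Q => c.tm V + (P.tm V + Q.tm V) + 50
  | loop _ _ P => V * (P.tm V + 50) + 50

/-- The compiler for commands; only registers from `δ` on are used as scratch. -/
def compile : Cmd → ℕ → Prog
  | skip, _ => .skip
  | setN i e, δ => .seq (comp e [] δ) (.setN i (.reg δ))
  | setR i e, δ => .seq (comp e [] δ) (.setR i (.reg δ))
  | storeN j a e, δ => .seq (comp a [] δ) (.seq (comp e [] (δ + 1))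
      (.storeN (.addr j δ) (.reg (δ + 1))))
  | storeR j a e, δ => .seq (comp a [] δ) (.seq (comp e [] (δ + 1))
      (.storeR (.addr j δ) (.reg (δ + 1))))
  | seq P Q, δ => .seq (P.compile δ) (Q.compile δ)
  | ite c P Q, δ => .seq (comp c [] δ) (.ite (.nle (.lit 1) (.reg δ)) (P.compile δ) (Q.compile δ))
  | loop v b P, δ => .seq (.setN δ (.lit 0)) (upTo b δ (.seq (.setN v (.reg δ))
      (P.compile (δ + 1))))

/-- The compiled command halts within the time bound and has the effect `h ↦ h'` on the registers
below `64` and on the memories. -/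
def Spec (V : ℕ) (c : Cmd) (h h' : State) : Prop :=
  ∀ s δ, 64 ≤ δ → Keep 64 h s → ∃ s' τ, Runs (c.compile δ) s s' τ ∧ τ ≤ c.tm V ∧ Keep 64 h' s' ∧
    ∀ i, 64 ≤ i → i < δ → s'.nreg i = s.nreg i

/-- Loop bounds live in registers below `8`. As a well-formed command leaves these alone, a single
bound `V` on their initial contents controls the running time of the whole command. -/
theorem nreg_of_ok {c : Cmd} (hc : c.ok) (s : State) : ∀ b < 8, (c.run s).nreg b = s.nreg b := by
  induction c generalizing s with
  | skip => exact fun _ _ => rfl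
  | setN i e =>
    simp only [ok, Bool.and_eq_true, decide_eq_true_eq] at hc
    intro b hb
    rw [run, State.nreg_setN, if_neg (by omega)]
  | setR i e => exact fun _ _ => rfl
  | storeN j a e => exact fun _ _ => rfl
  | storeR j a e => exact fun _ _ => rfl
  | seq P Q hP hQ =>
    simp only [ok, Bool.and_eq_true] at hc
    intro b hb
    rw [run, hQ hc.2 _ b hb, hP hc.1 _ b hb]
  | ite c P Q hP hQ =>
    simp only [ok, Bool.and_eq_true] at hc
    intro b hb
    rw [run]
    split_ifs
    · exact hP hc.2.1 _ b hb
    · exact hQ hc.2.2 _ b hb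
  | loop v b P hP =>
    simp only [ok, Bool.and_eq_true, decide_eq_true_eq] at hc
    intro b' hb'
    rw [run]
    generalize s.nreg b = N
    induction N with
    | zero => rfl
    | succ N ih =>
      rw [State.iter, hP hc.2.2.2 _ b' hb', State.nreg_setN, if_neg (by omega), ih]

theorem Keep.setN_setN {h s : State} (hk : Keep 64 h s) (i v : ℕ) :
    Keep 64 (h.setN i v) (s.setN i v) :=
  ⟨fun j hj => by simp only [State.nreg_setN, hk.nreg j hj], hk.rreg, hk.nmem, hk.rmem⟩

theorem Keep.setR_setR {h s : State} (hk : Keep 64 h s) (i : ℕ) (v : ℝ) :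
    Keep 64 (h.setR i v) (s.setR i v) :=
  ⟨hk.nreg, fun j hj => by simp only [State.rreg_setR, hk.rreg j hj], hk.nmem, hk.rmem⟩

theorem eval_runs {V : ℕ} {σ : Ty} {e : Ex σ} (he : e.ok) {h s : State} {δ : ℕ} (hδ : 64 ≤ δ)
    (hk : Keep 64 h s) (hV : ∀ b < 8, h.nreg b ≤ V) :
    ∃ s' τ, Runs (comp e [] δ) s s' τ ∧ τ ≤ e.tm V ∧ Keep δ s s' ∧ Res s' δ σ (e.eval h []) := by
  have := comp_spec V e he [] [] δ s hδ List.Forall₂.nil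
    (fun b hb => by rw [hk.nreg b (by omega)]; exact hV b hb)
  rwa [Ex.eval_keep hk e he] at this

/-- Stated separately, and for every `i < 64`, because the program itself must set the loop bounds
in the registers below `8`, which `ok` forbids. -/
theorem spec_setN {V i : ℕ} {e : Ex .nat} (hi : i < 64) (he : e.ok) (h : State)
    (hV : ∀ b < 8, h.nreg b ≤ V) : Spec V (setN i e) h ((setN i e).run h) := by
  intro s δ hδ hk
  obtain ⟨s1, τ1, r1, t1, k1, e1⟩ := eval_runs he hδ hk hV
  refine ⟨_, _, r1.seq (Runs.setN s1 i (.reg δ)), ?_, ?_, ?_⟩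
  · simp only [NExp.time, tm]; omega
  · simp only [Res] at e1
    rw [NExp.eval, e1, run]
    exact Keep.setN_setN (hk.trans (k1.mono hδ)) _ _
  · intro j hj hj'
    rw [State.nreg_setN, if_neg (by omega), k1.nreg j hj']

theorem Spec.seq {V : ℕ} {P Q : Cmd} {h h' h'' : State} (hP : Spec V P h h')
    (hQ : Spec V Q h' h'') : Spec V (seq P Q) h h'' := by
  intro s δ hδ hk
  obtain ⟨s1, τ1, r1, t1, k1, e1⟩ := hP s δ hδ hk
  obtain ⟨s2, τ2, r2, t2, k2, e2⟩ := hQ s1 δ hδ k1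
  exact ⟨s2, _, r1.seq r2, by simp only [tm]; omega, k2,
    fun i hi hi' => (e2 i hi hi').trans (e1 i hi hi')⟩

/-- The abstract state records what the machine does to the memory and to the registers below `64`;
everything above is scratch. Expressions are handled by `comp_spec`, loops by `upTo_runs`. -/
theorem spec_of_ok {V : ℕ} {c : Cmd} (hc : c.ok) (h : State) (hV : ∀ b < 8, h.nreg b ≤ V) :
    Spec V c h (c.run h) := by
  induction c generalizing h with
  | skip =>
    intro s δ hδ hk
    exact ⟨s, _, Runs.skip s, by simp [tm], hk, fun _ _ _ => rfl⟩
  | setN i e =>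
    simp only [ok, Bool.and_eq_true, decide_eq_true_eq] at hc
    exact spec_setN hc.2.1 hc.2.2 h hV
  | setR i e =>
    simp only [ok, Bool.and_eq_true, decide_eq_true_eq] at hc
    intro s δ hδ hk
    obtain ⟨s1, τ1, r1, t1, k1, e1⟩ := eval_runs hc.2 hδ hk hV
    refine ⟨_, _, r1.seq (Runs.setR s1 i (.reg δ)), ?_, ?_, ?_⟩
    · simp only [RExp.time, tm]; omega
    · simp only [Res] at e1
      rw [RExp.eval, e1, run]
      exact Keep.setR_setR (hk.trans (k1.mono hδ)) _ _
    · intro j hj hj'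
      exact k1.nreg j hj'
  | storeN j a e =>
    simp only [ok, Bool.and_eq_true, decide_eq_true_eq] at hc
    intro s δ hδ hk
    obtain ⟨s1, τ1, r1, t1, k1, e1⟩ := eval_runs hc.2.1 hδ hk hV
    have hk1 := hk.trans (k1.mono hδ)
    obtain ⟨s2, τ2, r2, t2, k2, e2⟩ := eval_runs (δ := δ + 1) hc.2.2 (by omega) hk1 hV
    have hk2 := hk1.trans (k2.mono (by omega))
    simp only [Res] at e1 e2
    have e1' : s2.nreg δ = a.eval h [] := (k2.nreg δ (by omega)).trans e1
    refine ⟨_, _, r1.seq (r2.seq (Runs.storeN s2 j δ (δ + 1))), ?_, ?_, ?_⟩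
    · simp only [NExp.time, NExp.addr, tm]; omega
    · rw [e1', e2, run]
      refine ⟨hk2.nreg, hk2.rreg, ?_, hk2.rmem⟩
      simp only [State.storeN, hk2.nmem, hk2.addr le_rfl]
    · intro j hj hj'
      exact (k2.nreg j (by omega)).trans (k1.nreg j hj')
  | storeR j a e =>
    simp only [ok, Bool.and_eq_true, decide_eq_true_eq] at hc
    intro s δ hδ hk
    obtain ⟨s1, τ1, r1, t1, k1, e1⟩ := eval_runs hc.2.1 hδ hk hV
    have hk1 := hk.trans (k1.mono hδ)
    obtain ⟨s2, τ2, r2, t2, k2, e2⟩ := eval_runs (δ := δ + 1) hc.2.2 (by omega) hk1 hV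
    have hk2 := hk1.trans (k2.mono (by omega))
    simp only [Res] at e1 e2
    have e1' : s2.nreg δ = a.eval h [] := (k2.nreg δ (by omega)).trans e1
    refine ⟨_, _, r1.seq (r2.seq (Runs.storeR s2 j δ (δ + 1))), ?_, ?_, ?_⟩
    · simp only [NExp.time, NExp.addr, tm]; omega
    · rw [e1', e2, run]
      refine ⟨hk2.nreg, hk2.rreg, hk2.nmem, ?_⟩
      simp only [State.storeR, hk2.rmem, hk2.addr le_rfl]
    · intro j hj hj'
      exact (k2.nreg j (by omega)).trans (k1.nreg j hj')
  | seq P Q hP hQ =>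
    simp only [ok, Bool.and_eq_true] at hc
    exact (hP hc.1 h hV).seq (hQ hc.2 _ fun b hb => by rw [nreg_of_ok hc.1 h b hb]; exact hV b hb)
  | ite c P Q hP hQ =>
    simp only [ok, Bool.and_eq_true] at hc
    intro s δ hδ hk
    obtain ⟨s1, τ1, r1, t1, k1, e1⟩ := eval_runs hc.1 hδ hk hV
    have hf := res_flag e1
    have hk1 := hk.trans (k1.mono hδ)
    rw [run]
    split_ifs with hcond
    · obtain ⟨s2, τ2, r2, t2, k2, e2⟩ := hP hc.2.1 h hV s1 δ hδ hk1
      refine ⟨s2, _, r1.seq (Runs.ite_true (hf.mpr hcond) r2), ?_, k2, ?_⟩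
      · simp only [Test.time, NExp.time, tm]; omega
      · exact fun i hi hi' => (e2 i hi hi').trans (k1.nreg i hi')
    · obtain ⟨s2, τ2, r2, t2, k2, e2⟩ := hQ hc.2.2 h hV s1 δ hδ hk1
      refine ⟨s2, _, r1.seq (Runs.ite_false (fun h' => hcond (hf.mp h')) r2), ?_, k2, ?_⟩
      · simp only [Test.time, NExp.time, tm]; omega
      · exact fun i hi hi' => (e2 i hi hi').trans (k1.nreg i hi')
  | loop v b P hP =>
    have hall := hc
    simp only [ok, Bool.and_eq_true, decide_eq_true_eq] at hc
    intro s δ hδ hk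
    have hbnd : ∀ N, ∀ b < 8, (State.iter P.run v N h).nreg b = h.nreg b := by
      intro N b' hb'
      induction N with
      | zero => rfl
      | succ N ih =>
        rw [State.iter, nreg_of_ok hc.2.2.2 _ b' hb', State.nreg_setN, if_neg (by omega), ih]
    -- The machine counts in scratch register `δ` and copies the counter to `v` in each round, so
    -- the body is free to overwrite `v`. The body is compiled from `δ + 1` on and preserves `δ`.
    obtain ⟨s2, τ2, r2, t2, c2, e2, f2⟩ := upTo_runs (b := b) (c := δ) (N := h.nreg b)
      (tb := P.tm V + 5) (body := .seq (.setN v (.reg δ)) (P.compile (δ + 1)))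
      (fun j s' => s'.nreg δ = j ∧ Keep 64 (State.iter P.run v j h) s' ∧
        ∀ i, 64 ≤ i → i < δ → s'.nreg i = s.nreg i)
      (fun j s' ⟨h1, h2, _⟩ => ⟨h1, by rw [h2.nreg b (by omega), hbnd j b hc.2.2.1]⟩)
      (by
        intro j hj s' ⟨h1, h2, h3⟩
        obtain ⟨s3, τ3, r3, t3, k3, e3⟩ := hP hc.2.2.2 ((State.iter P.run v j h).setN v j)
          (fun b' hb' => by
            rw [State.nreg_setN, if_neg (by omega), hbnd j b' hb']; exact hV b' hb')
          (s'.setN v j) (δ + 1) (by omega) (Keep.setN_setN h2 v j)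
        have r1 := Runs.setN s' v (.reg δ)
        rw [NExp.eval, h1] at r1
        have h4 : s3.nreg δ = j := by
          rw [e3 δ hδ (by omega), State.nreg_setN, if_neg (by omega), h1]
        refine ⟨s3, _, r1.seq r3, ?_, h4, by simp [State.nreg_setN], ?_, ?_⟩
        · simp only [NExp.time]; omega
        · exact k3.trans (Keep.setN _ hδ)
        · intro i hi hi'
          rw [State.nreg_setN, if_neg (by omega), e3 i hi (by omega), State.nreg_setN,
            if_neg (by omega), h3 i hi hi'])
      (s.setN δ 0) ⟨by simp [State.nreg_setN], hk.trans (Keep.setN _ hδ), fun i hi hi' => by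
        rw [State.nreg_setN, if_neg (by omega)]⟩
    refine ⟨s2, _, (Runs.setN s δ (.lit 0)).seq r2, ?_, e2, f2⟩
    have : h.nreg b * (P.tm V + 5 + 10) ≤ V * (P.tm V + 50) :=
      Nat.mul_le_mul (hV b hc.2.2.1) (by omega)
    simp only [NExp.time, tm]
    omega

end Cmd

/-! ### Polynomial bounds for the running time -/

/-- The number of nodes of an expression, with a constant weight. -/
def Ex.size : {σ : Ty} → Ex σ → ℕ
  | _, lit _ | _, reg _ | _, bv _ | _, rreg _ => 50
  | _, mem e | _, arr _ e | _, ofNat e | _, rmem e | _, rarr _ e => e.size + 50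
  | _, add a b | _, sub a b => a.size + b.size + 50
  | _, radd a b | _, rsub a b | _, rmul a b | _, rdiv a b => a.size + b.size + 50
  | _, cond c a b => c.size + (a.size + b.size) + 50
  | _, nsum _ c e => c.size + e.size + 100
  | _, rsum _ c e => c.size + e.size + 100
  | _, find _ c | _, all _ c => c.size + 100
  | _, nle a b => a.size + b.size + 50
  | _, rle a b => a.size + b.size + 50
  | _, not a => a.size + 50
  | _, and a b => a.size + b.size + 50

/-- The nesting depth of the binders in an expression. -/
def Ex.depth : {σ : Ty} → Ex σ → ℕ
  | _, lit _ | _, reg _ | _, bv _ | _, rreg _ => 0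
  | _, mem e | _, arr _ e | _, ofNat e | _, rmem e | _, rarr _ e => e.depth
  | _, add a b | _, sub a b => a.depth + b.depth
  | _, radd a b | _, rsub a b | _, rmul a b | _, rdiv a b => a.depth + b.depth
  | _, cond c a b => c.depth + (a.depth + b.depth)
  | _, nsum _ c e => c.depth + e.depth + 1
  | _, rsum _ c e => c.depth + e.depth + 1
  | _, find _ c | _, all _ c => c.depth + 1
  | _, nle a b => a.depth + b.depth
  | _, rle a b => a.depth + b.depth
  | _, not a => a.depth
  | _, and a b => a.depth + b.depth

theorem pow_bound₁ {V s d : ℕ} {t : ℕ} (h : t ≤ s * (V + 1) ^ d) (c : ℕ) :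
    t + c ≤ (s + c) * (V + 1) ^ d := by
  have : 1 ≤ (V + 1) ^ d := Nat.one_le_pow _ _ (by omega)
  nlinarith

/-- Depths are added, not maximized, when parts are combined. This wastes some exponent but keeps
every bound a single monomial. -/
theorem pow_bound₂ {V s d s' d' : ℕ} {t t' : ℕ} (h : t ≤ s * (V + 1) ^ d)
    (h' : t' ≤ s' * (V + 1) ^ d') : t + t' ≤ (s + s') * (V + 1) ^ (d + d') := by
  have h1 : (V + 1) ^ d ≤ (V + 1) ^ (d + d') := Nat.pow_le_pow_right (by omega) (by omega)
  have h2 : (V + 1) ^ d' ≤ (V + 1) ^ (d + d') := Nat.pow_le_pow_right (by omega) (by omega)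
  nlinarith

theorem pow_bound_loop {V s d : ℕ} {t : ℕ} (h : t ≤ s * (V + 1) ^ d) :
    V * (t + 50) + 50 ≤ (s + 100) * (V + 1) ^ (d + 1) := by
  have := pow_bound₁ h 50
  have h1 : 1 ≤ (V + 1) ^ (d + 1) := Nat.one_le_pow _ _ (by omega)
  have h2 : V * (t + 50) ≤ (s + 50) * (V + 1) ^ (d + 1) := by
    rw [pow_succ]
    nlinarith
  nlinarith

theorem Ex.tm_le (V : ℕ) {σ : Ty} (e : Ex σ) : e.tm V ≤ e.size * (V + 1) ^ e.depth := by
  induction e <;> simp only [tm, size, depth, pow_zero, mul_one, le_refl]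
  case mem h | arr h | ofNat h | rmem h | rarr h | not h => exact pow_bound₁ h 50
  case add h h' | sub h h' | radd h h' | rsub h h' | rmul h h' | rdiv h h' | nle h h' | rle h h' |
    and h h' => exact pow_bound₁ (pow_bound₂ h h') 50
  case cond h h' h'' => exact pow_bound₁ (pow_bound₂ h (pow_bound₂ h' h'')) 50
  case nsum h h' | rsum h h' => exact pow_bound_loop (pow_bound₂ h h')
  case find h | all h => exact pow_bound_loop h

/-- The number of nodes of a command, with a constant weight. -/
def Cmd.size : Cmd → ℕ
  | skip => 50
  | setN _ e => e.size + 50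
  | setR _ e => e.size + 50
  | storeN _ a e => a.size + e.size + 100
  | storeR _ a e => a.size + e.size + 100
  | seq P Q => P.size + Q.size + 50
  | ite c P Q => c.size + (P.size + Q.size) + 50
  | loop _ _ P => P.size + 100

/-- The nesting depth of the loops in a command. -/
def Cmd.depth : Cmd → ℕ
  | skip => 0
  | setN _ e => e.depth
  | setR _ e => e.depth
  | storeN _ a e => a.depth + e.depth
  | storeR _ a e => a.depth + e.depth
  | seq P Q => P.depth + Q.depth
  | ite c P Q => c.depth + (P.depth + Q.depth)
  | loop _ _ P => P.depth + 1

theorem Cmd.tm_le (V : ℕ) (c : Cmd) : c.tm V ≤ c.size * (V + 1) ^ c.depth := by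
  induction c <;> simp only [tm, size, depth, pow_zero, mul_one, le_refl]
  case setN e => exact pow_bound₁ (e.tm_le V) 50
  case setR e => exact pow_bound₁ (e.tm_le V) 50
  case storeN a e => exact pow_bound₁ (pow_bound₂ (a.tm_le V) (e.tm_le V)) 100
  case storeR a e => exact pow_bound₁ (pow_bound₂ (a.tm_le V) (e.tm_le V)) 100
  case seq h h' => exact pow_bound₁ (pow_bound₂ h h') 50
  case ite c _ _ h h' => exact pow_bound₁ (pow_bound₂ (c.tm_le V) (pow_bound₂ h h')) 50
  case loop h => exact pow_bound_loop h

/-! ### Clusterings on the natural numbers, and heavy balls around uncovered centers -/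

/-- A clustering instance on the points `0, …, n - 1`, with all data extended to `ℕ`. -/
structure Data where
  n : ℕ
  k : ℕ
  t : ℕ
  C : Finset ℕ
  F : Finset ℕ
  d : ℕ → ℕ → ℝ
  G : ℕ → Finset ℕ
  lower : ℕ → ℕ
  upper : ℕ → ℕ
  cap : ℕ → ℕ
  two_le : 2 ≤ n
  k_pos : 0 < k
  C_lt : ∀ x ∈ C, x < n
  F_lt : ∀ x ∈ F, x < n
  d_self : ∀ x, d x x = 0
  d_symm : ∀ x y, d x y = d y x
  d_tri : ∀ x y z, d x z ≤ d x y + d y z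

namespace Data

variable (D : Data)

theorem d_nonneg (x y : ℕ) : 0 ≤ D.d x y := by
  have h1 := D.d_tri x y x
  rw [D.d_self, D.d_symm y x] at h1
  linarith

/-- The cost of assigning the clients in `A` by `ρ`. -/
noncomputable def costOn (p : ℕ) (A : Finset ℕ) (ρ : ℕ → ℕ) : ℝ := ∑ c ∈ A, D.d c (ρ c) ^ p

theorem costOn_nonneg (p : ℕ) (A : Finset ℕ) (ρ : ℕ → ℕ) : 0 ≤ D.costOn p A ρ :=
  Finset.sum_nonneg fun _ _ => pow_nonneg (D.d_nonneg _ _) _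

/-- The clients assigned to `f`. -/
def cluster (ρ : ℕ → ℕ) (f : ℕ) : Finset ℕ := D.C.filter fun c => ρ c = f

/-- The leader `m` of the cluster of `f` is close to `f`, up to a small additive term. -/
def CoveredBy (p : ℕ) (δ : ℝ) (ρ : ℕ → ℕ) (f m : ℕ) : Prop :=
  (D.cluster ρ f).card * D.d f m ^ p ≤
    (1 + 3 * δ) * D.costOn p (D.cluster ρ f) ρ + δ / D.k * D.costOn p D.C ρ

variable {D}

theorem sum_clusters {S : Finset ℕ} {ρ : ℕ → ℕ} (hρ : ∀ c ∈ D.C, ρ c ∈ S) (g : ℕ → ℝ) :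
    ∑ f ∈ S, ∑ c ∈ D.cluster ρ f, g c = ∑ c ∈ D.C, g c :=
  Finset.sum_fiberwise_of_maps_to hρ g

theorem add_pow_le_two {p : ℕ} (hp : p = 1 ∨ p = 2) {x y : ℝ} (hx : 0 ≤ x) (hy : 0 ≤ y) :
    (x + y) ^ p ≤ 2 * x ^ p + 2 * y ^ p := by
  rcases hp with rfl | rfl
  · simp only [pow_one]; linarith
  · nlinarith [sq_nonneg (x - y)]

/-- For `p = 2` this is (1 - δ/4)² ≥ 1 - δ/2. -/
theorem pow_shrink {p : ℕ} (hp : p = 1 ∨ p = 2) {δ x y : ℝ} (hδ : 0 < δ) (hδ1 : δ ≤ 1)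
    (hy : 0 ≤ y) (h : x ^ p ≤ (1 - δ / 2) * y ^ p) : x ≤ (1 - δ / 4) * y := by
  have h4 : 0 ≤ (1 - δ / 4) * y := mul_nonneg (by linarith) hy
  refine le_of_not_gt fun hlt => ?_
  rcases hp with rfl | rfl
  · simp only [pow_one] at h
    nlinarith [mul_nonneg hδ.le hy]
  · have h2 : ((1 - δ / 4) * y) ^ 2 < x ^ 2 := by gcongr
    nlinarith [mul_nonneg (sq_nonneg δ) (sq_nonneg y)]

/-- Markov's inequality: at most a fraction 1/(1 + δ) ≤ 1 - δ/2 of the elements exceed 1 + δ times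
the average. -/
theorem markov_card {A : Finset ℕ} {g : ℕ → ℝ} (hg : ∀ c ∈ A, 0 ≤ g c) {δ : ℝ} (hδ : 0 < δ)
    (hδ1 : δ ≤ 1) :
    (A.card : ℝ) * (δ / 2) ≤ (A.filter fun c => A.card * g c ≤ (1 + δ) * ∑ c ∈ A, g c).card := by
  classical
  set O := ∑ c ∈ A, g c with hO
  have hO0 : 0 ≤ O := Finset.sum_nonneg hg
  have hsplit := Finset.card_filter_add_card_filter_not (s := A)
    (fun c => (A.card : ℝ) * g c ≤ (1 + δ) * O)
  set good := A.filter fun c => (A.card : ℝ) * g c ≤ (1 + δ) * O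
  set bad := A.filter fun c => ¬ (A.card : ℝ) * g c ≤ (1 + δ) * O with hbad
  have hcast : (good.card : ℝ) + bad.card = A.card := by exact_mod_cast hsplit
  have hsum : (bad.card : ℝ) * ((1 + δ) * O) ≤ A.card * O := by
    calc (bad.card : ℝ) * ((1 + δ) * O) = ∑ c ∈ bad, (1 + δ) * O := by simp
      _ ≤ ∑ c ∈ bad, A.card * g c := Finset.sum_le_sum fun c hc =>
          (not_le.mp (Finset.mem_filter.mp hc).2).le
      _ ≤ ∑ c ∈ A, A.card * g c := Finset.sum_le_sum_of_subset_of_nonneg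
          (Finset.filter_subset _ _) fun c hc _ => mul_nonneg (Nat.cast_nonneg _) (hg c hc)
      _ = A.card * O := by rw [Finset.mul_sum]
  have hb0 : (0 : ℝ) ≤ bad.card := Nat.cast_nonneg _
  -- If the sum is zero, the inequality `hsum` says nothing, but then all summands vanish and no
  -- element is bad.
  rcases hO0.eq_or_lt with h0 | h0
  · have hempty : bad = ∅ := by
      refine Finset.filter_eq_empty_iff.mpr fun c hc => ?_
      have : g c = 0 := (Finset.sum_eq_zero_iff_of_nonneg hg).mp (hO ▸ h0.symm) c hc
      simp [this, ← h0]
    rw [hempty] at hcast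
    have : (0 : ℝ) ≤ A.card := Nat.cast_nonneg _
    simp only [Finset.card_empty, Nat.cast_zero, add_zero] at hcast
    nlinarith
  · have h1 : (bad.card : ℝ) * (1 + δ) ≤ A.card := by
      refine le_of_mul_le_mul_right ?_ h0
      linarith
    have h3 : (bad.card : ℝ) * δ ≥ 0 := mul_nonneg hb0 hδ.le
    nlinarith

/-- If some cluster is not covered by `M`, then there is an uncovered cluster such that some ball
around its center carries a large part of the weight, and all points in this ball cover the
cluster. -/
theorem exists_heavy_ball {p : ℕ} (hp : p = 1 ∨ p = 2) {δ : ℝ} (hδ : 0 < δ) (hδ1 : δ ≤ 1)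
    {M : Finset ℕ} {w : ℕ → ℝ} (hw : ∀ x < D.n, ∃ m ∈ M, w x = D.d x m ^ p)
    (hw' : ∀ x < D.n, ∀ m ∈ M, w x ≤ D.d x m ^ p) {S : Finset ℕ} (hSn : ∀ f ∈ S, f < D.n)
    {ρ : ℕ → ℕ} (hSk : S.card ≤ D.k)
    (hρ : ∀ c ∈ D.C, ρ c ∈ S) {f₁ : ℕ} (hf₁ : f₁ ∈ S)
    (hf₁M : ¬ ∃ m ∈ M, D.CoveredBy p δ ρ f₁ m) {Q : ℝ} (hQ : 448 * D.k / δ ^ 4 ≤ Q) :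
    ∃ f ∈ S, ∃ y ∈ D.C, (¬ ∃ m ∈ M, D.CoveredBy p δ ρ f m) ∧
      ∑ c ∈ D.C, w c ≤ Q * ∑ c ∈ D.C.filter (fun c => D.d f c ≤ D.d f y), w c ∧
      0 < ∑ c ∈ D.C.filter (fun c => D.d f c ≤ D.d f y), w c ∧
      ∀ m, D.d f m ≤ D.d f y → D.CoveredBy p δ ρ f m := by
  classical
  set N : ℕ → ℝ := fun f => ((D.cluster ρ f).card : ℝ) with hN
  set O : ℕ → ℝ := fun f => D.costOn p (D.cluster ρ f) ρ with hO
  set OPT := D.costOn p D.C ρ with hOPT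
  have hOPT0 : 0 ≤ OPT := D.costOn_nonneg _ _ _
  have hO0 : ∀ f, 0 ≤ O f := fun f => D.costOn_nonneg _ _ _
  have hN0 : ∀ f, 0 ≤ N f := fun f => Nat.cast_nonneg _
  have hw0 : ∀ x < D.n, 0 ≤ w x := fun x hx => by
    obtain ⟨m, -, hm⟩ := hw x hx
    rw [hm]; exact pow_nonneg (D.d_nonneg _ _) _
  have hk : (0 : ℝ) < D.k := by exact_mod_cast D.k_pos
  have hk1 : (1 : ℝ) ≤ D.k := by exact_mod_cast D.k_pos
  -- an uncovered cluster maximizing `N f * w f`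
  obtain ⟨f, hf, hmax⟩ := Finset.exists_max_image
    (S.filter fun f => ¬ ∃ m ∈ M, D.CoveredBy p δ ρ f m) (fun f => N f * w f)
    ⟨f₁, Finset.mem_filter.mpr ⟨hf₁, hf₁M⟩⟩
  obtain ⟨hfS, hfM⟩ := Finset.mem_filter.mp hf
  have hfn := hSn f hfS
  set Y := N f * w f with hY
  have hYlt : (1 + 3 * δ) * O f + δ / D.k * OPT < Y := by
    obtain ⟨m, hm, hwm⟩ := hw f hfn
    have : ¬ D.CoveredBy p δ ρ f m := fun h => hfM ⟨m, hm, h⟩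
    rw [CoveredBy, not_le, ← hwm] at this
    exact this
  have hY0 : 0 < Y := lt_of_le_of_lt (by have := hO0 f; positivity) hYlt
  have hNf : 0 < N f := by
    rcases (hN0 f).eq_or_lt with h | h
    · rw [hY, ← h, zero_mul] at hY0; exact absurd hY0 (lt_irrefl _)
    · exact h
  have hwf : 0 < w f := by
    rcases (hw0 f hfn).eq_or_lt with h | h
    · rw [hY, ← h, mul_zero] at hY0; exact absurd hY0 (lt_irrefl _)
    · exact h
  have hOPTY : δ * OPT ≤ D.k * Y := by
    have h1 : δ / D.k * OPT ≤ Y := by nlinarith [hO0 f]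
    rw [div_mul_eq_mul_div, div_le_iff₀ hk] at h1
    linarith
  -- the total weight
  have hW : ∑ c ∈ D.C, w c ≤ 12 * OPT + 2 * D.k * Y := by
    have h1 : ∀ c ∈ D.C, w c ≤ 2 * D.d c (ρ c) ^ p + 2 * w (ρ c) := by
      intro c hc
      obtain ⟨m, hm, hwm⟩ := hw (ρ c) (hSn _ (hρ c hc))
      rw [hwm]
      refine (hw' c (D.C_lt c hc) m hm).trans (le_trans ?_ (add_pow_le_two hp (D.d_nonneg _ _) (D.d_nonneg _ _)))
      exact pow_le_pow_left₀ (D.d_nonneg _ _) (D.d_tri _ _ _) _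
    -- Covered clusters are bounded by `CoveredBy`, with 1 + 3δ ≤ 4; uncovered ones by the
    -- maximality of `Y`.
    have h2 : ∀ f' ∈ S, N f' * w f' ≤ 4 * O f' + OPT / D.k + Y := by
      intro f' hf'
      by_cases hc : ∃ m ∈ M, D.CoveredBy p δ ρ f' m
      · obtain ⟨m, hm, hcov⟩ := hc
        have h3 : N f' * w f' ≤ N f' * D.d f' m ^ p :=
          mul_le_mul_of_nonneg_left (hw' _ (hSn _ hf') _ hm) (hN0 _)
        have h4 : N f' * D.d f' m ^ p ≤ (1 + 3 * δ) * O f' + δ / D.k * OPT := hcov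
        have h5 : δ / D.k * OPT ≤ OPT / D.k := by
          rw [div_mul_eq_mul_div]
          gcongr
          nlinarith
        nlinarith [hO0 f']
      · have := hmax f' (Finset.mem_filter.mpr ⟨hf', hc⟩)
        have h6 : 0 ≤ OPT / D.k := by positivity
        linarith [hO0 f']
    have h3 : ∑ c ∈ D.C, w (ρ c) = ∑ f' ∈ S, N f' * w f' := by
      rw [← sum_clusters hρ]
      refine Finset.sum_congr rfl fun f' _ => ?_
      rw [Finset.sum_congr rfl (g := fun _ => w f')
        (fun c hc => by rw [(Finset.mem_filter.mp hc).2])]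
      simp [hN]
    have h4 : ∑ f' ∈ S, O f' = OPT := sum_clusters hρ _
    have h5 : (S.card : ℝ) ≤ D.k := by exact_mod_cast hSk
    calc ∑ c ∈ D.C, w c ≤ ∑ c ∈ D.C, (2 * D.d c (ρ c) ^ p + 2 * w (ρ c)) := Finset.sum_le_sum h1
      _ = 2 * OPT + 2 * ∑ f' ∈ S, N f' * w f' := by
          rw [Finset.sum_add_distrib, ← Finset.mul_sum, ← Finset.mul_sum, h3]; rfl
      _ ≤ 2 * OPT + 2 * ∑ f' ∈ S, (4 * O f' + OPT / D.k + Y) := by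
          gcongr with f' hf'; exact h2 f' hf'
      _ = 2 * OPT + 2 * (4 * OPT + S.card * (OPT / D.k + Y)) := by
          simp only [Finset.sum_add_distrib, ← Finset.mul_sum, h4, Finset.sum_const, nsmul_eq_mul]
          ring
      _ ≤ 2 * OPT + 2 * (4 * OPT + D.k * (OPT / D.k + Y)) := by
          gcongr
      _ = 12 * OPT + 2 * D.k * Y := by field_simp; ring
  -- the good points
  set good := (D.cluster ρ f).filter fun c => N f * D.d c f ^ p ≤ (1 + δ) * O f with hgood
  have hOf : O f = ∑ c ∈ D.cluster ρ f, D.d c f ^ p :=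
    Finset.sum_congr rfl fun c hc => by rw [(Finset.mem_filter.mp hc).2]
  have hcard : N f * (δ / 2) ≤ good.card := by
    have := markov_card (A := D.cluster ρ f) (g := fun c => D.d c f ^ p)
      (fun c _ => pow_nonneg (D.d_nonneg _ _) _) hδ hδ1
    rw [← hOf] at this
    exact this
  have hgoodne : good.Nonempty := by
    rw [← Finset.card_pos]
    have : 0 < N f * (δ / 2) := by positivity
    exact_mod_cast this.trans_le hcard
  have hgoodC : ∀ c ∈ good, c ∈ D.C := fun c hc =>
    (Finset.mem_filter.mp (Finset.mem_filter.mp hc).1).1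
  -- A good client is closer to `f` than `f` is to `M`, by a definite factor. By the triangle
  -- inequality it keeps a distance of at least (δ/4) d(f, M) from `M`.
  have hgw : ∀ c ∈ good, δ ^ 2 / 16 * w f ≤ w c := by
    intro c hc
    have hcg := (Finset.mem_filter.mp hc).2
    obtain ⟨m₀, hm₀, hwm₀⟩ := hw f hfn
    obtain ⟨m, hm, hwm⟩ := hw c (D.C_lt c (hgoodC c hc))
    have h1 : D.d c f ^ p ≤ (1 - δ / 2) * D.d f m₀ ^ p := by
      rw [← hwm₀]
      refine le_of_mul_le_mul_left ?_ hNf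
      have h2 : (1 + 3 * δ) * O f ≤ Y := by
        have : 0 ≤ δ / D.k * OPT := by positivity
        linarith
      have h3 : (1 + δ) * O f ≤ (1 - δ / 2) * Y := by
        -- This is the gap between the constant `3 * δ` for covering and the constant `δ` for good
        -- clients.
        have h4 : (1 + δ) ≤ (1 - δ / 2) * (1 + 3 * δ) := by nlinarith
        calc (1 + δ) * O f ≤ (1 - δ / 2) * (1 + 3 * δ) * O f := by gcongr; exact hO0 f
          _ = (1 - δ / 2) * ((1 + 3 * δ) * O f) := by ring
          _ ≤ (1 - δ / 2) * Y := by gcongr; linarith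
      calc N f * D.d c f ^ p ≤ (1 - δ / 2) * Y := hcg.trans h3
        _ = N f * ((1 - δ / 2) * w f) := by rw [hY]; ring
    have h2 := pow_shrink hp hδ hδ1 (D.d_nonneg f m₀) h1
    have h3 : D.d f m₀ ≤ D.d f m := by
      have : D.d f m₀ ^ p ≤ D.d f m ^ p := hwm₀ ▸ hw' f hfn m hm
      exact le_of_pow_le_pow_left₀ (by omega) (D.d_nonneg _ _) this
    have h4 : δ / 4 * D.d f m₀ ≤ D.d c m := by
      have := D.d_tri f c m
      rw [D.d_symm f c] at this
      linarith
    rw [hwm, hwm₀]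
    have h5 : (δ / 4 * D.d f m₀) ^ p ≤ D.d c m ^ p :=
      pow_le_pow_left₀ (mul_nonneg (by linarith) (D.d_nonneg _ _)) h4 _
    refine le_trans ?_ h5
    rw [mul_pow]
    refine mul_le_mul_of_nonneg_right ?_ (pow_nonneg (D.d_nonneg _ _) _)
    rcases hp with rfl | rfl
    · rw [pow_one]; nlinarith
    · apply le_of_eq; ring
  -- The ball reaches to the farthest good client. It contains all good clients, which makes it
  -- heavy, and its points are no farther from `f` than a good client, which makes them cover the
  -- cluster.
  obtain ⟨y, hy, hymax⟩ := Finset.exists_max_image good (fun c => D.d f c) hgoodne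
  have hball : δ ^ 3 / 32 * Y ≤ ∑ c ∈ D.C.filter (fun c => D.d f c ≤ D.d f y), w c := by
    calc δ ^ 3 / 32 * Y = N f * (δ / 2) * (δ ^ 2 / 16 * w f) := by rw [hY]; ring
      _ ≤ good.card * (δ ^ 2 / 16 * w f) := by gcongr
      _ = ∑ c ∈ good, δ ^ 2 / 16 * w f := by simp
      _ ≤ ∑ c ∈ good, w c := Finset.sum_le_sum hgw
      _ ≤ _ := Finset.sum_le_sum_of_subset_of_nonneg
          (fun c hc => Finset.mem_filter.mpr ⟨hgoodC c hc, hymax c hc⟩)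
          fun c hc _ => hw0 c (D.C_lt c (Finset.mem_filter.mp hc).1)
  have hball0 : 0 < δ ^ 3 / 32 * Y := by positivity
  refine ⟨f, hfS, y, hgoodC y hy, hfM, ?_, hball0.trans_le hball, ?_⟩
  -- Total weight at most 14kY/δ, ball weight at least δ³Y/32; hence 448 = 14 · 32 and the power δ⁴.
  · calc ∑ c ∈ D.C, w c ≤ 12 * OPT + 2 * D.k * Y := hW
      _ ≤ 14 * D.k * Y / δ := by
          rw [le_div_iff₀ hδ]
          have : 0 < D.k * Y := by positivity
          nlinarith
      _ = 448 * D.k / δ ^ 4 * (δ ^ 3 / 32 * Y) := by field_simp; ring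
      _ ≤ Q * (δ ^ 3 / 32 * Y) := by gcongr
      _ ≤ _ := by
          refine mul_le_mul_of_nonneg_left hball (le_trans ?_ hQ)
          positivity
  · intro m hm
    have h1 : D.d f m ^ p ≤ D.d y f ^ p := by
      rw [D.d_symm y f]
      exact pow_le_pow_left₀ (D.d_nonneg _ _) hm _
    calc N f * D.d f m ^ p ≤ N f * D.d y f ^ p := by gcongr
      _ ≤ (1 + δ) * O f := (Finset.mem_filter.mp hy).2
      _ ≤ (1 + 3 * δ) * O f + δ / D.k * OPT := by
          have : 0 ≤ δ / D.k * OPT := by positivity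
          nlinarith [mul_nonneg hδ.le (hO0 f)]

end Data

open Classical in
theorem sumLt_eq {M : Type} [AddCommMonoid M] (N : ℕ) (P : ℕ → Prop) (f : ℕ → M) :
    sumLt N P f = ∑ j ∈ (Finset.range N).filter P, f j := (Finset.sum_filter _ _).symm

open Classical in
theorem sumLt_one (N : ℕ) (P : ℕ → Prop) :
    sumLt (M := ℕ) N P (fun _ => 1) = ((Finset.range N).filter P).card := by
  rw [sumLt_eq, Finset.card_eq_sum_ones]

/-! ### The greedy choice of leaders -/

namespace Data

variable (D : Data)

/-- The first point of `M` nearest to `x`. -/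
noncomputable def near (M : Finset ℕ) (x : ℕ) : ℕ :=
  findLt D.n fun m => m ∈ M ∧ ∀ m' < D.n, m' ∈ M → D.d x m ≤ D.d x m'

/-- The weight of `x`, if `nr x` is the point nearest to `x`. -/
noncomputable def wgt (p : ℕ) (nr : ℕ → ℕ) (x : ℕ) : ℝ := D.d x (nr x) ^ p

noncomputable def totW (p : ℕ) (nr : ℕ → ℕ) : ℝ := sumLt D.n (fun c => c ∈ D.C) (D.wgt p nr)

/-- The weight of the clients in the ball around `f` through `y`. -/
noncomputable def ballW (p : ℕ) (nr : ℕ → ℕ) (f y : ℕ) : ℝ :=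
  sumLt D.n (fun c => c ∈ D.C ∧ D.d f c ≤ D.d f y) (D.wgt p nr)

/-- The ball around `f` through `y` is heavy and contains no point of `M`. -/
def Live (p Q : ℕ) (nr : ℕ → ℕ) (M : Finset ℕ) (f y : ℕ) : Prop :=
  D.totW p nr ≤ Q * D.ballW p nr f y ∧ 0 < D.ballW p nr f y ∧
    ∀ m < D.n, ¬ (m ∈ M ∧ D.d f m ≤ D.d f y)

/-- The number of live balls containing `x`. -/
noncomputable def hits (p Q : ℕ) (nr : ℕ → ℕ) (M : Finset ℕ) (x : ℕ) : ℕ :=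
  sumLt D.n (fun _ => True) fun f =>
    sumLt D.n (fun y => D.Live p Q nr M f y ∧ D.d f x ≤ D.d f y) fun _ => 1

/-- The first point in the largest number of live balls. -/
noncomputable def best (p Q : ℕ) (nr : ℕ → ℕ) (M : Finset ℕ) : ℕ :=
  findLt D.n fun x => ∀ x' < D.n, D.hits p Q nr M x' ≤ D.hits p Q nr M x

/-- Without live balls nothing is added, so superfluous iterations do no harm. -/
noncomputable def addBest (p Q : ℕ) (nr : ℕ → ℕ) (M : Finset ℕ) : Finset ℕ :=
  if 0 < D.hits p Q nr M (D.best p Q nr M) then insert (D.best p Q nr M) M else M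

/-- The nearest points, hence the weights, stay those of the set at the start of the round; only the
condition of avoiding the current set is updated. Running `n` iterations spares the program the
computation of the logarithmic number that is really needed. -/
noncomputable def round (p Q : ℕ) (M : Finset ℕ) : Finset ℕ := (D.addBest p Q (D.near M))^[D.n] M

/-- The candidates for leaders of the clusters. -/
noncomputable def leaders (p Q : ℕ) : Finset ℕ := (D.round p Q)^[D.k] {0}

open Classical in
noncomputable def liveSet (p Q : ℕ) (nr : ℕ → ℕ) (M : Finset ℕ) : Finset (ℕ × ℕ) :=
  (Finset.range D.n ×ˢ Finset.range D.n).filter fun b => D.Live p Q nr M b.1 b.2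

variable {D}

theorem mem_liveSet {p Q : ℕ} {nr : ℕ → ℕ} {M : Finset ℕ} {b : ℕ × ℕ} :
    b ∈ D.liveSet p Q nr M ↔ (b.1 < D.n ∧ b.2 < D.n) ∧ D.Live p Q nr M b.1 b.2 := by
  simp [liveSet]

theorem near_spec {M : Finset ℕ} (hM : ∀ m ∈ M, m < D.n) (hne : M.Nonempty) (x : ℕ) :
    D.near M x ∈ M ∧ ∀ m ∈ M, D.d x (D.near M x) ≤ D.d x m := by
  obtain ⟨m, hm, hmin⟩ := Finset.exists_min_image M (D.d x) hne
  have h := findLt_spec (findLt_lt_of (N := D.n)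
    (P := fun m => m ∈ M ∧ ∀ m' < D.n, m' ∈ M → D.d x m ≤ D.d x m') (hM m hm)
    ⟨hm, fun m' _ hm' => hmin m' hm'⟩)
  exact ⟨h.1, fun m hm => h.2 m (hM m hm) hm⟩

theorem near_lt {M : Finset ℕ} (hM : ∀ m ∈ M, m < D.n) (hne : M.Nonempty) (x : ℕ) :
    D.near M x < D.n := hM _ (near_spec hM hne x).1

theorem hits_eq (p Q : ℕ) (nr : ℕ → ℕ) (M : Finset ℕ) (x : ℕ) :
    D.hits p Q nr M x =
      ((D.liveSet p Q nr M).filter fun b => D.d b.1 x ≤ D.d b.1 b.2).card := by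
  classical
  rw [hits, sumLt_eq]
  simp only [sumLt_one, Finset.filter_true]
  rw [liveSet, Finset.filter_filter, Finset.card_filter, Finset.sum_product]
  refine Finset.sum_congr rfl fun f _ => ?_
  rw [Finset.card_filter]
  exact Finset.sum_congr rfl fun y _ => by congr

theorem best_spec {p Q : ℕ} {nr : ℕ → ℕ} {M : Finset ℕ} : D.best p Q nr M < D.n ∧
    ∀ x < D.n, D.hits p Q nr M x ≤ D.hits p Q nr M (D.best p Q nr M) := by
  obtain ⟨x, hx, hmax⟩ := Finset.exists_max_image (Finset.range D.n) (D.hits p Q nr M)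
    ⟨0, Finset.mem_range.mpr (by have := D.two_le; omega)⟩
  have h := findLt_lt_of (N := D.n)
    (P := fun x => ∀ x' < D.n, D.hits p Q nr M x' ≤ D.hits p Q nr M x) (Finset.mem_range.mp hx)
    fun x' hx' => hmax x' (Finset.mem_range.mpr hx')
  exact ⟨h, findLt_spec h⟩

theorem wgt_nonneg (p : ℕ) (nr : ℕ → ℕ) (x : ℕ) : 0 ≤ D.wgt p nr x := pow_nonneg (D.d_nonneg _ _) _

theorem filter_range_client : (Finset.range D.n).filter (· ∈ D.C) = D.C := by
  ext x
  simp only [Finset.mem_filter, Finset.mem_range]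
  exact ⟨fun h => h.2, fun h => ⟨D.C_lt x h, h⟩⟩

theorem totW_eq (p : ℕ) (nr : ℕ → ℕ) : D.totW p nr = ∑ c ∈ D.C, D.wgt p nr c := by
  classical
  rw [totW, sumLt_eq, ← filter_range_client]
  exact Finset.sum_congr (by simp [filter_range_client]) fun _ _ => rfl

theorem ballW_eq (p : ℕ) (nr : ℕ → ℕ) (f y : ℕ) : D.ballW p nr f y =
    ∑ c ∈ D.C.filter (fun c => D.d f c ≤ D.d f y), D.wgt p nr c := by
  classical
  rw [ballW, sumLt_eq]
  refine Finset.sum_congr ?_ fun _ _ => rfl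
  ext c
  simp only [Finset.mem_filter, Finset.mem_range]
  exact ⟨fun h => h.2, fun h => ⟨D.C_lt c h.1, h⟩⟩

/-- Some point lies in a large part of the live balls. -/
theorem card_liveSet_le (p Q : ℕ) (nr : ℕ → ℕ) (M : Finset ℕ) :
    (D.liveSet p Q nr M).card ≤ Q * D.hits p Q nr M (D.best p Q nr M) := by
  classical
  set H := D.liveSet p Q nr M
  set m := D.hits p Q nr M (D.best p Q nr M)
  rcases H.eq_empty_or_nonempty with h0 | ⟨b, hb⟩
  · simp [h0]
  have hWpos : 0 < D.totW p nr := by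
    have h1 := (mem_liveSet.mp hb).2.2.1
    rw [ballW_eq] at h1
    rw [totW_eq]
    exact h1.trans_le (Finset.sum_le_sum_of_subset_of_nonneg (Finset.filter_subset _ _)
      fun c _ _ => wgt_nonneg _ _ _)
  -- Double counting: the ball weights, summed over the live balls, equal the client weights, each
  -- multiplied by the number of live balls containing the client.
  have key : (H.card : ℝ) * D.totW p nr ≤ Q * m * D.totW p nr := by
    calc (H.card : ℝ) * D.totW p nr = ∑ b ∈ H, D.totW p nr := by simp
      _ ≤ ∑ b ∈ H, Q * D.ballW p nr b.1 b.2 :=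
          Finset.sum_le_sum fun b hb => (mem_liveSet.mp hb).2.1
      _ = Q * ∑ b ∈ H, ∑ c ∈ D.C, if D.d b.1 c ≤ D.d b.1 b.2 then D.wgt p nr c else 0 := by
          rw [Finset.mul_sum]
          refine Finset.sum_congr rfl fun b _ => ?_
          rw [ballW_eq, Finset.sum_filter]
      _ = Q * ∑ c ∈ D.C, D.hits p Q nr M c * D.wgt p nr c := by
          rw [Finset.sum_comm]
          congr 1
          refine Finset.sum_congr rfl fun c _ => ?_
          rw [← Finset.sum_filter, hits_eq, Finset.sum_const, nsmul_eq_mul]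
      _ ≤ Q * ∑ c ∈ D.C, m * D.wgt p nr c := by
          refine mul_le_mul_of_nonneg_left (Finset.sum_le_sum fun c hc => ?_) (Nat.cast_nonneg _)
          refine mul_le_mul_of_nonneg_right ?_ (wgt_nonneg _ _ _)
          exact_mod_cast best_spec.2 c (D.C_lt c hc)
      _ = Q * m * D.totW p nr := by rw [← Finset.mul_sum, ← totW_eq, mul_assoc]
  exact_mod_cast le_of_mul_le_mul_right key hWpos

theorem liveSet_mono {p Q : ℕ} {nr : ℕ → ℕ} {M M' : Finset ℕ} (h : M ⊆ M') :
    D.liveSet p Q nr M' ⊆ D.liveSet p Q nr M := fun b hb => by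
  obtain ⟨h1, h2, h3, h4⟩ := mem_liveSet.mp hb
  exact mem_liveSet.mpr ⟨h1, h2, h3, fun m hm hm' => h4 m hm ⟨h hm'.1, hm'.2⟩⟩

theorem subset_addBest {p Q : ℕ} {nr : ℕ → ℕ} {M : Finset ℕ} : M ⊆ D.addBest p Q nr M := by
  rw [addBest]
  split_ifs
  · exact Finset.subset_insert _ _
  · exact subset_rfl

theorem addBest_lt {p Q : ℕ} {nr : ℕ → ℕ} {M : Finset ℕ} (hM : ∀ m ∈ M, m < D.n) :
    ∀ m ∈ D.addBest p Q nr M, m < D.n := by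
  rw [addBest]
  split_ifs
  · intro m hm
    rcases Finset.mem_insert.mp hm with rfl | h
    · exact best_spec.1
    · exact hM m h
  · exact hM

/-- The chosen point hits a 1/Q share of the live balls, which thereby die. It is new, since live
balls avoid `M`. -/
theorem addBest_of_nonempty {p Q : ℕ} {nr : ℕ → ℕ} {M : Finset ℕ} (hM : ∀ m ∈ M, m < D.n)
    (hQ : 0 < Q) (h : (D.liveSet p Q nr M).Nonempty) :
    (D.addBest p Q nr M).card = M.card + 1 ∧
      ((D.liveSet p Q nr (D.addBest p Q nr M)).card : ℝ) ≤
        (1 - 1 / Q) * (D.liveSet p Q nr M).card := by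
  classical
  have hcard := D.card_liveSet_le p Q nr M
  have hpos : 0 < D.hits p Q nr M (D.best p Q nr M) := by
    rw [← Finset.card_pos] at h
    exact Nat.pos_of_ne_zero fun h0 => by rw [h0] at hcard; omega
  have hadd : D.addBest p Q nr M = insert (D.best p Q nr M) M := if_pos hpos
  have hnot : D.best p Q nr M ∉ M := by
    intro hmem
    rw [hits_eq, Finset.card_pos] at hpos
    obtain ⟨b, hb⟩ := hpos
    obtain ⟨hb, hd⟩ := Finset.mem_filter.mp hb
    exact (mem_liveSet.mp hb).2.2.2 _ (hM _ hmem) ⟨hmem, hd⟩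
  refine ⟨by rw [hadd, Finset.card_insert_of_notMem hnot], ?_⟩
  have hsub : D.liveSet p Q nr (D.addBest p Q nr M) ⊆ (D.liveSet p Q nr M).filter
      fun b => ¬ D.d b.1 (D.best p Q nr M) ≤ D.d b.1 b.2 := by
    intro b hb
    refine Finset.mem_filter.mpr ⟨liveSet_mono subset_addBest hb, fun hd => ?_⟩
    exact (mem_liveSet.mp hb).2.2.2 _ best_spec.1 ⟨by rw [hadd]; exact Finset.mem_insert_self _ _, hd⟩
  have h1 := Finset.card_le_card hsub
  have h2 := Finset.card_filter_add_card_filter_not (s := D.liveSet p Q nr M)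
    (fun b => D.d b.1 (D.best p Q nr M) ≤ D.d b.1 b.2)
  rw [← hits_eq] at h2
  have hQ' : (0 : ℝ) < Q := by exact_mod_cast hQ
  have h3 : ((D.liveSet p Q nr M).card : ℝ) / Q ≤ D.hits p Q nr M (D.best p Q nr M) := by
    rw [div_le_iff₀ hQ', mul_comm]
    exact_mod_cast hcard
  have h4 : ((D.liveSet p Q nr (D.addBest p Q nr M)).card : ℝ) +
      D.hits p Q nr M (D.best p Q nr M) ≤ (D.liveSet p Q nr M).card := by
    exact_mod_cast (by omega)
  rw [sub_mul, one_mul, div_mul_eq_mul_div, one_mul]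
  linarith

theorem addBest_of_empty {p Q : ℕ} {nr : ℕ → ℕ} {M : Finset ℕ}
    (h : D.liveSet p Q nr M = ∅) : D.addBest p Q nr M = M := by
  rw [addBest, if_neg]
  rw [hits_eq, h]
  simp

/-- Since (1 - 1/Q)^Q ≤ 1/e ≤ 1/2, each block of Q steps halves the number of live balls, and 2ℓ + 1
halvings bring n² ≤ 4^ℓ below 1. -/
theorem pow_half {Q ℓ n : ℕ} (hQ : 0 < Q) (hn : n ≤ 2 ^ ℓ) :
    (n : ℝ) ^ 2 * (1 - 1 / Q) ^ (Q * (2 * ℓ + 1)) < 1 := by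
  have h1 : (1 - 1 / (Q : ℝ)) ^ Q ≤ 1 / 2 := by
    refine (Real.one_sub_div_pow_le_exp_neg (n := Q) (t := 1) (by exact_mod_cast hQ)).trans ?_
    rw [Real.exp_neg, one_div]
    refine inv_anti₀ (by norm_num) ?_
    have := Real.add_one_le_exp (1 : ℝ)
    linarith
  have h0 : 0 ≤ 1 - 1 / (Q : ℝ) := by
    have : (1 : ℝ) ≤ Q := by exact_mod_cast hQ
    rw [sub_nonneg, div_le_one (by linarith)]
    exact this
  have h2 : ((1 - 1 / (Q : ℝ)) ^ Q) ^ (2 * ℓ + 1) ≤ (1 / 2) ^ (2 * ℓ + 1) :=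
    pow_le_pow_left₀ (pow_nonneg h0 _) h1 _
  have h3 : (n : ℝ) ^ 2 ≤ (2 ^ ℓ) ^ 2 := by
    have : (n : ℝ) ≤ 2 ^ ℓ := by exact_mod_cast hn
    gcongr
  rw [pow_mul]
  calc (n : ℝ) ^ 2 * ((1 - 1 / (Q : ℝ)) ^ Q) ^ (2 * ℓ + 1)
      ≤ (2 ^ ℓ) ^ 2 * (1 / 2) ^ (2 * ℓ + 1) := by
        apply mul_le_mul h3 h2 (pow_nonneg (pow_nonneg h0 _) _) (by positivity)
    _ = 1 / 2 := by
        rw [← pow_mul, mul_comm ℓ 2, pow_succ, ← mul_assoc, ← mul_pow]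
        norm_num
    _ < 1 := by norm_num

/-- Geometric decay of the number of live balls bounds the number of points added; that `n`
iterations leave no live ball follows from a mere count of points. -/
theorem round_spec {p Q ℓ : ℕ} (hQ : 0 < Q) (hn : D.n ≤ 2 ^ ℓ) {M : Finset ℕ}
    (hM : ∀ m ∈ M, m < D.n) (hne : M.Nonempty) :
    M ⊆ D.round p Q M ∧ (∀ m ∈ D.round p Q M, m < D.n) ∧
      (D.round p Q M).card ≤ M.card + Q * (2 * ℓ + 1) ∧
      D.liveSet p Q (D.near M) (D.round p Q M) = ∅ := by
  classical
  set nr := D.near M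
  set L := Q * (2 * ℓ + 1) with hL
  have h0 : 0 ≤ 1 - 1 / (Q : ℝ) := by
    have : (1 : ℝ) ≤ Q := by exact_mod_cast hQ
    rw [sub_nonneg, div_le_one (by linarith)]
    exact this
  have h1 : 1 - 1 / (Q : ℝ) ≤ 1 := by
    have : 0 ≤ 1 / (Q : ℝ) := by positivity
    linarith
  -- As long as live balls remain, every iteration has added a point and shrunk the live set by the
  -- factor 1 - 1/Q; afterwards the set is stationary.
  have key : ∀ s, M ⊆ (D.addBest p Q nr)^[s] M ∧ (∀ m ∈ (D.addBest p Q nr)^[s] M, m < D.n) ∧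
      ((D.addBest p Q nr)^[s] M).card ≤ M.card + L ∧
      ((D.liveSet p Q nr ((D.addBest p Q nr)^[s] M)).Nonempty →
        ((D.addBest p Q nr)^[s] M).card = M.card + s ∧
        ((D.liveSet p Q nr ((D.addBest p Q nr)^[s] M)).card : ℝ) ≤
          (D.n : ℝ) ^ 2 * (1 - 1 / Q) ^ s) := by
    intro s
    induction s with
    | zero =>
      refine ⟨subset_rfl, hM, by simp, fun _ => ⟨rfl, ?_⟩⟩
      have : (D.liveSet p Q nr M).card ≤ D.n * D.n := by
        refine (Finset.card_filter_le _ _).trans ?_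
        simp
      rw [pow_zero, mul_one, sq]
      exact_mod_cast this
    | succ s ih =>
      obtain ⟨i1, i2, i3, i4⟩ := ih
      rw [Function.iterate_succ_apply']
      set M' := (D.addBest p Q nr)^[s] M
      refine ⟨i1.trans subset_addBest, addBest_lt i2, ?_, ?_⟩
      · rcases (D.liveSet p Q nr M').eq_empty_or_nonempty with h | h
        · rw [addBest_of_empty h]; exact i3
        · obtain ⟨j1, j2⟩ := i4 h
          rw [(addBest_of_nonempty i2 hQ h).1]
          -- Otherwise the nonempty live set would have fewer than one element.
          have : s < L := by
            by_contra hs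
            have h5 : (1 : ℝ) ≤ (D.liveSet p Q nr M').card := by
              exact_mod_cast Finset.card_pos.mpr h
            have h6 : (1 - 1 / (Q : ℝ)) ^ s ≤ (1 - 1 / Q) ^ L :=
              pow_le_pow_of_le_one h0 h1 (not_lt.mp hs)
            have h7 := pow_half hQ hn
            have h8 : (D.n : ℝ) ^ 2 * (1 - 1 / Q) ^ s ≤ (D.n : ℝ) ^ 2 * (1 - 1 / Q) ^ L := by
              gcongr
            linarith
          omega
      · intro h
        have h' := h.mono (liveSet_mono subset_addBest)
        obtain ⟨j1, j2⟩ := i4 h'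
        obtain ⟨l1, l2⟩ := addBest_of_nonempty i2 hQ h'
        refine ⟨by omega, l2.trans ?_⟩
        rw [pow_succ' _ s, mul_left_comm]
        exact mul_le_mul_of_nonneg_left j2 h0
  obtain ⟨i1, i2, i3, i4⟩ := key D.n
  refine ⟨i1, i2, i3, ?_⟩
  by_contra h
  -- A surviving live ball would mean that `n` points have been added to the nonempty `M`, more than
  -- there are points.
  have h5 := (i4 (Finset.nonempty_iff_ne_empty.mpr h)).1
  have h6 : ((D.addBest p Q nr)^[D.n] M).card ≤ D.n := by
    have := Finset.card_le_card (s := (D.addBest p Q nr)^[D.n] M) (t := Finset.range D.n)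
      fun m hm => Finset.mem_range.mpr (i2 m hm)
    simpa using this
  have := Finset.card_pos.mpr hne
  omega

open Classical in
/-- The centers whose clusters are not covered by `M`. -/
noncomputable def uncovered (D : Data) (p : ℕ) (δ : ℝ) (S : Finset ℕ) (ρ : ℕ → ℕ) (M : Finset ℕ) :
    Finset ℕ := S.filter fun f => ¬ ∃ m ∈ M, D.CoveredBy p δ ρ f m

theorem mem_uncovered {p : ℕ} {δ : ℝ} {S : Finset ℕ} {ρ : ℕ → ℕ} {M : Finset ℕ} {f : ℕ} :
    f ∈ D.uncovered p δ S ρ M ↔ f ∈ S ∧ ¬ ∃ m ∈ M, D.CoveredBy p δ ρ f m := by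
  simp [uncovered]

/-- The leaders cover all clusters of every solution with at most `k` centers. -/
theorem leaders_spec {p : ℕ} (hp : p = 1 ∨ p = 2) {Q ℓ : ℕ} (hn : D.n ≤ 2 ^ ℓ)
    {δ : ℝ} (hδ : 0 < δ) (hδ1 : δ ≤ 1) (hQ : 448 * D.k / δ ^ 4 ≤ Q) :
    (∀ m ∈ D.leaders p Q, m < D.n) ∧ (D.leaders p Q).Nonempty ∧
      (D.leaders p Q).card ≤ 1 + D.k * (Q * (2 * ℓ + 1)) ∧
      ∀ S : Finset ℕ, (∀ f ∈ S, f < D.n) → S.card ≤ D.k → ∀ ρ : ℕ → ℕ, (∀ c ∈ D.C, ρ c ∈ S) →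
        ∀ f ∈ S, ∃ m ∈ D.leaders p Q, D.CoveredBy p δ ρ f m := by
  classical
  have hQ0 : 0 < Q := by
    have hk : (0 : ℝ) < D.k := by exact_mod_cast D.k_pos
    have : (0 : ℝ) < Q := lt_of_lt_of_le (by positivity) hQ
    exact_mod_cast this
  -- After `s` rounds at least `s` clusters of any solution are covered, or all of them; truncated
  -- subtraction expresses both.
  have key : ∀ s, (∀ m ∈ (D.round p Q)^[s] {0}, m < D.n) ∧ ((D.round p Q)^[s] {0}).Nonempty ∧
      ((D.round p Q)^[s] {0}).card ≤ 1 + s * (Q * (2 * ℓ + 1)) ∧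
      ∀ S : Finset ℕ, (∀ f ∈ S, f < D.n) → S.card ≤ D.k → ∀ ρ : ℕ → ℕ, (∀ c ∈ D.C, ρ c ∈ S) →
        (D.uncovered p δ S ρ ((D.round p Q)^[s] {0})).card ≤
          S.card - s := by
    intro s
    induction s with
    | zero =>
      refine ⟨by simpa using (by have := D.two_le; omega), by simp, by simp, ?_⟩
      intro S _ _ ρ _
      exact Finset.card_filter_le _ _
    | succ s ih =>
      obtain ⟨i1, i2, i3, i4⟩ := ih
      rw [Function.iterate_succ_apply']
      set M := (D.round p Q)^[s] {0}
      obtain ⟨r1, r2, r3, r4⟩ := round_spec (p := p) hQ0 hn i1 i2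
      refine ⟨r2, i2.mono r1, by rw [add_mul]; omega, ?_⟩
      intro S hSn hSk ρ hρ
      have h4 := i4 S hSn hSk ρ hρ
      have hsub : (D.uncovered p δ S ρ (D.round p Q M)) ⊆
          D.uncovered p δ S ρ M := by
        intro f hf
        obtain ⟨hf, hf'⟩ := mem_uncovered.mp hf
        exact mem_uncovered.mpr ⟨hf, fun ⟨m, hm, hc⟩ => hf' ⟨m, r1 hm, hc⟩⟩
      rcases (D.uncovered p δ S ρ M).eq_empty_or_nonempty with h | h
      · rw [h, Finset.subset_empty] at hsub
        rw [hsub]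
        simp
      · obtain ⟨f₁, hf₁⟩ := h
        obtain ⟨hf₁, hf₁'⟩ := mem_uncovered.mp hf₁
        obtain ⟨f, hf, y, hy, hfM, e1, e2, e3⟩ := exists_heavy_ball hp hδ hδ1 (M := M)
          (w := D.wgt p (D.near M))
          (fun x hx => ⟨_, (near_spec i1 i2 x).1, rfl⟩)
          (fun x hx m hm => pow_le_pow_left₀ (D.d_nonneg _ _) ((near_spec i1 i2 x).2 m hm) _)
          hSn hSk hρ hf₁ hf₁' hQ
        have hcov : ∃ m ∈ D.round p Q M, D.CoveredBy p δ ρ f m := by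
          -- The weights have been frozen, so the heavy ball satisfies the weight conditions at the
          -- end of the round too. Not being live, it contains a point of the new set, and this
          -- point covers the cluster of `f`.
          have hnot : (f, y) ∉ D.liveSet p Q (D.near M) (D.round p Q M) := by
            rw [r4]; simp
          rw [mem_liveSet] at hnot
          by_contra hcon
          refine hnot ⟨⟨hSn f hf, D.C_lt y hy⟩, ?_, ?_, ?_⟩
          · rw [totW_eq, ballW_eq]; exact e1
          · rw [ballW_eq]; exact e2
          · exact fun m _ hm => hcon ⟨m, hm.1, e3 m hm.2⟩
        have hlt : (D.uncovered p δ S ρ (D.round p Q M)).card <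
            (D.uncovered p δ S ρ M).card := by
          refine Finset.card_lt_card ⟨hsub, fun hsup => ?_⟩
          have := hsup (mem_uncovered.mpr ⟨hf, hfM⟩)
          exact (mem_uncovered.mp this).2 hcov
        omega
  obtain ⟨i1, i2, i3, i4⟩ := key D.k
  refine ⟨i1, i2, i3, fun S hSn hSk ρ hρ f hf => ?_⟩
  have h := i4 S hSn hSk ρ hρ
  by_contra hcon
  have : 0 < (D.uncovered p δ S ρ ((D.round p Q)^[D.k] {0})).card :=
    Finset.card_pos.mpr ⟨f, mem_uncovered.mpr ⟨hf, hcon⟩⟩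
  omega

end Data

/-! ### Feasible solutions and the ranking of facilities by capacity -/

namespace Data

variable (D : Data)

/-- `(S, ρ)` is a feasible solution for the clients in `A`, apart from the fairness constraints. -/
structure Fits (A S : Finset ℕ) (ρ : ℕ → ℕ) : Prop where
  assigned : ∀ c ∈ A, ρ c ∈ S
  capacity : ∀ f ∈ S, (A.filter fun c => ρ c = f).card ≤ D.cap f

/-- The fairness constraints. -/
def Fair (S : Finset ℕ) : Prop :=
  ∀ i < D.t, D.lower i ≤ (S ∩ D.G i).card ∧ (S ∩ D.G i).card ≤ D.upper i

structure Feas (S : Finset ℕ) (ρ : ℕ → ℕ) : Prop where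
  subset : S ⊆ D.F
  card_le : S.card ≤ D.k
  fair : D.Fair S
  fits : D.Fits D.C S ρ

/-- The facility `f'` is preferred to `f`. -/
def Better (f' f : ℕ) : Prop := D.cap f < D.cap f' ∨ D.cap f = D.cap f' ∧ f' < f

open Classical in
/-- The number of elements of `A` preferred to `f`. -/
noncomputable def rank (A : Finset ℕ) (f : ℕ) : ℕ := (A.filter fun f' => D.Better f' f).card

variable {D}

theorem Better.trans {f g h : ℕ} (h1 : D.Better f g) (h2 : D.Better g h) : D.Better f h := by
  unfold Better at *; omega

theorem not_better_self (f : ℕ) : ¬ D.Better f f := by unfold Better; omega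

theorem better_or {f g : ℕ} (h : f ≠ g) : D.Better f g ∨ D.Better g f := by
  unfold Better; omega

theorem rank_lt {A : Finset ℕ} {f g : ℕ} (hf : f ∈ A) (h : D.Better f g) :
    D.rank A f < D.rank A g := by
  classical
  refine Finset.card_lt_card ⟨fun x hx => ?_, fun hsub => ?_⟩
  · obtain ⟨h1, h2⟩ := Finset.mem_filter.mp hx
    exact Finset.mem_filter.mpr ⟨h1, h2.trans h⟩
  · exact not_better_self f (Finset.mem_filter.mp (hsub (Finset.mem_filter.mpr ⟨hf, h⟩))).2

/-- Ties in capacity are broken by the index, so the preference is a strict total order and the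
ranks in `A` run through 0, …, |A| - 1. Rank below `k` therefore selects at most `k` facilities, and
exactly `k` of a class with at least `k` members. -/
theorem rank_injOn (A : Finset ℕ) : Set.InjOn (D.rank A) A := by
  intro f hf g hg h
  by_contra hne
  rcases better_or (D := D) hne with hb | hb
  · exact absurd (rank_lt hf hb) (by omega)
  · exact absurd (rank_lt hg hb) (by omega)

theorem rank_lt_card {A : Finset ℕ} {f : ℕ} (hf : f ∈ A) : D.rank A f < A.card := by
  classical
  exact Finset.card_lt_card ⟨Finset.filter_subset _ _, fun hsub =>
    not_better_self f (Finset.mem_filter.mp (hsub hf)).2⟩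

theorem card_rank_lt_le (A : Finset ℕ) (k : ℕ) : (A.filter fun f => D.rank A f < k).card ≤ k := by
  refine (Finset.card_le_card_of_injOn (D.rank A) (t := Finset.range k) (fun f hf => ?_)
    ((rank_injOn A).mono fun f hf => (Finset.mem_filter.mp hf).1)).trans (by simp)
  simpa using (Finset.mem_filter.mp hf).2

theorem le_card_rank_lt {A : Finset ℕ} {k : ℕ} (hk : k ≤ A.card) :
    k ≤ (A.filter fun f => D.rank A f < k).card := by
  have himg : A.image (D.rank A) = Finset.range A.card := by
    refine Finset.eq_of_subset_of_card_le (fun j hj => ?_) ?_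
    · obtain ⟨f, hf, rfl⟩ := Finset.mem_image.mp hj
      exact Finset.mem_range.mpr (rank_lt_card hf)
    · rw [Finset.card_image_of_injOn (rank_injOn A), Finset.card_range]
  have hsub : Finset.range k ⊆ (A.filter fun f => D.rank A f < k).image (D.rank A) := by
    intro j hj
    have hj := Finset.mem_range.mp hj
    have : j ∈ A.image (D.rank A) := by rw [himg]; exact Finset.mem_range.mpr (by omega)
    obtain ⟨f, hf, rfl⟩ := Finset.mem_image.mp this
    exact Finset.mem_image_of_mem _ (Finset.mem_filter.mpr ⟨hf, hj⟩)
  calc k = (Finset.range k).card := by simp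
    _ ≤ _ := Finset.card_le_card hsub
    _ ≤ _ := Finset.card_image_le

theorem cap_le_of_rank {A : Finset ℕ} {f g : ℕ} (hf : f ∈ A)
    (h : D.rank A g ≤ D.rank A f) : D.cap f ≤ D.cap g := by
  by_contra hlt
  have : D.Better f g := Or.inl (not_le.mp hlt)
  exact absurd (rank_lt hf this) (by omega)

variable (D)

/-! ### Rings and the candidate facilities -/

/-- The first point nearest to `m` and different from `m`. -/
noncomputable def nn (m : ℕ) : ℕ :=
  findLt D.n fun x => x ≠ m ∧ ∀ x' < D.n, x' ≠ m → D.d m x ≤ D.d m x'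

/-- The radii of the rings. -/
noncomputable def radius (q : ℕ) : ℕ → ℝ
  | 0 => 0
  | j + 1 => (1 + 1 / q) ^ j

/-- The index of the ring around `m` that contains `f`. -/
noncomputable def ring (q R m f : ℕ) : ℕ :=
  findLt R fun j => D.d m f ≤ radius q j * D.d m (D.nn m)

def SameType (f f' : ℕ) : Prop := ∀ i < D.t, (f ∈ D.G i ↔ f' ∈ D.G i)

/-- `f'` is preferred to `f`, has the same type and lies in the same ring around `m`. -/
def Rival (q R m f f' : ℕ) : Prop :=
  f' ∈ D.F ∧ D.SameType f f' ∧ D.ring q R m f = D.ring q R m f' ∧ D.Better f' f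

/-- The candidate facilities: those with fewer than `k` rivals with respect to some leader. -/
def InZ (q R : ℕ) (M : Finset ℕ) (f : ℕ) : Prop :=
  f ∈ D.F ∧ ∃ m < D.n, m ∈ M ∧ sumLt (M := ℕ) D.n (fun f' => D.Rival q R m f f') (fun _ => 1) < D.k

open Classical in
noncomputable def candidates (q R : ℕ) (M : Finset ℕ) : Finset ℕ :=
  (Finset.range D.n).filter (D.InZ q R M)

/-- The groups containing `f`. -/
def type (f : ℕ) : Finset ℕ := (Finset.range D.t).filter fun i => f ∈ D.G i

/-- The facilities of a given type in a given ring. -/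
noncomputable def cls (q R m : ℕ) (T : Finset ℕ) (j : ℕ) : Finset ℕ :=
  D.F.filter fun f => D.type f = T ∧ D.ring q R m f = j

/-- Distances differ by a factor of at most `n ^ a`. -/
def Aspect (a : ℕ) : Prop :=
  ∀ x y x' y', x < D.n → y < D.n → x' < D.n → y' < D.n → x' ≠ y' →
    D.d x y ≤ (D.n : ℝ) ^ a * D.d x' y'

variable {D}

theorem sameType_iff {f f' : ℕ} : D.SameType f f' ↔ D.type f = D.type f' := by
  rw [type, type, Finset.filter_inj']
  simp [SameType]

theorem mem_candidates {q R : ℕ} {M : Finset ℕ} {f : ℕ} :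
    f ∈ D.candidates q R M ↔ D.InZ q R M f := by
  classical
  rw [candidates, Finset.mem_filter, Finset.mem_range]
  exact ⟨fun h => h.2, fun h => ⟨D.F_lt f h.1, h⟩⟩

theorem rivals_eq (q R m f : ℕ) :
    sumLt (M := ℕ) D.n (fun f' => D.Rival q R m f f') (fun _ => 1) =
      D.rank (D.cls q R m (D.type f) (D.ring q R m f)) f := by
  classical
  rw [sumLt_one, rank]
  congr 1
  ext f'
  simp only [Finset.mem_filter, Finset.mem_range, Rival, cls, sameType_iff]
  constructor
  · rintro ⟨-, h1, h2, h3, h4⟩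
    exact ⟨⟨h1, h2.symm, h3.symm⟩, h4⟩
  · rintro ⟨⟨h1, h2, h3⟩, h4⟩
    exact ⟨D.F_lt f' h1, h1, h2.symm, h3.symm, h4⟩

theorem inZ_iff {q R : ℕ} {M : Finset ℕ} (hM : ∀ m ∈ M, m < D.n) {f : ℕ} : D.InZ q R M f ↔
    f ∈ D.F ∧ ∃ m ∈ M, D.rank (D.cls q R m (D.type f) (D.ring q R m f)) f < D.k := by
  rw [InZ]
  simp only [rivals_eq]
  exact and_congr_right fun _ => ⟨fun ⟨m, _, h⟩ => ⟨m, h⟩, fun ⟨m, h⟩ => ⟨m, hM m h.1, h⟩⟩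

theorem nn_spec {m : ℕ} : D.nn m < D.n ∧ D.nn m ≠ m ∧
    ∀ x < D.n, x ≠ m → D.d m (D.nn m) ≤ D.d m x := by
  have hne : ((Finset.range D.n).erase m).Nonempty := by
    rw [← Finset.card_pos]
    have h1 := Finset.pred_card_le_card_erase (s := Finset.range D.n) (a := m)
    rw [Finset.card_range] at h1
    have := D.two_le
    omega
  obtain ⟨x, hx, hmin⟩ := Finset.exists_min_image _ (D.d m) hne
  obtain ⟨hx1, hx2⟩ := Finset.mem_erase.mp hx
  have h := findLt_lt_of (N := D.n)
    (P := fun x => x ≠ m ∧ ∀ x' < D.n, x' ≠ m → D.d m x ≤ D.d m x') (Finset.mem_range.mp hx2)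
    ⟨hx1, fun x' h1 h2 => hmin x' (Finset.mem_erase.mpr ⟨h2, Finset.mem_range.mpr h1⟩)⟩
  exact ⟨h, (findLt_spec h).1, (findLt_spec h).2⟩

/-- Bernoulli's inequality gives (1 + 1/q)^q ≥ 2. -/
theorem pow_radius_ge {q ℓ n : ℕ} (hq : 0 < q) (hn : n ≤ 2 ^ ℓ) (a : ℕ) :
    (n : ℝ) ^ a ≤ (1 + 1 / q) ^ (q * a * ℓ) := by
  have h1 : (2 : ℝ) ≤ (1 + 1 / q) ^ q := by
    have := one_add_mul_le_pow (a := 1 / (q : ℝ)) (by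
      have : 0 ≤ 1 / (q : ℝ) := by positivity
      linarith) q
    have hq' : (q : ℝ) ≠ 0 := by exact_mod_cast hq.ne'
    rw [mul_one_div_cancel hq'] at this
    linarith
  have h2 : (n : ℝ) ≤ 2 ^ ℓ := by exact_mod_cast hn
  calc (n : ℝ) ^ a ≤ (2 ^ ℓ) ^ a := by gcongr
    _ = 2 ^ (a * ℓ) := by rw [← pow_mul, mul_comm]
    _ ≤ ((1 + 1 / q) ^ q) ^ (a * ℓ) := by gcongr
    _ = _ := by rw [← pow_mul, mul_assoc]

/-- Radii are measured in units of the distance from `m` to its nearest neighbour, and the aspect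
ratio bounds all distances by n^a such units. The bound does not involve `R`: a search among more
indices stops at the same place. -/
theorem ring_le {a q R ℓ : ℕ} (hA : D.Aspect a) (hq : 0 < q) (hn : D.n ≤ 2 ^ ℓ) {m f : ℕ}
    (hm : m < D.n) (hf : f < D.n) : D.ring q R m f ≤ q * a * ℓ + 1 := by
  refine findLt_le_of ?_
  obtain ⟨h1, h2, -⟩ := nn_spec (D := D) (m := m)
  refine (hA m f m (D.nn m) hm hf hm h1 h2.symm).trans ?_
  exact mul_le_mul_of_nonneg_right (pow_radius_ge hq hn a) (D.d_nonneg _ _)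

/-- The assumption that the index is below `R` excludes the default value of an unsuccessful search,
for which lying in the same ring would mean nothing. -/
theorem dist_le_of_ring_eq {q R : ℕ} {m f g : ℕ} (hf : f < D.n)
    (hR : D.ring q R m f < R) (h : D.ring q R m f = D.ring q R m g) :
    D.d m g ≤ (1 + 1 / q) * D.d m f := by
  have hg : D.d m g ≤ radius q (D.ring q R m f) * D.d m (D.nn m) := by
    have := findLt_spec (h ▸ hR : D.ring q R m g < R)
    rw [h]
    exact this
  have hnot := fun j hj => not_of_lt_findLt (N := R)
    (P := fun j => D.d m f ≤ radius q j * D.d m (D.nn m)) (j := j) hj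
  have hq0 : (0 : ℝ) ≤ 1 / q := by positivity
  have hd0 := D.d_nonneg m f
  change ∀ j, j < D.ring q R m f → _ at hnot
  -- Ring 0 is `m` itself. In ring 1 all distances equal the nearest-neighbour distance, because `f`
  -- is not `m`. From ring 2 on, `f` lies beyond the previous radius, which is smaller by the factor
  -- 1 + 1/q.
  rcases hj : D.ring q R m f with _ | _ | j
  · rw [hj, radius, zero_mul] at hg
    have : 0 ≤ 1 / (q : ℝ) * D.d m f := by positivity
    linarith
  · rw [hj, radius, pow_zero, one_mul] at hg
    have h0 := hnot 0 (by omega)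
    rw [radius, zero_mul, not_le] at h0
    have hne : f ≠ m := by
      rintro rfl
      rw [D.d_self] at h0
      exact lt_irrefl _ h0
    have := nn_spec.2.2 f hf hne
    have : 0 ≤ 1 / (q : ℝ) * D.d m f := by positivity
    linarith
  · have h0 := hnot (j + 1) (by omega)
    rw [radius, not_le] at h0
    rw [hj, radius, pow_succ] at hg
    nlinarith

/-- At most `k` facilities are kept for each leader, each of the `2 ^ D.t` types and each ring that
can occur. -/
theorem card_candidates_le {a q R ℓ : ℕ} (hA : D.Aspect a) (hq : 0 < q) (hn : D.n ≤ 2 ^ ℓ)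
    {M : Finset ℕ} (hM : ∀ m ∈ M, m < D.n) :
    (D.candidates q R M).card ≤ M.card * (2 ^ D.t * ((q * a * ℓ + 2) * D.k)) := by
  classical
  have hsub : D.candidates q R M ⊆ M.biUnion fun m => (Finset.range D.t).powerset.biUnion fun T =>
      (Finset.range (q * a * ℓ + 2)).biUnion fun j =>
        (D.cls q R m T j).filter fun f => D.rank (D.cls q R m T j) f < D.k := by
    intro f hf
    obtain ⟨hfF, m, hm, hr⟩ := (inZ_iff hM).mp (mem_candidates.mp hf)
    simp only [Finset.mem_biUnion]
    refine ⟨m, hm, D.type f, Finset.mem_powerset.mpr (Finset.filter_subset _ _),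
      D.ring q R m f, ?_, ?_⟩
    · have := ring_le (R := R) hA hq hn (hM m hm) (D.F_lt f hfF)
      exact Finset.mem_range.mpr (by omega)
    · exact Finset.mem_filter.mpr ⟨Finset.mem_filter.mpr ⟨hfF, rfl, rfl⟩, hr⟩
  refine (Finset.card_le_card hsub).trans (Finset.card_biUnion_le_card_mul _ _ _ fun m _ => ?_)
  have h2 : 2 ^ D.t = (Finset.range D.t).powerset.card := by simp
  rw [h2]
  refine Finset.card_biUnion_le_card_mul _ _ _ fun T _ => ?_
  refine (Finset.card_biUnion_le_card_mul _ _ D.k fun j _ => card_rank_lt_le _ _).trans ?_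
  simp

/-- The centers of a solution can be replaced by candidates of the same type, in the same rings
around given leaders, with at least the same capacities. -/
theorem exists_replacement {q R : ℕ} {M : Finset ℕ} (hM : ∀ m ∈ M, m < D.n) {S : Finset ℕ}
    (hSF : S ⊆ D.F) (hSk : S.card ≤ D.k) (ld : ℕ → ℕ) (hld : ∀ f ∈ S, ld f ∈ M) :
    ∃ g : ℕ → ℕ, Set.InjOn g S ∧ ∀ f ∈ S, D.InZ q R M (g f) ∧ D.SameType f (g f) ∧
      D.ring q R (ld f) f = D.ring q R (ld f) (g f) ∧ D.cap f ≤ D.cap (g f) := by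
  classical
  let A : ℕ → Finset ℕ := fun f => D.cls q R (ld f) (D.type f) (D.ring q R (ld f) f)
  -- A center that is a candidate for any reason stays where it is. Otherwise it ranks at least `k`
  -- in its class around its own leader, and the `k` facilities ranked highest there are admissible.
  let L : S → Finset ℕ := fun f => if D.InZ q R M f then {(f : ℕ)} else
    (A f).filter fun g => D.rank (A f) g < D.k
  have hL : ∀ f : S, ∀ g ∈ L f, D.InZ q R M g ∧ D.SameType f g ∧
      D.ring q R (ld f) f = D.ring q R (ld f) g ∧ D.cap f ≤ D.cap g := by
    intro f g hg
    have hfA : (f : ℕ) ∈ A f := Finset.mem_filter.mpr ⟨hSF f.2, rfl, rfl⟩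
    by_cases hf : D.InZ q R M f
    · rw [show L f = {(f : ℕ)} from if_pos hf, Finset.mem_singleton] at hg
      subst hg
      exact ⟨hf, fun _ _ => Iff.rfl, rfl, le_rfl⟩
    · rw [show L f = _ from if_neg hf] at hg
      obtain ⟨hgA, hgr⟩ := Finset.mem_filter.mp hg
      obtain ⟨hgF, hgt, hgring⟩ := Finset.mem_filter.mp hgA
      have hfr : D.k ≤ D.rank (A f) f := by
        by_contra hlt
        exact hf ((inZ_iff hM).mpr ⟨hSF f.2, ld f, hld f f.2, not_le.mp hlt⟩)
      refine ⟨(inZ_iff hM).mpr ⟨hgF, ld f, hld f f.2, ?_⟩, sameType_iff.mpr hgt.symm,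
        hgring.symm, cap_le_of_rank hfA (by omega)⟩
      rw [hgt, hgring]
      exact hgr
  have hcard : ∀ f : S, ¬ D.InZ q R M f → D.k ≤ (L f).card := by
    intro f hf
    have hfA : (f : ℕ) ∈ A f := Finset.mem_filter.mpr ⟨hSF f.2, rfl, rfl⟩
    have hfr : D.k ≤ D.rank (A f) f := by
      by_contra hlt
      exact hf ((inZ_iff hM).mpr ⟨hSF f.2, ld f, hld f f.2, not_le.mp hlt⟩)
    rw [show L f = _ from if_neg hf]
    exact le_card_rank_lt (hfr.trans (rank_lt_card hfA).le)
  -- Hall's condition: a set of centers with singleton lists has disjoint lists; any other set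
  -- includes a center whose list alone has at least k ≥ |S| elements.
  obtain ⟨g, hginj, hgL⟩ := (Finset.all_card_le_biUnion_card_iff_exists_injective L).mp (by
    intro s
    by_cases hs : ∀ f ∈ s, D.InZ q R M (f : ℕ)
    · have : s.image (fun f : S => (f : ℕ)) ⊆ s.biUnion L := by
        intro x hx
        obtain ⟨f, hf, rfl⟩ := Finset.mem_image.mp hx
        refine Finset.mem_biUnion.mpr ⟨f, hf, ?_⟩
        rw [show L f = _ from if_pos (hs f hf)]
        exact Finset.mem_singleton_self _
      calc s.card = (s.image fun f : S => (f : ℕ)).card :=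
            (Finset.card_image_of_injective _ Subtype.val_injective).symm
        _ ≤ _ := Finset.card_le_card this
    · push Not at hs
      obtain ⟨f, hf, hfZ⟩ := hs
      calc s.card ≤ Fintype.card S := Finset.card_le_univ s
        _ = S.card := Fintype.card_coe S
        _ ≤ D.k := hSk
        _ ≤ (L f).card := hcard f hfZ
        _ ≤ _ := Finset.card_le_card (Finset.subset_biUnion_of_mem L hf))
  refine ⟨fun f => if h : f ∈ S then g ⟨f, h⟩ else 0, ?_, ?_⟩
  · intro x hx y hy hxy
    have hx' : x ∈ S := hx
    have hy' : y ∈ S := hy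
    simp only [hx', hy', dif_pos] at hxy
    simpa using hginj hxy
  · intro f hf
    simp only [hf, dif_pos]
    exact hL ⟨f, hf⟩ _ (hgL ⟨f, hf⟩)

/-- Moving the centers to facilities that are not much farther from the leaders costs a factor of
about `3 ^ p`. -/
theorem cost_replacement {p : ℕ} (hp : p = 1 ∨ p = 2) {δ : ℝ} (hδ : 0 < δ) (hδ1 : δ ≤ 1)
    {S : Finset ℕ} {ρ : ℕ → ℕ} (hSk : S.card ≤ D.k) (hρ : ∀ c ∈ D.C, ρ c ∈ S) (ld g : ℕ → ℕ)
    (hld : ∀ f ∈ S, D.CoveredBy p δ ρ f (ld f))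
    (hg : ∀ f ∈ S, D.d (ld f) (g f) ≤ (1 + δ) * D.d (ld f) f) :
    D.costOn p D.C (fun c => g (ρ c)) ≤ (3 ^ p + 62 * δ) * D.costOn p D.C ρ := by
  set OPT := D.costOn p D.C ρ with hOPT
  have hOPT0 : 0 ≤ OPT := D.costOn_nonneg _ _ _
  have hk : (0 : ℝ) < D.k := by exact_mod_cast D.k_pos
  -- Summing the covering inequality over at most `k` clusters turns the additive terms into δ times
  -- the cost.
  have hlead : ∑ c ∈ D.C, D.d (ρ c) (ld (ρ c)) ^ p ≤ (1 + 4 * δ) * OPT := by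
    rw [← sum_clusters hρ]
    have h1 : ∀ f ∈ S, ∑ c ∈ D.cluster ρ f, D.d (ρ c) (ld (ρ c)) ^ p ≤
        (1 + 3 * δ) * D.costOn p (D.cluster ρ f) ρ + δ / D.k * OPT := by
      intro f hf
      rw [Finset.sum_congr rfl (g := fun _ => D.d f (ld f) ^ p)
        (fun c hc => by rw [(Finset.mem_filter.mp hc).2])]
      rw [Finset.sum_const, nsmul_eq_mul]
      exact hld f hf
    refine (Finset.sum_le_sum h1).trans ?_
    rw [Finset.sum_add_distrib, ← Finset.mul_sum, Finset.sum_const, nsmul_eq_mul]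
    have h2 : ∑ f ∈ S, D.costOn p (D.cluster ρ f) ρ = OPT := sum_clusters hρ _
    rw [h2]
    have h3 : (S.card : ℝ) ≤ D.k := by exact_mod_cast hSk
    have h4 : (S.card : ℝ) * (δ / D.k * OPT) ≤ D.k * (δ / D.k * OPT) := by gcongr
    have h5 : (D.k : ℝ) * (δ / D.k * OPT) = δ * OPT := by field_simp
    linarith
  -- From the client to its old center, on to the leader, and back out to the new center, which lies
  -- in the same ring.
  have hdist : ∀ c ∈ D.C, D.d c (g (ρ c)) ≤
      D.d c (ρ c) + (2 + δ) * D.d (ρ c) (ld (ρ c)) := by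
    intro c hc
    have h1 := D.d_tri c (ρ c) (g (ρ c))
    have h2 := D.d_tri (ρ c) (ld (ρ c)) (g (ρ c))
    have h3 := hg _ (hρ c hc)
    rw [D.d_symm (ld (ρ c)) (ρ c)] at h3
    linarith
  rcases hp with rfl | rfl
  · simp only [pow_one] at hlead ⊢
    calc D.costOn 1 D.C (fun c => g (ρ c))
        ≤ ∑ c ∈ D.C, (D.d c (ρ c) + (2 + δ) * D.d (ρ c) (ld (ρ c))) := by
          simp only [costOn, pow_one]
          exact Finset.sum_le_sum hdist
      _ = OPT + (2 + δ) * ∑ c ∈ D.C, D.d (ρ c) (ld (ρ c)) := by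
          rw [Finset.sum_add_distrib, ← Finset.mul_sum]
          simp only [hOPT, costOn, pow_one]
      _ ≤ OPT + (2 + δ) * ((1 + 4 * δ) * OPT) := by gcongr
      _ ≤ (3 + 62 * δ) * OPT := by
          have : (2 + δ) * (1 + 4 * δ) ≤ 2 + 62 * δ := by nlinarith
          nlinarith
  · calc D.costOn 2 D.C (fun c => g (ρ c))
        ≤ ∑ c ∈ D.C, (3 * D.d c (ρ c) ^ 2 +
            6 * (1 + δ / 2) ^ 2 * D.d (ρ c) (ld (ρ c)) ^ 2) := by
          refine Finset.sum_le_sum fun c hc => ?_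
          have h1 := hdist c hc
          have h2 := D.d_nonneg c (g (ρ c))
          calc D.d c (g (ρ c)) ^ 2
              ≤ (D.d c (ρ c) + (2 + δ) * D.d (ρ c) (ld (ρ c))) ^ 2 := by gcongr
            _ ≤ _ := by
                -- With z = (1 + δ/2) y this is (x + 2z)² ≤ 3x² + 6z², that is, 2(x - z)² ≥ 0. These
                -- weights give 3 + 6 = 9.
                nlinarith [sq_nonneg (D.d c (ρ c) - (1 + δ / 2) * D.d (ρ c) (ld (ρ c)))]
      _ = 3 * OPT + 6 * (1 + δ / 2) ^ 2 * ∑ c ∈ D.C, D.d (ρ c) (ld (ρ c)) ^ 2 := by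
          rw [Finset.sum_add_distrib, ← Finset.mul_sum, ← Finset.mul_sum]
          simp only [hOPT, costOn]
      _ ≤ 3 * OPT + 6 * (1 + δ / 2) ^ 2 * ((1 + 4 * δ) * OPT) := by gcongr
      _ ≤ (3 ^ 2 + 62 * δ) * OPT := by
          -- Using δ² ≤ δ, the coefficient of δ is at most 6 · (5/4 + 4 + 5) = 61.5, which is the
          -- origin of the constant 62.
          have h3 : 6 * (1 + δ / 2) ^ 2 * (1 + 4 * δ) ≤ 6 + 62 * δ := by
            have : (1 + δ / 2) ^ 2 ≤ 1 + 5 / 4 * δ := by nlinarith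
            nlinarith
          nlinarith

/-- Some solution with candidate centers is almost as good as `3 ^ p` times a given solution. -/
theorem exists_candidate_solution {p : ℕ} (hp : p = 1 ∨ p = 2) {a q R ℓ Q : ℕ} (hA : D.Aspect a)
    (hq : 0 < q) (hn : D.n ≤ 2 ^ ℓ) (hR : q * a * ℓ + 1 < R) (hQ : 448 * D.k * q ^ 4 ≤ Q)
    {S : Finset ℕ} {ρ : ℕ → ℕ} (h : D.Feas S ρ) :
    ∃ S' ρ', S' ⊆ D.candidates q R (D.leaders p Q) ∧ D.Feas S' ρ' ∧
      D.costOn p D.C ρ' ≤ (3 ^ p + 62 / q) * D.costOn p D.C ρ := by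
  classical
  have hq' : (0 : ℝ) < q := by exact_mod_cast hq
  have hq1 : (1 : ℝ) ≤ q := by exact_mod_cast hq
  have hδ1 : 1 / (q : ℝ) ≤ 1 := by rw [div_le_one hq']; exact hq1
  have hQ' : 448 * D.k / (1 / (q : ℝ)) ^ 4 ≤ Q := by
    rw [one_div, inv_pow, div_inv_eq_mul]
    exact_mod_cast hQ
  obtain ⟨hM, -, -, hcov⟩ := leaders_spec hp hn (one_div_pos.mpr hq') hδ1 hQ'
  have hSn : ∀ f ∈ S, f < D.n := fun f hf => D.F_lt f (h.subset hf)
  have hcov := hcov S hSn h.card_le ρ h.fits.assigned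
  choose! ld hld using hcov
  obtain ⟨g, hinj, hg⟩ := exists_replacement (q := q) (R := R) hM h.subset h.card_le ld
    fun f hf => (hld f hf).1
  refine ⟨S.image g, fun c => g (ρ c), ?_, ⟨?_, ?_, ?_, ?_, ?_⟩, ?_⟩
  · intro x hx
    obtain ⟨f, hf, rfl⟩ := Finset.mem_image.mp hx
    exact mem_candidates.mpr (hg f hf).1
  · intro x hx
    obtain ⟨f, hf, rfl⟩ := Finset.mem_image.mp hx
    exact (hg f hf).1.1
  · exact Finset.card_image_le.trans h.card_le
  · intro i hi
    have : S.image g ∩ D.G i = (S ∩ D.G i).image g := by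
      ext x
      simp only [Finset.mem_inter, Finset.mem_image]
      constructor
      · rintro ⟨⟨f, hf, rfl⟩, hx⟩
        exact ⟨f, ⟨hf, ((hg f hf).2.1 i hi).mpr hx⟩, rfl⟩
      · rintro ⟨f, ⟨hf, hx⟩, rfl⟩
        exact ⟨⟨f, hf, rfl⟩, ((hg f hf).2.1 i hi).mp hx⟩
    rw [this, Finset.card_image_of_injOn (hinj.mono fun x hx => (Finset.mem_inter.mp hx).1)]
    exact h.fair i hi
  · exact fun c hc => Finset.mem_image_of_mem g (h.fits.assigned c hc)
  · intro x hx
    obtain ⟨f, hf, rfl⟩ := Finset.mem_image.mp hx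
    refine le_trans (le_of_eq ?_) ((h.fits.capacity f hf).trans (hg f hf).2.2.2)
    congr 1
    refine Finset.filter_congr fun c hc => ?_
    -- As `g` is injective on the centers, the new center inherits exactly the clients of the old
    -- one.
    exact ⟨fun he => hinj (h.fits.assigned c hc) hf he, fun he => by rw [he]⟩
  · have hδ := cost_replacement hp (one_div_pos.mpr hq') hδ1 h.card_le h.fits.assigned ld g
      (fun f hf => (hld f hf).2) fun f hf => ?_
    · rwa [mul_one_div] at hδ
    · refine dist_le_of_ring_eq (R := R) (hSn f hf) ?_ (hg f hf).2.2.1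
      exact (ring_le hA hq hn (hM _ (hld f hf).1) (hSn f hf)).trans_lt hR

end Data

/-! ### Optimal capacitated assignments by augmenting paths -/

/-- Used with two functions `h`: the cost of a client at a facility, and the indicator of one
facility. Costs and loads are thus tracked by the same identity when clients are reassigned. -/
theorem sum_piecewise_injOn {A I : Finset ℕ} {x : ℕ → ℕ} (hx : Set.InjOn x I)
    (hA : ∀ i ∈ I, x i ∈ A) (h : ℕ → ℕ → ℝ) (ρ τ : ℕ → ℕ) :
    ∑ y ∈ A, h y (if y ∈ I.image x then τ y else ρ y) =
      ∑ y ∈ A, h y (ρ y) + ∑ i ∈ I, (h (x i) (τ (x i)) - h (x i) (ρ (x i))) := by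
  have h1 : ∑ i ∈ I, (h (x i) (τ (x i)) - h (x i) (ρ (x i))) =
      ∑ y ∈ A, if y ∈ I.image x then h y (τ y) - h y (ρ y) else 0 := by
    rw [← Finset.sum_image (f := fun y => h y (τ y) - h y (ρ y)) hx, ← Finset.sum_filter]
    refine Finset.sum_congr ?_ fun _ _ => rfl
    ext y
    simp only [Finset.mem_filter, Finset.mem_image]
    constructor
    · rintro ⟨i, hi, rfl⟩
      exact ⟨hA i hi, i, hi, rfl⟩
    · exact fun h => h.2
  rw [h1, ← Finset.sum_add_distrib]
  refine Finset.sum_congr rfl fun y _ => ?_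
  split_ifs <;> ring

theorem card_filter_eq_sum (A : Finset ℕ) (ρ : ℕ → ℕ) (f : ℕ) :
    ((A.filter fun y => ρ y = f).card : ℝ) = ∑ y ∈ A, if ρ y = f then (1 : ℝ) else 0 := by
  simp

namespace Data

variable (D : Data)

/-- The client before `c` assigned to `f` that is cheapest to move to `g`. -/
noncomputable def mover (p : ℕ) (ρ : ℕ → ℕ) (c f g : ℕ) : ℕ :=
  findLt D.n fun x => (x < c ∧ x ∈ D.C ∧ ρ x = f) ∧
    ∀ x' < D.n, (x' < c ∧ x' ∈ D.C ∧ ρ x' = f) →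
      D.d x g ^ p - D.d x f ^ p ≤ D.d x' g ^ p - D.d x' f ^ p

/-- The first step of the path `P` at which the client `x` is moved. -/
noncomputable def moveIdx (p : ℕ) (ρ : ℕ → ℕ) (c : ℕ) (P : ℕ → ℕ) (x : ℕ) : ℕ :=
  findLt D.k fun i => i + 1 < D.k ∧ P i ≠ P (i + 1) ∧ D.mover p ρ c (P i) (P (i + 1)) = x

/-- The assignment after assigning `c` to `P 0` and moving one client along each step of `P`. -/
noncomputable def shift (p : ℕ) (ρ : ℕ → ℕ) (c : ℕ) (P : ℕ → ℕ) (x : ℕ) : ℕ :=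
  choose (x = c) (P 0)
    (choose (D.moveIdx p ρ c P x < D.k) (P (D.moveIdx p ρ c P x + 1)) (ρ x))

/-- `ρ` is a cheapest assignment of the clients in `A` to `S`. -/
structure Optimal (p : ℕ) (A S : Finset ℕ) (ρ : ℕ → ℕ) : Prop where
  fits : D.Fits A S ρ
  le : ∀ σ, D.Fits A S σ → D.costOn p A ρ ≤ D.costOn p A σ

/-- An augmenting path from the facility of `c` to a facility with spare capacity. -/
structure Path (A S : Finset ℕ) (ρ : ℕ → ℕ) (m : ℕ) (P x : ℕ → ℕ) : Prop where
  pos : 0 < m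
  mem : ∀ i < m, P i ∈ S
  inj : Set.InjOn P (Finset.range m)
  client : ∀ i, i + 1 < m → x i ∈ A ∧ ρ (x i) = P i
  spare : (A.filter fun y => ρ y = P (m - 1)).card < D.cap (P (m - 1))

variable {D}

/-- Moving one client along each step of a path changes the load only at its two ends, and not at
all along a closed path. -/
theorem telescope (P : ℕ → ℕ) (f : ℕ) {a m : ℕ} (h : a ≤ m) :
    ∑ i ∈ Finset.Ico a m, ((if P (i + 1) = f then (1 : ℝ) else 0) - if P i = f then 1 else 0) =
      (if P m = f then 1 else 0) - if P a = f then 1 else 0 := by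
  rw [Finset.sum_Ico_eq_sub _ h, Finset.sum_range_sub (fun i => if P i = f then (1 : ℝ) else 0),
    Finset.sum_range_sub (fun i => if P i = f then (1 : ℝ) else 0)]
  ring

theorem fits_of_load {A B S : Finset ℕ} {ρ σ : ℕ → ℕ} (hσ : D.Fits B S σ)
    (hS : ∀ y ∈ A, ρ y ∈ S)
    (hload : ∀ f ∈ S, ∑ y ∈ A, (if ρ y = f then (1 : ℝ) else 0) ≤
      ∑ y ∈ B, if σ y = f then (1 : ℝ) else 0) : D.Fits A S ρ := by
  refine ⟨hS, fun f hf => le_trans ?_ (hσ.capacity f hf)⟩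
  have := hload f hf
  rw [← card_filter_eq_sum, ← card_filter_eq_sum] at this
  exact_mod_cast this

/-- Exchanging clients along a cycle of facilities. -/
theorem exchange_cycle {p : ℕ} {A S : Finset ℕ} {c : ℕ} {ρ σ : ℕ → ℕ}
    (hρ : D.Optimal p A S ρ) (hσ : D.Fits (insert c A) S σ) {a m : ℕ} (ham : a < m)
    {P x : ℕ → ℕ} (hPS : ∀ i ≤ m, P i ∈ S) (hinj : Set.InjOn P (Finset.Ico a m))
    (hx : ∀ i ∈ Finset.Ico a m, x i ∈ A ∧ ρ (x i) = P i ∧ σ (x i) = P (i + 1)) (hP : P m = P a)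
    (hne : P a ≠ P (a + 1)) :
    ∃ σ', D.Fits (insert c A) S σ' ∧
      D.costOn p (insert c A) σ' ≤ D.costOn p (insert c A) σ ∧
      (A.filter fun y => σ' y ≠ ρ y).card < (A.filter fun y => σ y ≠ ρ y).card := by
  classical
  set I := Finset.Ico a m
  have hxinj : Set.InjOn x I := fun i hi j hj hij => hinj hi hj (by
    rw [← (hx i hi).2.1, ← (hx j hj).2.1, hij])
  have hxA : ∀ i ∈ I, x i ∈ A := fun i hi => (hx i hi).1
  have hxA' : ∀ i ∈ I, x i ∈ insert c A := fun i hi => Finset.mem_insert_of_mem (hx i hi).1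
  set ρ' : ℕ → ℕ := fun y => if y ∈ I.image x then σ y else ρ y with hρ'
  set σ' : ℕ → ℕ := fun y => if y ∈ I.image x then ρ y else σ y with hσ'
  have hmemI : ∀ y ∈ I.image x, ρ y ∈ S ∧ σ y ∈ S := by
    intro y hy
    obtain ⟨i, hi, rfl⟩ := Finset.mem_image.mp hy
    have := Finset.mem_Ico.mp hi
    rw [(hx i hi).2.1, (hx i hi).2.2]
    exact ⟨hPS i this.2.le, hPS (i + 1) this.2⟩
  have tele : ∀ f, ∑ i ∈ I, ((if σ (x i) = f then (1 : ℝ) else 0) - if ρ (x i) = f then 1 else 0)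
      = 0 := by
    intro f
    rw [Finset.sum_congr rfl (fun i hi => by rw [(hx i hi).2.1, (hx i hi).2.2]),
      telescope P f ham.le, hP, sub_self]
  have tele' : ∀ f, ∑ i ∈ I, ((if ρ (x i) = f then (1 : ℝ) else 0) - if σ (x i) = f then 1 else 0)
      = 0 := by
    intro f
    have := tele f
    rw [← neg_eq_zero, ← Finset.sum_neg_distrib] at this
    simpa only [neg_sub] using this
  have hρ'fits : D.Fits A S ρ' := by
    refine fits_of_load hρ.fits (fun y hy => ?_) fun f hf => ?_
    · simp only [hρ']
      split_ifs with h
      · exact (hmemI y h).2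
      · exact hρ.fits.assigned y hy
    · have := sum_piecewise_injOn hxinj hxA (fun _ g => if g = f then 1 else 0) ρ σ
      rw [tele f, add_zero] at this
      exact this.le
  have hσ'fits : D.Fits (insert c A) S σ' := by
    refine fits_of_load hσ (fun y hy => ?_) fun f hf => ?_
    · simp only [hσ']
      split_ifs with h
      · exact (hmemI y h).1
      · exact hσ.assigned y hy
    · have := sum_piecewise_injOn hxinj hxA' (fun _ g => if g = f then 1 else 0) σ ρ
      rw [tele' f, add_zero] at this
      exact this.le
  refine ⟨σ', hσ'fits, ?_, ?_⟩
  -- The two assignments are swapped on the cycle, so the costs of `ρ'` and `σ'` add up to those of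
  -- `ρ` and `σ`. As `ρ'` cannot beat `ρ`, the cost of `σ'` is at most that of `σ`.
  · have h1 := hρ.le ρ' hρ'fits
    have h2 := sum_piecewise_injOn hxinj hxA (fun y g => D.d y g ^ p) ρ σ
    have h3 := sum_piecewise_injOn hxinj hxA' (fun y g => D.d y g ^ p) σ ρ
    have h4 : ∑ i ∈ I, (D.d (x i) (ρ (x i)) ^ p - D.d (x i) (σ (x i)) ^ p) =
        - ∑ i ∈ I, (D.d (x i) (σ (x i)) ^ p - D.d (x i) (ρ (x i)) ^ p) := by
      rw [← Finset.sum_neg_distrib]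
      simp only [neg_sub]
    simp only [costOn] at h1 ⊢
    rw [h4] at h3
    linarith
  · refine Finset.card_lt_card ⟨fun y hy => ?_, fun hsub => ?_⟩
    · obtain ⟨hy, hne⟩ := Finset.mem_filter.mp hy
      simp only [hσ'] at hne
      split_ifs at hne with h
      · exact absurd rfl hne
      · exact Finset.mem_filter.mpr ⟨hy, hne⟩
    -- The client `x a` used to be a disagreement, because `P a ≠ P (a + 1)`, and is none any more.
    · have ha : a ∈ I := Finset.mem_Ico.mpr ⟨le_rfl, ham⟩
      have h1 := hx a ha
      have : x a ∈ A.filter fun y => σ' y ≠ ρ y := hsub (Finset.mem_filter.mpr ⟨h1.1, by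
        rw [h1.2.1, h1.2.2]; exact hne.symm⟩)
      have h2 := (Finset.mem_filter.mp this).2
      simp only [hσ', Finset.mem_image_of_mem x ha, if_pos] at h2
      exact h2 rfl

/-- Compare `ρ` with a competitor `σ` that also serves `c`, and follow the disagreements: start at
`σ c`, and from a facility go to where `σ` puts one of the clients that `ρ` puts there. A longest
such trail either ends at a facility with spare capacity, and is the path sought, or closes up to a
cycle. A cycle is removed by `exchange_cycle`, and the induction is on the number of disagreements.
-/
theorem exists_path_aux {p : ℕ} {A S : Finset ℕ} {c : ℕ} (hc : c ∉ A) {ρ : ℕ → ℕ}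
    (hρ : D.Optimal p A S ρ) (N : ℕ) : ∀ σ, (A.filter fun y => σ y ≠ ρ y).card = N →
    D.Fits (insert c A) S σ → ∃ m P x, D.Path A S ρ m P x ∧
      D.costOn p A ρ + D.d c (P 0) ^ p +
        ∑ i ∈ Finset.range (m - 1), (D.d (x i) (P (i + 1)) ^ p - D.d (x i) (P i) ^ p) ≤
      D.costOn p (insert c A) σ := by
  classical
  induction N using Nat.strong_induction_on with
  | _ N ih =>
  intro σ hN hσ
  -- a longest trail
  let Trail : ℕ → Prop := fun m => 0 < m ∧ ∃ P x : ℕ → ℕ, P 0 = σ c ∧ (∀ i < m, P i ∈ S) ∧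
    Set.InjOn P (Finset.range m) ∧
    ∀ i, i + 1 < m → x i ∈ A ∧ ρ (x i) = P i ∧ σ (x i) = P (i + 1)
  have hbound : ∀ m, Trail m → m ≤ S.card := by
    rintro m ⟨-, P, x, -, hS, hinj, -⟩
    have := Finset.card_le_card_of_injOn P (s := Finset.range m) (t := S)
      (fun i hi => hS i (by simpa using hi)) hinj
    simpa using this
  have hone : Trail 1 := by
    refine ⟨one_pos, fun _ => σ c, fun _ => 0, rfl, fun _ _ => hσ.assigned c (Finset.mem_insert_self _ _), ?_, ?_⟩
    · intro i hi j hj _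
      simp only [Finset.range_one, Finset.coe_singleton, Set.mem_singleton_iff] at hi hj
      omega
    · intro i hi; omega
  set m := Nat.findGreatest Trail S.card with hm
  have hmT : Trail m := Nat.findGreatest_spec (hbound 1 hone) hone
  have hmax : ¬ Trail (m + 1) := fun h => by
    have := Nat.le_findGreatest (hbound _ h) h
    omega
  obtain ⟨hmpos, P, x, hP0, hPS, hinj, hx⟩ := hmT
  obtain ⟨m', hm'⟩ : ∃ m', m = m' + 1 := ⟨m - 1, by omega⟩
  rw [hm'] at hmax hPS hinj hx
  clear_value m
  subst hm'
  -- With spare capacity at the end, undoing the trail in `σ` yields an assignment of `A` alone;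
  -- that `ρ` costs no more is the claimed inequality.
  by_cases hspare : (A.filter fun y => ρ y = P m').card < D.cap (P m')
  · refine ⟨m' + 1, P, x, ⟨by omega, hPS, hinj, fun i hi => ⟨(hx i hi).1, (hx i hi).2.1⟩,
      by simpa using hspare⟩, ?_⟩
    rw [Nat.add_sub_cancel]
    set I := Finset.Ico 0 m'
    have hI : Finset.range m' = I := Finset.range_eq_Ico m'
    have hx' : ∀ i ∈ I, x i ∈ A ∧ ρ (x i) = P i ∧ σ (x i) = P (i + 1) := fun i hi =>
      hx i (by have := (Finset.mem_Ico.mp hi).2; omega)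
    have hxinj : Set.InjOn x I := fun i hi j hj hij => by
      have h1 := (Finset.mem_Ico.mp hi).2
      have h2 := (Finset.mem_Ico.mp hj).2
      refine hinj (by simp; omega) (by simp; omega) ?_
      rw [← (hx' i hi).2.1, ← (hx' j hj).2.1, hij]
    have hxA : ∀ i ∈ I, x i ∈ A := fun i hi => (hx' i hi).1
    set σ' : ℕ → ℕ := fun y => if y ∈ I.image x then ρ y else σ y with hσ'
    have hfits : D.Fits A S σ' := by
      refine fits_of_load hσ (fun y hy => ?_) fun f hf => ?_
      · simp only [hσ']
        split_ifs with h
        · exact hρ.fits.assigned y hy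
        · exact hσ.assigned y (Finset.mem_insert_of_mem hy)
      · have h1 := sum_piecewise_injOn hxinj hxA (fun _ g => if g = f then 1 else 0) σ ρ
        have h2 : ∑ i ∈ I, ((if ρ (x i) = f then (1 : ℝ) else 0) - if σ (x i) = f then 1 else 0) =
            (if P 0 = f then 1 else 0) - if P m' = f then 1 else 0 := by
          rw [Finset.sum_congr rfl (fun i hi => by rw [(hx' i hi).2.1, (hx' i hi).2.2])]
          have := telescope P f (Nat.zero_le m')
          rw [← neg_inj, ← Finset.sum_neg_distrib] at this
          simpa only [neg_sub] using this
        have h3 : (0 : ℝ) ≤ if P m' = f then 1 else 0 := by split_ifs <;> norm_num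
        rw [Finset.sum_insert hc, ← hP0]
        rw [h2] at h1
        simp only [hσ'] at h1 ⊢
        linarith
    have h1 := hρ.le σ' hfits
    have h2 := sum_piecewise_injOn hxinj hxA (fun y g => D.d y g ^ p) σ ρ
    have h4 : ∑ i ∈ I, (D.d (x i) (P (i + 1)) ^ p - D.d (x i) (P i) ^ p) =
        - ∑ i ∈ I, (D.d (x i) (ρ (x i)) ^ p - D.d (x i) (σ (x i)) ^ p) := by
      rw [← Finset.sum_neg_distrib]
      exact Finset.sum_congr rfl fun i hi => by rw [(hx' i hi).2.1, (hx' i hi).2.2, neg_sub]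
    rw [hI, h4, hP0]
    simp only [costOn] at h1 ⊢
    rw [Finset.sum_insert hc]
    linarith
  · -- the last facility of the trail is full, so that the trail closes up
    have hlast : P m' ∈ S := hPS m' (by omega)
    -- Otherwise `σ` would keep all clients that `ρ` has at this full facility and add one more,
    -- namely `c` or the last client of the trail, exceeding the capacity.
    obtain ⟨z, hzA, hzρ, hzσ⟩ : ∃ z ∈ A, ρ z = P m' ∧ σ z ≠ P m' := by
      by_contra hcon
      push Not at hcon
      have hsub : (A.filter fun y => ρ y = P m') ⊂
          (insert c A).filter fun y => σ y = P m' := by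
        refine ⟨fun y hy => ?_, fun hsub => ?_⟩
        · obtain ⟨hy, hy'⟩ := Finset.mem_filter.mp hy
          exact Finset.mem_filter.mpr ⟨Finset.mem_insert_of_mem hy, hcon y hy hy'⟩
        · rcases Nat.eq_zero_or_pos m' with h0 | h0
          · have : c ∈ A.filter fun y => ρ y = P m' :=
              hsub (Finset.mem_filter.mpr ⟨Finset.mem_insert_self _ _, by rw [h0, hP0]⟩)
            exact hc (Finset.mem_filter.mp this).1
          · obtain ⟨h1, h2, h3⟩ := hx (m' - 1) (by omega)
            rw [Nat.sub_add_cancel h0] at h3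
            have : x (m' - 1) ∈ A.filter fun y => ρ y = P m' :=
              hsub (Finset.mem_filter.mpr ⟨Finset.mem_insert_of_mem h1, h3⟩)
            have h4 := (Finset.mem_filter.mp this).2
            rw [h2] at h4
            have := hinj (by simp) (by simp) h4
            omega
      have h1 := Finset.card_lt_card hsub
      have h2 := hσ.capacity (P m') hlast
      omega
    have hzS : σ z ∈ S := hσ.assigned z (Finset.mem_insert_of_mem hzA)
    set P' := Function.update P (m' + 1) (σ z) with hP'
    set x' := Function.update x m' z with hx'
    have hPi : ∀ i < m' + 1, P' i = P i := fun i hi => Function.update_of_ne (by omega) _ _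
    have hPm : P' (m' + 1) = σ z := Function.update_self _ _ _
    have hxi : ∀ i, i ≤ m' → x' i ∈ A ∧ ρ (x' i) = P' i ∧ σ (x' i) = P' (i + 1) := by
      intro i hi
      rcases hi.eq_or_lt with rfl | hi
      · rw [hPm, hPi i (by omega), hx', Function.update_self]
        exact ⟨hzA, hzρ, rfl⟩
      · rw [hPi i (by omega), hPi (i + 1) (by omega), hx', Function.update_of_ne hi.ne]
        exact hx i (by omega)
    have hPS' : ∀ i ≤ m' + 1, P' i ∈ S := by
      intro i hi
      rcases hi.eq_or_lt with rfl | hi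
      · rw [hPm]; exact hzS
      · rw [hPi i hi]; exact hPS i hi
    -- The trail is prolonged by `z`. A repeated facility closes a cycle; a new one contradicts
    -- maximality.
    by_cases hnew : ∃ a < m' + 1, P a = σ z
    · obtain ⟨a, ha, haz⟩ := hnew
      have hne : P' a ≠ P' (a + 1) := by
        rcases (Nat.lt_succ_iff.mp ha).eq_or_lt with rfl | ha'
        · rw [hPm, hPi a (by omega)]; exact hzσ.symm
        · rw [hPi a (by omega), hPi (a + 1) (by omega)]
          intro h
          have := hinj (by simp; omega) (by simp; omega) h
          omega
      obtain ⟨σ', h1, h2, h3⟩ := exchange_cycle hρ hσ (a := a) (m := m' + 1) ha (P := P') (x := x')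
        hPS'
        (fun i hi j hj hij => by
          have hi' := (Finset.mem_Ico.mp hi).2
          have hj' := (Finset.mem_Ico.mp hj).2
          rw [hPi i hi', hPi j hj'] at hij
          exact hinj (by simpa using hi') (by simpa using hj') hij)
        (fun i hi => hxi i (by have := (Finset.mem_Ico.mp hi).2; omega))
        (by rw [hPm, hPi a ha, haz]) hne
      obtain ⟨m₁, P₁, x₁, h4, h5⟩ := ih _ (hN ▸ h3) σ' rfl h1
      exact ⟨m₁, P₁, x₁, h4, h5.trans h2⟩
    · push Not at hnew
      refine absurd ⟨by omega, P', x', ?_, fun i hi => hPS' i (by omega), ?_,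
        fun i hi => hxi i (by omega)⟩ hmax
      · rw [hPi 0 (by omega), hP0]
      · intro i hi j hj hij
        simp only [Finset.coe_range, Set.mem_Iio] at hi hj
        rcases Nat.lt_or_ge i (m' + 1) with h1 | h1 <;> rcases Nat.lt_or_ge j (m' + 1) with h2 | h2
        · rw [hPi i h1, hPi j h2] at hij
          exact hinj (by simpa using h1) (by simpa using h2) hij
        · obtain rfl : j = m' + 1 := by omega
          rw [hPi i h1, hPm] at hij
          exact absurd hij (hnew i h1)
        · obtain rfl : i = m' + 1 := by omega
          rw [hPi j h2, hPm] at hij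
          exact absurd hij.symm (hnew j h2)
        · omega

theorem mover_spec {p c f g y : ℕ} {ρ : ℕ → ℕ}
    (hy : y ∈ D.C.filter (· < c)) (hρ : ρ y = f) :
    D.mover p ρ c f g ∈ D.C.filter (· < c) ∧ ρ (D.mover p ρ c f g) = f ∧
      D.d (D.mover p ρ c f g) g ^ p - D.d (D.mover p ρ c f g) f ^ p ≤
        D.d y g ^ p - D.d y f ^ p := by
  classical
  obtain ⟨x, hx, hmin⟩ := Finset.exists_min_image
    ((D.C.filter (· < c)).filter fun x => ρ x = f) (fun x => D.d x g ^ p - D.d x f ^ p)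
    ⟨y, Finset.mem_filter.mpr ⟨hy, hρ⟩⟩
  simp only [Finset.mem_filter] at hx hmin hy
  have h := findLt_spec (findLt_lt_of (N := D.n)
    (P := fun x => (x < c ∧ x ∈ D.C ∧ ρ x = f) ∧
      ∀ x' < D.n, (x' < c ∧ x' ∈ D.C ∧ ρ x' = f) →
        D.d x g ^ p - D.d x f ^ p ≤ D.d x' g ^ p - D.d x' f ^ p) (D.C_lt x hx.1.1)
    ⟨⟨hx.1.2, hx.1.1, hx.2⟩, fun x' _ h' => hmin x' ⟨⟨h'.2.1, h'.1⟩, h'.2.2⟩⟩)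
  exact ⟨Finset.mem_filter.mpr ⟨h.1.2.1, h.1.1⟩, h.1.2.2,
    h.2 y (D.C_lt y hy.1) ⟨hy.2, hy.1, hρ⟩⟩

/-- An optimal assignment of the clients before `c` can be extended to `c` along some path, at
least as cheaply as by any other assignment. -/
theorem exists_shift {p : ℕ} {S : Finset ℕ} (hSk : S.card ≤ D.k) {c : ℕ} {ρ σ : ℕ → ℕ}
    (hρ : D.Optimal p (D.C.filter (· < c)) S ρ)
    (hσ : D.Fits (insert c (D.C.filter (· < c))) S σ) :
    ∃ P : ℕ → ℕ, (∀ i, P i ∈ S) ∧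
      D.Fits (insert c (D.C.filter (· < c))) S (D.shift p ρ c P) ∧
      D.costOn p (insert c (D.C.filter (· < c))) (D.shift p ρ c P) ≤
        D.costOn p (insert c (D.C.filter (· < c))) σ := by
  classical
  set A := D.C.filter (· < c) with hA
  have hc : c ∉ A := fun h => lt_irrefl c (Finset.mem_filter.mp h).2
  obtain ⟨m, P, x, hP, hcost⟩ := exists_path_aux hc hρ _ σ rfl hσ
  obtain ⟨m, rfl⟩ : ∃ m', m = m' + 1 := ⟨m - 1, by have := hP.pos; omega⟩
  have hmk : m + 1 ≤ D.k := by
    have := Finset.card_le_card_of_injOn P (s := Finset.range (m + 1)) (t := S)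
      (fun i hi => hP.mem i (by simpa using hi)) hP.inj
    rw [Finset.card_range] at this
    omega
  -- Repeating the last facility pads the path to the fixed length `k`; `moveIdx` ignores steps that
  -- do not change the facility.
  set P' : ℕ → ℕ := fun i => P (min i m) with hP'
  have hPi : ∀ i ≤ m, P' i = P i := fun i hi => by rw [hP']; simp [hi]
  have hPi' : ∀ i ≥ m, P' i = P m := fun i hi => by rw [hP']; simp [hi]
  set I := Finset.range m with hI
  -- The clients of the path are replaced by the cheapest movers between the same facilities. Loads
  -- change in the same way and the cost does not go up. The program can thus recover the moves from
  -- the facilities alone.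
  set z : ℕ → ℕ := fun i => D.mover p ρ c (P i) (P (i + 1)) with hz
  have hzspec : ∀ i ∈ I, z i ∈ A ∧ ρ (z i) = P i ∧
      D.d (z i) (P (i + 1)) ^ p - D.d (z i) (P i) ^ p ≤
        D.d (x i) (P (i + 1)) ^ p - D.d (x i) (P i) ^ p := by
    intro i hi
    have := hP.client i (by have := Finset.mem_range.mp hi; omega)
    exact mover_spec this.1 this.2
  have hne : ∀ i ∈ I, P i ≠ P (i + 1) := by
    intro i hi h
    have hi' := Finset.mem_range.mp hi
    have := hP.inj (by simp; omega) (by simp; omega) h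
    omega
  have hzinj : Set.InjOn z I := by
    intro i hi j hj hij
    have h1 := Finset.mem_range.mp hi
    have h2 := Finset.mem_range.mp hj
    refine hP.inj (by simp; omega) (by simp; omega) ?_
    rw [← (hzspec i hi).2.1, ← (hzspec j hj).2.1, hij]
  -- The mover at step `i` is assigned to `P i` and the `P i` are distinct, so the step is
  -- determined by the client.
  have hidx : ∀ i ∈ I, D.moveIdx p ρ c P' (z i) = i := by
    intro i hi
    have hi' := Finset.mem_range.mp hi
    have hlt : D.moveIdx p ρ c P' (z i) < D.k := findLt_lt_of (j := i) (by omega)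
      ⟨by omega, by rw [hPi i (by omega), hPi (i + 1) (by omega)]; exact hne i hi,
        by rw [hPi i (by omega), hPi (i + 1) (by omega)]⟩
    obtain ⟨h1, h2, h3⟩ := findLt_spec hlt
    set j := findLt D.k fun i_1 => i_1 + 1 < D.k ∧ P' i_1 ≠ P' (i_1 + 1) ∧
      D.mover p ρ c (P' i_1) (P' (i_1 + 1)) = z i
    have hj : j < m := by
      by_contra hj
      exact h2 (by rw [hPi' j (by omega), hPi' (j + 1) (by omega)])
    rw [hPi j hj.le, hPi (j + 1) hj] at h3
    exact hzinj (Finset.mem_range.mpr hj) hi h3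
  have hidx' : ∀ y, y ∉ I.image z → ¬ D.moveIdx p ρ c P' y < D.k := by
    intro y hy hlt
    obtain ⟨h1, h2, h3⟩ := findLt_spec hlt
    set j := findLt D.k fun i_1 => i_1 + 1 < D.k ∧ P' i_1 ≠ P' (i_1 + 1) ∧
      D.mover p ρ c (P' i_1) (P' (i_1 + 1)) = y
    have hj : j < m := by
      by_contra hj
      exact h2 (by rw [hPi' j (by omega), hPi' (j + 1) (by omega)])
    rw [hPi j hj.le, hPi (j + 1) hj] at h3
    exact hy (Finset.mem_image.mpr ⟨j, Finset.mem_range.mpr hj, h3⟩)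
  set τ := D.shift p ρ c P' with hτ
  have hτc : τ c = P 0 := by rw [hτ, shift, choose_pos rfl, hPi 0 (by omega)]
  have hτz : ∀ i ∈ I, τ (z i) = P (i + 1) := by
    intro i hi
    have hi' := Finset.mem_range.mp hi
    rw [hτ, shift, choose_neg (P := z i = c) (fun h => hc (h ▸ (hzspec i hi).1)), hidx i hi,
      choose_pos (by omega), hPi _ (by omega)]
  have hτy : ∀ y ∈ A, τ y = if y ∈ I.image z then τ y else ρ y := by
    intro y hy
    split_ifs with h
    · rfl
    · rw [hτ, shift, choose_neg (P := y = c) (fun he => hc (he ▸ hy)), choose_neg (hidx' y h)]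
  have hsum : ∀ h : ℕ → ℕ → ℝ, ∑ y ∈ insert c A, h y (τ y) = ∑ y ∈ A, h y (ρ y) + h c (P 0) +
      ∑ i ∈ I, (h (z i) (P (i + 1)) - h (z i) (P i)) := by
    intro h
    have h1 : ∑ y ∈ A, h y (τ y) = ∑ y ∈ A, h y (if y ∈ I.image z then τ y else ρ y) :=
      Finset.sum_congr rfl fun y hy => congrArg (h y) (hτy y hy)
    have h2 : ∑ i ∈ I, (h (z i) (τ (z i)) - h (z i) (ρ (z i))) =
        ∑ i ∈ I, (h (z i) (P (i + 1)) - h (z i) (P i)) :=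
      Finset.sum_congr rfl fun i hi => by rw [hτz i hi, (hzspec i hi).2.1]
    rw [Finset.sum_insert hc, hτc, h1,
      sum_piecewise_injOn hzinj (fun i hi => (hzspec i hi).1) h ρ τ, h2]
    ring
  refine ⟨P', fun i => hP.mem _ (by omega), ⟨?_, ?_⟩, ?_⟩
  · intro y hy
    change τ y ∈ S
    rcases Finset.mem_insert.mp hy with rfl | hy
    · rw [hτc]; exact hP.mem 0 (by omega)
    · rw [hτy y hy]
      split_ifs with h
      · obtain ⟨i, hi, rfl⟩ := Finset.mem_image.mp h
        rw [hτz i hi]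
        exact hP.mem _ (by have := Finset.mem_range.mp hi; omega)
      · exact hρ.fits.assigned y hy
  · intro f hf
    change ((insert c A).filter fun y => τ y = f).card ≤ _
    have h1 := hsum fun _ g => if g = f then 1 else 0
    have h2 := telescope P f (Nat.zero_le m)
    rw [← Finset.range_eq_Ico] at h2
    rw [h2, ← card_filter_eq_sum, ← card_filter_eq_sum] at h1
    -- Only the end of the path gains a client: `c` comes in at `P 0`, and one client leaves every
    -- facility but the last.
    have h3 : (((insert c A).filter fun y => τ y = f).card : ℝ) =
        (A.filter fun y => ρ y = f).card + if P m = f then 1 else 0 := by linarith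
    split_ifs at h3 with h4
    · have h5 := hP.spare
      rw [Nat.add_sub_cancel, h4] at h5
      have : ((insert c A).filter fun y => τ y = f).card = (A.filter fun y => ρ y = f).card + 1 := by
        exact_mod_cast h3
      omega
    · have : ((insert c A).filter fun y => τ y = f).card = (A.filter fun y => ρ y = f).card := by
        rw [add_zero] at h3
        exact_mod_cast h3
      rw [this]
      exact hρ.fits.capacity f hf
  · change D.costOn p (insert c A) τ ≤ _
    have h1 := hsum fun y g => D.d y g ^ p
    have h2 : ∑ i ∈ I, (D.d (z i) (P (i + 1)) ^ p - D.d (z i) (P i) ^ p) ≤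
        ∑ i ∈ I, (D.d (x i) (P (i + 1)) ^ p - D.d (x i) (P i) ^ p) :=
      Finset.sum_le_sum fun i hi => (hzspec i hi).2.2
    rw [Nat.add_sub_cancel] at hcost
    simp only [costOn] at hcost ⊢
    linarith

end Data

/-! ### What a command leaves unchanged -/

/-- Entry `i` of the natural-number array `j`. -/
def State.A (s : State) (j i : ℕ) : ℕ := s.nmem (s.addr j i)

/-- Entry `i` of the real array `j`. -/
def State.RA (s : State) (j i : ℕ) : ℝ := s.rmem (s.addr j i)

theorem State.addr_setN (s : State) {r : ℕ} (hr : r ≠ 0) (v j i : ℕ) :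
    (s.setN r v).addr j i = s.addr j i := by
  rw [addr, nreg_setN, if_neg hr.symm]; rfl

theorem State.A_setN (s : State) {r : ℕ} (hr : r ≠ 0) (v j i : ℕ) :
    (s.setN r v).A j i = s.A j i := by
  rw [A, addr_setN s hr]; rfl

theorem State.RA_setN (s : State) {r : ℕ} (hr : r ≠ 0) (v j i : ℕ) :
    (s.setN r v).RA j i = s.RA j i := by
  rw [RA, addr_setN s hr]; rfl

@[simp] theorem State.RA_setR (s : State) (r : ℕ) (v : ℝ) (j i : ℕ) :
    (s.setR r v).RA j i = s.RA j i := rfl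
@[simp] theorem State.nreg_storeN (s : State) (j i v : ℕ) : (s.storeN j i v).nreg = s.nreg := rfl

@[simp] theorem State.rreg_storeR (s : State) (j i : ℕ) (v : ℝ) :
    (s.storeR j i v).rreg = s.rreg := rfl

theorem State.addr_inj {s : State} {j i j' i' : ℕ} (hj : j < 16) (hj' : j' < 16) :
    s.addr j i = s.addr j' i' ↔ j = j' ∧ i = i' := by
  simp only [addr]; omega

theorem State.A_storeN (s : State) {j i v j' i' : ℕ} (hj : j < 16) (hj' : j' < 16) :
    (s.storeN j i v).A j' i' = if j' = j ∧ i' = i then v else s.A j' i' := by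
  have : (s.storeN j i v).A j' i' = Function.update s.nmem (s.addr j i) v (s.addr j' i') := rfl
  rw [this, Function.update_apply]
  simp only [addr_inj hj' hj]
  rfl

theorem State.RA_storeR (s : State) {j i : ℕ} {v : ℝ} {j' i' : ℕ} (hj : j < 16) (hj' : j' < 16) :
    (s.storeR j i v).RA j' i' = if j' = j ∧ i' = i then v else s.RA j' i' := by
  have : (s.storeR j i v).RA j' i' = Function.update s.rmem (s.addr j i) v (s.addr j' i') := rfl
  rw [this, Function.update_apply]
  simp only [addr_inj hj' hj]
  rfl

theorem State.low_storeN (s : State) (j i v : ℕ) {a : ℕ} (ha : a < s.nreg 0) :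
    (s.storeN j i v).nmem a = s.nmem a :=
  Function.update_of_ne (by simp only [addr]; omega) _ _

theorem State.low_storeR (s : State) (j i : ℕ) (v : ℝ) {a : ℕ} (ha : a < s.nreg 0) :
    (s.storeR j i v).rmem a = s.rmem a :=
  Function.update_of_ne (by simp only [addr]; omega) _ _

theorem State.iter_ind {f : State → State} {v : ℕ} (I : ℕ → State → Prop) {N : ℕ} {s : State}
    (h0 : I 0 s) (hs : ∀ j < N, ∀ s', I j s' → I (j + 1) (f (s'.setN v j))) :
    I N (State.iter f v N s) := by
  induction N with
  | zero => exact h0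
  | succ N ih => exact hs N (by omega) _ (ih fun j hj => hs j (by omega))

namespace Cmd

/-- The command writes register `r`. -/
def wN (r : ℕ) : Cmd → Bool
  | setN i _ => decide (i = r)
  | seq P Q => P.wN r || Q.wN r
  | ite _ P Q => P.wN r || Q.wN r
  | loop v _ P => decide (v = r) || P.wN r
  | _ => false

/-- The command writes the real register `r`. -/
def wR (r : ℕ) : Cmd → Bool
  | setR i _ => decide (i = r)
  | seq P Q => P.wR r || Q.wR r
  | ite _ P Q => P.wR r || Q.wR r
  | loop _ _ P => P.wR r
  | _ => false

/-- The command writes the natural-number array `j`. -/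
def wA (j : ℕ) : Cmd → Bool
  | storeN i _ _ => decide (i = j)
  | seq P Q => P.wA j || Q.wA j
  | ite _ P Q => P.wA j || Q.wA j
  | loop _ _ P => P.wA j
  | _ => false

/-- A frame rule. What a command writes is decided by a Boolean computation that does not inspect
the expressions, so its hypothesis is usually closed by `rfl`, even with symbolic parameters. The
same goes for `run_rreg` and `run_A`. -/
theorem run_nreg {r : ℕ} {c : Cmd} (hc : c.wN r = false) (s : State) :
    (c.run s).nreg r = s.nreg r := by
  induction c generalizing s with
  | skip => rfl
  | setN i e =>
    simp only [wN, decide_eq_false_iff_not] at hc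
    rw [run, State.nreg_setN, if_neg (Ne.symm hc)]
  | setR i e => rfl
  | storeN j a e => rfl
  | storeR j a e => rfl
  | seq P Q hP hQ =>
    simp only [wN, Bool.or_eq_false_iff] at hc
    rw [run, hQ hc.2, hP hc.1]
  | ite c P Q hP hQ =>
    simp only [wN, Bool.or_eq_false_iff] at hc
    rw [run]
    split_ifs
    · exact hP hc.1 _
    · exact hQ hc.2 _
  | loop v b P hP =>
    simp only [wN, Bool.or_eq_false_iff, decide_eq_false_iff_not] at hc
    exact State.iter_ind (I := fun _ s' => s'.nreg r = s.nreg r) rfl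
      fun j _ s' h => by rw [hP hc.2, State.nreg_setN, if_neg (Ne.symm hc.1), h]

theorem run_rreg {r : ℕ} {c : Cmd} (hc : c.wR r = false) (s : State) :
    (c.run s).rreg r = s.rreg r := by
  induction c generalizing s with
  | skip => rfl
  | setN i e => rfl
  | setR i e =>
    simp only [wR, decide_eq_false_iff_not] at hc
    rw [run, State.rreg_setR, if_neg (Ne.symm hc)]
  | storeN j a e => rfl
  | storeR j a e => rfl
  | seq P Q hP hQ =>
    simp only [wR, Bool.or_eq_false_iff] at hc
    rw [run, hQ hc.2, hP hc.1]
  | ite c P Q hP hQ =>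
    simp only [wR, Bool.or_eq_false_iff] at hc
    rw [run]
    split_ifs
    · exact hP hc.1 _
    · exact hQ hc.2 _
  | loop v b P hP =>
    exact State.iter_ind (I := fun _ s' => s'.rreg r = s.rreg r) rfl
      fun j _ s' h => by rw [hP hc, State.rreg_setN, h]

theorem run_A {j : ℕ} (hj : j < 16) {c : Cmd} (hok : c.ok) (hc : c.wA j = false) (s : State)
    (i : ℕ) : (c.run s).A j i = s.A j i := by
  induction c generalizing s with
  | skip => rfl
  | setN r e =>
    simp only [ok, Bool.and_eq_true, decide_eq_true_eq] at hok
    exact State.A_setN _ (by omega) _ _ _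
  | setR i e => rfl
  | storeN j' a e =>
    simp only [ok, Bool.and_eq_true, decide_eq_true_eq] at hok
    simp only [wA, decide_eq_false_iff_not] at hc
    rw [run, State.A_storeN _ hok.1 hj, if_neg fun h => hc h.1.symm]
  | storeR j a e => rfl
  | seq P Q hP hQ =>
    simp only [ok, wA, Bool.or_eq_false_iff, Bool.and_eq_true] at hc hok
    rw [run, hQ hok.2 hc.2, hP hok.1 hc.1]
  | ite c P Q hP hQ =>
    simp only [ok, wA, Bool.or_eq_false_iff, Bool.and_eq_true] at hc hok
    rw [run]
    split_ifs
    · exact hP hok.2.1 hc.1 _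
    · exact hQ hok.2.2 hc.2 _
  | loop v b P hP =>
    simp only [ok, Bool.and_eq_true, decide_eq_true_eq] at hok
    exact State.iter_ind (I := fun _ s' => s'.A j i = s.A j i) rfl
      fun j _ s' h => by rw [hP hok.2.2.2 hc, State.A_setN _ (by omega), h]

/-- Stores only reach array entries, which lie above the base address in register `0`; the input
below is never overwritten. -/
theorem run_low {c : Cmd} (hok : c.ok) (s : State) {a : ℕ} (ha : a < s.nreg 0) :
    (c.run s).nmem a = s.nmem a ∧ (c.run s).rmem a = s.rmem a := by
  induction c generalizing s with
  | skip => exact ⟨rfl, rfl⟩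
  | setN r e => exact ⟨rfl, rfl⟩
  | setR i e => exact ⟨rfl, rfl⟩
  | storeN j a e => exact ⟨State.low_storeN _ _ _ _ ha, rfl⟩
  | storeR j a e => exact ⟨rfl, State.low_storeR _ _ _ _ ha⟩
  | seq P Q hP hQ =>
    simp only [ok, Bool.and_eq_true] at hok
    have h1 := hP hok.1 s ha
    have h2 := hQ hok.2 (P.run s) (by rw [nreg_of_ok hok.1 s 0 (by omega)]; exact ha)
    exact ⟨h2.1.trans h1.1, h2.2.trans h1.2⟩
  | ite c P Q hP hQ =>
    simp only [ok, Bool.and_eq_true] at hok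
    rw [run]
    split_ifs
    · exact hP hok.2.1 _ ha
    · exact hQ hok.2.2 _ ha
  | loop v b P hP =>
    simp only [ok, Bool.and_eq_true, decide_eq_true_eq] at hok
    refine (State.iter_ind (I := fun _ s' => s'.nreg 0 = s.nreg 0 ∧ s'.nmem a = s.nmem a ∧
      s'.rmem a = s.rmem a) ⟨rfl, rfl, rfl⟩ fun j _ s' h => ?_).2
    have h0 : (s'.setN v j).nreg 0 = s'.nreg 0 := by rw [State.nreg_setN, if_neg (by omega)]
    have h1 := hP hok.2.2.2 (s'.setN v j) (by rw [h0, h.1]; exact ha)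
    exact ⟨by rw [nreg_of_ok hok.2.2.2 _ 0 (by omega), h0, h.1], h1.1.trans h.2.1,
      h1.2.trans h.2.2⟩

/-- Store the value of `e` in entry `i` of array `j` for all `i` below the bound, with `i` in
register `8`. -/
def fill (j b : ℕ) (e : Ex .nat) : Cmd := loop 8 b (storeN j (.reg 8) e)

/-- The states `s'` that occur while array `j` is filled, starting from `s`. -/
structure FillOf (s : State) (j : ℕ) (s' : State) : Prop where
  nreg : ∀ r, r ≠ 8 → s'.nreg r = s.nreg r
  rreg : s'.rreg = s.rreg
  rmem : s'.rmem = s.rmem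
  A : ∀ j' < 16, j' ≠ j → ∀ i, s'.A j' i = s.A j' i
  low : ∀ a < s.nreg 0, s'.nmem a = s.nmem a

theorem FillOf.RA {s s' : State} {j : ℕ} (h : FillOf s j s') (j' i : ℕ) : s'.RA j' i = s.RA j' i := by
  rw [State.RA, State.RA, h.rmem, State.addr, State.addr, h.nreg 0 (by decide)]

/-- The expression is evaluated in intermediate states with the array partly filled, so its value
must be known in every state that differs from `s` only in array `j` and register `8`. -/
theorem run_fill {s : State} {j b : ℕ} {e : Ex .nat} (hj : j < 16) (v : ℕ → ℕ)
    (h : ∀ i < s.nreg b, ∀ s', FillOf s j s' → s'.nreg 8 = i → e.eval s' [] = v i) :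
    FillOf s j ((fill j b e).run s) ∧
      ∀ i, ((fill j b e).run s).A j i = if i < s.nreg b then v i else s.A j i := by
  have key := State.iter_ind (f := (storeN j (.reg 8) e).run) (v := 8) (N := s.nreg b) (s := s)
    (I := fun N s' => FillOf s j s' ∧ ∀ i, s'.A j i = if i < N then v i else s.A j i)
    ⟨⟨fun _ _ => rfl, rfl, rfl, fun _ _ _ _ => rfl, fun _ _ => rfl⟩, by simp⟩ ?_
  · exact key
  intro N hN s' ⟨h1, h2⟩
  have h8 : (s'.setN 8 N).nreg 8 = N := by simp [State.nreg_setN]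
  have hfo : FillOf s j (s'.setN 8 N) := by
    refine ⟨fun r hr => ?_, h1.rreg, h1.rmem, fun j' hj' hne i => ?_, h1.low⟩
    · rw [State.nreg_setN, if_neg hr, h1.nreg r hr]
    · rw [State.A_setN _ (by decide), h1.A j' hj' hne]
  have hev := h N hN _ hfo h8
  have hrun : (storeN j (.reg 8) e).run (s'.setN 8 N) = (s'.setN 8 N).storeN j N (v N) := by
    rw [run, hev, Ex.eval, h8]
  rw [hrun]
  refine ⟨⟨?_, ?_, ?_, ?_, ?_⟩, ?_⟩
  · exact fun r hr => hfo.nreg r hr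
  · exact hfo.rreg
  · exact hfo.rmem
  · intro j' hj' hne i
    rw [State.A_storeN _ hj hj', if_neg fun h => hne h.1, hfo.A j' hj' hne]
  · intro a ha
    rw [State.low_storeN _ _ _ _ (by rw [hfo.nreg 0 (by decide)]; exact ha), hfo.low a ha]
  · intro i
    rw [State.A_storeN _ hj hj]
    rcases lt_trichotomy i N with hi | hi | hi
    · rw [if_neg fun h => hi.ne h.2, State.A_setN _ (by decide), h2, if_pos hi, if_pos (by omega)]
    · rw [if_pos ⟨rfl, hi⟩, if_pos (by omega), hi]
    · rw [if_neg fun h => hi.ne' h.2, State.A_setN _ (by decide), h2, if_neg (by omega),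
        if_neg (by omega)]

end Cmd

/-! ### Abbreviations for expressions -/

namespace Ex

def tt : Ex .bool := nle (lit 0) (lit 0)
def lt (a b : Ex .nat) : Ex .bool := not (nle b a)
def eq (a b : Ex .nat) : Ex .bool := and (nle a b) (nle b a)
def or (a b : Ex .bool) : Ex .bool := not (and (not a) (not b))
def ex (b : ℕ) (c : Ex .bool) : Ex .bool := not (all b (not c))
def ind (a : Ex .bool) : Ex .nat := cond a (lit 1) (lit 0)
def count (b : ℕ) (c : Ex .bool) : Ex .nat := nsum b c (lit 1)
/-- The product with a register. -/
def times (b : ℕ) (e : Ex .nat) : Ex .nat := nsum b tt e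
def powr (e : Ex .real) : ℕ → Ex .real
  | 0 => ofNat (lit 1)
  | p + 1 => rmul (powr e p) e

/-- The distance between two points. -/
def dist (x y : Ex .nat) : Ex .real := rmem (add (arr 15 x) y)
def client (x : Ex .nat) : Ex .bool := nle (lit 1) (mem (add (lit 3) x))
def facility (x : Ex .nat) : Ex .bool := nle (lit 1) (mem (add (lit 3) (add (reg 1) x)))
def capa (x : Ex .nat) : Ex .nat := mem (add (lit 3) (add (reg 1) (add (reg 1) x)))
def low (i : Ex .nat) : Ex .nat := mem (add (lit 3) (add (reg 1) (add (reg 1) (add (reg 1) i))))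
def upp (i : Ex .nat) : Ex .nat :=
  mem (add (lit 3) (add (reg 1) (add (reg 1) (add (reg 1) (add (reg 3) i)))))
def group (i x : Ex .nat) : Ex .bool := nle (lit 1)
  (mem (add (lit 3) (add (reg 1) (add (reg 1) (add (reg 1) (add (reg 3) (add (reg 3)
    (add (arr 14 i) x))))))))

variable (s : State) (ρ : List ℕ)

theorem eval_tt : tt.eval s ρ ↔ True := by simp [tt, eval]
theorem eval_lt (a b : Ex .nat) : (lt a b).eval s ρ ↔ (a.eval s ρ : ℕ) < b.eval s ρ := by
  simp [lt, eval]
theorem eval_eq (a b : Ex .nat) : (eq a b).eval s ρ ↔ (a.eval s ρ : ℕ) = b.eval s ρ := by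
  simp only [eq, eval]; exact le_antisymm_iff.symm
theorem eval_or (a b : Ex .bool) : (or a b).eval s ρ ↔ a.eval s ρ ∨ b.eval s ρ := by
  simp only [or, eval]; tauto
theorem eval_ex (b : ℕ) (c : Ex .bool) :
    (ex b c).eval s ρ ↔ ∃ j < s.nreg b, c.eval s (j :: ρ) := by
  simp only [ex, eval]; push Not; rfl
theorem eval_ind (a : Ex .bool) : (ind a).eval s ρ = choose (a.eval s ρ) 1 0 := rfl
theorem eval_count (b : ℕ) (c : Ex .bool) : (count b c).eval s ρ =
    sumLt (M := ℕ) (s.nreg b) (fun j => c.eval s (j :: ρ)) fun _ => 1 := rfl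
theorem eval_powr (e : Ex .real) (p : ℕ) : (powr e p).eval s ρ = (e.eval s ρ : ℝ) ^ p := by
  induction p with
  | zero => simp [powr, eval]
  | succ p ih => simp only [powr, eval, ih, pow_succ]

end Ex

theorem one_le_choose {P : Prop} : 1 ≤ choose P 1 0 ↔ P := by
  by_cases h : P
  · rw [choose_pos h]; simp [h]
  · rw [choose_neg h]; simp [h]

/-! ### The input in the memory of the machine -/

/-- The input and the tables of row offsets are in their places. -/
structure Ready (D : Data) (s : State) : Prop where
  n : s.nreg 1 = D.n
  k : s.nreg 2 = D.k
  t : s.nreg 3 = D.t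
  base : s.nreg 0 = 3 + 3 * D.n + 2 * D.t + D.t * D.n + D.n * D.n
  client : ∀ x < D.n, (1 ≤ s.nmem (3 + x) ↔ x ∈ D.C)
  facility : ∀ x < D.n, (1 ≤ s.nmem (3 + (D.n + x)) ↔ x ∈ D.F)
  cap : ∀ x < D.n, s.nmem (3 + (D.n + (D.n + x))) = D.cap x
  lower : ∀ i < D.t, s.nmem (3 + (D.n + (D.n + (D.n + i)))) = D.lower i
  upper : ∀ i < D.t, s.nmem (3 + (D.n + (D.n + (D.n + (D.t + i))))) = D.upper i
  group : ∀ i < D.t, ∀ x < D.n,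
    (1 ≤ s.nmem (3 + (D.n + (D.n + (D.n + (D.t + (D.t + (i * D.n + x))))))) ↔ x ∈ D.G i)
  dist : ∀ x < D.n, ∀ y < D.n, s.rmem (x * D.n + y) = D.d x y
  rows : ∀ x < D.n, s.A 15 x = x * D.n
  groupRows : ∀ i < D.t, s.A 14 i = i * D.n

theorem mul_add_lt {a b x y : ℕ} (hx : x < a) (hy : y < b) : x * b + y < a * b := by
  have : (x + 1) * b ≤ a * b := Nat.mul_le_mul_right b hx
  rw [add_mul] at this
  omega

/-- All input cells lie below the base address, which is the total length of the natural-number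
input plus room for the distance matrix. It is enough that nothing below it and neither of the
arrays `14` and `15` changes. -/
theorem Ready.mono {D : Data} {s s' : State} (h : Ready D s)
    (hr : ∀ r < 4, s'.nreg r = s.nreg r)
    (hlow : ∀ a < s.nreg 0, s'.nmem a = s.nmem a ∧ s'.rmem a = s.rmem a)
    (hA : ∀ i, s'.A 15 i = s.A 15 i ∧ s'.A 14 i = s.A 14 i) : Ready D s' := by
  have hb := h.base
  refine ⟨(hr 1 (by omega)).trans h.n, (hr 2 (by omega)).trans h.k, (hr 3 (by omega)).trans h.t,
    (hr 0 (by omega)).trans h.base, ?_, ?_, ?_, ?_, ?_, ?_, ?_, ?_, ?_⟩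
  · intro x hx; rw [(hlow _ (by omega)).1]; exact h.client x hx
  · intro x hx; rw [(hlow _ (by omega)).1]; exact h.facility x hx
  · intro x hx; rw [(hlow _ (by omega)).1]; exact h.cap x hx
  · intro i hi; rw [(hlow _ (by omega)).1]; exact h.lower i hi
  · intro i hi; rw [(hlow _ (by omega)).1]; exact h.upper i hi
  · intro i hi x hx
    have := mul_add_lt hi hx
    rw [(hlow _ (by omega)).1]; exact h.group i hi x hx
  · intro x hx y hy
    have := mul_add_lt hx hy
    rw [(hlow _ (by omega)).2]; exact h.dist x hx y hy
  · intro x hx; rw [(hA x).1]; exact h.rows x hx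
  · intro i hi; rw [(hA i).2]; exact h.groupRows i hi

theorem Ready.run {D : Data} {s : State} (h : Ready D s) {c : Cmd} (hok : c.ok)
    (h15 : c.wA 15 = false) (h14 : c.wA 14 = false) : Ready D (c.run s) :=
  h.mono (fun r hr => Cmd.nreg_of_ok hok s r (by omega)) (fun _ ha => Cmd.run_low hok s ha)
    fun i => ⟨Cmd.run_A (by decide) hok h15 s i, Cmd.run_A (by decide) hok h14 s i⟩

theorem Ready.setN {D : Data} {s : State} (h : Ready D s) {r : ℕ} (hr : 8 ≤ r) (v : ℕ) :
    Ready D (s.setN r v) :=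
  h.mono (fun r' hr' => by rw [State.nreg_setN, if_neg (by omega)]) (fun _ _ => ⟨rfl, rfl⟩)
    fun i => ⟨State.A_setN _ (by omega) _ _ _, State.A_setN _ (by omega) _ _ _⟩

theorem Ready.setR {D : Data} {s : State} (h : Ready D s) (r : ℕ) (v : ℝ) :
    Ready D (s.setR r v) :=
  h.mono (fun _ _ => rfl) (fun _ _ => ⟨rfl, rfl⟩) fun _ => ⟨rfl, rfl⟩

theorem Ready.fill {D : Data} {s s' : State} {j : ℕ} (h : Ready D s) (hj : j < 14)
    (hf : Cmd.FillOf s j s') : Ready D s' :=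
  h.mono (fun r hr => hf.nreg r (by omega)) (fun a ha => ⟨hf.low a ha, by rw [hf.rmem]⟩)
    fun i => ⟨hf.A 15 (by decide) (by omega) i, hf.A 14 (by decide) (by omega) i⟩

section

variable {D : Data} {s : State} {ρ : List ℕ}

theorem Ready.eval_dist (h : Ready D s) {x y : Ex .nat} (hx : x.eval s ρ < D.n) (hy : y.eval s ρ < D.n) :
    (Ex.dist x y).eval s ρ = D.d (x.eval s ρ) (y.eval s ρ) := by
  have h1 := h.rows _ hx
  simp only [State.A] at h1
  simp only [Ex.dist, Ex.eval, h1]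
  exact h.dist _ hx _ hy

theorem Ready.eval_client (h : Ready D s) {x : Ex .nat} (hx : x.eval s ρ < D.n) :
    (Ex.client x).eval s ρ ↔ x.eval s ρ ∈ D.C := h.client _ hx

theorem Ready.eval_facility (h : Ready D s) {x : Ex .nat} (hx : x.eval s ρ < D.n) :
    (Ex.facility x).eval s ρ ↔ x.eval s ρ ∈ D.F := by
  simp only [Ex.facility, Ex.eval, h.n]; exact h.facility _ hx

theorem Ready.eval_capa (h : Ready D s) {x : Ex .nat} (hx : x.eval s ρ < D.n) :
    (Ex.capa x).eval s ρ = D.cap (x.eval s ρ) := by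
  simp only [Ex.capa, Ex.eval, h.n]; exact h.cap _ hx

theorem Ready.eval_low (h : Ready D s) {i : Ex .nat} (hi : i.eval s ρ < D.t) :
    (Ex.low i).eval s ρ = D.lower (i.eval s ρ) := by
  simp only [Ex.low, Ex.eval, h.n]; exact h.lower _ hi

theorem Ready.eval_upp (h : Ready D s) {i : Ex .nat} (hi : i.eval s ρ < D.t) :
    (Ex.upp i).eval s ρ = D.upper (i.eval s ρ) := by
  simp only [Ex.upp, Ex.eval, h.n, h.t]; exact h.upper _ hi

theorem Ready.eval_group (h : Ready D s) {i x : Ex .nat} (hi : i.eval s ρ < D.t) (hx : x.eval s ρ < D.n) :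
    (Ex.group i x).eval s ρ ↔ x.eval s ρ ∈ D.G (i.eval s ρ) := by
  have h1 := h.groupRows _ hi
  simp only [State.A] at h1
  simp only [Ex.group, Ex.eval, h.n, h.t, h1]; exact h.group _ hi _ hx

end

/-! ### Computing the leaders -/

namespace Ex

def imp (a b : Ex .bool) : Ex .bool := not (and a (not b))

theorem eval_imp (s : State) (ρ : List ℕ) (a b : Ex .bool) :
    (imp a b).eval s ρ ↔ (a.eval s ρ → b.eval s ρ) := by
  simp only [imp, eval]; tauto

/-- Entry `x` of array `j` is not zero. -/
def isIn (j : ℕ) (x : Ex .nat) : Ex .bool := nle (lit 1) (arr j x)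

def nearest : Ex .nat := find 1 (and (isIn 0 (bv 0))
  (all 1 (imp (isIn 0 (bv 0)) (rle (dist (reg 8) (bv 1)) (dist (reg 8) (bv 0))))))

def weight (p : ℕ) : Ex .real := powr (dist (bv 0) (arr 1 (bv 0))) p

def totalWeight (p : ℕ) : Ex .real := rsum 1 (client (bv 0)) (weight p)

def ballWeight (p : ℕ) : Ex .real :=
  rsum 1 (and (client (bv 0)) (rle (dist (bv 2) (bv 0)) (dist (bv 2) (bv 1)))) (weight p)

def liveBall (p q : ℕ) : Ex .bool :=
  and (rle (rreg 0) (rmul (rmul (ofNat (reg 2)) (ofNat (lit (448 * q ^ 4)))) (ballWeight p)))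
    (and (not (rle (ballWeight p) (ofNat (lit 0))))
      (all 1 (not (and (isIn 0 (bv 0)) (rle (dist (bv 2) (bv 0)) (dist (bv 2) (bv 1)))))))

/-- The number of live balls containing `x`, where two binders are added above `x`. -/
def numHits (p q : ℕ) (x : Ex .nat) : Ex .nat :=
  nsum 1 tt (count 1 (and (liveBall p q) (rle (dist (bv 1) x) (dist (bv 1) (bv 0)))))

def bestPoint (p q : ℕ) : Ex .nat :=
  find 1 (all 1 (nle (numHits p q (bv 2)) (numHits p q (bv 3))))

end Ex

open Ex in
def Cmd.addBest (p q : ℕ) : Cmd :=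
  seq (setN 11 (bestPoint p q)) (ite (.lt (.lit 0) (numHits p q (.reg 11)))
    (storeN 0 (.reg 11) (.lit 1)) skip)

open Ex in
def Cmd.round (p q : ℕ) : Cmd :=
  seq (fill 1 1 nearest) (seq (setR 0 (totalWeight p)) (loop 10 1 (addBest p q)))

open Ex in
def Cmd.leaders (p q : ℕ) : Cmd :=
  seq (fill 0 1 (ind (eq (.reg 8) (.lit 0)))) (loop 9 2 (round p q))

theorem Ex.ok_weight (p : ℕ) : (weight p).ok = true := by
  induction p with
  | zero => rfl
  | succ p ih =>
    change ((weight p).ok && _) = true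
    rw [ih]; rfl

theorem Cmd.ok_addBest (p q : ℕ) : (addBest p q).ok = true := by
  simp [addBest, ok, Ex.ok, Ex.bestPoint, Ex.numHits, Ex.liveBall, Ex.ballWeight, Ex.ok_weight,
    Ex.lt, Ex.tt, Ex.count, Ex.isIn, Ex.dist, Ex.client]

theorem Cmd.ok_round (p q : ℕ) : (round p q).ok = true := by
  have : (Ex.totalWeight p).ok = true := by simp [Ex.totalWeight, Ex.ok, Ex.client, Ex.ok_weight]
  simp only [round, ok, this, ok_addBest]
  rfl

theorem Cmd.ok_leaders (p q : ℕ) : (leaders p q).ok = true := by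
  simp only [leaders, ok, ok_round]
  rfl

/-- Array `j` represents the set `M`. -/
def Rep (D : Data) (j : ℕ) (M : Finset ℕ) (s : State) : Prop := ∀ x < D.n, (1 ≤ s.A j x ↔ x ∈ M)

namespace Ready

variable {D : Data} {s : State} {ρ : List ℕ} {M : Finset ℕ} {p q : ℕ} {nr : ℕ → ℕ}

theorem eval_nearest (h : Ready D s) (hM : Rep D 0 M s) (h8 : s.nreg 8 < D.n) :
    Ex.nearest.eval s ρ = D.near M (s.nreg 8) := by
  simp only [Ex.nearest, Ex.eval, h.n]
  refine findLt_congr fun m hm => and_congr (hM m hm) (forall₂_congr fun m' hm' => ?_)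
  rw [Ex.eval_imp]
  refine imp_congr (hM m' hm') ?_
  simp only [Ex.eval]
  rw [h.eval_dist, h.eval_dist] <;> first | rfl | assumption

theorem eval_weight (h : Ready D s) (hnr : ∀ x < D.n, s.A 1 x = nr x) (hlt : ∀ x < D.n, nr x < D.n)
    {x : ℕ} (hx : x < D.n) : (Ex.weight p).eval s (x :: ρ) = D.wgt p nr x := by
  have h1 : (Ex.arr 1 (.bv 0)).eval s (x :: ρ) = nr x := hnr x hx
  rw [Ex.weight, Ex.eval_powr, h.eval_dist (show Ex.eval s (.bv 0) (x :: ρ) < D.n from hx)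
    (by rw [h1]; exact hlt x hx), h1]
  rfl

theorem eval_totalWeight (h : Ready D s) (hnr : ∀ x < D.n, s.A 1 x = nr x)
    (hlt : ∀ x < D.n, nr x < D.n) : (Ex.totalWeight p).eval s ρ = D.totW p nr := by
  simp only [Ex.totalWeight, Ex.eval, h.n]
  exact sumLt_congr (fun j hj => h.eval_client (x := .bv 0) hj)
    fun j hj _ => h.eval_weight hnr hlt hj

theorem eval_ballWeight (h : Ready D s) (hnr : ∀ x < D.n, s.A 1 x = nr x)
    (hlt : ∀ x < D.n, nr x < D.n) {f y : ℕ} (hf : f < D.n) (hy : y < D.n) :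
    (Ex.ballWeight p).eval s (y :: f :: ρ) = D.ballW p nr f y := by
  simp only [Ex.ballWeight, Ex.eval, h.n]
  refine sumLt_congr (fun j hj => and_congr (h.eval_client (x := .bv 0) hj) ?_)
    fun j hj _ => h.eval_weight hnr hlt hj
  rw [h.eval_dist, h.eval_dist] <;> first | rfl | assumption

theorem eval_liveBall (h : Ready D s) (hM : Rep D 0 M s) (hnr : ∀ x < D.n, s.A 1 x = nr x)
    (hlt : ∀ x < D.n, nr x < D.n) (hW : s.rreg 0 = D.totW p nr) {f y : ℕ} (hf : f < D.n)
    (hy : y < D.n) :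
    (Ex.liveBall p q).eval s (y :: f :: ρ) ↔ D.Live p (448 * D.k * q ^ 4) nr M f y := by
  simp only [Ex.liveBall, Ex.eval, h.n, h.k, hW, h.eval_ballWeight hnr hlt hf hy, Data.Live]
  refine and_congr ?_ (and_congr (by simp) (forall₂_congr fun m hm => not_congr
    (and_congr (hM m hm) ?_)))
  · rw [show ((448 * D.k * q ^ 4 : ℕ) : ℝ) = D.k * (448 * q ^ 4 : ℕ) by push_cast; ring]
  · rw [h.eval_dist, h.eval_dist] <;> first | rfl | assumption

theorem eval_numHits (h : Ready D s) (hM : Rep D 0 M s) (hnr : ∀ x < D.n, s.A 1 x = nr x)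
    (hlt : ∀ x < D.n, nr x < D.n) (hW : s.rreg 0 = D.totW p nr) {e : Ex .nat} {x : ℕ}
    (hx : x < D.n) (he : ∀ f y, e.eval s (y :: f :: ρ) = x) :
    (Ex.numHits p q e).eval s ρ = D.hits p (448 * D.k * q ^ 4) nr M x := by
  simp only [Ex.numHits, Ex.eval, h.n, Ex.eval_count]
  refine sumLt_congr (fun _ _ => by simp [Ex.eval_tt]) fun f hf _ => ?_
  refine sumLt_congr (fun y hy => and_congr (h.eval_liveBall hM hnr hlt hW hf hy) ?_)
    fun _ _ _ => rfl
  rw [h.eval_dist, h.eval_dist, he]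
  · rfl
  · exact hf
  · exact hy
  · exact hf
  · rw [he]; exact hx

theorem eval_bestPoint (h : Ready D s) (hM : Rep D 0 M s) (hnr : ∀ x < D.n, s.A 1 x = nr x)
    (hlt : ∀ x < D.n, nr x < D.n) (hW : s.rreg 0 = D.totW p nr) :
    (Ex.bestPoint p q).eval s ρ = D.best p (448 * D.k * q ^ 4) nr M := by
  simp only [Ex.bestPoint, Ex.eval, h.n]
  refine findLt_congr fun x hx => forall₂_congr fun x' hx' => ?_
  rw [h.eval_numHits hM hnr hlt hW hx' fun _ _ => rfl, h.eval_numHits hM hnr hlt hW hx fun _ _ => rfl]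

theorem run_addBest (h : Ready D s) (hM : Rep D 0 M s) (hnr : ∀ x < D.n, s.A 1 x = nr x)
    (hlt : ∀ x < D.n, nr x < D.n) (hW : s.rreg 0 = D.totW p nr) :
    Rep D 0 (D.addBest p (448 * D.k * q ^ 4) nr M) ((Cmd.addBest p q).run s) := by
  set b := D.best p (448 * D.k * q ^ 4) nr M with hb
  have hbn : b < D.n := Data.best_spec.1
  set s' := s.setN 11 b with hs'
  have h' : Ready D s' := h.setN (by decide) _
  have hM' : Rep D 0 M s' := fun x hx => by rw [State.A_setN _ (by decide)]; exact hM x hx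
  have hnr' : ∀ x < D.n, s'.A 1 x = nr x := fun x hx => by
    rw [State.A_setN _ (by decide)]; exact hnr x hx
  have h11 : s'.nreg 11 = b := by simp [hs', State.nreg_setN]
  have hrun : (Cmd.addBest p q).run s = (Cmd.ite (.lt (.lit 0) (Ex.numHits p q (.reg 11)))
      (.storeN 0 (.reg 11) (.lit 1)) .skip).run s' := by
    rw [Cmd.addBest, Cmd.run, Cmd.run, h.eval_bestPoint hM hnr hlt hW]
  have hc : (Ex.lt (.lit 0) (Ex.numHits p q (.reg 11))).eval s' [] ↔
      0 < D.hits p (448 * D.k * q ^ 4) nr M b := by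
    rw [Ex.eval_lt, h'.eval_numHits (e := .reg 11) hM' hnr' hlt hW hbn fun _ _ => h11]; rfl
  rw [hrun, Cmd.run, Data.addBest]
  by_cases hpos : 0 < D.hits p (448 * D.k * q ^ 4) nr M b
  · rw [if_pos (hc.mpr hpos), if_pos hpos]
    intro x hx
    rw [Cmd.run, State.A_storeN _ (by decide) (by decide), Ex.eval, Ex.eval, h11,
      Finset.mem_insert]
    by_cases hxb : x = b
    · simp [hxb]; exact Or.inl hb
    · rw [if_neg fun h => hxb h.2, hM' x hx]
      exact ⟨Or.inr, fun h => h.resolve_left hxb⟩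
  · rw [if_neg (mt hc.mp hpos), if_neg hpos]
    exact hM'

theorem run_round (h : Ready D s) (hM : Rep D 0 M s) (hn : ∀ m ∈ M, m < D.n) (hne : M.Nonempty) :
    Rep D 0 (D.round p (448 * D.k * q ^ 4) M) ((Cmd.round p q).run s) := by
  obtain ⟨hf, hnear⟩ := Cmd.run_fill (s := s) (j := 1) (b := 1) (e := Ex.nearest) (by decide)
    (D.near M) fun i hi s' hs' h8 => by
      rw [h.n] at hi
      rw [← h8]
      exact (h.fill (by decide) hs').eval_nearest
        (fun x hx => by rw [hs'.A 0 (by decide) (by decide)]; exact hM x hx) (by rw [h8]; exact hi)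
  rw [Cmd.round, Cmd.run, Cmd.run]
  set s1 := (Cmd.fill 1 1 Ex.nearest).run s
  have h1 : Ready D s1 := h.fill (by decide) hf
  have hlt : ∀ x < D.n, D.near M x < D.n := fun x _ => Data.near_lt hn hne x
  have hnr1 : ∀ x < D.n, s1.A 1 x = D.near M x := fun x hx => by
    rw [hnear, if_pos (by rw [h.n]; exact hx)]
  rw [Cmd.run, h1.eval_totalWeight hnr1 hlt]
  set s2 := s1.setR 0 (D.totW p (D.near M)) with hs2
  have h2 : Ready D s2 := h1.setR _ _
  rw [Cmd.run, h2.n]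
  refine (State.iter_ind (I := fun i s' => Ready D s' ∧
    Rep D 0 ((D.addBest p (448 * D.k * q ^ 4) (D.near M))^[i] M) s' ∧
    (∀ x < D.n, s'.A 1 x = D.near M x) ∧ s'.rreg 0 = D.totW p (D.near M)) ⟨h2, ?_, hnr1, ?_⟩ ?_).2.1
  · intro x hx
    change 1 ≤ s1.A 0 x ↔ _
    rw [hf.A 0 (by decide) (by decide)]
    exact hM x hx
  · simp [hs2, State.rreg_setR]
  · intro j hj s' ⟨i1, i2, i3, i4⟩
    have i1' := i1.setN (r := 10) (by decide) j
    have i3' : ∀ x < D.n, (s'.setN 10 j).A 1 x = D.near M x := fun x hx => by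
      rw [State.A_setN _ (by decide), i3 x hx]
    refine ⟨i1'.run (Cmd.ok_addBest p q) rfl rfl, ?_, fun x hx => ?_, ?_⟩
    · rw [Function.iterate_succ_apply']
      exact i1'.run_addBest (fun x hx => by rw [State.A_setN _ (by decide)]; exact i2 x hx)
        i3' hlt i4
    · rw [Cmd.run_A (by decide) (Cmd.ok_addBest p q) rfl, i3' x hx]
    · rw [Cmd.run_rreg rfl, State.rreg_setN, i4]

theorem run_leaders (h : Ready D s) (hq : 0 < q) :
    Rep D 0 (D.leaders p (448 * D.k * q ^ 4)) ((Cmd.leaders p q).run s) := by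
  obtain ⟨hf, hin⟩ := Cmd.run_fill (s := s) (j := 0) (b := 1)
    (e := Ex.ind (Ex.eq (.reg 8) (.lit 0))) (by decide) (fun i => choose (i = 0) 1 0)
    fun i hi s' hs' h8 => by
      rw [Ex.eval_ind, Ex.eval_eq, Ex.eval, Ex.eval, h8]
  rw [Cmd.leaders, Cmd.run]
  set s1 := (Cmd.fill 0 1 (Ex.ind (Ex.eq (.reg 8) (.lit 0)))).run s
  have h1 : Ready D s1 := h.fill (by decide) hf
  have hQ : 0 < 448 * D.k * q ^ 4 := by have := D.k_pos; positivity
  rw [Cmd.run, h1.k]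
  refine (State.iter_ind (I := fun i s' => Ready D s' ∧
    Rep D 0 ((D.round p (448 * D.k * q ^ 4))^[i] {0}) s' ∧
    (∀ m ∈ (D.round p (448 * D.k * q ^ 4))^[i] {0}, m < D.n) ∧
    ((D.round p (448 * D.k * q ^ 4))^[i] {0}).Nonempty) ⟨h1, ?_, ?_, ?_⟩ ?_).2.1
  · intro x hx
    rw [hin, if_pos (by rw [h.n]; exact hx), one_le_choose]
    simp
  · have := D.two_le
    simp; omega
  · simp
  · intro j hj s' ⟨i1, i2, i3, i4⟩
    have i1' := i1.setN (r := 9) (by decide) j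
    -- Only the inclusion and the range of the points matter for correctness, so the crude exponent
    -- `n` is good enough here.
    have hr := Data.round_spec (p := p) hQ (Nat.lt_two_pow_self (n := D.n)).le i3 i4
    refine ⟨i1'.run (Cmd.ok_round p q) rfl rfl, ?_, ?_, ?_⟩
    · rw [Function.iterate_succ_apply']
      exact i1'.run_round (fun x hx => by rw [State.A_setN _ (by decide)]; exact i2 x hx) i3 i4
    · rw [Function.iterate_succ_apply']; exact hr.2.1
    · rw [Function.iterate_succ_apply']; exact i4.mono hr.1

end Ready

/-! ### Computing the candidate facilities -/

namespace Ex

def iff (a b : Ex .bool) : Ex .bool := and (imp a b) (imp b a)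

theorem eval_iff (s : State) (ρ : List ℕ) (a b : Ex .bool) :
    (iff a b).eval s ρ ↔ (a.eval s ρ ↔ b.eval s ρ) := by
  simp only [iff, eval, eval_imp]; exact iff_def.symm

def nextNearest : Ex .nat := find 1 (and (not (eq (bv 0) (reg 8)))
  (all 1 (imp (not (eq (bv 0) (reg 8))) (rle (dist (reg 8) (bv 1)) (dist (reg 8) (bv 0))))))

/-- The index of the ring around `m` containing `x`, where one binder is added above both. -/
def ringIdx (m x : Ex .nat) : Ex .nat :=
  find 4 (rle (dist m x) (rmul (rarr 0 (bv 0)) (dist m (arr 13 m))))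

def better (x y : Ex .nat) : Ex .bool :=
  or (lt (capa y) (capa x)) (and (eq (capa y) (capa x)) (lt x y))

def rival : Ex .bool := and (facility (bv 0))
  (and (all 3 (iff (group (bv 0) (reg 8)) (group (bv 0) (bv 1))))
    (and (eq (ringIdx (bv 2) (reg 8)) (ringIdx (bv 2) (bv 1))) (better (bv 0) (reg 8))))

def isCandidate : Ex .bool := and (facility (reg 8))
  (ex 1 (and (isIn 0 (bv 0)) (lt (count 1 rival) (reg 2))))

end Ex

open Ex in
/-- Tabulate the radii of the rings. -/
def Cmd.radii (q : ℕ) : Cmd :=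
  seq (storeR 0 (.lit 0) (.ofNat (.lit 0))) (seq (setR 1 (.ofNat (.lit 1)))
    (loop 9 4 (seq (storeR 0 (.add (.reg 9) (.lit 1)) (.rreg 1))
      (setR 1 (.rmul (.rreg 1) (.radd (.ofNat (.lit 1)) (.rdiv (.ofNat (.lit 1)) (.ofNat (.lit q)))))))))

def Cmd.candidates (q : ℕ) : Cmd :=
  seq (radii q) (seq (fill 13 1 Ex.nextNearest) (fill 2 1 (Ex.ind Ex.isCandidate)))

theorem Cmd.run_seq (P Q : Cmd) (s : State) : (seq P Q).run s = Q.run (P.run s) := rfl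

namespace Ready

variable {D : Data} {s : State} {ρ : List ℕ} {M : Finset ℕ} {q : ℕ}

theorem eval_nextNearest (h : Ready D s) (h8 : s.nreg 8 < D.n) :
    Ex.nextNearest.eval s ρ = D.nn (s.nreg 8) := by
  simp only [Ex.nextNearest, Ex.eval, h.n]
  refine findLt_congr fun m hm => and_congr (not_congr (Ex.eval_eq _ _ _ _))
    (forall₂_congr fun m' hm' => ?_)
  rw [Ex.eval_imp]
  refine imp_congr (not_congr (Ex.eval_eq _ _ _ _)) ?_
  simp only [Ex.eval]
  rw [h.eval_dist, h.eval_dist] <;> first | rfl | assumption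

theorem _root_.CFR.Cmd.run_radii : ∀ j < s.nreg 4, ((Cmd.radii q).run s).RA 0 j = Data.radius q j := by
  rw [Cmd.radii, Cmd.run_seq, Cmd.run_seq]
  set s1 := (s.storeR 0 0 0).setR 1 1
  have hs1 : (Cmd.setR 1 (.ofNat (.lit 1))).run ((Cmd.storeR 0 (.lit 0) (.ofNat (.lit 0))).run s) =
      s1 := by
    simp [Cmd.run, Ex.eval, s1]
  rw [hs1, Cmd.run]
  -- Entry `0` is the exceptional radius zero; the power kept in real register `1` is stored with
  -- the index shifted by one.
  have key := State.iter_ind (f := Cmd.run (.seq (.storeR 0 (.add (.reg 9) (.lit 1)) (.rreg 1))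
    (.setR 1 (.rmul (.rreg 1) (.radd (.ofNat (.lit 1)) (.rdiv (.ofNat (.lit 1)) (.ofNat (.lit q))))))))
    (v := 9) (N := s1.nreg 4) (s := s1) (I := fun N s' => s'.rreg 1 = (1 + 1 / (q : ℝ)) ^ N ∧
      ∀ j ≤ N, s'.RA 0 j = Data.radius q j) ⟨by simp [s1, State.rreg_setR], ?_⟩ ?_
  · exact fun j hj => key.2 j (le_of_lt hj)
  · intro j hj
    obtain rfl : j = 0 := by omega
    rw [State.RA_setR, State.RA_storeR _ (by decide) (by decide), if_pos ⟨rfl, rfl⟩]; rfl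
  · intro N _ s' ⟨h1, h2⟩
    rw [Cmd.run, Cmd.run, Cmd.run]
    have e9 : (s'.setN 9 N).nreg 9 = N := by simp [State.nreg_setN]
    simp only [Ex.eval, e9, State.rreg_setR, State.rreg_storeR, State.rreg_setN, h1, if_true]
    refine ⟨by push_cast; rw [pow_succ], fun j hj => ?_⟩
    rw [State.RA_setR, State.RA_storeR _ (by decide) (by decide)]
    rcases eq_or_lt_of_le hj with rfl | hj
    · rw [if_pos ⟨rfl, rfl⟩]; rfl
    · rw [if_neg fun h => hj.ne h.2, State.RA_setN _ (by decide), h2 j (by omega)]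

theorem eval_ringIdx (h : Ready D s) (hrad : ∀ j < s.nreg 4, s.RA 0 j = Data.radius q j)
    (hnn : ∀ x < D.n, s.A 13 x = D.nn x) {m x : Ex .nat} {a b : ℕ}
    (hm : ∀ j, m.eval s (j :: ρ) = a) (hx : ∀ j, x.eval s (j :: ρ) = b) (ha : a < D.n)
    (hb : b < D.n) : (Ex.ringIdx m x).eval s ρ = D.ring q (s.nreg 4) a b := by
  simp only [Ex.ringIdx, Ex.eval]
  refine findLt_congr fun j hj => ?_
  have h1 : s.rmem (s.addr 0 ((j :: ρ).getD 0 0)) = Data.radius q j := hrad j hj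
  have h2 : (Ex.arr 13 m).eval s (j :: ρ) = D.nn a := by rw [Ex.eval, hm]; exact hnn a ha
  rw [h1, h.eval_dist (by rw [hm]; exact ha) (by rw [hx]; exact hb),
    h.eval_dist (by rw [hm]; exact ha) (by rw [h2]; exact Data.nn_spec.1), h2, hm, hx]

theorem eval_better (h : Ready D s) {x y : Ex .nat} {a b : ℕ} (hx : x.eval s ρ = a)
    (hy : y.eval s ρ = b) (ha : a < D.n) (hb : b < D.n) :
    (Ex.better x y).eval s ρ ↔ D.Better a b := by
  rw [Ex.better, Ex.eval_or, Ex.eval_lt, Ex.eval, Ex.eval_eq, Ex.eval_lt,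
    h.eval_capa (by rw [hy]; exact hb), h.eval_capa (by rw [hx]; exact ha), hx, hy]
  rfl

theorem eval_rival (h : Ready D s) (hrad : ∀ j < s.nreg 4, s.RA 0 j = Data.radius q j)
    (hnn : ∀ x < D.n, s.A 13 x = D.nn x) (h8 : s.nreg 8 < D.n) {m f' : ℕ} (hm : m < D.n)
    (hf' : f' < D.n) :
    Ex.rival.eval s (f' :: m :: ρ) ↔ D.Rival q (s.nreg 4) m (s.nreg 8) f' := by
  simp only [Ex.rival, Ex.eval, h.t]
  refine and_congr (h.eval_facility (x := .bv 0) (ρ := f' :: m :: ρ) hf') (and_congr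
    (forall₂_congr fun i hi => ?_) (and_congr ?_ (h.eval_better rfl rfl hf' h8)))
  · rw [Ex.eval_iff]
    exact iff_congr (h.eval_group (i := .bv 0) (x := .reg 8) (ρ := i :: f' :: m :: ρ) hi h8)
      (h.eval_group (i := .bv 0) (x := .bv 1) (ρ := i :: f' :: m :: ρ) hi hf')
  · rw [Ex.eval_eq, h.eval_ringIdx hrad hnn (fun _ => rfl) (fun _ => rfl) hm h8,
      h.eval_ringIdx hrad hnn (fun _ => rfl) (fun _ => rfl) hm hf']

theorem eval_isCandidate (h : Ready D s) (hM : Rep D 0 M s)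
    (hrad : ∀ j < s.nreg 4, s.RA 0 j = Data.radius q j)
    (hnn : ∀ x < D.n, s.A 13 x = D.nn x) (h8 : s.nreg 8 < D.n) :
    Ex.isCandidate.eval s ρ ↔ D.InZ q (s.nreg 4) M (s.nreg 8) := by
  rw [Ex.isCandidate, Ex.eval, Ex.eval_ex, h.n]
  refine and_congr (h.eval_facility (x := .reg 8) (ρ := ρ) h8) (exists_congr fun m =>
    and_congr_right fun hm => and_congr (hM m hm) ?_)
  rw [Ex.eval_lt, Ex.eval_count, h.n]
  have : sumLt (M := ℕ) D.n (fun j => Ex.rival.eval s (j :: m :: ρ)) (fun _ => 1) =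
      sumLt D.n (fun f' => D.Rival q (s.nreg 4) m (s.nreg 8) f') (fun _ => 1) :=
    sumLt_congr (fun j hj => h.eval_rival hrad hnn h8 hm hj) fun _ _ _ => rfl
  rw [this, Ex.eval, h.k]

theorem run_candidates (h : Ready D s) (hM : Rep D 0 M s) :
    Rep D 2 (D.candidates q (s.nreg 4) M) ((Cmd.candidates q).run s) := by
  rw [Cmd.candidates, Cmd.run, Cmd.run]
  set s1 := (Cmd.radii q).run s with hs1
  have h1 : Ready D s1 := h.run (c := Cmd.radii q) rfl rfl rfl
  have hrad := Cmd.run_radii (s := s) (q := q)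
  rw [← hs1] at hrad
  have h41 : s1.nreg 4 = s.nreg 4 := Cmd.nreg_of_ok (c := Cmd.radii q) rfl s 4 (by decide)
  have hM1 : Rep D 0 M s1 := fun x hx => by
    rw [Cmd.run_A (c := Cmd.radii q) (by decide) rfl rfl]; exact hM x hx
  obtain ⟨hf, hnn⟩ := Cmd.run_fill (s := s1) (j := 13) (b := 1) (e := Ex.nextNearest) (by decide)
    D.nn fun i hi s' hs' h8 => by
      rw [h1.n] at hi
      rw [← h8]
      exact (h1.fill (by decide) hs').eval_nextNearest (by rw [h8]; exact hi)
  set s2 := (Cmd.fill 13 1 Ex.nextNearest).run s1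
  have h2 : Ready D s2 := h1.fill (by decide) hf
  have h42 : s2.nreg 4 = s.nreg 4 := (hf.nreg 4 (by decide)).trans h41
  obtain ⟨-, hZ⟩ := Cmd.run_fill (s := s2) (j := 2) (b := 1) (e := Ex.ind Ex.isCandidate) (by decide)
    (fun x => choose (D.InZ q (s.nreg 4) M x) 1 0) fun i hi s' hs' h8 => by
      rw [h2.n] at hi
      have h43 : s'.nreg 4 = s.nreg 4 := (hs'.nreg 4 (by decide)).trans h42
      rw [Ex.eval_ind, (h2.fill (by decide) hs').eval_isCandidate (q := q) (M := M) ?_ ?_ ?_ ?_,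
        h8, h43]
      · intro x hx
        rw [hs'.A 0 (by decide) (by decide), hf.A 0 (by decide) (by decide)]
        exact hM1 x hx
      · intro j hj
        rw [hs'.RA, hf.RA]
        exact hrad j (by rwa [h43] at hj)
      · intro x hx
        rw [hs'.A 13 (by decide) (by decide), hnn, if_pos (by rw [h1.n]; exact hx)]
      · rw [h8]; exact hi
  intro x hx
  rw [hZ, if_pos (by rw [h2.n]; exact hx), one_le_choose, Data.mem_candidates]

end Ready

/-! ### Enumerating the candidate facilities and the tuples of candidate facilities -/

namespace Data

variable (D : Data)

/-- The `i`-th element of `Z`, and `n` if `Z` has at most `i` elements. -/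
noncomputable def enum (Z : Finset ℕ) (i : ℕ) : ℕ :=
  findLt D.n fun x => x ∈ Z ∧ sumLt (M := ℕ) D.n (fun x' => x' ∈ Z ∧ x' < x) (fun _ => 1) = i

variable {D}

theorem enum_mem {Z : Finset ℕ} {i : ℕ} (h : D.enum Z i < D.n) : D.enum Z i ∈ Z := (findLt_spec h).1

theorem card_below {Z : Finset ℕ} (hZ : ∀ z ∈ Z, z < D.n) (x : ℕ) :
    sumLt (M := ℕ) D.n (fun x' => x' ∈ Z ∧ x' < x) (fun _ => 1) = (Z.filter (· < x)).card := by
  classical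
  rw [sumLt_one]
  congr 1
  ext y
  simp only [Finset.mem_filter, Finset.mem_range]
  exact ⟨fun h => h.2, fun h => ⟨hZ y h.1, h⟩⟩

theorem card_below_lt {Z : Finset ℕ} {x y : ℕ} (hx : x ∈ Z) (h : x < y) :
    (Z.filter (· < x)).card < (Z.filter (· < y)).card := by
  refine Finset.card_lt_card ⟨fun z hz => ?_, fun hsub => ?_⟩
  · simp only [Finset.mem_filter] at hz ⊢; exact ⟨hz.1, hz.2.trans h⟩
  · have := hsub (Finset.mem_filter.mpr ⟨hx, h⟩)
    simp at this

theorem exists_enum {Z : Finset ℕ} (hZ : ∀ z ∈ Z, z < D.n) {z : ℕ} (hz : z ∈ Z) :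
    ∃ i < Z.card, D.enum Z i = z := by
  refine ⟨(Z.filter (· < z)).card, Finset.card_lt_card ⟨Finset.filter_subset _ _, fun h => ?_⟩, ?_⟩
  · have := h hz
    simp at this
  · have hlt : D.enum Z (Z.filter (· < z)).card < D.n :=
      findLt_lt_of (hZ z hz) ⟨hz, card_below hZ z⟩
    have h := findLt_spec hlt
    rw [card_below hZ] at h
    change D.enum Z _ ∈ Z ∧ (Z.filter (· < D.enum Z _)).card = _ at h
    rcases lt_trichotomy (D.enum Z (Z.filter (· < z)).card) z with hl | hl | hl
    · have := card_below_lt h.1 hl; omega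
    · exact hl
    · have := card_below_lt hz hl; omega

/-- The first index past the elements yields the value `n` of an unsuccessful search. It serves as
the blank in tuples, so that sets with fewer than `k` elements are enumerated as well. -/
theorem enum_card {Z : Finset ℕ} (hZ : ∀ z ∈ Z, z < D.n) : D.enum Z Z.card = D.n := by
  refine le_antisymm (findLt_le _ _) (not_lt.mp fun hlt => ?_)
  have h := findLt_spec hlt
  rw [card_below hZ] at h
  have : (Z.filter (· < D.enum Z Z.card)).card < Z.card :=
    Finset.card_lt_card ⟨Finset.filter_subset _ _, fun hs => by
      exact lt_irrefl _ (Finset.mem_filter.mp (hs h.1)).2⟩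
  exact absurd h.2 this.ne

/-- The tuple with number `e` of elements of `Z` and blanks. -/
noncomputable def tuple (D : Data) (Z : Finset ℕ) (e i : ℕ) : ℕ :=
  D.enum Z (e / (Z.card + 1) ^ i % (Z.card + 1))

/-- Tuples correspond to the numbers below (|Z| + 1)^k through their digits in base |Z| + 1. -/
theorem exists_tuple {Z : Finset ℕ} (hZ : ∀ z ∈ Z, z < D.n) {g : ℕ → ℕ}
    (hg : ∀ i < D.k, g i ∈ Z ∨ g i = D.n) :
    ∃ e < (Z.card + 1) ^ D.k, ∀ i < D.k, D.tuple Z e i = g i := by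
  have h1 : ∀ i : Fin D.k, ∃ j : Fin (Z.card + 1), D.enum Z j = g i := by
    intro i
    rcases hg i i.2 with h | h
    · obtain ⟨j, hj, hj'⟩ := exists_enum hZ h
      exact ⟨⟨j, by omega⟩, hj'⟩
    · exact ⟨⟨Z.card, by omega⟩, by rw [h]; exact enum_card hZ⟩
  choose J hJ using h1
  refine ⟨finFunctionFinEquiv J, (finFunctionFinEquiv J).2, fun i hi => ?_⟩
  have h2 := congrArg Fin.val (congrFun (finFunctionFinEquiv.symm_apply_apply J) ⟨i, hi⟩)
  rw [finFunctionFinEquiv_symm_apply_val] at h2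
  rw [tuple, ← hJ ⟨i, hi⟩, ← h2]

end Data

namespace Ex

theorem eval_times {s : State} {ρ : List ℕ} {b : ℕ} {e : Ex .nat} {v : ℕ}
    (h : ∀ j, e.eval s (j :: ρ) = v) : (times b e).eval s ρ = s.nreg b * v := by
  simp only [times, eval, h, sumLt, eval_tt]
  simp

def numCandidates : Ex .nat := count 1 (isIn 2 (bv 0))

def nthCandidate : Ex .nat := find 1 (and (isIn 2 (bv 0))
  (eq (count 1 (and (isIn 2 (bv 0)) (lt (bv 0) (bv 1)))) (reg 8)))

end Ex

namespace Cmd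

/-- Tabulate the candidates, and compute the number of `k`-tuples of candidates and blanks. -/
def enumerate : Cmd := seq (fill 3 5 Ex.nthCandidate)
  (seq (setN 12 (.lit 1)) (loop 9 2 (setN 12 (.times 5 (.reg 12)))))

open Ex in
/-- Write the tuple whose number is in register `r` to array `j`. -/
def decode (j r : ℕ) : Cmd := seq (setN 12 (.reg r)) (loop 13 2
  (seq (setN 14 (.find 6 (lt (.reg 12) (times 5 (.add (.bv 1) (.lit 1))))))
    (seq (storeN j (.reg 13) (.arr 3 (.sub (.reg 12) (times 5 (.reg 14))))) (setN 12 (.reg 14)))))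

end Cmd

theorem Ready.eval_numCandidates {D : Data} {s : State} (h : Ready D s) {Z : Finset ℕ}
    (hlt : ∀ z ∈ Z, z < D.n) (hZ : Rep D 2 Z s) : Ex.numCandidates.eval s [] = Z.card := by
  classical
  rw [Ex.numCandidates, Ex.eval_count, h.n]
  have : sumLt (M := ℕ) D.n (fun j => (Ex.isIn 2 (.bv 0)).eval s [j]) (fun _ => 1) =
      sumLt D.n (fun j => j ∈ Z) (fun _ => 1) := sumLt_congr (fun j hj => hZ j hj) fun _ _ _ => rfl
  rw [this, sumLt_one]
  congr 1
  ext x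
  simp only [Finset.mem_filter, Finset.mem_range]
  exact ⟨fun h => h.2, fun h => ⟨hlt x h, h⟩⟩

theorem Ready.run_enumerate {D : Data} {s : State} (h : Ready D s) {Z : Finset ℕ}
    (hZ : Rep D 2 Z s) :
    (∀ i < s.nreg 5, (Cmd.enumerate.run s).A 3 i = D.enum Z i) ∧
      (Cmd.enumerate.run s).nreg 12 = s.nreg 5 ^ D.k := by
  obtain ⟨hf, hA⟩ := Cmd.run_fill (s := s) (j := 3) (b := 5) (e := Ex.nthCandidate) (by decide)
    (D.enum Z) fun i hi s' hs' h8 => by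
      have h' := h.fill (by decide) hs'
      have hZ' : ∀ x < D.n, (1 ≤ s'.nmem (s'.addr 2 x) ↔ x ∈ Z) := fun x hx => by
        have := hs'.A 2 (by decide) (by decide) x
        rw [State.A] at this
        rw [this]; exact hZ x hx
      rw [Ex.nthCandidate, Ex.eval, h'.n]
      refine findLt_congr fun x hx => ?_
      rw [Ex.eval, Ex.eval_eq, Ex.eval_count, h'.n]
      refine and_congr (hZ' x hx) ?_
      have : sumLt (M := ℕ) D.n (fun j => ((Ex.isIn 2 (.bv 0)).and
          ((Ex.bv 0).lt (.bv 1))).eval s' [j, x]) (fun _ => 1) =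
          sumLt D.n (fun x' => x' ∈ Z ∧ x' < x) (fun _ => 1) :=
        sumLt_congr (fun j hj => by
          rw [Ex.eval, Ex.eval_lt]
          exact and_congr (hZ' j hj) Iff.rfl) fun _ _ _ => rfl
      rw [this, Ex.eval, h8]
  rw [Cmd.enumerate, Cmd.run_seq, Cmd.run_seq]
  set s1 := (Cmd.fill 3 5 Ex.nthCandidate).run s
  constructor
  · intro i hi
    rw [Cmd.run_A (by decide) rfl rfl, Cmd.run_A (by decide) rfl rfl, hA, if_pos hi]
  · have h2 : ((Cmd.setN 12 (.lit 1)).run s1).nreg 2 = D.k := by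
      rw [Cmd.run, State.nreg_setN, if_neg (by decide), hf.nreg 2 (by decide), h.k]
    have h5 : ((Cmd.setN 12 (.lit 1)).run s1).nreg 5 = s.nreg 5 := by
      rw [Cmd.run, State.nreg_setN, if_neg (by decide), hf.nreg 5 (by decide)]
    have h12 : ((Cmd.setN 12 (.lit 1)).run s1).nreg 12 = 1 := by
      rw [Cmd.run, State.nreg_setN, if_pos rfl]; rfl
    set s2 := (Cmd.setN 12 (.lit 1)).run s1
    rw [Cmd.run, h2]
    refine (State.iter_ind (I := fun N s' => s'.nreg 5 = s.nreg 5 ∧ s'.nreg 12 = s.nreg 5 ^ N)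
      ⟨h5, h12⟩ ?_).2
    · intro N _ s' ⟨h5, h12⟩
      rw [Cmd.run, State.nreg_setN, if_neg (by decide), State.nreg_setN, if_neg (by decide),
        State.nreg_setN, if_pos rfl, Ex.eval_times (v := s'.nreg 12), State.nreg_setN,
        if_neg (by decide), h5, h12, pow_succ']
      · exact ⟨rfl, rfl⟩
      · intro j; rw [Ex.eval, State.nreg_setN, if_neg (by decide)]

/-- The candidates `Z` have been enumerated. -/
structure Env (D : Data) (Z : Finset ℕ) (s : State) : Prop where
  ready : Ready D s
  base : s.nreg 5 = Z.card + 1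
  total : s.nreg 6 = (Z.card + 1) ^ D.k
  enum : ∀ i < Z.card + 1, s.A 3 i = D.enum Z i

namespace Env

variable {D : Data} {Z : Finset ℕ} {s : State}

theorem run (h : Env D Z s) {c : Cmd} (hok : c.ok) (h15 : c.wA 15 = false) (h14 : c.wA 14 = false)
    (h3 : c.wA 3 = false) : Env D Z (c.run s) :=
  ⟨h.ready.run hok h15 h14, (Cmd.nreg_of_ok hok s 5 (by decide)).trans h.base,
    (Cmd.nreg_of_ok hok s 6 (by decide)).trans h.total,
    fun i hi => (Cmd.run_A (by decide) hok h3 s i).trans (h.enum i hi)⟩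

theorem setN (h : Env D Z s) {r : ℕ} (hr : 8 ≤ r) (v : ℕ) : Env D Z (s.setN r v) :=
  ⟨h.ready.setN hr v, by rw [State.nreg_setN, if_neg (by omega), h.base],
    by rw [State.nreg_setN, if_neg (by omega), h.total],
    fun i hi => by rw [State.A_setN _ (by omega), h.enum i hi]⟩

theorem fill (h : Env D Z s) {s' : State} {j : ℕ} (hj : j < 14) (hj3 : j ≠ 3)
    (hf : Cmd.FillOf s j s') : Env D Z s' :=
  ⟨h.ready.fill hj hf, (hf.nreg 5 (by decide)).trans h.base,
    (hf.nreg 6 (by decide)).trans h.total,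
    fun i hi => (hf.A 3 (by decide) hj3.symm i).trans (h.enum i hi)⟩

/-- Register `12` holds the remaining quotient after each step, and the next digit is its remainder
modulo the base. -/
theorem run_decode (h : Env D Z s) {j r : ℕ} (hj : j < 14) (hj3 : j ≠ 3)
    (hlt : s.nreg r < (Z.card + 1) ^ D.k) :
    ∀ i < D.k, ((Cmd.decode j r).run s).A j i = D.tuple Z (s.nreg r) i := by
  set B := Z.card + 1 with hB
  set e := s.nreg r with he
  rw [Cmd.decode, Cmd.run_seq]
  set s1 := (Cmd.setN 12 (.reg r)).run s with hs1
  have hs1' : s1 = s.setN 12 e := rfl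
  have h1 : Env D Z s1 := h.setN (by decide) _
  rw [Cmd.run, h1.ready.k]
  refine (State.iter_ind (I := fun N s' => Env D Z s' ∧ s'.nreg 12 = e / B ^ N ∧
    ∀ i < N, s'.A j i = D.tuple Z e i) ⟨h1, ?_, by simp⟩ ?_).2.2
  · rw [hs1', State.nreg_setN, if_pos rfl, pow_zero, Nat.div_one]
  intro N _ s' ⟨i1, i2, i3⟩
  rw [Cmd.run_seq, Cmd.run_seq]
  set s2 := s'.setN 13 N with hs2
  have e2 : Env D Z s2 := i1.setN (by decide) _
  have h12 : s2.nreg 12 = e / B ^ N := by rw [hs2, State.nreg_setN, if_neg (by decide), i2]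
  -- The machine has no division on natural numbers. The quotient is the least `u` such that the
  -- dividend is below B(u + 1), and it is below the search bound because `e` is.
  have hfind : (Ex.find 6 (.lt (.reg 12) (.times 5 (.add (.bv 1) (.lit 1))))).eval s2 [] =
      e / B ^ (N + 1) := by
    rw [Ex.eval, e2.total]
    have hP : ∀ u, (Ex.lt (.reg 12) (.times 5 (.add (.bv 1) (.lit 1)))).eval s2 [u] ↔
        e / B ^ N / B ≤ u := fun u => by
      rw [Ex.eval_lt, Ex.eval_times (v := u + 1) fun _ => rfl, Ex.eval, h12, e2.base, mul_comm,
        ← Nat.div_lt_iff_lt_mul (x := e / B ^ N) (y := u + 1) (k := Z.card + 1) (by omega),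
        Nat.lt_succ_iff]
    rw [pow_succ, ← Nat.div_div_eq_div_mul]
    have hlt' : e / B ^ N / B < B ^ D.k :=
      ((Nat.div_le_self _ _).trans (Nat.div_le_self _ _)).trans_lt hlt
    have hle : findLt (B ^ D.k) (fun u =>
        (Ex.lt (.reg 12) (.times 5 (.add (.bv 1) (.lit 1)))).eval s2 [u]) ≤ e / B ^ N / B :=
      findLt_le_of ((hP _).mpr le_rfl)
    exact le_antisymm hle ((hP _).mp (findLt_spec (hle.trans_lt hlt')))
  have hr1 : (Cmd.setN 14 (.find 6 (.lt (.reg 12) (.times 5 (.add (.bv 1) (.lit 1)))))).run s2 =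
      s2.setN 14 (e / B ^ (N + 1)) := by rw [Cmd.run, hfind]
  rw [hr1]
  set s3 := s2.setN 14 (e / B ^ (N + 1)) with hs3
  have e3 : Env D Z s3 := e2.setN (by decide) _
  have hdig : (Ex.arr 3 (.sub (.reg 12) (.times 5 (.reg 14)))).eval s3 [] = D.tuple Z e N := by
    have h14 : s3.nreg 14 = e / B ^ (N + 1) := by rw [hs3, State.nreg_setN, if_pos rfl]
    have h12' : s3.nreg 12 = e / B ^ N := by
      rw [hs3, State.nreg_setN, if_neg (by decide), h12]
    have : (Ex.sub (.reg 12) (.times 5 (.reg 14))).eval s3 [] = e / B ^ N % B := by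
      rw [Ex.eval, Ex.eval_times (e := .reg 14) (v := e / B ^ (N + 1)) fun _ => h14, Ex.eval, h12', e3.base,
        ← hB, show e / B ^ (N + 1) = e / B ^ N / B by rw [pow_succ, Nat.div_div_eq_div_mul]]
      change e / B ^ N - B * (e / B ^ N / B) = e / B ^ N % B
      have := Nat.div_add_mod (e / B ^ N) B
      omega
    rw [Ex.eval, this]
    exact e3.enum _ (Nat.mod_lt _ (by omega))
  have h13 : (Ex.reg 13).eval s3 [] = N := by
    rw [Ex.eval, hs3, State.nreg_setN, if_neg (by decide), hs2, State.nreg_setN, if_pos rfl]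
  have hr2 : (Cmd.storeN j (.reg 13) (.arr 3 (.sub (.reg 12) (.times 5 (.reg 14))))).run s3 =
      s3.storeN j N (D.tuple Z e N) := by rw [Cmd.run, hdig, h13]
  rw [hr2]
  set s4 := s3.storeN j N (D.tuple Z e N) with hs4
  have hA4 : ∀ j' < 16, ∀ i, s4.A j' i = if j' = j ∧ i = N then D.tuple Z e N else s'.A j' i := by
    intro j' hj' i
    rw [hs4, State.A_storeN _ (by omega) hj', hs3, State.A_setN _ (by decide), hs2,
      State.A_setN _ (by decide)]
  have e4 : Env D Z s4 := by
    refine ⟨e3.ready.mono (fun _ _ => rfl) (fun a ha => ⟨State.low_storeN _ _ _ _ ha, rfl⟩)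
      fun i => ?_, e3.base, e3.total, fun i hi => ?_⟩
    · constructor <;> rw [hs4, State.A_storeN _ (by omega) (by decide), if_neg (by omega)]
    · rw [hA4 3 (by decide), if_neg (by omega), i1.enum i hi]
  rw [Cmd.run]
  refine ⟨e4.setN (by decide) _, ?_, fun i hi => ?_⟩
  · rw [State.nreg_setN, if_pos rfl, Ex.eval, hs4, State.nreg_storeN, hs3, State.nreg_setN,
      if_pos rfl]
  · rw [State.A_setN _ (by decide), hA4 j (by omega)]
    split_ifs with hc
    · rw [hc.2]
    · exact i3 i (by omega)

end Env

/-! ### Assigning the clients one by one -/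

namespace Data

variable {D : Data}

/-- Only the first `k` entries of the path are ever read, which allows an arbitrary path to be
replaced by a tuple. -/
theorem shift_congr (p : ℕ) (ρ : ℕ → ℕ) (c : ℕ) {P P' : ℕ → ℕ} (h : ∀ i < D.k, P i = P' i) :
    D.shift p ρ c P = D.shift p ρ c P' := by
  funext x
  have h1 : D.moveIdx p ρ c P x = D.moveIdx p ρ c P' x := findLt_congr fun i hi =>
    and_congr_right fun hi' => by rw [h i hi, h (i + 1) hi']
  rw [shift, shift, h1, h 0 D.k_pos]
  congr 1
  by_cases hm : D.moveIdx p ρ c P' x < D.k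
  · have : D.moveIdx p ρ c P' x + 1 < D.k := (findLt_spec hm).1
    rw [choose_pos hm, choose_pos hm, h (_ + 1) this]
  · rw [choose_neg hm, choose_neg hm]

theorem shift_lt {p : ℕ} {ρ : ℕ → ℕ} {c : ℕ} {P : ℕ → ℕ} (hρ : ∀ x < D.n, ρ x < D.n)
    (hP : ∀ i < D.k, P i < D.n) {x : ℕ} (hx : x < D.n) : D.shift p ρ c P x < D.n := by
  rw [shift]
  by_cases hc : x = c
  · rw [choose_pos hc]; exact hP 0 D.k_pos
  rw [choose_neg hc]
  by_cases hm : D.moveIdx p ρ c P x < D.k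
  · rw [choose_pos hm]; exact hP _ (findLt_spec hm).1
  · rw [choose_neg hm]; exact hρ x hx

theorem Fits.congr {A S : Finset ℕ} {ρ ρ' : ℕ → ℕ} (h : D.Fits A S ρ) (he : ∀ x ∈ A, ρ x = ρ' x) :
    D.Fits A S ρ' := by
  refine ⟨fun c hc => he c hc ▸ h.assigned c hc, fun f hf => ?_⟩
  rw [← Finset.filter_congr (p := fun c => ρ c = f) fun x hx => by rw [he x hx]]
  exact h.capacity f hf

theorem Fits.mono {A A' S : Finset ℕ} {ρ : ℕ → ℕ} (h : D.Fits A S ρ) (hA : A' ⊆ A) :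
    D.Fits A' S ρ :=
  ⟨fun c hc => h.assigned c (hA hc), fun f hf =>
    (Finset.card_le_card (Finset.filter_subset_filter _ hA)).trans (h.capacity f hf)⟩

theorem costOn_congr {p : ℕ} {A : Finset ℕ} {ρ ρ' : ℕ → ℕ} (he : ∀ x ∈ A, ρ x = ρ' x) :
    D.costOn p A ρ = D.costOn p A ρ' := Finset.sum_congr rfl fun x hx => by rw [he x hx]

theorem Optimal.congr {p : ℕ} {A S : Finset ℕ} {ρ ρ' : ℕ → ℕ} (h : D.Optimal p A S ρ)
    (he : ∀ x ∈ A, ρ x = ρ' x) : D.Optimal p A S ρ' :=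
  ⟨h.fits.congr he, fun σ hσ => costOn_congr (D := D) (p := p) he ▸ h.le σ hσ⟩

end Data

namespace Ex

theorem eval_and (s : State) (ρ : List ℕ) (a b : Ex .bool) :
    (and a b).eval s ρ ↔ a.eval s ρ ∧ b.eval s ρ := Iff.rfl
theorem eval_not (s : State) (ρ : List ℕ) (a : Ex .bool) :
    (not a).eval s ρ ↔ ¬ a.eval s ρ := Iff.rfl
theorem eval_all (s : State) (ρ : List ℕ) (b : ℕ) (a : Ex .bool) :
    (all b a).eval s ρ ↔ ∀ j < s.nreg b, a.eval s (j :: ρ) := Iff.rfl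
theorem eval_rle (s : State) (ρ : List ℕ) (a b : Ex .real) :
    (rle a b).eval s ρ ↔ (a.eval s ρ : ℝ) ≤ b.eval s ρ := Iff.rfl
theorem eval_nle (s : State) (ρ : List ℕ) (a b : Ex .nat) :
    (nle a b).eval s ρ ↔ (a.eval s ρ : ℕ) ≤ b.eval s ρ := Iff.rfl
theorem eval_arr (s : State) (ρ : List ℕ) (j : ℕ) (a : Ex .nat) :
    (arr j a).eval s ρ = s.A j (a.eval s ρ) := rfl

/-- `x` is a client at most as large as the one in register `18`. -/
def arrived (x : Ex .nat) : Ex .bool := and (client x) (nle x (reg 18))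

def movable (x i : Ex .nat) : Ex .bool :=
  and (lt x (reg 18)) (and (client x) (eq (arr 7 x) (arr 8 i)))

def moveCost (p : ℕ) (x i : Ex .nat) : Ex .real :=
  rsub (powr (dist x (arr 8 (add i (lit 1)))) p) (powr (dist x (arr 8 i)) p)

def cheapest (p : ℕ) : Ex .nat := find 1 (and (movable (bv 0) (bv 1))
  (all 1 (imp (movable (bv 0) (bv 2)) (rle (moveCost p (bv 1) (bv 2)) (moveCost p (bv 0) (bv 2))))))

def moveStep (p : ℕ) : Ex .nat := find 2 (and (lt (add (bv 0) (lit 1)) (reg 2))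
  (and (not (eq (arr 8 (bv 0)) (arr 8 (add (bv 0) (lit 1))))) (eq (cheapest p) (reg 8))))

def shifted (p : ℕ) : Ex .nat := cond (eq (reg 8) (reg 18)) (arr 8 (lit 0))
  (cond (lt (moveStep p) (reg 2)) (arr 8 (add (moveStep p) (lit 1))) (arr 7 (reg 8)))

/-- The value of `x` is a point of the set represented by array `6`. -/
def isCenter (x : Ex .nat) : Ex .bool := and (lt x (reg 1)) (isIn 6 x)

def isPath : Ex .bool := all 2 (isCenter (arr 8 (bv 0)))

def fitting : Ex .bool := and (all 1 (imp (arrived (bv 0)) (isCenter (arr 9 (bv 0)))))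
  (all 1 (imp (isIn 6 (bv 0))
    (nle (count 1 (and (arrived (bv 0)) (eq (arr 9 (bv 0)) (bv 1)))) (capa (bv 0)))))

def arrivedCost (p : ℕ) : Ex .real :=
  rsum 1 (arrived (bv 0)) (powr (dist (bv 0) (arr 9 (bv 0))) p)

end Ex

namespace Cmd

-- Array `8` holds the path, array `9` the shifted assignment. Array `10` and real register `2` keep
-- the cheapest fitting one so far and its cost, and register `17` tells whether there is one.
open Ex in
def tryPath (p : ℕ) : Cmd := seq (decode 8 19) (ite isPath
  (seq (fill 9 1 (shifted p)) (ite (.and fitting (.or (.eq (.reg 17) (.lit 0))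
      (.not (.rle (.rreg 2) (arrivedCost p)))))
    (seq (setR 2 (arrivedCost p)) (seq (setN 17 (.lit 1)) (fill 10 1 (.arr 9 (.reg 8))))) skip)) skip)

open Ex in
/-- Extend a cheapest assignment of the clients before the one in register `18` to this client. -/
def extend (p : ℕ) : Cmd := seq (setN 17 (.lit 0)) (seq (loop 19 6 (tryPath p))
  (ite (.nle (.lit 1) (.reg 17)) (fill 7 1 (.arr 10 (.reg 8))) skip))

theorem ok_powr (e : Ex .real) (he : e.ok = true) (p : ℕ) : (Ex.powr e p).ok = true := by
  induction p with
  | zero => rfl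
  | succ p ih => simp only [Ex.powr, Ex.ok, ih, he]; rfl

theorem ok_arrivedCost (p : ℕ) : (Ex.arrivedCost p).ok = true := by
  simp only [Ex.arrivedCost, Ex.ok, ok_powr (Ex.dist (.bv 0) (.arr 9 (.bv 0))) rfl]; rfl

theorem ok_shifted (p : ℕ) : (Ex.shifted p).ok = true := by
  have h1 (i j : ℕ) : (Ex.moveCost p (.bv i) (.bv j)).ok = true := by
    simp only [Ex.moveCost, Ex.ok, ok_powr (Ex.dist (.bv i) (.arr 8 (.bv j))) rfl,
      ok_powr (Ex.dist (.bv i) (.arr 8 (.add (.bv j) (.lit 1)))) rfl]; rfl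
  have h2 : (Ex.cheapest p).ok = true := by
    simp only [Ex.cheapest, Ex.ok, Ex.imp, h1]; rfl
  have h3 : (Ex.moveStep p).ok = true := by
    simp only [Ex.moveStep, Ex.ok, Ex.eq, h2]; rfl
  simp only [Ex.shifted, Ex.ok, Ex.lt, h3]; rfl

theorem ok_tryPath (p : ℕ) : (tryPath p).ok = true := by
  simp only [tryPath, ok, fill, ok_shifted, Ex.or, Ex.ok, ok_arrivedCost]; rfl

theorem ok_extend (p : ℕ) : (extend p).ok = true := by
  simp only [extend, ok, ok_tryPath]; rfl

end Cmd

theorem insert_filter_lt {A : Finset ℕ} {c x : ℕ} (hc : c ∈ A) :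
    x ∈ insert c (A.filter (· < c)) ↔ x ∈ A ∧ x ≤ c := by
  rw [Finset.mem_insert, Finset.mem_filter]
  constructor
  · rintro (rfl | h)
    · exact ⟨hc, le_rfl⟩
    · exact ⟨h.1, h.2.le⟩
  · rintro ⟨h1, h2⟩
    rcases eq_or_lt_of_le h2 with h | h
    · exact Or.inl h
    · exact Or.inr ⟨h1, h⟩

namespace Ready

variable {D : Data} {s : State} {ρ : List ℕ} {p : ℕ} {S : Finset ℕ}

theorem eval_movable (h : Ready D s) {x i : Ex .nat} {a j : ℕ} (hx : x.eval s ρ = a)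
    (hi : i.eval s ρ = j) (ha : a < D.n) :
    (Ex.movable x i).eval s ρ ↔ a < s.nreg 18 ∧ a ∈ D.C ∧ s.A 7 a = s.A 8 j := by
  rw [Ex.movable, Ex.eval_and, Ex.eval_lt, Ex.eval_and, Ex.eval_eq,
    h.eval_client (by rw [hx]; exact ha), Ex.eval_arr, Ex.eval_arr, hx, hi]
  rfl

theorem eval_moveCost (h : Ready D s) {x i : Ex .nat} {a j : ℕ} (hx : x.eval s ρ = a)
    (hi : i.eval s ρ = j) (ha : a < D.n) (h1 : s.A 8 j < D.n) (h2 : s.A 8 (j + 1) < D.n) :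
    (Ex.moveCost p x i).eval s ρ = D.d a (s.A 8 (j + 1)) ^ p - D.d a (s.A 8 j) ^ p := by
  have e1 : (Ex.arr 8 i).eval s ρ = s.A 8 j := by rw [Ex.eval, hi]; rfl
  have e2 : (Ex.arr 8 (.add i (.lit 1))).eval s ρ = s.A 8 (j + 1) := by
    rw [Ex.eval, Ex.eval, hi]; rfl
  rw [Ex.moveCost, Ex.eval, Ex.eval_powr, Ex.eval_powr,
    h.eval_dist (by rw [hx]; exact ha) (by rw [e2]; exact h2),
    h.eval_dist (by rw [hx]; exact ha) (by rw [e1]; exact h1), e1, e2, hx]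

theorem eval_cheapest (h : Ready D s) {i : ℕ} (h1 : s.A 8 i < D.n) (h2 : s.A 8 (i + 1) < D.n) :
    (Ex.cheapest p).eval s (i :: ρ) =
      D.mover p (s.A 7) (s.nreg 18) (s.A 8 i) (s.A 8 (i + 1)) := by
  rw [Ex.cheapest, Ex.eval, h.n]
  refine findLt_congr fun x hx => ?_
  rw [Ex.eval_and, h.eval_movable (ρ := x :: i :: ρ) (x := .bv 0) (i := .bv 1) rfl rfl hx,
    Ex.eval_all, h.n]
  refine and_congr Iff.rfl (forall₂_congr fun x' hx' => ?_)
  rw [Ex.eval_imp, Ex.eval_rle,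
    h.eval_movable (ρ := x' :: x :: i :: ρ) (x := .bv 0) (i := .bv 2) rfl rfl hx',
    h.eval_moveCost (ρ := x' :: x :: i :: ρ) (x := .bv 1) (i := .bv 2) rfl rfl hx h1 h2,
    h.eval_moveCost (ρ := x' :: x :: i :: ρ) (x := .bv 0) (i := .bv 2) rfl rfl hx' h1 h2]
  rfl

theorem eval_moveStep (h : Ready D s) (hP : ∀ i < D.k, s.A 8 i < D.n) :
    (Ex.moveStep p).eval s ρ = D.moveIdx p (s.A 7) (s.nreg 18) (s.A 8) (s.nreg 8) := by
  rw [Ex.moveStep, Ex.eval, h.k]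
  refine findLt_congr fun i hi => ?_
  rw [Ex.eval_and, Ex.eval_lt, Ex.eval_and, Ex.eval_not, Ex.eval_eq, Ex.eval_eq,
    show (Ex.reg 2).eval s (i :: ρ) = D.k from h.k]
  refine and_congr_right fun hi' => and_congr Iff.rfl ?_
  rw [h.eval_cheapest (hP i hi) (hP (i + 1) hi')]
  rfl

theorem eval_shifted (h : Ready D s) (hP : ∀ i < D.k, s.A 8 i < D.n) :
    (Ex.shifted p).eval s ρ = D.shift p (s.A 7) (s.nreg 18) (s.A 8) (s.nreg 8) := by
  have h1 : (Ex.moveStep p).eval s ρ = _ := h.eval_moveStep hP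
  simp only [Ex.shifted, Ex.eval, Ex.eval_eq, Ex.eval_lt, h1, h.k]
  rfl

theorem eval_isCenter (hn : s.nreg 1 = D.n) (hS : Rep D 6 S s) (hSn : ∀ f ∈ S, f < D.n)
    {x : Ex .nat} {a : ℕ} (hx : x.eval s ρ = a) : (Ex.isCenter x).eval s ρ ↔ a ∈ S := by
  rw [Ex.isCenter, Ex.eval_and, Ex.eval_lt, Ex.isIn, Ex.eval_nle, Ex.eval_arr, hx,
    show (Ex.reg 1).eval s ρ = D.n from hn]
  exact ⟨fun h => (hS a h.1).mp h.2, fun h => ⟨hSn a h, (hS a (hSn a h)).mpr h⟩⟩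

theorem eval_arrived (h : Ready D s) {c : ℕ} (h18 : s.nreg 18 = c) (hc : c ∈ D.C) {x : Ex .nat}
    {a : ℕ} (hx : x.eval s ρ = a) (ha : a < D.n) :
    (Ex.arrived x).eval s ρ ↔ a ∈ insert c (D.C.filter (· < c)) := by
  rw [Ex.arrived, Ex.eval_and, Ex.eval_nle, h.eval_client (by rw [hx]; exact ha), hx,
    show (Ex.reg 18).eval s ρ = c from h18, insert_filter_lt hc]

theorem eval_fitting (h : Ready D s) {c : ℕ} (h18 : s.nreg 18 = c) (hc : c ∈ D.C)
    (hS : Rep D 6 S s) (hSn : ∀ f ∈ S, f < D.n) :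
    Ex.fitting.eval s ρ ↔ D.Fits (insert c (D.C.filter (· < c))) S (s.A 9) := by
  classical
  have hAn : ∀ x ∈ insert c (D.C.filter (· < c)), x < D.n := fun x hx =>
    D.C_lt x ((insert_filter_lt hc).mp hx).1
  have h1 : Ex.fitting.eval s ρ ↔
      (∀ x < D.n, x ∈ insert c (D.C.filter (· < c)) → s.A 9 x ∈ S) ∧ ∀ f < D.n, f ∈ S →
        ((insert c (D.C.filter (· < c))).filter fun x => s.A 9 x = f).card ≤ D.cap f := by
    rw [Ex.fitting, Ex.eval_and, Ex.eval_all, Ex.eval_all, h.n]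
    refine and_congr (forall₂_congr fun x hx => ?_) (forall₂_congr fun f hf => ?_)
    · rw [Ex.eval_imp, h.eval_arrived (ρ := x :: ρ) (x := .bv 0) h18 hc rfl hx,
        eval_isCenter h.n hS hSn rfl]
      rfl
    · rw [Ex.eval_imp, Ex.eval_nle,
        h.eval_capa (ρ := f :: ρ) (x := .bv 0) hf,
        Ex.eval_count, h.n]
      refine imp_congr (hS f hf) ?_
      have : sumLt (M := ℕ) D.n (fun j => ((Ex.arrived (.bv 0)).and
          (.eq (.arr 9 (.bv 0)) (.bv 1))).eval s (j :: f :: ρ)) (fun _ => 1) =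
          sumLt D.n (fun j => j ∈ insert c (D.C.filter (· < c)) ∧ s.A 9 j = f) (fun _ => 1) :=
        sumLt_congr (fun j hj => by
          rw [Ex.eval_and, h.eval_arrived (ρ := j :: f :: ρ) (x := .bv 0) h18 hc rfl hj, Ex.eval_eq]
          rfl) fun _ _ _ => rfl
      have h2 : sumLt D.n (fun j => j ∈ insert c (D.C.filter (· < c)) ∧ s.A 9 j = f) (fun _ => 1) =
          ((insert c (D.C.filter (· < c))).filter fun x => s.A 9 x = f).card := by
        rw [sumLt_one]
        congr 1
        ext x
        simp only [Finset.mem_filter, Finset.mem_range]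
        exact ⟨fun h => h.2, fun h => ⟨hAn x h.1, h⟩⟩
      rw [this, h2]
      rfl
  rw [h1]
  exact ⟨fun h => ⟨fun x hx => h.1 x (hAn x hx) hx, fun f hf => h.2 f (hSn f hf) hf⟩,
    fun h => ⟨fun x _ hx => h.assigned x hx, fun f _ hf => h.capacity f hf⟩⟩

theorem eval_arrivedCost (h : Ready D s) {c : ℕ} (h18 : s.nreg 18 = c) (hc : c ∈ D.C)
    (h9 : ∀ x < D.n, s.A 9 x < D.n) : (Ex.arrivedCost p).eval s ρ =
      D.costOn p (insert c (D.C.filter (· < c))) (s.A 9) := by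
  classical
  rw [Ex.arrivedCost, Ex.eval, h.n]
  have : sumLt (M := ℝ) D.n (fun j => (Ex.arrived (.bv 0)).eval s (j :: ρ)) (fun j =>
      (Ex.powr (Ex.dist (.bv 0) (.arr 9 (.bv 0))) p).eval s (j :: ρ)) =
      sumLt D.n (fun j => j ∈ insert c (D.C.filter (· < c))) fun j => D.d j (s.A 9 j) ^ p := by
    refine sumLt_congr (fun j hj =>
      h.eval_arrived (ρ := j :: ρ) (x := .bv 0) h18 hc rfl hj) fun j hj _ => ?_
    rw [Ex.eval_powr, h.eval_dist]
    · rfl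
    · exact hj
    · exact h9 j hj
  rw [this, sumLt_eq, Data.costOn]
  refine Finset.sum_congr ?_ fun _ _ => rfl
  ext x
  simp only [Finset.mem_filter, Finset.mem_range]
  exact ⟨fun h => h.2, fun h => ⟨D.C_lt x ((insert_filter_lt hc).mp h).1, h⟩⟩

end Ready

/-- The invariant of the search for a shift of `ρ` that assigns the client `c` as well: the paths
with numbers below `N` have been tried. -/
structure Trying (D : Data) (Z S : Finset ℕ) (ρ : ℕ → ℕ) (c p N : ℕ) (s : State) : Prop where
  env : Env D Z s
  centers : Rep D 6 S s
  client : s.nreg 18 = c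
  old : ∀ i, s.A 7 i = ρ i
  got : s.nreg 17 ≠ 0 → D.Fits (insert c (D.C.filter (· < c))) S (s.A 10) ∧
    (∀ x < D.n, s.A 10 x < D.n) ∧
    s.rreg 2 = D.costOn p (insert c (D.C.filter (· < c))) (s.A 10)
  le : ∀ e < N, (∀ i < D.k, D.tuple Z e i ∈ S) →
    D.Fits (insert c (D.C.filter (· < c))) S (D.shift p ρ c (D.tuple Z e)) → s.nreg 17 ≠ 0 ∧
      s.rreg 2 ≤ D.costOn p (insert c (D.C.filter (· < c))) (D.shift p ρ c (D.tuple Z e))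

namespace Trying

variable {D : Data} {Z S : Finset ℕ} {ρ : ℕ → ℕ} {c p N : ℕ} {s : State}

theorem setN (h : Trying D Z S ρ c p N s) {r : ℕ} (hr : 8 ≤ r) (h17 : r ≠ 17) (h18 : r ≠ 18)
    (v : ℕ) : Trying D Z S ρ c p N (s.setN r v) := by
  have hA : ∀ j i, (s.setN r v).A j i = s.A j i := fun j i => State.A_setN _ (by omega) _ _ _
  have e17 : (s.setN r v).nreg 17 = s.nreg 17 := by rw [State.nreg_setN, if_neg h17.symm]
  have e10 : (s.setN r v).A 10 = s.A 10 := funext (hA 10)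
  refine ⟨h.env.setN hr v, fun x hx => by rw [hA]; exact h.centers x hx, ?_,
    fun i => by rw [hA]; exact h.old i, ?_, ?_⟩
  · rw [State.nreg_setN, if_neg h18.symm]; exact h.client
  · rw [e17, e10]; exact h.got
  · rw [e17]; exact h.le

theorem run (h : Trying D Z S ρ c p N s) {cmd : Cmd} (hok : cmd.ok) (h15 : cmd.wA 15 = false)
    (h14 : cmd.wA 14 = false) (h3 : cmd.wA 3 = false) (h6 : cmd.wA 6 = false)
    (h7 : cmd.wA 7 = false) (h10 : cmd.wA 10 = false) (h17 : cmd.wN 17 = false)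
    (h18 : cmd.wN 18 = false) (h2 : cmd.wR 2 = false) : Trying D Z S ρ c p N (cmd.run s) := by
  have e10 : (cmd.run s).A 10 = s.A 10 := funext (Cmd.run_A (by decide) hok h10 s)
  refine ⟨h.env.run hok h15 h14 h3, fun x hx => ?_, ?_, fun i => ?_, ?_, ?_⟩
  · rw [Cmd.run_A (by decide) hok h6]; exact h.centers x hx
  · rw [Cmd.run_nreg h18]; exact h.client
  · rw [Cmd.run_A (by decide) hok h7]; exact h.old i
  · rw [e10, Cmd.run_nreg h17, Cmd.run_rreg h2]; exact h.got
  · rw [Cmd.run_nreg h17, Cmd.run_rreg h2]; exact h.le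

theorem succ (h : Trying D Z S ρ c p N s) (hle : (∀ i < D.k, D.tuple Z N i ∈ S) →
    D.Fits (insert c (D.C.filter (· < c))) S (D.shift p ρ c (D.tuple Z N)) → s.nreg 17 ≠ 0 ∧
      s.rreg 2 ≤ D.costOn p (insert c (D.C.filter (· < c))) (D.shift p ρ c (D.tuple Z N))) :
    Trying D Z S ρ c p (N + 1) s :=
  { h with
    le := fun e he => by
      rcases Nat.lt_succ_iff_lt_or_eq.mp he with he | rfl
      · exact h.le e he
      · exact hle }

/-- Paths that leave the set of centers are skipped, which also guarantees that distances are
evaluated only at valid points. A fitting shift replaces the stored one if there is none or it is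
cheaper. -/
theorem run_tryPath (h : Trying D Z S ρ c p N s) (hc : c ∈ D.C) (hSn : ∀ f ∈ S, f < D.n)
    (hρ : ∀ x < D.n, ρ x < D.n) (hN : N < (Z.card + 1) ^ D.k) :
    Trying D Z S ρ c p (N + 1) ((Cmd.tryPath p).run (s.setN 19 N)) := by
  have hAn : ∀ x ∈ insert c (D.C.filter (· < c)), x < D.n := fun x hx =>
    D.C_lt x ((insert_filter_lt hc).mp hx).1
  rw [Cmd.tryPath, Cmd.run_seq]
  have h1 : Trying D Z S ρ c p N (s.setN 19 N) := h.setN (by decide) (by decide) (by decide) N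
  have hdec := h1.env.run_decode (j := 8) (r := 19) (by decide) (by decide)
    (by rw [State.nreg_setN, if_pos rfl]; exact hN)
  rw [State.nreg_setN, if_pos rfl] at hdec
  have h2 : Trying D Z S ρ c p N ((Cmd.decode 8 19).run (s.setN 19 N)) :=
    h1.run rfl rfl rfl rfl rfl rfl rfl rfl rfl rfl
  set s2 := (Cmd.decode 8 19).run (s.setN 19 N)
  have hpath : Ex.isPath.eval s2 [] ↔ ∀ i < D.k, D.tuple Z N i ∈ S := by
    rw [Ex.isPath, Ex.eval_all, h2.env.ready.k]
    refine forall₂_congr fun i hi => ?_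
    rw [Ready.eval_isCenter h2.env.ready.n h2.centers hSn rfl, Ex.eval_arr]
    exact (hdec i hi) ▸ Iff.rfl
  rw [Cmd.run]
  split_ifs with hp
  swap
  · exact h2.succ fun hp' => absurd (hpath.mpr hp') hp
  have hPS := hpath.mp hp
  set σ := D.shift p ρ c (D.tuple Z N) with hσ
  have hP2 : ∀ i < D.k, s2.A 8 i < D.n := fun i hi => by rw [hdec i hi]; exact hSn _ (hPS i hi)
  obtain ⟨-, h9⟩ := Cmd.run_fill (s := s2) (j := 9) (b := 1) (e := Ex.shifted p) (by decide) σ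
    fun i _ s' hs' h8 => by
      have e8 : s'.A 8 = s2.A 8 := funext (hs'.A 8 (by decide) (by decide))
      have e7 : s'.A 7 = ρ := funext fun i => by
        rw [hs'.A 7 (by decide) (by decide)]; exact h2.old i
      rw [(h2.env.fill (by decide) (by decide) hs').ready.eval_shifted (by rw [e8]; exact hP2),
        e8, e7, h8, hs'.nreg 18 (by decide), h2.client, hσ, Data.shift_congr p ρ c hdec]
  rw [h2.env.ready.n] at h9
  rw [Cmd.run_seq]
  have h3 : Trying D Z S ρ c p N ((Cmd.fill 9 1 (Ex.shifted p)).run s2) :=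
    h2.run (by simp only [Cmd.fill, Cmd.ok, Cmd.ok_shifted]; rfl) rfl rfl rfl rfl rfl rfl rfl rfl rfl
  set s3 := (Cmd.fill 9 1 (Ex.shifted p)).run s2
  have h9' : ∀ x < D.n, s3.A 9 x = σ x := fun x hx => by rw [h9, if_pos hx]
  have hσn : ∀ x < D.n, σ x < D.n := fun x hx => Data.shift_lt hρ
    (fun i hi => hSn _ (hPS i hi)) hx
  have hfit : Ex.fitting.eval s3 [] ↔ D.Fits (insert c (D.C.filter (· < c))) S σ := by
    rw [h3.env.ready.eval_fitting h3.client hc h3.centers hSn]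
    exact ⟨fun h => h.congr fun x hx => h9' x (hAn x hx),
      fun h => h.congr fun x hx => (h9' x (hAn x hx)).symm⟩
  have hcost : (Ex.arrivedCost p).eval s3 [] = D.costOn p (insert c (D.C.filter (· < c))) σ := by
    rw [h3.env.ready.eval_arrivedCost h3.client hc fun x hx => by rw [h9' x hx]; exact hσn x hx]
    exact Data.costOn_congr fun x hx => h9' x (hAn x hx)
  rw [Cmd.run]
  split_ifs with ht
  swap
  · refine h3.succ fun _ hf => ?_
    rw [Ex.eval_and, Ex.eval_or, Ex.eval_eq, Ex.eval_not, Ex.eval_rle, hcost] at ht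
    push Not at ht
    exact ht (hfit.mpr hf)
  rw [Ex.eval_and, hfit] at ht
  have hr : (Cmd.seq (.setR 2 (Ex.arrivedCost p)) (.seq (.setN 17 (.lit 1))
      (.fill 10 1 (.arr 9 (.reg 8))))).run s3 = (Cmd.fill 10 1 (.arr 9 (.reg 8))).run
      ((s3.setR 2 (D.costOn p (insert c (D.C.filter (· < c))) σ)).setN 17 1) := by
    rw [Cmd.run_seq, Cmd.run_seq, Cmd.run, Cmd.run, hcost]; rfl
  rw [hr]
  set s4 := (s3.setR 2 (D.costOn p (insert c (D.C.filter (· < c))) σ)).setN 17 1 with hs4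
  have hA4 : ∀ j i, s4.A j i = s3.A j i := fun j i => State.A_setN _ (by decide) _ _ _
  have e4 : Env D Z s4 := (Env.setN (s := s3.setR 2 _) ⟨h3.env.ready.setR _ _, h3.env.base,
    h3.env.total, h3.env.enum⟩ (by decide) _)
  obtain ⟨hf, h10⟩ := Cmd.run_fill (s := s4) (j := 10) (b := 1) (e := .arr 9 (.reg 8)) (by decide) σ
    fun i hi s' hs' h8 => by
      rw [e4.ready.n] at hi
      rw [Ex.eval_arr, hs'.A 9 (by decide) (by decide), hA4, Ex.eval, h8, h9' i hi]
  rw [e4.ready.n] at h10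
  set s5 := (Cmd.fill 10 1 (.arr 9 (.reg 8))).run s4
  have h10' : ∀ x < D.n, σ x = s5.A 10 x := fun x hx => by rw [h10, if_pos hx]
  have e17 : s5.nreg 17 = 1 := by rw [hf.nreg 17 (by decide), hs4, State.nreg_setN, if_pos rfl]
  have e2 : s5.rreg 2 = D.costOn p (insert c (D.C.filter (· < c))) σ := by
    rw [hf.rreg, hs4, State.rreg_setN, State.rreg_setR, if_pos rfl]
  refine ⟨e4.fill (by decide) (by decide) hf, ?_, ?_, ?_, ?_, ?_⟩
  · intro x hx
    rw [hf.A 6 (by decide) (by decide), hA4]; exact h3.centers x hx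
  · rw [hf.nreg 18 (by decide), hs4, State.nreg_setN, if_neg (by decide)]; exact h3.client
  · intro i
    rw [hf.A 7 (by decide) (by decide), hA4]; exact h3.old i
  · intro _
    refine ⟨ht.1.congr fun x hx => h10' x (hAn x hx), fun x hx => ?_, ?_⟩
    · rw [← h10' x hx]; exact hσn x hx
    · rw [e2]; exact Data.costOn_congr fun x hx => h10' x (hAn x hx)
  · rw [e17, e2]
    intro e he hPS' hfit'
    refine ⟨one_ne_zero, ?_⟩
    rcases Nat.lt_succ_iff_lt_or_eq.mp he with he | rfl
    · obtain ⟨h17, hle⟩ := h3.le e he hPS' hfit'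
      refine le_trans ?_ hle
      rcases (Ex.eval_or _ _ _ _).mp ht.2 with h0 | h0
      · exact absurd ((Ex.eval_eq _ _ _ _).mp h0) h17
      · rw [Ex.eval_not, Ex.eval_rle, hcost] at h0
        exact (not_le.mp h0).le
    · exact le_rfl

end Trying

/-- The invariant of the assignment of the clients: the clients below `N` have been assigned to the
centers in `S`, if possible. -/
structure Assigned (D : Data) (Z S : Finset ℕ) (p N : ℕ) (s : State) : Prop where
  env : Env D Z s
  centers : Rep D 6 S s
  pos : s.nreg 17 ≠ 0 → D.Fair S ∧ D.Optimal p (D.C.filter (· < N)) S (s.A 7) ∧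
    ∀ x < D.n, s.A 7 x < D.n
  zero : s.nreg 17 = 0 → D.Fair S → ∀ σ, ¬ D.Fits (D.C.filter (· < N)) S σ

theorem filter_lt_succ {A : Finset ℕ} {c : ℕ} (hc : c ∈ A) :
    A.filter (· < c + 1) = insert c (A.filter (· < c)) := by
  ext x
  rw [insert_filter_lt hc, Finset.mem_filter, Nat.lt_succ_iff]

/-- By `exists_shift`, the cheapest shift along any path is a cheapest assignment including `c`; if
no shift fits, then no assignment does. -/
theorem Assigned.run_extend {D : Data} {Z S : Finset ℕ} {p c : ℕ} {s : State}
    (h : Assigned D Z S p c s) (h18 : s.nreg 18 = c) (hc : c ∈ D.C) (hSZ : S ⊆ Z)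
    (hZn : ∀ z ∈ Z, z < D.n) (hSk : S.card ≤ D.k) (h17 : s.nreg 17 ≠ 0) :
    Assigned D Z S p (c + 1) ((Cmd.extend p).run s) := by
  classical
  obtain ⟨hfair, hopt, hρ⟩ := h.pos h17
  have hSn : ∀ f ∈ S, f < D.n := fun f hf => hZn f (hSZ hf)
  have hAn : ∀ x ∈ insert c (D.C.filter (· < c)), x < D.n := fun x hx =>
    D.C_lt x ((insert_filter_lt hc).mp hx).1
  rw [Cmd.extend, Cmd.run_seq, Cmd.run_seq]
  set s1 := (Cmd.setN 17 (.lit 0)).run s with hs1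
  have hs1' : s1 = s.setN 17 0 := rfl
  have e1 : Env D Z s1 := h.env.setN (by decide) _
  have h1 : Trying D Z S (s.A 7) c p 0 s1 := by
    refine ⟨e1, fun x hx => ?_, ?_, fun i => State.A_setN _ (by decide) _ _ _, fun h0 => ?_, by simp⟩
    · rw [hs1', State.A_setN _ (by decide)]; exact h.centers x hx
    · rw [hs1', State.nreg_setN, if_neg (by decide), h18]
    · rw [hs1', State.nreg_setN, if_pos rfl] at h0; exact absurd rfl h0
  have h2 : Trying D Z S (s.A 7) c p ((Z.card + 1) ^ D.k) ((Cmd.loop 19 6 (Cmd.tryPath p)).run s1) := by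
    rw [Cmd.run, e1.total]
    exact State.iter_ind (I := fun N s' => Trying D Z S (s.A 7) c p N s') h1 fun j hj s' hs' =>
      hs'.run_tryPath hc hSn hρ hj
  set s2 := (Cmd.loop 19 6 (Cmd.tryPath p)).run s1
  -- The path given by `exists_shift` has all its facilities in S ⊆ Z, hence is one of the tuples
  -- that have been tried.
  have hbest : ∀ σ, D.Fits (insert c (D.C.filter (· < c))) S σ → s2.nreg 17 ≠ 0 ∧
      s2.rreg 2 ≤ D.costOn p (insert c (D.C.filter (· < c))) σ := by
    intro σ hσ
    obtain ⟨P, hP, hfit, hle⟩ := Data.exists_shift hSk hopt hσ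
    obtain ⟨e, he, hPe⟩ := Data.exists_tuple (g := P) hZn fun i _ => Or.inl (hSZ (hP i))
    rw [← Data.shift_congr p (s.A 7) c hPe] at hfit hle
    obtain ⟨h3, h4⟩ := h2.le e he (fun i hi => by rw [hPe i hi]; exact hP i) hfit
    exact ⟨h3, h4.trans hle⟩
  rw [Cmd.run]
  split_ifs with ht
  · rw [Ex.eval_nle] at ht
    have h17' : s2.nreg 17 ≠ 0 := Nat.one_le_iff_ne_zero.mp ht
    obtain ⟨hfit, hlt, hcost⟩ := h2.got h17'
    obtain ⟨hf, h7⟩ := Cmd.run_fill (s := s2) (j := 7) (b := 1) (e := .arr 10 (.reg 8)) (by decide)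
      (s2.A 10) fun i hi s' hs' h8 => by
        rw [Ex.eval_arr, hs'.A 10 (by decide) (by decide), Ex.eval, h8]
    rw [h2.env.ready.n] at h7
    set s3 := (Cmd.fill 7 1 (.arr 10 (.reg 8))).run s2
    have h7' : ∀ x < D.n, s2.A 10 x = s3.A 7 x := fun x hx => by rw [h7, if_pos hx]
    refine ⟨h2.env.fill (by decide) (by decide) hf, fun x hx => ?_, fun _ => ⟨hfair, ?_, ?_⟩,
      fun h0 => ?_⟩
    · rw [hf.A 6 (by decide) (by decide)]; exact h2.centers x hx
    · rw [filter_lt_succ hc]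
      refine Data.Optimal.congr ⟨hfit, fun σ hσ => ?_⟩ fun x hx => h7' x (hAn x hx)
      rw [← hcost]; exact (hbest σ hσ).2
    · intro x hx; rw [← h7' x hx]; exact hlt x hx
    · rw [hf.nreg 17 (by decide)] at h0
      exact absurd h0 h17'
  · rw [Ex.eval_nle] at ht
    have h17' : s2.nreg 17 = 0 := Nat.lt_one_iff.mp (not_le.mp ht)
    refine ⟨h2.env, h2.centers, fun h0 => absurd h17' h0, fun _ _ σ hσ => ?_⟩
    rw [filter_lt_succ hc] at hσ
    exact (hbest σ hσ).1 h17'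

/-! ### Trying all sets of candidates -/

namespace Ex

def inGroup : Ex .nat := count 1 (and (isIn 6 (bv 0)) (group (bv 1) (bv 0)))

def isFair : Ex .bool :=
  all 3 (and (nle (low (bv 0)) inGroup) (nle inGroup (upp (bv 0))))

def totalCost (p : ℕ) : Ex .real :=
  rsum 1 (client (bv 0)) (powr (dist (bv 0) (arr 7 (bv 0))) p)

end Ex

namespace Cmd

-- Register `17` is one as long as the centers are fair and all clients so far could be assigned;
-- after a failure the remaining clients are skipped. Array `7` starts with zeros so that it always
-- contains valid points.
open Ex in
def assign (p : ℕ) : Cmd := seq (setN 17 (ind isFair)) (seq (fill 7 1 (.lit 0))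
  (loop 18 1 (ite (.and (.nle (.lit 1) (.reg 17)) (client (.reg 18))) (extend p) skip)))

open Ex in
def keep (p : ℕ) : Cmd := seq (setR 3 (totalCost p)) (seq (setN 20 (.lit 1))
  (seq (fill 11 1 (.arr 6 (.reg 8))) (fill 12 1 (.arr 7 (.reg 8)))))

open Ex in
def guess (p : ℕ) : Cmd := seq (decode 5 16)
  (seq (fill 6 1 (ind (ex 2 (.eq (.arr 5 (.bv 0)) (.reg 8))))) (seq (assign p)
    (ite (.and (.nle (.lit 1) (.reg 17)) (.or (.eq (.reg 20) (.lit 0))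
      (.not (.rle (.rreg 3) (totalCost p))))) (keep p) skip)))

def search (p : ℕ) : Cmd := seq (setN 20 (.lit 0)) (loop 16 6 (guess p))

theorem ok_totalCost (p : ℕ) : (Ex.totalCost p).ok = true := by
  simp only [Ex.totalCost, Ex.ok, ok_powr (Ex.dist (.bv 0) (.arr 7 (.bv 0))) rfl]; rfl

theorem ok_assign (p : ℕ) : (assign p).ok = true := by
  simp only [assign, ok, ok_extend]; rfl

theorem ok_guess (p : ℕ) : (guess p).ok = true := by
  simp only [guess, keep, ok, ok_assign, Ex.or, Ex.ok, ok_totalCost]; rfl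

theorem ok_search (p : ℕ) : (search p).ok = true := by
  simp only [search, ok, ok_guess]; rfl

end Cmd

namespace Data

variable (D : Data)

open Classical in
/-- The points in the tuple with number `e`. -/
noncomputable def centers (Z : Finset ℕ) (e : ℕ) : Finset ℕ :=
  (Finset.range D.n).filter fun x => ∃ i < D.k, D.tuple Z e i = x

variable {D}

theorem mem_centers {Z : Finset ℕ} {e x : ℕ} :
    x ∈ D.centers Z e ↔ x < D.n ∧ ∃ i < D.k, D.tuple Z e i = x := by
  simp [centers]

theorem centers_subset (Z : Finset ℕ) (e : ℕ) : D.centers Z e ⊆ Z := fun x hx => by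
  obtain ⟨h1, i, -, rfl⟩ := mem_centers.mp hx
  exact enum_mem h1

theorem card_centers_le (Z : Finset ℕ) (e : ℕ) : (D.centers Z e).card ≤ D.k := by
  classical
  have : D.centers Z e ⊆ (Finset.range D.k).image (D.tuple Z e) := fun x hx => by
    obtain ⟨-, i, hi, rfl⟩ := mem_centers.mp hx
    exact Finset.mem_image_of_mem _ (Finset.mem_range.mpr hi)
  exact (Finset.card_le_card this).trans (Finset.card_image_le.trans (by simp))

theorem exists_centers {Z S : Finset ℕ} (hZ : ∀ z ∈ Z, z < D.n) (hS : S ⊆ Z) (hk : S.card ≤ D.k) :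
    ∃ e < (Z.card + 1) ^ D.k, D.centers Z e = S := by
  have hSn : ∀ z ∈ S, z < D.n := fun z hz => hZ z (hS hz)
  have hg : ∀ i, D.enum S i ∈ S ∨ D.enum S i = D.n := fun i =>
    (lt_or_eq_of_le (findLt_le _ _ : D.enum S i ≤ D.n)).imp_left enum_mem
  obtain ⟨e, he, het⟩ := exists_tuple (g := D.enum S) hZ fun i _ => (hg i).imp_left fun h => hS h
  refine ⟨e, he, ?_⟩
  ext x
  rw [mem_centers]
  constructor
  · rintro ⟨hx, i, hi, rfl⟩
    rw [het i hi] at hx ⊢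
    exact enum_mem hx
  · intro hx
    obtain ⟨i, hi, hix⟩ := exists_enum hSn hx
    exact ⟨hSn x hx, i, hi.trans_le hk, by rw [het i (hi.trans_le hk), hix]⟩

theorem filter_lt_n : D.C.filter (· < D.n) = D.C :=
  Finset.filter_true_of_mem fun x hx => D.C_lt x hx

end Data

theorem Ready.eval_isFair {D : Data} {s : State} {S : Finset ℕ} (h : Ready D s)
    (hS : Rep D 6 S s) (hSn : ∀ f ∈ S, f < D.n) : Ex.isFair.eval s [] ↔ D.Fair S := by
  classical
  rw [Ex.isFair, Ex.eval_all, h.t]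
  refine forall₂_congr fun i hi => ?_
  have hcard : Ex.inGroup.eval s [i] = (S ∩ D.G i).card := by
    rw [Ex.inGroup, Ex.eval_count, h.n]
    have : sumLt (M := ℕ) D.n (fun j => ((Ex.isIn 6 (.bv 0)).and
        (.group (.bv 1) (.bv 0))).eval s [j, i]) (fun _ => 1) =
        sumLt D.n (fun j => j ∈ S ∩ D.G i) (fun _ => 1) :=
      sumLt_congr (fun j hj => by
        rw [Ex.eval_and, h.eval_group (ρ := [j, i]) (i := .bv 1) (x := .bv 0) hi hj,
          Finset.mem_inter]
        exact and_congr (hS j hj) Iff.rfl) fun _ _ _ => rfl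
    rw [this, sumLt_one]
    congr 1
    ext x
    simp only [Finset.mem_filter, Finset.mem_range]
    exact ⟨fun h => h.2, fun h => ⟨hSn x (Finset.mem_inter.mp h).1, h⟩⟩
  rw [Ex.eval_and, Ex.eval_nle, Ex.eval_nle, hcard, h.eval_low (ρ := [i]) (i := .bv 0) hi,
    h.eval_upp (ρ := [i]) (i := .bv 0) hi]
  rfl

theorem Ready.eval_totalCost {D : Data} {s : State} {p : ℕ} (h : Ready D s)
    (h7 : ∀ x < D.n, s.A 7 x < D.n) : (Ex.totalCost p).eval s [] = D.costOn p D.C (s.A 7) := by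
  classical
  rw [Ex.totalCost, Ex.eval, h.n]
  have : sumLt (M := ℝ) D.n (fun j => (Ex.client (.bv 0)).eval s [j]) (fun j =>
      (Ex.powr (Ex.dist (.bv 0) (.arr 7 (.bv 0))) p).eval s [j]) =
      sumLt D.n (fun j => j ∈ D.C) fun j => D.d j (s.A 7 j) ^ p := by
    refine sumLt_congr (fun j hj => h.eval_client (ρ := [j]) (x := .bv 0) hj) fun j hj _ => ?_
    rw [Ex.eval_powr, h.eval_dist]
    · rfl
    · exact hj
    · exact h7 j hj
  rw [this, sumLt_eq, Data.costOn]
  refine Finset.sum_congr ?_ fun _ _ => rfl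
  ext x
  simp only [Finset.mem_filter, Finset.mem_range]
  exact ⟨fun h => h.2, fun h => ⟨D.C_lt x h, h⟩⟩

/-- The empty assignment is optimal for no clients; from there on each client is handled by
`run_extend`. -/
theorem Env.run_assign {D : Data} {Z S : Finset ℕ} {p : ℕ} {s : State} (h : Env D Z s)
    (hS : Rep D 6 S s) (hSZ : S ⊆ Z) (hZn : ∀ z ∈ Z, z < D.n) (hSk : S.card ≤ D.k) :
    Assigned D Z S p D.n ((Cmd.assign p).run s) := by
  have hSn : ∀ f ∈ S, f < D.n := fun f hf => hZn f (hSZ hf)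
  rw [Cmd.assign, Cmd.run_seq, Cmd.run_seq]
  have hs1 : (Cmd.setN 17 (.ind .isFair)).run s = s.setN 17 (choose (D.Fair S) 1 0) := by
    rw [Cmd.run, Ex.eval_ind, h.ready.eval_isFair hS hSn]
  rw [hs1]
  set s1 := s.setN 17 (choose (D.Fair S) 1 0) with hs1'
  have e1 : Env D Z s1 := h.setN (by decide) _
  obtain ⟨hf, h7⟩ := Cmd.run_fill (s := s1) (j := 7) (b := 1) (e := .lit 0) (by decide)
    (fun _ => 0) fun i _ s' _ _ => rfl
  rw [e1.ready.n] at h7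
  set s2 := (Cmd.fill 7 1 (.lit 0)).run s1
  have e2 : Env D Z s2 := e1.fill (by decide) (by decide) hf
  have h17 : s2.nreg 17 = choose (D.Fair S) 1 0 := by
    rw [hf.nreg 17 (by decide), hs1', State.nreg_setN, if_pos rfl]
  have h2 : Assigned D Z S p 0 s2 := by
    refine ⟨e2, fun x hx => ?_, fun h0 => ?_, fun h0 hfair => ?_⟩
    · rw [hf.A 6 (by decide) (by decide), State.A_setN _ (by decide)]; exact hS x hx
    · have hfair : D.Fair S := one_le_choose.mp (by rw [← h17]; omega)
      refine ⟨hfair, ⟨⟨by simp, by simp⟩, fun σ _ => by simp [Data.costOn]⟩, fun x hx => ?_⟩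
      rw [h7, if_pos hx]
      exact Nat.zero_lt_of_lt hx
    · rw [h17, choose_pos hfair] at h0
      exact absurd h0 one_ne_zero
  rw [Cmd.run, e2.ready.n]
  refine State.iter_ind (I := fun N s' => Assigned D Z S p N s') h2 fun c hc s' hs' => ?_
  have h' : Assigned D Z S p c (s'.setN 18 c) := by
    have e7 : (s'.setN 18 c).A 7 = s'.A 7 := funext fun i => State.A_setN _ (by decide) _ _ _
    have e17 : (s'.setN 18 c).nreg 17 = s'.nreg 17 := by rw [State.nreg_setN, if_neg (by decide)]
    refine ⟨hs'.env.setN (by decide) _, fun x hx => ?_, ?_, ?_⟩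
    · rw [State.A_setN _ (by decide)]; exact hs'.centers x hx
    · rw [e7, e17]; exact hs'.pos
    · rw [e17]; exact hs'.zero
  have h18 : (s'.setN 18 c).nreg 18 = c := by rw [State.nreg_setN, if_pos rfl]
  set s3 := s'.setN 18 c
  rw [Cmd.run]
  have ht : (Ex.and (.nle (.lit 1) (.reg 17)) (.client (.reg 18))).eval s3 [] ↔
      s3.nreg 17 ≠ 0 ∧ c ∈ D.C := by
    rw [Ex.eval_and, Ex.eval_nle, h'.env.ready.eval_client (ρ := []) (x := .reg 18)
      (by rw [Ex.eval, h18]; exact hc), show (Ex.reg 18).eval s3 [] = c from h18]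
    exact and_congr Nat.one_le_iff_ne_zero Iff.rfl
  split_ifs with hif
  · obtain ⟨h17', hcC⟩ := ht.mp hif
    exact h'.run_extend h18 hcC hSZ hZn hSk h17'
  · rw [ht] at hif
    by_cases hcC : c ∈ D.C
    -- A failure persists: an assignment of more clients would restrict to one of the earlier
    -- clients.
    · have h0 : s3.nreg 17 = 0 := by_contra fun h0 => hif ⟨h0, hcC⟩
      refine ⟨h'.env, h'.centers, fun h1 => absurd h0 h1, fun _ hfair σ hσ => ?_⟩
      refine h'.zero h0 hfair σ (hσ.mono fun x hx => ?_)
      rw [Finset.mem_filter] at hx ⊢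
      exact ⟨hx.1, hx.2.trans (Nat.lt_succ_self c)⟩
    · have hfil : D.C.filter (· < c + 1) = D.C.filter (· < c) := Finset.filter_congr fun x hx => by
        have : x ≠ c := fun h => hcC (h ▸ hx)
        omega
      refine ⟨h'.env, h'.centers, ?_, ?_⟩
      · rw [hfil]; exact h'.pos
      · rw [hfil]; exact h'.zero

/-- The invariant of the search: the tuples with numbers below `N` have been tried. -/
structure Searching (D : Data) (Z : Finset ℕ) (p N : ℕ) (s : State) : Prop where
  env : Env D Z s
  got : s.nreg 20 ≠ 0 → ∃ S, D.Feas S (s.A 12) ∧ (∀ x < D.n, s.A 11 x = choose (x ∈ S) 1 0) ∧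
    s.rreg 3 = D.costOn p D.C (s.A 12)
  le : ∀ e < N, ∀ σ, D.Feas (D.centers Z e) σ → s.nreg 20 ≠ 0 ∧ s.rreg 3 ≤ D.costOn p D.C σ

/-- For fixed centers the assignment found is optimal, so comparing its cost with the stored one
accounts for all solutions with these centers. -/
theorem Searching.run_guess {D : Data} {Z : Finset ℕ} {p N : ℕ} {s : State}
    (h : Searching D Z p N s) (hZ : ∀ z ∈ Z, z ∈ D.F) (hN : N < (Z.card + 1) ^ D.k) :
    Searching D Z p (N + 1) ((Cmd.guess p).run (s.setN 16 N)) := by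
  classical
  have hZn : ∀ z ∈ Z, z < D.n := fun z hz => D.F_lt z (hZ z hz)
  set S := D.centers Z N with hSdef
  have hSZ : S ⊆ Z := D.centers_subset Z N
  rw [Cmd.guess, Cmd.run_seq, Cmd.run_seq, Cmd.run_seq]
  set s1 := s.setN 16 N with hs1
  have e1 : Env D Z s1 := h.env.setN (by decide) _
  have h16 : s1.nreg 16 = N := by rw [hs1, State.nreg_setN, if_pos rfl]
  have hdec := e1.run_decode (j := 5) (r := 16) (by decide) (by decide) (by rw [h16]; exact hN)
  rw [h16] at hdec
  have e2 : Env D Z ((Cmd.decode 5 16).run s1) := e1.run rfl rfl rfl rfl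
  set s2 := (Cmd.decode 5 16).run s1 with hs2
  obtain ⟨hf6, h6⟩ := Cmd.run_fill (s := s2) (j := 6) (b := 1)
    (e := .ind (.ex 2 (.eq (.arr 5 (.bv 0)) (.reg 8)))) (by decide)
    (fun x => choose (x ∈ S) 1 0) fun x hx s' hs' h8 => by
      rw [e2.ready.n] at hx
      have hm : (Ex.ex 2 (.eq (.arr 5 (.bv 0)) (.reg 8))).eval s' [] ↔ x ∈ S := by
        rw [Ex.eval_ex, hs'.nreg 2 (by decide), e2.ready.k, hSdef, Data.mem_centers]
        refine Iff.trans (exists_congr fun i => and_congr_right fun hi => ?_)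
          (and_iff_right hx).symm
        rw [Ex.eval_eq, Ex.eval_arr, hs'.A 5 (by decide) (by decide),
          show (Ex.reg 8).eval s' [i] = x from h8]
        exact (hdec i hi) ▸ Iff.rfl
      rw [Ex.eval_ind, hm]
  rw [e2.ready.n] at h6
  set F6 := Cmd.fill 6 1 (.ind (.ex 2 (.eq (.arr 5 (.bv 0)) (.reg 8)))) with hF6
  have e3 : Env D Z (F6.run s2) := e2.fill (by decide) (by decide) hf6
  set s3 := F6.run s2 with hs3
  have hS3 : ∀ x < D.n, s3.A 6 x = choose (x ∈ S) 1 0 := fun x hx => by rw [h6, if_pos hx]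
  have h4 : Assigned D Z S p D.n ((Cmd.assign p).run s3) := e3.run_assign
    (fun x hx => by rw [hS3 x hx, one_le_choose]) hSZ hZn (D.card_centers_le Z N)
  obtain ⟨e4, -, hpos, hzero⟩ := h4
  rw [Data.filter_lt_n] at hpos hzero
  set s4 := (Cmd.assign p).run s3 with hs4
  have hok := Cmd.ok_assign p
  have e20 : s4.nreg 20 = s.nreg 20 := by
    rw [hs4, Cmd.run_nreg rfl, hs3, Cmd.run_nreg rfl, hs2, Cmd.run_nreg rfl, hs1, State.nreg_setN,
      if_neg (by decide)]
  have r3 : s4.rreg 3 = s.rreg 3 := by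
    rw [hs4, Cmd.run_rreg rfl, hs3, Cmd.run_rreg rfl, hs2, Cmd.run_rreg rfl, hs1, State.rreg_setN]
  have a11 : s4.A 11 = s.A 11 := funext fun i => by
    rw [hs4, Cmd.run_A (by decide) hok rfl, hs3, Cmd.run_A (by decide) rfl rfl, hs2,
      Cmd.run_A (by decide) rfl rfl, hs1, State.A_setN _ (by decide)]
  have a12 : s4.A 12 = s.A 12 := funext fun i => by
    rw [hs4, Cmd.run_A (by decide) hok rfl, hs3, Cmd.run_A (by decide) rfl rfl, hs2,
      Cmd.run_A (by decide) rfl rfl, hs1, State.A_setN _ (by decide)]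
  have hS4 : ∀ x < D.n, s4.A 6 x = choose (x ∈ S) 1 0 := fun x hx => by
    rw [hs4, Cmd.run_A (by decide) hok rfl]; exact hS3 x hx
  have hfound : ∀ σ, D.Feas S σ → s4.nreg 17 ≠ 0 := fun σ hσ h0 => hzero h0 hσ.fair σ hσ.fits
  have hcost : s4.nreg 17 ≠ 0 → (Ex.totalCost p).eval s4 [] = D.costOn p D.C (s4.A 7) :=
    fun h0 => e4.ready.eval_totalCost (hpos h0).2.2
  clear_value s4
  have ht : (Ex.and (.nle (.lit 1) (.reg 17)) (.or (.eq (.reg 20) (.lit 0))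
      (.not (.rle (.rreg 3) (.totalCost p))))).eval s4 [] ↔ s4.nreg 17 ≠ 0 ∧ (s4.nreg 20 = 0 ∨
        ¬ s4.rreg 3 ≤ (Ex.totalCost p).eval s4 []) := by
    rw [Ex.eval_and, Ex.eval_nle, Ex.eval_or, Ex.eval_eq, Ex.eval_not, Ex.eval_rle]
    exact and_congr Nat.one_le_iff_ne_zero Iff.rfl
  rw [Cmd.run]
  split_ifs with hif
  swap
  · rw [ht] at hif
    change Searching D Z p (N + 1) s4
    refine ⟨e4, ?_, fun e he σ hσ => ?_⟩
    · rw [e20, r3, a11, a12]; exact h.got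
    rcases Nat.lt_succ_iff_lt_or_eq.mp he with he | rfl
    · rw [e20, r3]; exact h.le e he σ hσ
    · have h17 := hfound σ hσ
      rw [hcost h17] at hif
      push Not at hif
      obtain ⟨h1, h2⟩ := hif h17
      exact ⟨h1, h2.trans ((hpos h17).2.1.le σ hσ.fits)⟩
  obtain ⟨h17, hbetter⟩ := ht.mp hif
  obtain ⟨hfair, hopt, h7n⟩ := hpos h17
  rw [hcost h17] at hbetter
  have hr : (Cmd.keep p).run s4 = (Cmd.fill 12 1 (.arr 7 (.reg 8))).run
      ((Cmd.fill 11 1 (.arr 6 (.reg 8))).run ((s4.setR 3 (D.costOn p D.C (s4.A 7))).setN 20 1)) := by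
    rw [Cmd.keep, Cmd.run_seq, Cmd.run_seq, Cmd.run_seq, Cmd.run.eq_3, hcost h17]; rfl
  rw [hr]
  set s5 := (s4.setR 3 (D.costOn p D.C (s4.A 7))).setN 20 1 with hs5
  -- The improving solution is copied to arrays `11` and `12`, since arrays `6` and `7` are reused
  -- for the next tuple.
  have hA5 : ∀ j i, s5.A j i = s4.A j i := fun j i => State.A_setN _ (by decide) _ _ _
  have e5 : Env D Z s5 := (Env.setN (s := s4.setR 3 _) ⟨e4.ready.setR _ _, e4.base,
    e4.total, e4.enum⟩ (by decide) _)
  obtain ⟨hf, h11⟩ := Cmd.run_fill (s := s5) (j := 11) (b := 1) (e := .arr 6 (.reg 8)) (by decide)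
    (fun x => choose (x ∈ S) 1 0) fun i hi s' hs' h8 => by
      rw [e5.ready.n] at hi
      rw [Ex.eval_arr, hs'.A 6 (by decide) (by decide), hA5, Ex.eval, h8, hS4 i hi]
  rw [e5.ready.n] at h11
  set s6 := (Cmd.fill 11 1 (.arr 6 (.reg 8))).run s5
  have e6 : Env D Z s6 := e5.fill (by decide) (by decide) hf
  obtain ⟨hf', h12⟩ := Cmd.run_fill (s := s6) (j := 12) (b := 1) (e := .arr 7 (.reg 8)) (by decide)
    (s4.A 7) fun i hi s' hs' h8 => by
      rw [Ex.eval_arr, hs'.A 7 (by decide) (by decide), hf.A 7 (by decide) (by decide), hA5, Ex.eval,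
        h8]
  rw [e6.ready.n] at h12
  set s7 := (Cmd.fill 12 1 (.arr 7 (.reg 8))).run s6
  have h12' : ∀ x ∈ D.C, s4.A 7 x = s7.A 12 x := fun x hx => by rw [h12, if_pos (D.C_lt x hx)]
  have f20 : s7.nreg 20 = 1 := by
    rw [hf'.nreg 20 (by decide), hf.nreg 20 (by decide), hs5, State.nreg_setN, if_pos rfl]
  have f3 : s7.rreg 3 = D.costOn p D.C (s4.A 7) := by
    rw [hf'.rreg, hf.rreg, hs5, State.rreg_setN, State.rreg_setR, if_pos rfl]
  refine ⟨e6.fill (by decide) (by decide) hf', fun _ => ⟨S, ⟨fun x hx => hZ x (hSZ hx),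
    D.card_centers_le Z N, hfair, hopt.fits.congr h12'⟩, fun x hx => ?_, ?_⟩, fun e he σ hσ => ?_⟩
  · rw [hf'.A 11 (by decide) (by decide), h11, if_pos hx]
  · rw [f3]; exact Data.costOn_congr h12'
  · rw [f20, f3]
    refine ⟨one_ne_zero, ?_⟩
    rcases Nat.lt_succ_iff_lt_or_eq.mp he with he | rfl
    · obtain ⟨h1, h2⟩ := h.le e he σ hσ
      rw [e20, r3] at hbetter
      rcases hbetter with hb | hb
      · exact absurd hb h1
      · exact (not_le.mp hb).le.trans h2
    · exact hopt.le σ hσ.fits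

/-- The search finds a feasible solution that is at least as good as any with candidate centers. -/
theorem Env.run_search {D : Data} {Z : Finset ℕ} {p : ℕ} {s : State} (h : Env D Z s)
    (hZ : ∀ z ∈ Z, z ∈ D.F) {S' : Finset ℕ} (hS' : S' ⊆ Z) {ρ' : ℕ → ℕ} (hF : D.Feas S' ρ') :
    ∃ S, D.Feas S (((Cmd.search p).run s).A 12) ∧
      (∀ x < D.n, ((Cmd.search p).run s).A 11 x = choose (x ∈ S) 1 0) ∧
      ∀ S' ⊆ Z, ∀ ρ', D.Feas S' ρ' →
        D.costOn p D.C (((Cmd.search p).run s).A 12) ≤ D.costOn p D.C ρ' := by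
  have hZn : ∀ z ∈ Z, z < D.n := fun z hz => D.F_lt z (hZ z hz)
  have e1 : Env D Z (s.setN 20 0) := h.setN (by decide) _
  have key : Searching D Z p ((Z.card + 1) ^ D.k) ((Cmd.search p).run s) := by
    have hr : (Cmd.search p).run s = State.iter (Cmd.guess p).run 16 ((s.setN 20 0).nreg 6)
      (s.setN 20 0) := rfl
    rw [hr, e1.total]
    refine State.iter_ind (I := fun N s' => Searching D Z p N s') ⟨e1, fun h0 => ?_, by simp⟩
      fun N hN s' hs' => hs'.run_guess hZ hN
    rw [State.nreg_setN, if_pos rfl] at h0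
    exact absurd rfl h0
  have hall : ∀ S' ⊆ Z, ∀ ρ', D.Feas S' ρ' → ((Cmd.search p).run s).nreg 20 ≠ 0 ∧
      ((Cmd.search p).run s).rreg 3 ≤ D.costOn p D.C ρ' := fun S' hS' ρ' hF => by
    obtain ⟨e, he, rfl⟩ := Data.exists_centers hZn hS' hF.card_le
    exact key.le e he ρ' hF
  obtain ⟨S, h1, h2, h3⟩ := key.got (hall S' hS' ρ' hF).1
  exact ⟨S, h1, h2, fun S' hS' ρ' hF => h3 ▸ (hall S' hS' ρ' hF).2⟩

/-! ### Instances and their representation in the memory -/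

namespace Instance

variable (I : Instance) (hn : 2 ≤ I.n)

/-- The point with number `x`; numbers that are too large stand for point `0`. -/
def clamp (x : ℕ) : Fin I.n := if h : x < I.n then ⟨x, h⟩ else ⟨0, by omega⟩

theorem clamp_val (x : Fin I.n) : I.clamp hn x = x := by simp [clamp]

theorem val_clamp {x : ℕ} (hx : x < I.n) : (I.clamp hn x : ℕ) = x := by simp [clamp, hx]

theorem d_self (x : Fin I.n) : I.d x x = 0 := (I.d_eq_zero_iff x x).mpr rfl

theorem d_nonneg (x y : Fin I.n) : 0 ≤ I.d x y := by
  have h1 := I.d_triangle x y x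
  rw [I.d_self, I.d_symm y x] at h1
  linarith

/-- The instance with all data extended to the natural numbers. -/
def data : Data where
  n := I.n
  k := I.k
  t := I.t
  C := I.C.map Fin.valEmbedding
  F := I.F.map Fin.valEmbedding
  d x y := I.d (I.clamp hn x) (I.clamp hn y)
  G i := if h : i < I.t then (I.G ⟨i, h⟩).map Fin.valEmbedding else ∅
  lower i := if h : i < I.t then I.lower ⟨i, h⟩ else 0
  upper i := if h : i < I.t then I.upper ⟨i, h⟩ else 0
  cap x := I.cap (I.clamp hn x)
  two_le := hn
  k_pos := I.k_pos
  C_lt x hx := by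
    obtain ⟨y, -, rfl⟩ := Finset.mem_map.mp hx
    exact y.2
  F_lt x hx := by
    obtain ⟨y, -, rfl⟩ := Finset.mem_map.mp hx
    exact y.2
  d_self x := I.d_self _
  d_symm x y := I.d_symm _ _
  d_tri x y z := I.d_triangle _ _ _

variable {I}

theorem data_G (i : Fin I.t) : (I.data hn).G i = (I.G i).map Fin.valEmbedding := by
  simp [data]

theorem data_lower (i : Fin I.t) : (I.data hn).lower i = I.lower i := by simp [data]

theorem data_upper (i : Fin I.t) : (I.data hn).upper i = I.upper i := by simp [data]

theorem data_aspect {a : ℕ} (h : I.AspectRatioLE ((I.n : ℝ) ^ a)) : (I.data hn).Aspect a := by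
  intro x y x' y' _ _ hx' hy' hne
  refine h _ _ _ _ fun he => hne ?_
  rw [← I.val_clamp hn hx', he, I.val_clamp hn hy']

theorem mem_map_val {n : ℕ} {S : Finset (Fin n)} {x : ℕ} (hx : x < n) :
    x ∈ S.map Fin.valEmbedding ↔ (⟨x, hx⟩ : Fin n) ∈ S := by
  rw [Finset.mem_map]
  constructor
  · rintro ⟨y, hy, rfl⟩; exact hy
  · exact fun h => ⟨_, h, rfl⟩

theorem cost_eq (p : ℕ) {ρ : Fin I.n → Fin I.n} {σ : ℕ → ℕ} (h : ∀ c ∈ I.C, σ c = ρ c) :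
    (I.data hn).costOn p (I.data hn).C σ = I.cost p ρ := by
  have : (I.data hn).C = I.C.map Fin.valEmbedding := rfl
  rw [Data.costOn, this, Finset.sum_map, cost]
  refine Finset.sum_congr rfl fun c hc => ?_
  have h1 : (I.data hn).d (Fin.valEmbedding c) (σ (Fin.valEmbedding c)) = I.d c (ρ c) := by
    rw [Fin.valEmbedding_apply, h c hc]
    change I.d (I.clamp hn c) (I.clamp hn (ρ c)) = _
    rw [clamp_val, clamp_val]
  rw [h1]

theorem feas_iff {S : Finset (Fin I.n)} {ρ : Fin I.n → Fin I.n} {σ : ℕ → ℕ}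
    (h : ∀ c ∈ I.C, σ c = ρ c) :
    (I.data hn).Feas (S.map Fin.valEmbedding) σ ↔ I.Feasible S ρ := by
  have hcap : ∀ f : Fin I.n, ((I.data hn).C.filter fun c => σ c = (f : ℕ)).card =
      (I.C.filter fun c => ρ c = f).card := fun f => by
    have : (I.data hn).C = I.C.map Fin.valEmbedding := rfl
    rw [this, Finset.filter_map, Finset.card_map]
    congr 1
    refine Finset.filter_congr fun c hc => ?_
    rw [Function.comp, Fin.valEmbedding_apply, h c hc, Fin.val_inj]
  have hG : ∀ i : Fin I.t, (S.map Fin.valEmbedding ∩ (I.data hn).G i).card = (S ∩ I.G i).card :=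
    fun i => by rw [data_G, ← Finset.map_inter, Finset.card_map]
  constructor
  · intro ⟨h1, h2, h3, h4⟩
    refine ⟨Finset.map_subset_map.mp h1, by rwa [Finset.card_map] at h2, fun c hc => ?_,
      fun i => ?_, fun f hf => ?_⟩
    · have := h4.assigned c (Finset.mem_map_of_mem _ hc)
      rw [h c hc, mem_map_val (ρ c).2] at this
      exact this
    · have := h3 i i.2
      rwa [hG, data_lower, data_upper] at this
    · have := h4.capacity f (Finset.mem_map_of_mem _ hf)
      rw [hcap] at this
      exact this.trans (by simp [data, clamp_val])
  · intro hF
    refine ⟨Finset.map_subset_map.mpr hF.subset, by rw [Finset.card_map]; exact hF.card_le,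
      fun i hi => ?_, fun c hc => ?_, fun f hf => ?_⟩
    · have := hF.fair ⟨i, hi⟩
      rwa [← hG, ← data_lower hn, ← data_upper hn] at this
    · obtain ⟨x, hx, rfl⟩ := Finset.mem_map.mp hc
      rw [Fin.valEmbedding_apply, h x hx]
      exact Finset.mem_map_of_mem _ (hF.assigned x hx)
    · obtain ⟨x, hx, rfl⟩ := Finset.mem_map.mp hf
      rw [Fin.valEmbedding_apply]
      exact (hcap x).le.trans <| (hF.capacity x hx).trans (by simp [data, clamp_val])

end Instance

/-! ### The layout of the input -/

theorem getD_append_add {α : Type*} (l l' : List α) {m : ℕ} (h : l.length = m) (i : ℕ) (a : α) :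
    (l ++ l').getD (m + i) a = l'.getD i a := by
  rw [List.getD_append_right _ _ _ _ (by omega)]
  congr 1
  omega

theorem getD_flatten {α : Type*} {m : ℕ} (L : List (List α)) (hL : ∀ l ∈ L, l.length = m) {x : ℕ}
    (hx : x < m) (i : ℕ) (a : α) : L.flatten.getD (i * m + x) a = (L.getD i []).getD x a := by
  induction L generalizing i with
  | nil => simp
  | cons l L ih =>
    have hl : l.length = m := hL l (by simp)
    rw [List.flatten_cons]
    cases i with
    | zero => rw [zero_mul, zero_add, List.getD_append _ _ _ _ (by omega)]; rfl
    | succ i =>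
      rw [show (i + 1) * m + x = m + (i * m + x) by ring, getD_append_add _ _ hl,
        ih (fun l' hl' => hL l' (by simp [hl'])), List.getD_cons_succ]

theorem getD_ofFn {α : Type*} {n : ℕ} (f : Fin n → α) {i : ℕ} (hi : i < n) (a : α) :
    (List.ofFn f).getD i a = f ⟨i, hi⟩ := by
  rw [List.getD_eq_getElem _ _ (by simpa using hi)]
  simp

theorem one_le_getD_indicator {n : ℕ} (A : Finset (Fin n)) {x : ℕ} (hx : x < n) :
    1 ≤ (indicator A).getD x 0 ↔ x ∈ A.map Fin.valEmbedding := by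
  rw [indicator, getD_ofFn _ hx, Instance.mem_map_val hx]
  split_ifs with h <;> simp [h]

theorem length_indicator {n : ℕ} (A : Finset (Fin n)) : (indicator A).length = n := by
  simp [indicator]

/-- Each item of the input is located by stripping off the blocks before it, whose lengths are
known. -/
theorem ready_of_start {I : Instance} (hn : 2 ≤ I.n) {s : State} (h1 : s.nreg 1 = I.n)
    (h2 : s.nreg 2 = I.k) (h3 : s.nreg 3 = I.t)
    (h0 : s.nreg 0 = 3 + 3 * I.n + 2 * I.t + I.t * I.n + I.n * I.n)
    (hlow : ∀ a < s.nreg 0, s.nmem a = (start I).nmem a ∧ s.rmem a = (start I).rmem a)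
    (h15 : ∀ x < I.n, s.A 15 x = x * I.n) (h14 : ∀ i < I.t, s.A 14 i = i * I.n) :
    Ready (I.data hn) s := by
  have hnat : ∀ a, (start I).nmem a = (natInput I).getD a 0 := fun _ => rfl
  simp only [natInput, List.append_assoc] at hnat
  have e3 : ([I.n, I.k, I.t] : List ℕ).length = 3 := rfl
  have hlen : ∀ A : Finset (Fin I.n), (indicator A).length = I.n := length_indicator
  have hcl : (List.ofFn I.cap).length = I.n := by simp
  have hll : (List.ofFn I.lower).length = I.t := by simp
  have hul : (List.ofFn I.upper).length = I.t := by simp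
  refine ⟨h1, h2, h3, h0, fun x hx => ?_, fun x hx => ?_, fun x hx => ?_, fun i hi => ?_,
    fun i hi => ?_, fun i hi x hx => ?_, fun x hx y hy => ?_, h15, h14⟩
  · change x < I.n at hx
    rw [(hlow _ (by omega)).1, hnat, getD_append_add _ _ e3,
      List.getD_append _ _ _ _ (by rw [hlen]; exact hx)]
    exact one_le_getD_indicator _ hx
  · change x < I.n at hx
    change 1 ≤ s.nmem (3 + (I.n + x)) ↔ _
    rw [(hlow _ (by omega)).1, hnat, getD_append_add _ _ e3, getD_append_add _ _ (hlen _),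
      List.getD_append _ _ _ _ (by rw [hlen]; exact hx)]
    exact one_le_getD_indicator _ hx
  · change x < I.n at hx
    change s.nmem (3 + (I.n + (I.n + x))) = I.cap (I.clamp hn x)
    rw [(hlow _ (by omega)).1, hnat, getD_append_add _ _ e3, getD_append_add _ _ (hlen _),
      getD_append_add _ _ (hlen _), List.getD_append _ _ _ _ (by rw [hcl]; exact hx),
      getD_ofFn _ hx]
    simp [Instance.clamp, hx]
  · change i < I.t at hi
    change s.nmem (3 + (I.n + (I.n + (I.n + i)))) = _
    rw [(hlow _ (by omega)).1, hnat, getD_append_add _ _ e3, getD_append_add _ _ (hlen _),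
      getD_append_add _ _ (hlen _), getD_append_add _ _ hcl,
      List.getD_append _ _ _ _ (by rw [hll]; exact hi), getD_ofFn _ hi]
    exact (Instance.data_lower hn ⟨i, hi⟩).symm
  · change i < I.t at hi
    change s.nmem (3 + (I.n + (I.n + (I.n + (I.t + i))))) = _
    rw [(hlow _ (by omega)).1, hnat, getD_append_add _ _ e3, getD_append_add _ _ (hlen _),
      getD_append_add _ _ (hlen _), getD_append_add _ _ hcl, getD_append_add _ _ hll,
      List.getD_append _ _ _ _ (by rw [hul]; exact hi), getD_ofFn _ hi]
    exact (Instance.data_upper hn ⟨i, hi⟩).symm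
  · change i < I.t at hi
    change x < I.n at hx
    change 1 ≤ s.nmem (3 + (I.n + (I.n + (I.n + (I.t + (I.t + (i * I.n + x))))))) ↔ _
    have := mul_add_lt hi hx
    rw [(hlow _ (by omega)).1, hnat, getD_append_add _ _ e3, getD_append_add _ _ (hlen _),
      getD_append_add _ _ (hlen _), getD_append_add _ _ hcl, getD_append_add _ _ hll,
      getD_append_add _ _ hul, getD_flatten (m := I.n) _ (by simp [List.mem_ofFn, hlen]) hx,
      getD_ofFn _ hi, one_le_getD_indicator _ hx]
    exact (Instance.data_G hn ⟨i, hi⟩) ▸ Iff.rfl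
  · change x < I.n at hx
    change y < I.n at hy
    change s.rmem (x * I.n + y) = I.d (I.clamp hn x) (I.clamp hn y)
    have := mul_add_lt hx hy
    have hreal : (start I).rmem (x * I.n + y) = (realInput I).getD (x * I.n + y) 0 := rfl
    rw [(hlow _ (by omega)).2, hreal, realInput,
      getD_flatten (m := I.n) _ (by simp [List.mem_ofFn]) hy, getD_ofFn _ hx, getD_ofFn _ hy]
    simp [Instance.clamp, hx, hy]

/-! ### The program -/

namespace Cmd

open Ex in
/-- Load the parameters, and compute the base address of the arrays and the number of rings. -/
def boot (q a : ℕ) : Cmd := seq (setN 1 (.mem (.lit 0))) (seq (setN 2 (.mem (.lit 1)))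
  (seq (setN 3 (.mem (.lit 2))) (seq (setN 0 (.add (.lit 3) (.add (.add (.reg 1)
    (.add (.reg 1) (.reg 1))) (.add (.add (.reg 3) (.reg 3)) (.add (times 3 (.reg 1))
      (times 1 (.reg 1))))))) (setN 4 (times 1 (.lit (q * a + 2)))))))

open Ex in
/-- Tabulate the multiples of `n`. -/
def tables : Cmd := seq (fill 15 1 (.nsum 1 (lt (.bv 0) (.reg 8)) (.reg 1)))
  (fill 14 3 (.nsum 3 (lt (.bv 0) (.reg 8)) (.reg 1)))

/-- Only `boot` and the assignments to registers `5` and `6` write loop bounds; the commands between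
them are well-formed in the sense of `ok`. -/
def main (p q a : ℕ) : Cmd := seq (boot q a) (seq (seq tables (seq (leaders p q) (candidates q)))
  (seq (setN 5 (.add .numCandidates (.lit 1))) (seq enumerate (seq (setN 6 (.reg 12)) (search p)))))

end Cmd

theorem State.setN_le {V : ℕ} {s : State} (h : ∀ b < 8, s.nreg b ≤ V) (r : ℕ) {v : ℕ} (hv : v ≤ V) :
    ∀ b < 8, (s.setN r v).nreg b ≤ V := fun b hb => by
  rw [nreg_setN]
  split_ifs
  · exact hv
  · exact h b hb

/-- The base address of the arrays. -/
def Instance.base (I : Instance) : ℕ := 3 + 3 * I.n + 2 * I.t + I.t * I.n + I.n * I.n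

noncomputable def booted (I : Instance) (q a : ℕ) : State :=
  (((((start I).setN 1 I.n).setN 2 I.k).setN 3 I.t).setN 0 I.base).setN 4 (I.n * (q * a + 2))

/-- The code writes the registers below `8`, so `spec_of_ok` does not apply, and the bound `V` has
to be checked again after every assignment. -/
theorem spec_boot (I : Instance) {q a V : ℕ} (hk : I.k ≤ V) (hb : I.base ≤ V) : Cmd.Spec V (Cmd.boot q a) (start I) (booted I q a) := by
  have hn : I.n ≤ V := by simp only [Instance.base] at hb; omega
  have ht : I.t ≤ V := by simp only [Instance.base] at hb; omega
  have v0 : ∀ b < 8, (start I).nreg b ≤ V := fun b _ => Nat.zero_le _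
  have v1 := State.setN_le v0 1 hn
  have v2 := State.setN_le v1 2 hk
  have v3 := State.setN_le v2 3 ht
  have v4 := State.setN_le v3 0 hb
  have s1 : Cmd.Spec V (.setN 1 (.mem (.lit 0))) (start I) ((start I).setN 1 I.n) :=
    Cmd.spec_setN (by decide) rfl _ v0
  have s2 : Cmd.Spec V (.setN 2 (.mem (.lit 1))) ((start I).setN 1 I.n)
      (((start I).setN 1 I.n).setN 2 I.k) := Cmd.spec_setN (by decide) rfl _ v1
  have s3 : Cmd.Spec V (.setN 3 (.mem (.lit 2))) (((start I).setN 1 I.n).setN 2 I.k)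
      ((((start I).setN 1 I.n).setN 2 I.k).setN 3 I.t) := Cmd.spec_setN (by decide) rfl _ v2
  set t3 := (((start I).setN 1 I.n).setN 2 I.k).setN 3 I.t with ht3
  have r1 : t3.nreg 1 = I.n := by simp [ht3, State.nreg_setN]
  have r3 : t3.nreg 3 = I.t := by simp [ht3, State.nreg_setN]
  have s4 := Cmd.spec_setN (V := V) (i := 0) (e := .add (.lit 3) (.add (.add (.reg 1)
    (.add (.reg 1) (.reg 1))) (.add (.add (.reg 3) (.reg 3)) (.add (.times 3 (.reg 1))
      (.times 1 (.reg 1)))))) (by decide) rfl t3 v3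
  have e4 : (Ex.add (.lit 3) (.add (.add (.reg 1)
    (.add (.reg 1) (.reg 1))) (.add (.add (.reg 3) (.reg 3)) (.add (.times 3 (.reg 1))
      (.times 1 (.reg 1)))))).eval t3 [] = I.base := by
    have h1 : ∀ b, (Ex.times b (.reg 1)).eval t3 [] = t3.nreg b * I.n := fun b =>
      Ex.eval_times fun _ => r1
    simp only [Ex.eval, h1, r1, r3, Instance.base]
    ring
  rw [Cmd.run, e4] at s4
  have s5 := Cmd.spec_setN (V := V) (i := 4) (e := .times 1 (.lit (q * a + 2))) (by decide) rfl
    (t3.setN 0 I.base) v4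
  have e5 : (Ex.times 1 (.lit (q * a + 2))).eval (t3.setN 0 I.base) [] = I.n * (q * a + 2) := by
    rw [Ex.eval_times (v := q * a + 2) fun _ => rfl, State.nreg_setN, if_neg (by decide), r1]
  rw [Cmd.run, e5] at s5
  exact s1.seq (s2.seq (s3.seq (s4.seq s5)))

theorem eval_multiples {s : State} {b m : ℕ} (hb : s.nreg 8 < s.nreg b) (h1 : s.nreg 1 = m) :
    (Ex.nsum b (.lt (.bv 0) (.reg 8)) (.reg 1)).eval s [] = s.nreg 8 * m := by
  classical
  rw [Ex.eval, sumLt_eq]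
  have : (Finset.range (s.nreg b)).filter (fun j => (Ex.lt (.bv 0) (.reg 8)).eval s [j]) =
      Finset.range (s.nreg 8) := by
    ext x
    rw [Finset.mem_filter, Ex.eval_lt, Finset.mem_range, Finset.mem_range]
    change x < _ ∧ x < s.nreg 8 ↔ _
    omega
  rw [this]
  change ∑ _j ∈ Finset.range (s.nreg 8), s.nreg 1 = _
  rw [h1, Finset.sum_const, Finset.card_range]
  rfl

theorem ready_tables {I : Instance} (hn : 2 ≤ I.n) (q a : ℕ) :
    Ready (I.data hn) (Cmd.tables.run (booted I q a)) := by
  set s := booted I q a with hs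
  have r : s.nreg 0 = I.base ∧ s.nreg 1 = I.n ∧ s.nreg 2 = I.k ∧ s.nreg 3 = I.t := by
    simp [hs, booted, State.nreg_setN]
  obtain ⟨r0, r1, r2, r3⟩ := r
  rw [Cmd.tables, Cmd.run_seq]
  obtain ⟨f, hA⟩ := Cmd.run_fill (s := s) (j := 15) (b := 1)
    (e := .nsum 1 (.lt (.bv 0) (.reg 8)) (.reg 1)) (by decide) (fun x => x * I.n)
    fun i hi s' hs' h8 => by
      rw [eval_multiples (m := I.n) (by rw [h8, hs'.nreg 1 (by decide)]; exact hi)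
        (by rw [hs'.nreg 1 (by decide), r1]), h8]
  set s1 := (Cmd.fill 15 1 (.nsum 1 (.lt (.bv 0) (.reg 8)) (.reg 1))).run s
  obtain ⟨f', hA'⟩ := Cmd.run_fill (s := s1) (j := 14) (b := 3)
    (e := .nsum 3 (.lt (.bv 0) (.reg 8)) (.reg 1)) (by decide) (fun x => x * I.n)
    fun i hi s' hs' h8 => by
      rw [eval_multiples (m := I.n) (by rw [h8, hs'.nreg 3 (by decide)]; exact hi)
        (by rw [hs'.nreg 1 (by decide), f.nreg 1 (by decide), r1]), h8]
  refine ready_of_start hn ?_ ?_ ?_ ?_ (fun b hb => ⟨?_, ?_⟩) (fun x hx => ?_) fun i hi => ?_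
  · rw [f'.nreg 1 (by decide), f.nreg 1 (by decide), r1]
  · rw [f'.nreg 2 (by decide), f.nreg 2 (by decide), r2]
  · rw [f'.nreg 3 (by decide), f.nreg 3 (by decide), r3]
  · rw [f'.nreg 0 (by decide), f.nreg 0 (by decide), r0]; rfl
  · rw [f'.nreg 0 (by decide)] at hb
    rw [f'.low b hb, f.low b (by rwa [f.nreg 0 (by decide)] at hb)]; rfl
  · rw [f'.rmem, f.rmem]; rfl
  · rw [f'.A 15 (by decide) (by decide), hA, if_pos (by rw [r1]; exact hx)]
  · rw [hA', if_pos (by rw [f.nreg 3 (by decide), r3]; exact hi)]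

/-- The candidates computed by the program. -/
noncomputable def Instance.candidates (I : Instance) (hn : 2 ≤ I.n) (p q a : ℕ) : Finset ℕ :=
  (I.data hn).candidates q (I.n * (q * a + 2)) ((I.data hn).leaders p (448 * I.k * q ^ 4))

/-- The final state is named before `V` is chosen: it does not depend on the time bound. The pieces
between the writes to loop bounds are covered by `spec_of_ok` and joined by `Spec.seq`. -/
theorem spec_main {I : Instance} (hn : 2 ≤ I.n) {p q a : ℕ} (hq : 0 < q) :
    ∃ s, Env (I.data hn) (I.candidates hn p q a) s ∧ s.nreg 0 = I.base ∧
      ∀ V, I.k ≤ V → I.base ≤ V → I.n * (q * a + 2) ≤ V →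
        ((I.candidates hn p q a).card + 1) ^ I.k ≤ V →
        Cmd.Spec V (Cmd.main p q a) (start I) ((Cmd.search p).run s) := by
  set Z := I.candidates hn p q a with hZ
  have hZF : ∀ z ∈ Z, z ∈ (I.data hn).F := fun z hz => (Data.mem_candidates.mp hz).1
  set c1 : Cmd := .seq .tables (.seq (.leaders p q) (.candidates q)) with hc1
  have ok1 : c1.ok = true := by
    simp only [hc1, Cmd.ok, Cmd.ok_leaders]; rfl
  set s0 := booted I q a with hs0
  have r4 : s0.nreg 4 = I.n * (q * a + 2) := by simp [hs0, booted, State.nreg_setN]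
  set s1 := Cmd.tables.run s0 with hs1
  have h1 : Ready (I.data hn) s1 := ready_tables hn q a
  set s2 := (Cmd.leaders p q).run s1 with hs2
  have h2 : Ready (I.data hn) s2 := h1.run (Cmd.ok_leaders p q) rfl rfl
  have hM : Rep (I.data hn) 0 ((I.data hn).leaders p (448 * I.k * q ^ 4)) s2 := h1.run_leaders hq
  set s3 := (Cmd.candidates q).run s2 with hs3
  have h3 : Ready (I.data hn) s3 := h2.run (c := Cmd.candidates q) rfl rfl rfl
  have h24 : s2.nreg 4 = I.n * (q * a + 2) := by
    rw [hs2, Cmd.nreg_of_ok (Cmd.ok_leaders p q) _ _ (by decide), hs1,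
      Cmd.nreg_of_ok (c := Cmd.tables) rfl _ _ (by decide), r4]
  have hrep : Rep (I.data hn) 2 Z s3 := by
    have := h2.run_candidates (q := q) hM
    rwa [h24] at this
  have hc1run : c1.run s0 = s3 := rfl
  have hcard : Ex.numCandidates.eval s3 [] = Z.card :=
    h3.eval_numCandidates (fun z hz => (I.data hn).F_lt z (hZF z hz)) hrep
  set s4 := s3.setN 5 (Z.card + 1) with hs4
  have hr4 : (Cmd.setN 5 (.add .numCandidates (.lit 1))).run s3 = s4 := by
    rw [Cmd.run, Ex.eval, hcard]; rfl
  have h4 : Ready (I.data hn) s4 := h3.mono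
    (fun r hr => by rw [hs4, State.nreg_setN, if_neg (by omega)]) (fun _ _ => ⟨rfl, rfl⟩)
    fun i => ⟨State.A_setN _ (by decide) _ _ _, State.A_setN _ (by decide) _ _ _⟩
  have hrep4 : Rep (I.data hn) 2 Z s4 := fun x hx => by
    rw [hs4, State.A_setN _ (by decide)]; exact hrep x hx
  have r45 : s4.nreg 5 = Z.card + 1 := by rw [hs4, State.nreg_setN, if_pos rfl]
  obtain ⟨henum, h12⟩ := h4.run_enumerate hrep4
  set s5 := Cmd.enumerate.run s4 with hs5
  have h5 : Ready (I.data hn) s5 := h4.run (c := Cmd.enumerate) rfl rfl rfl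
  rw [r45] at henum h12
  set s6 := s5.setN 6 ((Z.card + 1) ^ I.k) with hs6
  have hr6 : (Cmd.setN 6 (.reg 12)).run s5 = s6 := by rw [Cmd.run, Ex.eval, h12]; rfl
  have r55 : s5.nreg 5 = Z.card + 1 :=
    (Cmd.nreg_of_ok (c := Cmd.enumerate) rfl _ _ (by decide)).trans r45
  have h6 : Env (I.data hn) Z s6 := by
    refine ⟨h5.mono (fun r hr => by rw [hs6, State.nreg_setN, if_neg (by omega)])
      (fun _ _ => ⟨rfl, rfl⟩) fun i => ⟨State.A_setN _ (by decide) _ _ _,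
        State.A_setN _ (by decide) _ _ _⟩, ?_, ?_, fun i hi => ?_⟩
    · rw [hs6, State.nreg_setN, if_neg (by decide), r55]
    · rw [hs6, State.nreg_setN, if_pos rfl]; rfl
    · rw [hs6, State.A_setN _ (by decide), henum i hi]
  refine ⟨s6, h6, h6.ready.base, fun V hk hb hR hB => ?_⟩
  have hB' : Z.card + 1 ≤ V :=
    (Nat.le_self_pow (Nat.pos_iff_ne_zero.mp I.k_pos) _).trans hB
  have v0 : ∀ b < 8, s0.nreg b ≤ V := by
    have hn' : I.n ≤ V := by simp only [Instance.base] at hb; omega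
    have ht : I.t ≤ V := by simp only [Instance.base] at hb; omega
    exact State.setN_le (State.setN_le (State.setN_le (State.setN_le (State.setN_le
      (fun b _ => Nat.zero_le _) 1 hn') 2 hk) 3 ht) 0 hb) 4 hR
  have v3 : ∀ b < 8, s3.nreg b ≤ V := fun b hb => by
    rw [← hc1run, Cmd.nreg_of_ok ok1 _ _ hb]; exact v0 b hb
  have v4 := State.setN_le v3 5 hB'
  have v5 : ∀ b < 8, s5.nreg b ≤ V := fun b hb => by
    rw [hs5, Cmd.nreg_of_ok (c := Cmd.enumerate) rfl _ _ hb]; exact v4 b hb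
  have v6 := State.setN_le v5 6 hB
  have p1 : Cmd.Spec V c1 s0 s3 := Cmd.spec_of_ok ok1 _ v0
  have p2 : Cmd.Spec V (.setN 5 (.add .numCandidates (.lit 1))) s3 s4 :=
    hr4 ▸ Cmd.spec_setN (by decide) rfl _ v3
  have p3 : Cmd.Spec V .enumerate s4 s5 := Cmd.spec_of_ok rfl _ v4
  have p4 : Cmd.Spec V (.setN 6 (.reg 12)) s5 s6 := hr6 ▸ Cmd.spec_setN (by decide) rfl _ v5
  have p5 : Cmd.Spec V (.search p) s6 ((Cmd.search p).run s6) :=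
    Cmd.spec_of_ok (Cmd.ok_search p) _ v6
  exact (spec_boot I hk hb).seq (p1.seq (p2.seq (p3.seq (p4.seq p5))))

/-- Copy the solution to the beginning of the memory. -/
def output : Prog := .seq (.setN 64 (.lit 0)) (upTo 1 64
  (.seq (.storeN (.reg 64) (.mem (.addr 11 64)))
    (.storeN (.add (.reg 1) (.reg 64)) (.mem (.addr 12 64)))))

/-- The output cells lie below `2 * n`, hence below the base address, so writing them does not
disturb the arrays still to be copied. -/
theorem output_runs {s : State} {n : ℕ} (h1 : s.nreg 1 = n) (h0 : 2 * n ≤ s.nreg 0) :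
    ∃ s' τ, Runs output s s' τ ∧ τ ≤ 100 * (n + 1) ∧
      ∀ x < n, s'.nmem x = s.A 11 x ∧ s'.nmem (n + x) = s.A 12 x := by
  let Inv : ℕ → State → Prop := fun j s' =>
    s'.nreg 64 = j ∧ s'.nreg 1 = n ∧ s'.nreg 0 = s.nreg 0 ∧
      (∀ a, s.nreg 0 ≤ a → s'.nmem a = s.nmem a) ∧
      ∀ x < j, s'.nmem x = s.A 11 x ∧ s'.nmem (n + x) = s.A 12 x
  have key : ∀ j < n, ∀ s', Inv j s' → ∃ s'' τ, Runs (.seq (.storeN (.reg 64) (.mem (.addr 11 64)))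
      (.storeN (.add (.reg 1) (.reg 64)) (.mem (.addr 12 64)))) s' s'' τ ∧ τ ≤ 80 ∧
        s''.nreg 64 = j ∧ Inv (j + 1) (s''.setN 64 (j + 1)) := by
    intro j hj s' ⟨i1, i2, i3, i4, i5⟩
    have ha : ∀ i j, s'.addr i j = s.addr i j := fun i j => by rw [State.addr, State.addr, i3]
    have hge : ∀ i j, s.nreg 0 ≤ s.addr i j := fun i j => by rw [State.addr]; omega
    have e1 : (NExp.mem (.addr 11 64)).eval s' = s.A 11 j := by
      rw [NExp.eval, NExp.eval_addr, i1, ha, i4 _ (hge _ _)]; rfl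
    set u : State := { s' with nmem := Function.update s'.nmem j (s.A 11 j) } with hu
    have x1 : Runs (.storeN (.reg 64) (.mem (.addr 11 64))) s' u
        ((NExp.reg 64).time + (NExp.mem (.addr 11 64)).time + 1) := fun ω => by
      have := Exec.storeN (ω := ω) s' (.reg 64) (.mem (.addr 11 64))
      rw [e1, NExp.eval, i1] at this
      exact this
    have e2 : (NExp.mem (.addr 12 64)).eval u = s.A 12 j := by
      have : u.addr 12 (u.nreg 64) = s.addr 12 j := by rw [show u.nreg 64 = j from i1]; exact ha _ _
      rw [NExp.eval, NExp.eval_addr, this]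
      have hne : s.addr 12 j ≠ j := by have := hge 12 j; omega
      change Function.update s'.nmem j (s.A 11 j) _ = _
      rw [Function.update_of_ne hne, i4 _ (hge _ _)]; rfl
    have e3 : (NExp.add (.reg 1) (.reg 64)).eval u = n + j := by
      rw [NExp.eval, NExp.eval, NExp.eval]
      change s'.nreg 1 + s'.nreg 64 = _
      rw [i1, i2]
    set v : State := { u with nmem := Function.update u.nmem (n + j) (s.A 12 j) } with hv
    have x2 : Runs (.storeN (.add (.reg 1) (.reg 64)) (.mem (.addr 12 64))) u v
        ((NExp.add (.reg 1) (.reg 64)).time + (NExp.mem (.addr 12 64)).time + 1) := fun ω => by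
      have := Exec.storeN (ω := ω) u (.add (.reg 1) (.reg 64)) (.mem (.addr 12 64))
      rw [e2, e3] at this
      exact this
    have hmem : ∀ b, v.nmem b = if b = n + j then s.A 12 j else if b = j then s.A 11 j else
        s'.nmem b := fun b => by
      simp only [hv, hu, Function.update_apply]
    refine ⟨v, _, x1.seq x2, ?_, i1, ?_, ?_, ?_, fun b hb => ?_, fun x hx => ?_⟩
    · simp only [NExp.time, NExp.addr]; omega
    · rw [State.nreg_setN, if_pos rfl]
    · rw [State.nreg_setN, if_neg (by decide)]; exact i2
    · rw [State.nreg_setN, if_neg (by decide)]; exact i3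
    · change v.nmem b = _
      rw [hmem, if_neg (show b ≠ n + j by omega), if_neg (show b ≠ j by omega), i4 b hb]
    · change v.nmem x = _ ∧ v.nmem (n + x) = _
      rw [hmem, hmem, if_neg (by omega)]
      rcases Nat.lt_succ_iff_lt_or_eq.mp hx with hx | rfl
      · rw [if_neg (by omega), if_neg (by omega), if_neg (by omega)]
        exact i5 x hx
      · exact ⟨if_pos rfl, if_pos rfl⟩
  obtain ⟨s', τ, r, ht, hI⟩ := upTo_runs (b := 1) (c := 64) Inv (fun j s' h => ⟨h.1, h.2.1⟩) key
    (s.setN 64 0) ⟨by simp [State.nreg_setN], by simp [State.nreg_setN, h1],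
      by simp [State.nreg_setN], fun _ _ => rfl, by simp⟩
  refine ⟨s', _, (Runs.setN s 64 (.lit 0)).seq r, ?_, hI.2.2.2.2⟩
  simp only [NExp.time]
  omega

/-! ### The approximation guarantee -/

/-- The run is the same for all random bits, so if it succeeds, all 2^T bit strings are successful.
-/
theorem approximatesInTime_of_runs {P : Prog} {p : ℕ} {γ : ℝ} {I : Instance} {T τ : ℕ} {s : State}
    (hr : Runs P (start I) s τ) (hτ : τ ≤ T) (h : (∃ S ρ, I.Feasible S ρ) →
      ∃ S ρ, Outputs I s S ρ ∧ I.IsApprox p γ S ρ) : ApproximatesInTime P p γ I T := by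
  refine ⟨fun w => ⟨s, τ, hτ, hr _⟩, fun hF => ?_⟩
  obtain ⟨S, ρ, ho, ha⟩ := h hF
  have hall : ∀ w : Fin T → Bool, ∃ s τ S ρ, τ ≤ T ∧ Exec (bits w) P (start I) s τ ∧
      Outputs I s S ρ ∧ I.IsApprox p γ S ρ := fun w => ⟨s, τ, S, ρ, hτ, hr _, ho, ha⟩
  rw [Nat.card_congr (Equiv.subtypeUnivEquiv hall)]
  simp only [Nat.card_eq_fintype_card, Fintype.card_fun, Fintype.card_bool, Fintype.card_fin]
  push_cast
  have : (0 : ℝ) ≤ 2 ^ T := by positivity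
  linarith

/-- The program. -/
def solver (p q a : ℕ) : Prog := .seq ((Cmd.main p q a).compile 64) output

theorem Instance.cost_nonneg (I : Instance) (p : ℕ) (ρ : Fin I.n → Fin I.n) : 0 ≤ I.cost p ρ :=
  Finset.sum_nonneg fun _ _ => pow_nonneg (I.d_nonneg _ _) _

/-- The optimum is matched, up to the factor `γ`, by a solution with candidate centers
(`exists_candidate_solution`), and the search returns the best of those. -/
theorem solver_approximates {I : Instance} (hn : 2 ≤ I.n) {p q a : ℕ} (hp : p = 1 ∨ p = 2)
    (hq : 0 < q) (hA : I.AspectRatioLE ((I.n : ℝ) ^ a)) {V : ℕ} (hk : I.k ≤ V) (hb : I.base ≤ V)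
    (hR : I.n * (q * a + 2) ≤ V) (hB : ((I.candidates hn p q a).card + 1) ^ I.k ≤ V)
    {γ : ℝ} (hγ : 3 ^ p + 62 / (q : ℝ) ≤ γ) :
    ApproximatesInTime (solver p q a) p γ I ((Cmd.main p q a).tm V + 100 * (I.n + 1)) := by
  classical
  obtain ⟨h, hE, h0, hspec⟩ := spec_main hn (p := p) (a := a) hq
  set Z := I.candidates hn p q a with hZ
  have hZF : ∀ z ∈ Z, z ∈ (I.data hn).F := fun z hz => (Data.mem_candidates.mp hz).1
  obtain ⟨s, τ, r, ht, hkeep, -⟩ := hspec V hk hb hR hB (start I) 64 le_rfl (Keep.refl _ _)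
  set h' := (Cmd.search p).run h with hh'
  have h1' : s.nreg 1 = I.n := by
    rw [hkeep.nreg 1 (by decide), hh', Cmd.nreg_of_ok (Cmd.ok_search p) _ _ (by decide)]
    exact hE.ready.n
  have h0' : s.nreg 0 = I.base := by
    rw [hkeep.nreg 0 (by decide), hh', Cmd.nreg_of_ok (Cmd.ok_search p) _ _ (by decide), h0]
  have hA' : ∀ j i, s.A j i = h'.A j i := fun j i => by
    rw [State.A, State.A, hkeep.nmem, hkeep.addr le_rfl]
  obtain ⟨s', τ', r', ht', hout⟩ := output_runs h1' (by rw [h0', Instance.base]; omega)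
  refine approximatesInTime_of_runs (r.seq r') (by omega) fun ⟨S₀, ρ₀, hF₀⟩ => ?_
  -- every feasible solution is matched by one with candidate centers
  have hlift : ∀ ρ : Fin I.n → Fin I.n, ∀ c ∈ I.C,
      (fun x => (ρ (I.clamp hn x) : ℕ)) (c : ℕ) = ρ c := fun ρ c _ => by
    simp only [Instance.clamp_val]
  have hcand : ∀ S ρ, I.Feasible S ρ → ∃ S' ρ', S' ⊆ Z ∧ (I.data hn).Feas S' ρ' ∧
      (I.data hn).costOn p (I.data hn).C ρ' ≤ γ * I.cost p ρ := by
    intro S ρ hF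
    have hFeas := (Instance.feas_iff hn (S := S) (σ := fun x => (ρ (I.clamp hn x) : ℕ)) (hlift ρ)).mpr hF
    have hcost := Instance.cost_eq hn p (σ := fun x => (ρ (I.clamp hn x) : ℕ)) (hlift ρ)
    -- The program does not compute logarithms: it takes ℓ = n and thus provides more ring indices
    -- than occur. The number of candidates is unaffected.
    have hR' : q * a * I.n + 1 < I.n * (q * a + 2) := by nlinarith
    obtain ⟨S', ρ', h1, h2, h3⟩ := Data.exists_candidate_solution hp
      (Instance.data_aspect hn hA) hq (Nat.lt_two_pow_self (n := I.n)).le hR' le_rfl hFeas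
    refine ⟨S', ρ', h1, h2, h3.trans ?_⟩
    rw [hcost]
    exact mul_le_mul_of_nonneg_right hγ (I.cost_nonneg p ρ)
  obtain ⟨S', ρ', hS', hF', -⟩ := hcand S₀ ρ₀ hF₀
  obtain ⟨S, hS, h11, hbest⟩ := hE.run_search hZF (p := p) hS' hF'
  rw [← hh'] at hS h11 hbest
  have hSn : ∀ x ∈ S, x < I.n := fun x hx => (I.data hn).F_lt x (hS.subset hx)
  set Sf : Finset (Fin I.n) := Finset.univ.filter fun x => (x : ℕ) ∈ S with hSf
  have hmem : ∀ x : Fin I.n, x ∈ Sf ↔ (x : ℕ) ∈ S := fun x => by simp [hSf]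
  have hmap : Sf.map Fin.valEmbedding = S := by
    ext x
    rw [Finset.mem_map]
    constructor
    · rintro ⟨y, hy, rfl⟩
      exact (Finset.mem_filter.mp hy).2
    · exact fun hx => ⟨⟨x, hSn x hx⟩, Finset.mem_filter.mpr ⟨Finset.mem_univ _, hx⟩, rfl⟩
  have hρ : ∀ c ∈ I.C, h'.A 12 (c : ℕ) = (I.clamp hn (h'.A 12 c) : ℕ) := fun c hc => by
    rw [Instance.val_clamp]
    exact hSn _ (hS.fits.assigned _ (Finset.mem_map_of_mem _ hc))
  refine ⟨Sf, fun c => I.clamp hn (h'.A 12 c), ⟨fun x => ?_, fun c hc => ?_⟩, ?_, ?_⟩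
  · rw [(hout x x.2).1, hA', h11 x x.2]
    by_cases hx : (x : ℕ) ∈ S
    · rw [choose_pos hx, if_pos ((hmem x).mpr hx)]
    · rw [choose_neg hx, if_neg fun h => hx ((hmem x).mp h)]
  · rw [(hout c c.2).2, hA', ← hρ c hc]
  · exact (Instance.feas_iff hn hρ).mp (hmap ▸ hS)
  · intro S'' ρ'' hF
    obtain ⟨S', ρ', h1, h2, h3⟩ := hcand S'' ρ'' hF
    rw [← Instance.cost_eq hn p hρ]
    exact (hbest S' h1 ρ' h2).trans h3

/-! ### The running time -/

/-- The parameters `q` and `a` enter the program only through literals, whose size is constant. Size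
and depth, and with them all exponents, are therefore independent of `ε` and `a`. -/
theorem size_main (p q a : ℕ) : (Cmd.main p q a).size = (Cmd.main p 0 0).size := rfl

theorem depth_main (p q a : ℕ) : (Cmd.main p q a).depth = (Cmd.main p 0 0).depth := rfl

theorem clog_le {n : ℕ} (hn : 2 ≤ n) : (Nat.clog 2 n : ℝ) ≤ 4 * Real.log n := by
  have h1 := Nat.pow_pred_clog_lt_self (b := 2) (by omega) (x := n) (by omega)
  have h2 : ((Nat.clog 2 n).pred : ℝ) * Real.log 2 ≤ Real.log n := by
    rw [← Real.log_pow]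
    refine Real.log_le_log (by positivity) ?_
    exact_mod_cast h1.le
  have h3 : (Nat.clog 2 n : ℝ) ≤ (Nat.clog 2 n).pred + 1 := by
    exact_mod_cast (by have := Nat.pred_eq_sub_one (n := Nat.clog 2 n); omega)
  have h4 : Real.log 2 ≤ Real.log n := Real.log_le_log (by norm_num) (by exact_mod_cast hn)
  have h5 := Real.log_two_gt_d9
  have h6 : ((Nat.clog 2 n).pred : ℝ) * 0.6931471803 ≤ Real.log n :=
    (mul_le_mul_of_nonneg_left h5.le (Nat.cast_nonneg _)).trans h2
  linarith

/-- A bound for the number of candidates in terms of the parameters. -/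
theorem card_candidates_le_pow {I : Instance} (hn : 2 ≤ I.n) {p q a ℓ : ℕ} (hp : p = 1 ∨ p = 2)
    (hq : 0 < q) (hA : I.AspectRatioLE ((I.n : ℝ) ^ a)) (hℓ : I.n ≤ 2 ^ ℓ) {Y : ℝ} (hY : 1 ≤ Y)
    (hYk : (I.k : ℝ) ≤ Y) (hYt : (2 ^ I.t : ℝ) ≤ Y) (hYq : (q : ℝ) ≤ Y) (hYℓ : (ℓ : ℝ) ≤ Y) :
    ((I.candidates hn p q a).card + 1 : ℝ) ≤ 1346 * (a + 2) * Y ^ 11 := by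
  have hq' : (0 : ℝ) < q := by exact_mod_cast hq
  have hδ1 : 1 / (q : ℝ) ≤ 1 := by
    rw [div_le_one hq']; exact_mod_cast hq
  have hQ : 448 * (I.data hn).k / (1 / (q : ℝ)) ^ 4 ≤ (448 * I.k * q ^ 4 : ℕ) := by
    rw [one_div, inv_pow, div_inv_eq_mul]
    push_cast
    exact le_rfl
  obtain ⟨hM, -, hMc, -⟩ := Data.leaders_spec (D := I.data hn) hp hℓ (one_div_pos.mpr hq') hδ1 hQ
  have hZc := Data.card_candidates_le (R := I.n * (q * a + 2)) (Instance.data_aspect hn hA) hq hℓ hM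
  have hY0 : (0 : ℝ) ≤ Y := by linarith
  have hMr : ((((I.data hn).leaders p (448 * I.k * q ^ 4)).card : ℕ) : ℝ) ≤
      1 + I.k * (448 * I.k * q ^ 4 * (2 * ℓ + 1)) := by exact_mod_cast hMc
  -- The constant is 1 + 448 · 3, with 2ℓ + 1 ≤ 3Y; the power 7 collects two factors k, four factors
  -- q and one ℓ. Type, ring and rank contribute four more powers of `Y`.
  have hM' : ((((I.data hn).leaders p (448 * I.k * q ^ 4)).card : ℕ) : ℝ) ≤ 1345 * Y ^ 7 := by
    have h1 : (1 : ℝ) ≤ Y ^ 7 := one_le_pow₀ hY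
    have h2 : (2 * (ℓ : ℝ) + 1) ≤ 3 * Y := by linarith
    have h3 : (I.k : ℝ) * (448 * I.k * q ^ 4 * (2 * ℓ + 1)) ≤ Y * (448 * Y * Y ^ 4 * (3 * Y)) := by
      gcongr
    have h4 : Y * (448 * Y * Y ^ 4 * (3 * Y)) = 1344 * Y ^ 7 := by ring
    linarith
  have hZr : ((I.candidates hn p q a).card : ℝ) ≤
      (((I.data hn).leaders p (448 * I.k * q ^ 4)).card : ℕ) *
        (2 ^ I.t * ((q * a * ℓ + 2) * I.k)) := by exact_mod_cast hZc
  have h5 : (q : ℝ) * a * ℓ + 2 ≤ (a + 2) * Y ^ 2 := by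
    have h1 : (1 : ℝ) ≤ Y ^ 2 := one_le_pow₀ hY
    have h2 : (q : ℝ) * a * ℓ ≤ Y * a * Y := by gcongr
    nlinarith
  have h6 : ((((I.data hn).leaders p (448 * I.k * q ^ 4)).card : ℕ) : ℝ) *
        (2 ^ I.t * ((q * a * ℓ + 2) * I.k)) ≤ 1345 * Y ^ 7 * (Y * ((a + 2) * Y ^ 2 * Y)) := by
    gcongr
  have h7 : 1345 * Y ^ 7 * (Y * ((a + 2) * Y ^ 2 * Y)) = 1345 * (a + 2) * Y ^ 11 := by ring
  have h8 : (1 : ℝ) ≤ Y ^ 11 := one_le_pow₀ hY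
  have h9 : (0 : ℝ) ≤ a := Nat.cast_nonneg _
  nlinarith

/-- A bound for all the loop bounds of the program. -/
noncomputable def Instance.loopBound (I : Instance) (hn : 2 ≤ I.n) (p q a : ℕ) : ℕ :=
  I.k + I.base + I.n * (q * a + 2) + ((I.candidates hn p q a).card + 1) ^ I.k

/-- The number of tuples is at most `W`. The other loop bounds together are at most `A * Y * I.n ^
2`, hence at most `W * I.n ^ 2`. The resulting factor 2 is absorbed by doubling the base of the
power. -/
theorem loopBound_le {I : Instance} (hn : 2 ≤ I.n) {p q a : ℕ} {Y : ℝ} (hY : 1 ≤ Y)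
    (hYk : (I.k : ℝ) ≤ Y) (hYt : (I.t : ℝ) ≤ Y) (hYq : (q : ℝ) ≤ Y)
    (hZ : ((I.candidates hn p q a).card + 1 : ℝ) ≤ 1346 * (a + 2) * Y ^ 11) :
    (I.loopBound hn p q a + 1 : ℝ) ≤ (2692 * (a + 2) * Y) ^ (11 * I.k) * I.n ^ 2 := by
  have ha : (0 : ℝ) ≤ a := Nat.cast_nonneg _
  have hn1 : (1 : ℝ) ≤ I.n := by exact_mod_cast (by omega : 1 ≤ I.n)
  have hn2 : (I.n : ℝ) ≤ I.n ^ 2 := le_self_pow₀ hn1 two_ne_zero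
  have hn3 : (1 : ℝ) ≤ I.n ^ 2 := one_le_pow₀ hn1
  set A : ℝ := 1346 * (a + 2) with hA
  have hA1 : 1 ≤ A := by rw [hA]; linarith
  have hAY : 1 ≤ A * Y := by nlinarith
  have hk : 11 * I.k ≠ 0 := by have := I.k_pos; omega
  set W : ℝ := (A * Y) ^ (11 * I.k) with hW
  have hW1 : A * Y ≤ W := le_self_pow₀ hAY hk
  have hB : ((I.candidates hn p q a).card + 1 : ℝ) ^ I.k ≤ W := by
    rw [hW, pow_mul]
    refine pow_le_pow_left₀ (by positivity) (hZ.trans ?_) _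
    rw [mul_pow]
    exact mul_le_mul_of_nonneg_right (le_self_pow₀ hA1 (by norm_num)) (by positivity)
  have hbase : (I.base : ℝ) ≤ 10 * Y * I.n ^ 2 := by
    rw [Instance.base]
    push_cast
    have h1 : (I.n : ℝ) ^ 2 ≤ Y * I.n ^ 2 := le_mul_of_one_le_left (by positivity) hY
    have h2 : (I.t : ℝ) * I.n ≤ Y * I.n ^ 2 := by gcongr
    have h3 : (I.t : ℝ) ≤ Y * I.n ^ 2 := hYt.trans (le_mul_of_one_le_right (by linarith) hn3)
    nlinarith
  have hR : (I.n : ℝ) * (q * a + 2) ≤ (a + 2) * Y * I.n ^ 2 := by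
    have h1 : (q : ℝ) * a + 2 ≤ (a + 2) * Y := by nlinarith
    calc (I.n : ℝ) * (q * a + 2) ≤ I.n ^ 2 * ((a + 2) * Y) := by gcongr
      _ = _ := by ring
  have hsum : (I.k : ℝ) + 10 * Y * I.n ^ 2 + (a + 2) * Y * I.n ^ 2 + 1 ≤ A * Y * I.n ^ 2 := by
    have h1 : Y ≤ Y * I.n ^ 2 := le_mul_of_one_le_right (by linarith) hn3
    have h2 : 0 ≤ a * (Y * I.n ^ 2) := by positivity
    rw [hA]
    nlinarith
  have h2W : 2 * W ≤ (2692 * (a + 2) * Y) ^ (11 * I.k) := by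
    have : 2692 * ((a : ℝ) + 2) * Y = 2 * (A * Y) := by rw [hA]; ring
    rw [this, mul_pow]
    exact mul_le_mul_of_nonneg_right (le_self_pow₀ (by norm_num) hk) (by positivity)
  have hV : (I.loopBound hn p q a + 1 : ℝ) ≤ 2 * W * I.n ^ 2 := by
    rw [Instance.loopBound]
    push_cast
    have h1 : A * Y * (I.n : ℝ) ^ 2 ≤ W * I.n ^ 2 := by gcongr
    have h2 : W ≤ W * (I.n : ℝ) ^ 2 := le_mul_of_one_le_right (by linarith) hn3
    linarith
  exact hV.trans (mul_le_mul_of_nonneg_right h2W (by positivity))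

/-- The exponent η + 1 rather than η leaves room for the linear time of the output. The factor σ +
100 moves into the base because the exponent is positive. -/
theorem time_le {I : Instance} (hn : 2 ≤ I.n) {p q a : ℕ} {X : ℝ} (hX : 0 ≤ X)
    (hV : (I.loopBound hn p q a + 1 : ℝ) ≤ X ^ (11 * I.k) * I.n ^ 2) {σ η : ℕ}
    (hσ : (Cmd.main p q a).size ≤ σ) (hη : (Cmd.main p q a).depth ≤ η) :
    (((Cmd.main p q a).tm (I.loopBound hn p q a) + 100 * (I.n + 1) : ℕ) : ℝ) ≤
      ((σ + 100) * X) ^ (11 * (η + 1) * I.k) * (I.n : ℝ) ^ (2 * (η + 1)) := by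
  set V := I.loopBound hn p q a with hVdef
  have hnV : I.n ≤ V := by simp only [hVdef, Instance.loopBound, Instance.base]; omega
  have h1 : (Cmd.main p q a).tm V + 100 * (I.n + 1) ≤ (σ + 100) * (V + 1) ^ (η + 1) := by
    have h2 : (Cmd.main p q a).tm V ≤ σ * (V + 1) ^ (η + 1) :=
      (Cmd.tm_le V _).trans (Nat.mul_le_mul hσ (Nat.pow_le_pow_right (by omega) (by omega)))
    have h3 : V + 1 ≤ (V + 1) ^ (η + 1) := Nat.le_self_pow (by omega) _
    rw [add_mul]
    exact Nat.add_le_add h2 (Nat.mul_le_mul_left _ (by omega))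
  have hk : 11 * (η + 1) * I.k ≠ 0 := by
    have := I.k_pos
    positivity
  calc (((Cmd.main p q a).tm V + 100 * (I.n + 1) : ℕ) : ℝ)
      ≤ (σ + 100) * (V + 1 : ℝ) ^ (η + 1) := by exact_mod_cast h1
    _ ≤ (σ + 100) * (X ^ (11 * I.k) * (I.n : ℝ) ^ 2) ^ (η + 1) := by gcongr
    _ = (σ + 100) * (X ^ (11 * (η + 1) * I.k) * (I.n : ℝ) ^ (2 * (η + 1))) := by
        rw [mul_pow, ← pow_mul, ← pow_mul]
        congr 3
        ring
    _ ≤ (σ + 100) ^ (11 * (η + 1) * I.k) *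
          (X ^ (11 * (η + 1) * I.k) * (I.n : ℝ) ^ (2 * (η + 1))) := by
        refine mul_le_mul_of_nonneg_right (le_self_pow₀ ?_ hk) (by positivity)
        have : (0 : ℝ) ≤ σ := Nat.cast_nonneg _
        linarith
    _ = _ := by rw [mul_pow]; ring

theorem exists_solver (a : ℕ) {p σ η : ℕ} (hp : p = 1 ∨ p = 2) (hσ : (Cmd.main p 0 0).size ≤ σ)
    (hη : (Cmd.main p 0 0).depth ≤ η) {ε : ℝ} (hε : 0 < ε) :
    ∃ P : Prog, ∀ I : Instance, 2 ≤ I.n → I.AspectRatioLE ((I.n : ℝ) ^ a) →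
      ∃ T : ℕ, ApproximatesInTime P p (3 ^ p + ε) I T ∧
        (T : ℝ) ≤ (((σ + 100) * (2692 * (a + 2) * 126) : ℕ) *
          (2 ^ I.t * I.k * max 1 ε⁻¹ * Real.log I.n)) ^ (11 * (η + 1) * I.k) *
            (I.n : ℝ) ^ (2 * (η + 1)) := by
  set m := max 1 ε⁻¹ with hm
  have hm1 : 1 ≤ m := le_max_left _ _
  -- Then 62/q ≤ 1/m ≤ ε, which turns the error 62δ of `cost_replacement` into `ε`.
  set q := ⌈62 * m⌉₊ with hqdef
  have hqm : 62 * m ≤ q := Nat.le_ceil _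
  have hqm' : (q : ℝ) ≤ 63 * m := by
    have := Nat.ceil_lt_add_one (a := 62 * m) (by positivity)
    rw [← hqdef] at this
    linarith
  have hq0 : (0 : ℝ) < q := by linarith
  have hq : 0 < q := by exact_mod_cast hq0
  have hγ : (3 : ℝ) ^ p + 62 / (q : ℝ) ≤ 3 ^ p + ε := by
    have h1 : ε⁻¹ ≤ m := le_max_right _ _
    have h2 : 1 ≤ m * ε := by rwa [inv_le_iff_one_le_mul₀ hε] at h1
    have : 62 / (q : ℝ) ≤ ε := by
      rw [div_le_iff₀ hq0]
      nlinarith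
    linarith
  refine ⟨solver p q a, fun I hn hA => ⟨_, solver_approximates hn hp hq hA
    (V := I.loopBound hn p q a) ?_ ?_ ?_ ?_ hγ, ?_⟩⟩
  iterate 4 simp only [Instance.loopBound]; omega
  set L := Real.log I.n with hL
  have hL1 : 1 / 2 ≤ L := by
    have h4 : Real.log 2 ≤ L := Real.log_le_log (by norm_num) (by exact_mod_cast hn)
    have h5 := Real.log_two_gt_d9
    linarith
  have hk1 : (1 : ℝ) ≤ I.k := by exact_mod_cast I.k_pos
  have ht1 : (1 : ℝ) ≤ 2 ^ I.t := one_le_pow₀ (by norm_num)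
  set X := 2 ^ I.t * I.k * m * L with hX
  -- The logarithm can be below one (for n = 2), but not below 1/2; this costs the factor 2.
  have key : ∀ {x y z w : ℝ}, 1 ≤ x → 1 ≤ y → 1 ≤ z → 1 / 2 ≤ w → x ≤ 2 * (x * y * z * w) := by
    intro x y z w hx hy hz hw
    have h1 : x ≤ x * y * z := by
      have h2 : x ≤ x * y := le_mul_of_one_le_right (by linarith) hy
      exact h2.trans (le_mul_of_one_le_right (by linarith) hz)
    nlinarith
  have x1 : (2 : ℝ) ^ I.t ≤ 2 * X := key ht1 hk1 hm1 hL1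
  have x2 : (I.k : ℝ) ≤ 2 * X := (key hk1 ht1 hm1 hL1).trans_eq (by rw [hX]; ring)
  have x3 : m ≤ 2 * X := (key hm1 ht1 hk1 hL1).trans_eq (by rw [hX]; ring)
  have x4 : L ≤ X := by
    have : 1 ≤ 2 ^ I.t * I.k * m := by
      have h1 : (1 : ℝ) ≤ 2 ^ I.t * I.k := one_le_mul_of_one_le_of_one_le ht1 hk1
      exact one_le_mul_of_one_le_of_one_le h1 hm1
    exact le_mul_of_one_le_left (by linarith) this
  have hX0 : 1 / 2 ≤ X := hL1.trans x4
  have htt : (I.t : ℝ) ≤ 2 ^ I.t := by exact_mod_cast (Nat.lt_two_pow_self (n := I.t)).le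
  have hℓ := clog_le hn
  -- The largest of the parameters in terms of `X` is q ≤ 63 m ≤ 126 X.
  have hY : (1 : ℝ) ≤ 126 * X := by linarith
  have hZ := card_candidates_le_pow hn (p := p) (ℓ := Nat.clog 2 I.n) hp hq hA
    (Nat.le_pow_clog (by omega) _) hY (by linarith) (by linarith) (by linarith) (by linarith)
  have hV := loopBound_le hn hY (by linarith) (by linarith) (by linarith) hZ
  have hT := time_le (σ := σ) (η := η) hn (by positivity) hV (by rwa [size_main]) (by rwa [depth_main])
  refine hT.trans_eq ?_
  push_cast
  ring_nf

end CFR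

theorem mainTheorem5 (a : ℕ) :
    ∃ c₁ c₂ c₃ : ℕ, ∀ ε : ℝ, 0 < ε →
      (∃ P : CFR.Prog, ∀ I : CFR.Instance, 2 ≤ I.n → I.AspectRatioLE ((I.n : ℝ) ^ a) →
        ∃ T : ℕ, CFR.ApproximatesInTime P 1 (3 + ε) I T ∧
          (T : ℝ) ≤ (c₁ * (2 ^ I.t * I.k * max 1 ε⁻¹ * Real.log I.n)) ^ (c₂ * I.k) *
            (I.n : ℝ) ^ c₃) ∧
      (∃ P : CFR.Prog, ∀ I : CFR.Instance, 2 ≤ I.n → I.AspectRatioLE ((I.n : ℝ) ^ a) →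
        ∃ T : ℕ, CFR.ApproximatesInTime P 2 (9 + ε) I T ∧
          (T : ℝ) ≤ (c₁ * (2 ^ I.t * I.k * max 1 ε⁻¹ * Real.log I.n)) ^ (c₂ * I.k) *
            (I.n : ℝ) ^ c₃) := by
  -- The constants have to serve both exponents, so the larger size and the larger depth are taken.
  set σ := max (CFR.Cmd.main 1 0 0).size (CFR.Cmd.main 2 0 0).size
  set η := max (CFR.Cmd.main 1 0 0).depth (CFR.Cmd.main 2 0 0).depth
  refine ⟨(σ + 100) * (2692 * (a + 2) * 126), 11 * (η + 1), 2 * (η + 1), fun ε hε => ⟨?_, ?_⟩⟩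
  · have h := CFR.exists_solver a (p := 1) (σ := σ) (η := η) (Or.inl rfl) (le_max_left _ _)
      (le_max_left _ _) hε
    rw [pow_one] at h
    exact h
  · have h := CFR.exists_solver a (p := 2) (σ := σ) (η := η) (Or.inr rfl) (le_max_right _ _)
      (le_max_right _ _) hε
    rw [show (3 : ℝ) ^ 2 = 9 by norm_num] at h
    exact h
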